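/- Consider $$\Delta\equiv u_{tt}-(\kappa u+\gamma u^2)_{xx}-u\,u_{xxxx}-\mu u_{xxtt}-\alpha u_xu_{xxx}-\beta u_{xx}^2=0,\qquad \mu\neq 0,$$ with constants $\alpha,\beta,\gamma,\kappa,\mu$ in $\mathbb K=\mathbb R$ or $\mathbb C$. Let $D$ be an open nonempty set of points $(x,t,u)\in\mathbb K^3$ and let $\xi,\varphi:D\to\mathbb K$ be infinitely differentiable (holomorphic if $\mathbb K=\mathbb C$). Let $\Delta^*$ be the differential expression in $x$-derivatives of $u$ obtained from $\Delta$ by eliminating $u_{tt}$ and $u_{xxtt}$ by means of the invariant surface condition $\xi u_x+u_t=\varphi$; its coefficient of $u_{xxxx}$ is $-(u+\mu\xi^2)$. The pair $(\xi,\varphi)$ is a *nonclassical* (Bluman–Cole, $\tau=1$) infinitesimal on $D$ if, for ${\bf v}=\xi\partial_x+\partial_t+\varphi\partial_u$, $\mathrm{pr}^{(4)}{\bf v}(\Delta^*)=0$ at every jet over $D$ with $\Delta^*=0$. It is *classical* if $(\xi,\varphi)=(\xi_0/\tau_0,\varphi_0/\tau_0)$ on $D$ for a classical Lie point symmetry $\xi_0\partial_x+\tau_0\partial_t+\varphi_0\partial_u$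 of $\Delta=0$ with smooth coefficients on $D$ and $\tau_0\ne0$ on $D$, i.e. one with $\mathrm{pr}^{(4)}{\bf v}_0(\Delta)=0$ at every jet over $D$ with $\Delta=0$. **A. Generic case.** Let $D$ be convex and $u+\mu\xi^2\ne0$ on $D$. Then $(\xi,\varphi)$ is nonclassical if and only if it is classical or belongs to one of the following seven families (the $c_i$ are constants in $\mathbb K$): (i) $\kappa=0$: $\xi=0$, $\varphi=g(t)u$, where $g''+gg'-g^3=0$; (ii) $1+2\gamma\mu=0$: $\xi=c_1t+c_2$, $\varphi=-2\mu c_1(c_1t+c_2)$; (iii) $\kappa=1+2\gamma\mu=0$: $\xi=c_2(t+c_1)^2$, $\varphi=u(t+c_1)^{-1}-3\mu c_2^2(t+c_1)^3$; (iv) $\alpha=\beta=\gamma=0$: $\xi=s$, $\varphi=c_3y^3+c_2y^2+c_1y+c_0$ with $y=x+st$, where $s\in\mathbb K$, $s^2=\kappa$; (v) $\alpha=-\tfrac32$, $\beta=2$, $\gamma=0$: $\xi=\tfrac12 s(x+c_1)$, $\varphi=2su+\tfrac14\mu s^3(x+c_1)^2$, where $s\in\mathbb K$, $\mu s^2=\kappa$;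 (vi) $\alpha=\beta=\gamma=\kappa=0$: $\xi=0$, $\varphi=c_3x^3+c_2x^2+c_1x+c_0$; (vii) $\alpha=\beta=\gamma=\kappa=0$: $\xi=0$, $\varphi=(u+c_3x^3+c_2x^2+c_1x+c_0)(t+c_4)^{-1}$. (Here $g$ is smooth on the set of values of $t$ on $D$, and $t+c_1$, $t+c_4$ do not vanish on $D$ in (iii), (vii). For $\mu=1$ the conditions on the parameters are $1+2\gamma=0$ in (ii), (iii), and $s=\pm\sqrt\kappa$ in (v).) These infinitesimals are genuinely nonclassical: a member of the family is classical only in the following cases, and then it is: (i) $g\equiv0$ or $g(t)=-2/(t+d)$ for a constant $d$; (ii) $c_1=0$; (iii) never; (iv) $c_0=c_1=c_2=c_3=0$; (v) $\kappa=0$; (vi) $c_0=c_1=c_2=c_3=0$; (vii) never. **B. Singular case.** Let $\mathbb K=\mathbb C$ and $u+\mu\xi^2=0$ on $D$. Then $(\xi,\varphi)$ is nonclassical if and only if $\alpha=4$, $1+2\gamma\mu=0$, $\kappa=0$ and $\varphi=0$ on $D$. In this case: - if $\beta\ne3$, every holomorphic $u(x,t)$ on a connected open set of $\mathbb C^2$,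 with graph in $D$, that satisfies both $\Delta=0$ and the invariant surface condition $\xi u_x+u_t=0$ is constant; - if $\beta=3$, then $\Delta^*$ vanishes identically over $D$, every holomorphic solution $u(x,t)$ of the invariant surface condition on an open set, with graph in $D$, solves $\Delta=0$, and there are nonconstant such solutions on some connected open set. For $\mu=1$ the only nontrivial singular case is thus $\alpha=4$, $\beta=3$, $\gamma=-\tfrac12$, $\kappa=0$, $\varphi=0$. -/

import Mathlib

open scoped ContDiff

namespace LieSym

noncomputable section

/-! ### Jets, total derivatives and prolongations

A point of jet space is `(x, t, p)`, where `p (i, j)` is the coordinate standing for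
`∂ₓⁱ ∂ₜʲ u`; in particular `p (0, 0)` is `u`. -/

/-- Functions on the jet space of scalar functions `u(x, t)`. -/
abbrev JetFun (𝕜 : Type*) := 𝕜 → 𝕜 → (ℕ × ℕ → 𝕜) → 𝕜

section

variable {𝕜 : Type*} [RCLike 𝕜]

/-- `∂F/∂x` (explicit dependence only). -/
def partialX (F : JetFun 𝕜) : JetFun 𝕜 := fun x t p => deriv (fun s => F s t p) x

/-- `∂F/∂t` (explicit dependence only). -/
def partialT (F : JetFun 𝕜) : JetFun 𝕜 := fun x t p => deriv (fun s => F x s p) t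

/-- `∂F/∂u_{ij}`, the derivative with respect to the jet coordinate `p (i, j)`. -/
def partialJet (k : ℕ × ℕ) (F : JetFun 𝕜) : JetFun 𝕜 :=
  fun x t p => deriv (fun s => F x t (Function.update p k s)) (p k)

/-- The total derivative `Dₓ`, on functions of the jet coordinates of order at most four. -/
def totalX (F : JetFun 𝕜) : JetFun 𝕜 := fun x t p =>
  partialX F x t p +
    ∑ n ∈ Finset.range 5, ∑ k ∈ Finset.HasAntidiagonal.antidiagonal n,
      p (k.1 + 1, k.2) * partialJet k F x t p

/-- The total derivative `Dₜ`, on functions of the jet coordinates of order at most four. -/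
def totalT (F : JetFun 𝕜) : JetFun 𝕜 := fun x t p =>
  partialT F x t p +
    ∑ n ∈ Finset.range 5, ∑ k ∈ Finset.HasAntidiagonal.antidiagonal n,
      p (k.1, k.2 + 1) * partialJet k F x t p

/-- The left-hand side `ψ = ξ uₓ + τ uₜ - φ` of the invariant surface condition. -/
def surfaceCondition (ξ τ φ : 𝕜 → 𝕜 → 𝕜 → 𝕜) : JetFun 𝕜 := fun x t p =>
  ξ x t (p (0, 0)) * p (1, 0) + τ x t (p (0, 0)) * p (0, 1) - φ x t (p (0, 0))

/-- The coefficient of `∂/∂u_{ij}` in the prolongation of `ξ ∂ₓ + τ ∂ₜ + φ ∂ᵤ`, that is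
`Dₓⁱ Dₜʲ (φ - ξ uₓ - τ uₜ) + ξ u_{i+1,j} + τ u_{i,j+1}`. -/
def prolongCoeff (ξ τ φ : 𝕜 → 𝕜 → 𝕜 → 𝕜) (k : ℕ × ℕ) : JetFun 𝕜 := fun x t p =>
  (totalX^[k.1] (totalT^[k.2] (fun x t p => -surfaceCondition ξ τ φ x t p))) x t p +
    ξ x t (p (0, 0)) * p (k.1 + 1, k.2) + τ x t (p (0, 0)) * p (k.1, k.2 + 1)

/-- The fourth prolongation of `ξ ∂ₓ + τ ∂ₜ + φ ∂ᵤ` applied to a function on jet space. -/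
def prolong (ξ τ φ : 𝕜 → 𝕜 → 𝕜 → 𝕜) (F : JetFun 𝕜) : JetFun 𝕜 := fun x t p =>
  ξ x t (p (0, 0)) * partialX F x t p + τ x t (p (0, 0)) * partialT F x t p +
    ∑ n ∈ Finset.range 5, ∑ k ∈ Finset.HasAntidiagonal.antidiagonal n,
      prolongCoeff ξ τ φ k x t p * partialJet k F x t p

/-- The infinitesimal criterion of the classical Lie method for the equation `E = 0` of order at
most four and the vector field `ξ ∂ₓ + τ ∂ₜ + φ ∂ᵤ` on a set `D` of points `(x, t, u)`:
the fourth prolongation annihilates `E` at all jets over `D` that satisfy `E = 0`. -/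
def IsLieSymmetry (E : JetFun 𝕜) (ξ τ φ : 𝕜 → 𝕜 → 𝕜 → 𝕜) (D : Set (𝕜 × 𝕜 × 𝕜)) : Prop :=
  ∀ (x t : 𝕜) (p : ℕ × ℕ → 𝕜), (x, t, p (0, 0)) ∈ D → E x t p = 0 → prolong ξ τ φ E x t p = 0

/-! ### The equation -/

/-- The equation with the two derivatives `u_tt` and `u_xxtt` left as arguments `a` and `b`. -/
def equationWith (α β γ κ μ : 𝕜) (a b : 𝕜) (p : ℕ × ℕ → 𝕜) : 𝕜 :=
  a - κ * p (2, 0) - 2 * γ * (p (0, 0) * p (2, 0) + p (1, 0) ^ 2) - p (0, 0) * p (4, 0)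
    - μ * b - α * p (1, 0) * p (3, 0) - β * p (2, 0) ^ 2

/-- `Δ = u_tt - (κ u + γ u²)_xx - u u_xxxx - μ u_xxtt - α u_x u_xxx - β u_xx²`. -/
def equation (α β γ κ μ : 𝕜) : JetFun 𝕜 := fun _ _ p =>
  equationWith α β γ κ μ (p (0, 2)) (p (2, 2)) p

/-- The `t`-derivative of a function of `x, t, u, u_x, u_xx, …` computed with the help of the
invariant surface condition with `τ = 1`, i.e. with `u_t` replaced by `W = φ - ξ u_x` and
`∂ₓⁱ u_t` replaced by `Dₓⁱ W`. -/
def surfaceT (ξ φ : 𝕜 → 𝕜 → 𝕜 → 𝕜) (F : JetFun 𝕜) : JetFun 𝕜 := fun x t p =>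
  partialT F x t p +
    ∑ i ∈ Finset.range 5,
      (totalX^[i] (fun x t p => φ x t (p (0, 0)) - ξ x t (p (0, 0)) * p (1, 0))) x t p *
        partialJet (i, 0) F x t p

/-- The expression for `u_tt` given by the invariant surface condition `u_t = φ - ξ u_x`; it
involves `x`-derivatives of `u` only. -/
def surfaceTT (ξ φ : 𝕜 → 𝕜 → 𝕜 → 𝕜) : JetFun 𝕜 :=
  surfaceT ξ φ (fun x t p => φ x t (p (0, 0)) - ξ x t (p (0, 0)) * p (1, 0))

/-- `Δ` after elimination of `u_tt` and `u_xxtt` by means of the invariant surface condition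
`ξ u_x + u_t = φ`. The coefficient of `u_xxxx` is `-(u + μ ξ²)`. -/
def reducedEquation (α β γ κ μ : 𝕜) (ξ φ : 𝕜 → 𝕜 → 𝕜 → 𝕜) : JetFun 𝕜 := fun x t p =>
  equationWith α β γ κ μ (surfaceTT ξ φ x t p) (totalX (totalX (surfaceTT ξ φ)) x t p) p

/-! ### Classical and nonclassical symmetries -/

/-- An infinitesimal that is infinitely differentiable on `D` (holomorphic if `𝕜 = ℂ`). -/
def SmoothOn (D : Set (𝕜 × 𝕜 × 𝕜)) (f : 𝕜 → 𝕜 → 𝕜 → 𝕜) : Prop :=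
  ContDiffOn 𝕜 ∞ (fun z : 𝕜 × 𝕜 × 𝕜 => f z.1 z.2.1 z.2.2) D

/-- `(ξ, 1, φ)` satisfies the nonclassical determining equations (Bluman–Cole, `τ = 1`):
the classical criterion holds for the equation reduced by the invariant surface condition. -/
def IsNonclassical (α β γ κ μ : 𝕜) (ξ φ : 𝕜 → 𝕜 → 𝕜 → 𝕜) (D : Set (𝕜 × 𝕜 × 𝕜)) : Prop :=
  IsLieSymmetry (reducedEquation α β γ κ μ ξ φ) ξ (fun _ _ _ => 1) φ D

/-- `(ξ, 1, φ)` comes from a classical Lie symmetry `(ξ₀, τ₀, φ₀)` of `Δ = 0` with `τ₀ ≠ 0` by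
the normalisation `τ = 1`. -/
def IsClassical (α β γ κ μ : 𝕜) (ξ φ : 𝕜 → 𝕜 → 𝕜 → 𝕜) (D : Set (𝕜 × 𝕜 × 𝕜)) : Prop :=
  ∃ ξ₀ τ₀ φ₀ : 𝕜 → 𝕜 → 𝕜 → 𝕜, SmoothOn D ξ₀ ∧ SmoothOn D τ₀ ∧ SmoothOn D φ₀ ∧
    IsLieSymmetry (equation α β γ κ μ) ξ₀ τ₀ φ₀ D ∧
    ∀ x t u, (x, t, u) ∈ D → τ₀ x t u ≠ 0 ∧
      ξ x t u = ξ₀ x t u / τ₀ x t u ∧ φ x t u = φ₀ x t u / τ₀ x t u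

/-! ### The seven families of nonclassical infinitesimals -/

/-- The set of values of `t` on `D`. -/
def times (D : Set (𝕜 × 𝕜 × 𝕜)) : Set 𝕜 := {t | ∃ x u, (x, t, u) ∈ D}

/-- `c₃ y³ + c₂ y² + c₁ y + c₀`. -/
def cubic (c : Fin 4 → 𝕜) (y : 𝕜) : 𝕜 := c 3 * y ^ 3 + c 2 * y ^ 2 + c 1 * y + c 0

/-- Family (i): `κ = 0`, `ξ = 0`, `φ = g(t) u` with `g'' + g g' - g³ = 0`. -/
def FamilyI (κ : 𝕜) (ξ φ : 𝕜 → 𝕜 → 𝕜 → 𝕜) (D : Set (𝕜 × 𝕜 × 𝕜)) (g : 𝕜 → 𝕜) : Prop :=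
  κ = 0 ∧ ContDiffOn 𝕜 ∞ g (times D) ∧
    (∀ t ∈ times D, deriv (deriv g) t + g t * deriv g t - g t ^ 3 = 0) ∧
    ∀ x t u, (x, t, u) ∈ D → ξ x t u = 0 ∧ φ x t u = g t * u

/-- Family (ii): `1 + 2γμ = 0`, `ξ = c₁ t + c₂`, `φ = -2 μ c₁ (c₁ t + c₂)`. -/
def FamilyII (γ μ : 𝕜) (ξ φ : 𝕜 → 𝕜 → 𝕜 → 𝕜) (D : Set (𝕜 × 𝕜 × 𝕜)) (c₁ c₂ : 𝕜) : Prop :=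
  1 + 2 * γ * μ = 0 ∧
    ∀ x t u, (x, t, u) ∈ D →
      ξ x t u = c₁ * t + c₂ ∧ φ x t u = -2 * μ * c₁ * (c₁ * t + c₂)

/-- Family (iii): `κ = 1 + 2γμ = 0`, `ξ = c₂ (t + c₁)²`,
`φ = u (t + c₁)⁻¹ - 3 μ c₂² (t + c₁)³`. -/
def FamilyIII (γ κ μ : 𝕜) (ξ φ : 𝕜 → 𝕜 → 𝕜 → 𝕜) (D : Set (𝕜 × 𝕜 × 𝕜)) (c₁ c₂ : 𝕜) : Prop :=
  κ = 0 ∧ 1 + 2 * γ * μ = 0 ∧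
    ∀ x t u, (x, t, u) ∈ D → t + c₁ ≠ 0 ∧
      ξ x t u = c₂ * (t + c₁) ^ 2 ∧
      φ x t u = u * (t + c₁)⁻¹ - 3 * μ * c₂ ^ 2 * (t + c₁) ^ 3

/-- Family (iv): `α = β = γ = 0`, `ξ = s`, `φ` a cubic in `x + s t`, where `s = ±√κ`. -/
def FamilyIV (α β γ κ : 𝕜) (ξ φ : 𝕜 → 𝕜 → 𝕜 → 𝕜) (D : Set (𝕜 × 𝕜 × 𝕜)) (s : 𝕜)
    (c : Fin 4 → 𝕜) : Prop :=
  α = 0 ∧ β = 0 ∧ γ = 0 ∧ s ^ 2 = κ ∧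
    ∀ x t u, (x, t, u) ∈ D → ξ x t u = s ∧ φ x t u = cubic c (x + s * t)

/-- Family (v): `α = -3/2`, `β = 2`, `γ = 0`, `ξ = (s/2) (x + c₁)`,
`φ = 2 s u + (1/4) μ s³ (x + c₁)²`, where `μ s² = κ`. -/
def FamilyV (α β γ κ μ : 𝕜) (ξ φ : 𝕜 → 𝕜 → 𝕜 → 𝕜) (D : Set (𝕜 × 𝕜 × 𝕜)) (s c₁ : 𝕜) : Prop :=
  α = -3 / 2 ∧ β = 2 ∧ γ = 0 ∧ μ * s ^ 2 = κ ∧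
    ∀ x t u, (x, t, u) ∈ D →
      ξ x t u = s / 2 * (x + c₁) ∧
      φ x t u = 2 * s * u + 1 / 4 * μ * s ^ 3 * (x + c₁) ^ 2

/-- Family (vi): `α = β = γ = κ = 0`, `ξ = 0`, `φ` a cubic in `x`. -/
def FamilyVI (α β γ κ : 𝕜) (ξ φ : 𝕜 → 𝕜 → 𝕜 → 𝕜) (D : Set (𝕜 × 𝕜 × 𝕜))
    (c : Fin 4 → 𝕜) : Prop :=
  α = 0 ∧ β = 0 ∧ γ = 0 ∧ κ = 0 ∧
    ∀ x t u, (x, t, u) ∈ D → ξ x t u = 0 ∧ φ x t u = cubic c x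

/-- Family (vii): `α = β = γ = κ = 0`, `ξ = 0`, `φ = (u + cubic in x) (t + c₄)⁻¹`. -/
def FamilyVII (α β γ κ : 𝕜) (ξ φ : 𝕜 → 𝕜 → 𝕜 → 𝕜) (D : Set (𝕜 × 𝕜 × 𝕜))
    (c : Fin 4 → 𝕜) (c₄ : 𝕜) : Prop :=
  α = 0 ∧ β = 0 ∧ γ = 0 ∧ κ = 0 ∧
    ∀ x t u, (x, t, u) ∈ D → t + c₄ ≠ 0 ∧
      ξ x t u = 0 ∧ φ x t u = (u + cubic c x) * (t + c₄)⁻¹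

/-! ### Solutions -/

/-- The jet of a function `u(x, t)` at the point `(x, t)`. -/
def jetOf (u : 𝕜 → 𝕜 → 𝕜) (x t : 𝕜) : ℕ × ℕ → 𝕜 := fun k =>
  iteratedDeriv k.1 (fun x' => iteratedDeriv k.2 (fun t' => u x' t') t) x

/-- `u` is a smooth function on `U` (holomorphic if `𝕜 = ℂ`) whose graph lies in `D`. -/
def IsFunctionInto (D : Set (𝕜 × 𝕜 × 𝕜)) (U : Set (𝕜 × 𝕜)) (u : 𝕜 → 𝕜 → 𝕜) : Prop :=
  ContDiffOn 𝕜 ∞ (fun z : 𝕜 × 𝕜 => u z.1 z.2) U ∧ ∀ x t, (x, t) ∈ U → (x, t, u x t) ∈ D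

/-- `u` satisfies the differential equation `E = 0` on `U`. -/
def Solves (E : JetFun 𝕜) (U : Set (𝕜 × 𝕜)) (u : 𝕜 → 𝕜 → 𝕜) : Prop :=
  ∀ x t, (x, t) ∈ U → E x t (jetOf u x t) = 0

end

end

end LieSym

open LieSym

/-!
The conditions in question are statements about jets. Over `D` every function on jet space that
occurs is a polynomial in the jet coordinates with coefficients in the ring `SmoothFn D` of smooth
functions of `(x, t, u)`. Such polynomials form the ring `JetPoly D`, on which total derivatives and
prolongations are derivations (`Represents`, `isLieSymmetry_iff`), so that the analysis takes place
in `SmoothFn D` with its three commuting derivations. This ring has zero divisors. Cancellation is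
replaced by restriction to the set where a function does not vanish, and by the fact that on a
convex set a solution of a linear homogeneous system of total differential equations vanishes if it
vanishes at one point (`SmoothFn.eq_zero_of_linear_system`); this is where convexity enters.

In the generic case the coefficient `w = u + μ ξ²` of `u_xxxx` is invertible. The reduced equation
can be solved for `u_xxxx`, the lower derivatives remain free, and the criterion says that the
coefficients of a polynomial in `u_x, u_xx, u_xxx` vanish. The top coefficients give `ξ_u = 0`
(`du_xi_eq_zero`) and `φ = A u + B` with `A`, `B` independent of `u` (`du_du_phi_eq_zero`). The
remaining coefficients are polynomials in `w`, whose coefficients in turn vanish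
(`determining_iff_core`, `Core`). Decisive is the function `defect`, the value of `v(w)` at `w = 0`,
where `v = ξ ∂ₓ + ∂ₜ + φ ∂ᵤ`. If it is not identically zero, then `α = β = γ = 0`, every lower
coefficient of the reduced equation satisfies a linear transport equation and vanishes where the
defect does not, hence everywhere, and only `ξ² = κ` with cubic polynomials in `x` is left
(`Core.of_defect_ne`). If the defect is zero, it expresses `B` by `ξ` and `A`. Then either `ξ_x ≠ 0`,
which leaves one family (`Core.of_dx_xi_ne`), or `ξ` and `A` are functions of `t` that satisfy an
overdetermined system of ordinary differential equations (`Core.ode`, `Ode.normalForm`). The result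
is the list `NormalForm`. Integrating its members, which all satisfy the determining equations,
gives the families (`isNonclassical_iff_families`).

For the classical symmetries, selected jets show that `ξ₀` is constant, `τ₀` is affine in `t` and
`φ₀ = -2 τ₀' u` with `κ τ₀' = 0`. Hence `ξ = c / (a t + b)` and `φ = -2 a u / (a t + b)` with
`a κ = 0` (`ClassicalForm`, `isClassical_iff`), and each family can be compared with this form.

In the singular case `u + μ ξ² = 0` determines `ξ` as a function of `u`, and `u_xxxx` cancels from
the reduced equation, which is affine in `u_xxx`. The growth of the criterion in `u_x` gives `α = 4`,
and its dependence on `u_xx` removes `u_xxx` altogether (`ThirdOrderCriterion.eps_eq_zero`,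
`ThirdOrderCriterion.q_eq_zero`). What is left is quadratic in `u_xx` with zero discriminant, or
linear (`ThirdOrderCriterion.discrim_eq_zero`, `ThirdOrderCriterion.leading_eq_zero`). Now `φ` is
homogeneous in `u`, and sorting the remaining identity by degree in `u` gives `φ = 0`, `κ = 0` and
`1 + 2 γ μ = 0` (`singular_homogeneous`). For these parameters the left-hand side of the equation is
`S - μ S_xx + (3 - β) u_xx²`, where `S = u_tt + (u²)_xx / (2 μ)` vanishes on the solutions of the
surface condition (`equation_of_surface`). So `β = 3` makes all of them solutions of the equation,
among them `-μ V²` with `V` a solution of `V_t + V V_x = 0` (`exists_nonconstant_solution`), and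
`β ≠ 3` leaves `u_xx = 0`, which forces `u` to be constant (`derivs_eq_zero_of_surface`).
-/


set_option linter.unusedSimpArgs false

/-! ### Smooth functions of `(x, t, u)` -/

/-- The functions on the open set `D` that are infinitely differentiable on `D`. -/
def smoothSubalgebra {𝕜 : Type*} [RCLike 𝕜] (D : TopologicalSpace.Opens (𝕜 × 𝕜 × 𝕜)) :
    Subalgebra 𝕜 (D → 𝕜) where
  carrier := {f | ∃ F : 𝕜 × 𝕜 × 𝕜 → 𝕜, ContDiffOn 𝕜 ∞ F D ∧ ∀ z : D, F z = f z}
  mul_mem' := by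
    rintro f g ⟨F, hF, hf⟩ ⟨G, hG, hg⟩
    exact ⟨fun z => F z * G z, hF.mul hG, fun z => by simp [hf, hg]⟩
  add_mem' := by
    rintro f g ⟨F, hF, hf⟩ ⟨G, hG, hg⟩
    exact ⟨fun z => F z + G z, hF.add hG, fun z => by simp [hf, hg]⟩
  algebraMap_mem' c := ⟨fun _ => c, contDiffOn_const, fun _ => rfl⟩

/-- The ring of infinitely differentiable functions of `(x, t, u)` on the open set `D`. -/
def SmoothFn {𝕜 : Type*} [RCLike 𝕜] (D : TopologicalSpace.Opens (𝕜 × 𝕜 × 𝕜)) : Type _ :=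
  smoothSubalgebra D

namespace SmoothFn

variable {𝕜 : Type*} [RCLike 𝕜] {D : TopologicalSpace.Opens (𝕜 × 𝕜 × 𝕜)}

noncomputable instance : CommRing (SmoothFn D) := inferInstanceAs (CommRing (smoothSubalgebra D))

noncomputable instance : Algebra 𝕜 (SmoothFn D) :=
  inferInstanceAs (Algebra 𝕜 (smoothSubalgebra D))

instance : CoeFun (SmoothFn D) (fun _ => D → 𝕜) := ⟨fun f => f.1⟩

@[ext] theorem ext {f g : SmoothFn D} (h : ∀ z, f z = g z) : f = g := Subtype.ext (funext h)

/-- Evaluation at a point of `D`. -/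
noncomputable def evalAt (z : D) : SmoothFn D →ₐ[𝕜] 𝕜 :=
  (Pi.evalAlgHom 𝕜 (fun _ : D => 𝕜) z).comp (smoothSubalgebra D).val

theorem evalAt_apply (z : D) (f : SmoothFn D) : evalAt z f = f z := rfl

@[simp] theorem coe_add (f g : SmoothFn D) (z : D) : (f + g) z = f z + g z := rfl
@[simp] theorem coe_sub (f g : SmoothFn D) (z : D) : (f - g) z = f z - g z := rfl
@[simp] theorem coe_mul (f g : SmoothFn D) (z : D) : (f * g) z = f z * g z := rfl
@[simp] theorem coe_neg (f : SmoothFn D) (z : D) : (-f) z = -f z := rfl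
@[simp] theorem coe_zero (z : D) : (0 : SmoothFn D) z = 0 := rfl
@[simp] theorem coe_one (z : D) : (1 : SmoothFn D) z = 1 := rfl
@[simp] theorem coe_smul (c : 𝕜) (f : SmoothFn D) (z : D) : (c • f) z = c * f z := rfl
@[simp] theorem coe_pow (f : SmoothFn D) (n : ℕ) (z : D) : (f ^ n) z = f z ^ n :=
  map_pow (evalAt z) f n
@[simp] theorem coe_algebraMap (c : 𝕜) (z : D) : (algebraMap 𝕜 (SmoothFn D) c) z = c := rfl
@[simp] theorem coe_ofNat (n : ℕ) [n.AtLeastTwo] (z : D) :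
    (ofNat(n) : SmoothFn D) z = ofNat(n) := map_ofNat (evalAt z) n
@[simp] theorem coe_natCast (n : ℕ) (z : D) : (n : SmoothFn D) z = n := map_natCast (evalAt z) n
@[simp] theorem coe_sum {ι : Type*} (s : Finset ι) (f : ι → SmoothFn D) (z : D) :
    (∑ i ∈ s, f i) z = ∑ i ∈ s, f i z := map_sum (evalAt z) f s

/-- A smooth function on `D`, extended by zero. -/
noncomputable def extend (f : SmoothFn D) : 𝕜 × 𝕜 × 𝕜 → 𝕜 :=
  Function.extend Subtype.val f.1 0

theorem extend_apply (f : SmoothFn D) (z : D) : f.extend z = f z :=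
  Subtype.val_injective.extend_apply _ _ _

theorem contDiffOn_extend (f : SmoothFn D) : ContDiffOn 𝕜 ∞ f.extend D := by
  obtain ⟨F, hF, hf⟩ := f.2
  refine hF.congr fun z hz => ?_
  rw [extend_apply f ⟨z, hz⟩]
  exact (hf ⟨z, hz⟩).symm

theorem contDiffAt_extend (f : SmoothFn D) (z : D) : ContDiffAt 𝕜 ∞ f.extend z :=
  f.contDiffOn_extend.contDiffAt (D.isOpen.mem_nhds z.2)

theorem differentiableAt_extend (f : SmoothFn D) (z : D) : DifferentiableAt 𝕜 f.extend z :=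
  (f.contDiffAt_extend z).differentiableAt (by simp)

/-- The smooth function on `D` given by a function that is smooth on `D`. -/
def mk (F : 𝕜 × 𝕜 × 𝕜 → 𝕜) (hF : ContDiffOn 𝕜 ∞ F D) : SmoothFn D :=
  ⟨fun z => F z, F, hF, fun _ => rfl⟩

@[simp] theorem mk_apply (F : 𝕜 × 𝕜 × 𝕜 → 𝕜) (hF : ContDiffOn 𝕜 ∞ F D) (z : D) :
    mk F hF z = F z := rfl

theorem extend_eventuallyEq (f : SmoothFn D) {F : 𝕜 × 𝕜 × 𝕜 → 𝕜} (h : ∀ z : D, f z = F z)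
    (z : D) : f.extend =ᶠ[nhds (z : 𝕜 × 𝕜 × 𝕜)] F := by
  filter_upwards [D.isOpen.mem_nhds z.2] with y hy
  rw [← h ⟨y, hy⟩, extend_apply f ⟨y, hy⟩]

/-- The directional derivative of smooth functions on `D` along a constant vector. -/
noncomputable def der (e : 𝕜 × 𝕜 × 𝕜) : Derivation 𝕜 (SmoothFn D) (SmoothFn D) :=
  Derivation.mk'
    { toFun := fun f => mk (fun z => fderiv 𝕜 f.extend z e)
        ((f.contDiffOn_extend.fderiv_of_isOpen D.isOpen (by simp)).clm_apply contDiffOn_const)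
      map_add' := fun f g => by
        ext z
        have h : (f + g).extend =ᶠ[nhds (z : 𝕜 × 𝕜 × 𝕜)] f.extend + g.extend :=
          extend_eventuallyEq _ (fun z => by simp [extend_apply]) z
        simp [h.fderiv_eq, fderiv_add (f.differentiableAt_extend z) (g.differentiableAt_extend z)]
      map_smul' := fun c f => by
        ext z
        have h : (c • f).extend =ᶠ[nhds (z : 𝕜 × 𝕜 × 𝕜)] c • f.extend :=
          extend_eventuallyEq _ (fun z => by simp [extend_apply]) z
        simp [h.fderiv_eq, fderiv_const_smul (f.differentiableAt_extend z)] }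
    fun f g => by
      ext z
      have h : (f * g).extend =ᶠ[nhds (z : 𝕜 × 𝕜 × 𝕜)] f.extend * g.extend :=
        extend_eventuallyEq _ (fun z => by simp [extend_apply]) z
      simp [h.fderiv_eq, fderiv_mul (f.differentiableAt_extend z) (g.differentiableAt_extend z),
        extend_apply]

theorem der_apply (e : 𝕜 × 𝕜 × 𝕜) (f : SmoothFn D) (z : D) :
    der e f z = fderiv 𝕜 f.extend z e := rfl

theorem der_comm (e e' : 𝕜 × 𝕜 × 𝕜) (f : SmoothFn D) : der e (der e' f) = der e' (der e f) := by
  ext z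
  have key : ∀ e e' : 𝕜 × 𝕜 × 𝕜,
      der e (der e' f) z = fderiv 𝕜 (fderiv 𝕜 f.extend) z e e' := by
    intro e e'
    have h : (der e' f).extend =ᶠ[nhds (z : 𝕜 × 𝕜 × 𝕜)] fun y => fderiv 𝕜 f.extend y e' :=
      extend_eventuallyEq _ (fun z => rfl) z
    have hd : DifferentiableAt 𝕜 (fderiv 𝕜 f.extend) z :=
      ((f.contDiffAt_extend z).fderiv_right (m := 1) (by norm_cast)).differentiableAt (by simp)
    rw [der_apply, h.fderiv_eq, fderiv_clm_apply hd (by fun_prop)]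
    simp
  rw [key, key]
  exact (f.contDiffAt_extend z).isSymmSndFDerivAt (by simpa using ENat.LEInfty.out) e e'

/-- `∂/∂x`. -/
noncomputable def dx : Derivation 𝕜 (SmoothFn D) (SmoothFn D) := der (1, 0, 0)
/-- `∂/∂t`. -/
noncomputable def dt : Derivation 𝕜 (SmoothFn D) (SmoothFn D) := der (0, 1, 0)
/-- `∂/∂u`. -/
noncomputable def du : Derivation 𝕜 (SmoothFn D) (SmoothFn D) := der (0, 0, 1)

theorem dt_dx (f : SmoothFn D) : dt (dx f) = dx (dt f) := der_comm _ _ f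
theorem du_dx (f : SmoothFn D) : du (dx f) = dx (du f) := der_comm _ _ f
theorem du_dt (f : SmoothFn D) : du (dt f) = dt (du f) := der_comm _ _ f

theorem fderiv_extend (f : SmoothFn D) (z : D) (e : 𝕜 × 𝕜 × 𝕜) :
    fderiv 𝕜 f.extend z e = e.1 * dx f z + e.2.1 * dt f z + e.2.2 * du f z := by
  have h : e = e.1 • ((1, 0, 0) : 𝕜 × 𝕜 × 𝕜) + e.2.1 • ((0, 1, 0) : 𝕜 × 𝕜 × 𝕜)
      + e.2.2 • ((0, 0, 1) : 𝕜 × 𝕜 × 𝕜) := by ext <;> simp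
  calc fderiv 𝕜 f.extend z e = fderiv 𝕜 f.extend z (e.1 • ((1, 0, 0) : 𝕜 × 𝕜 × 𝕜)
        + e.2.1 • ((0, 1, 0) : 𝕜 × 𝕜 × 𝕜) + e.2.2 • ((0, 0, 1) : 𝕜 × 𝕜 × 𝕜)) := by rw [← h]
    _ = _ := by
      simp only [map_add, map_smul, smul_eq_mul]
      rfl

@[simp] theorem derivation_ofNat (d : Derivation 𝕜 (SmoothFn D) (SmoothFn D)) (n : ℕ)
    [n.AtLeastTwo] : d ofNat(n) = 0 := by
  have := d.map_natCast n
  rwa [← Nat.cast_ofNat (R := SmoothFn D)]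

/-- The coordinate `x`. -/
noncomputable def x : SmoothFn D := mk (fun z => z.1) contDiff_fst.contDiffOn
/-- The coordinate `t`. -/
noncomputable def t : SmoothFn D :=
  mk (fun z => z.2.1) (contDiff_fst.comp contDiff_snd).contDiffOn
/-- The coordinate `u`. -/
noncomputable def u : SmoothFn D :=
  mk (fun z => z.2.2) (contDiff_snd.comp contDiff_snd).contDiffOn

@[simp] theorem x_apply (z : D) : x z = (z : 𝕜 × 𝕜 × 𝕜).1 := rfl
@[simp] theorem t_apply (z : D) : t z = (z : 𝕜 × 𝕜 × 𝕜).2.1 := rfl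
@[simp] theorem u_apply (z : D) : u z = (z : 𝕜 × 𝕜 × 𝕜).2.2 := rfl

theorem hasFDerivAt_extend (f : SmoothFn D) (z : D) :
    HasFDerivAt f.extend (fderiv 𝕜 f.extend z) (z : 𝕜 × 𝕜 × 𝕜) :=
  (f.differentiableAt_extend z).hasFDerivAt

/-- Directional derivatives can be computed from any extension. -/
theorem der_eq_of_hasFDerivAt (f : SmoothFn D) {F : 𝕜 × 𝕜 × 𝕜 → 𝕜} (h : ∀ z : D, f z = F z)
    (z : D) {F' : 𝕜 × 𝕜 × 𝕜 →L[𝕜] 𝕜} (hF : HasFDerivAt F F' z) (e : 𝕜 × 𝕜 × 𝕜) :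
    der e f z = F' e := by
  rw [der_apply, (f.extend_eventuallyEq h z).fderiv_eq, hF.fderiv]

section coordinates

theorem der_x (e : 𝕜 × 𝕜 × 𝕜) : der e (x : SmoothFn D) = algebraMap 𝕜 _ e.1 := by
  ext z
  exact der_eq_of_hasFDerivAt x (F := Prod.fst) (fun _ => rfl) z hasFDerivAt_fst e

theorem der_t (e : 𝕜 × 𝕜 × 𝕜) : der e (t : SmoothFn D) = algebraMap 𝕜 _ e.2.1 := by
  ext z
  exact der_eq_of_hasFDerivAt t (F := fun z => z.2.1) (fun _ => rfl) z
    (hasFDerivAt_fst.comp (z : 𝕜 × 𝕜 × 𝕜) hasFDerivAt_snd) e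

theorem der_u (e : 𝕜 × 𝕜 × 𝕜) : der e (u : SmoothFn D) = algebraMap 𝕜 _ e.2.2 := by
  ext z
  exact der_eq_of_hasFDerivAt u (F := fun z => z.2.2) (fun _ => rfl) z
    (hasFDerivAt_snd.comp (z : 𝕜 × 𝕜 × 𝕜) hasFDerivAt_snd) e

@[simp] theorem dx_x : dx (x : SmoothFn D) = 1 := by simp [dx, der_x]
@[simp] theorem dt_x : dt (x : SmoothFn D) = 0 := by simp [dt, der_x]
@[simp] theorem du_x : du (x : SmoothFn D) = 0 := by simp [du, der_x]
@[simp] theorem dx_t : dx (t : SmoothFn D) = 0 := by simp [dx, der_t]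
@[simp] theorem dt_t : dt (t : SmoothFn D) = 1 := by simp [dt, der_t]
@[simp] theorem du_t : du (t : SmoothFn D) = 0 := by simp [du, der_t]
@[simp] theorem dx_u : dx (u : SmoothFn D) = 0 := by simp [dx, der_u]
@[simp] theorem dt_u : dt (u : SmoothFn D) = 0 := by simp [dt, der_u]
@[simp] theorem du_u : du (u : SmoothFn D) = 1 := by simp [du, der_u]

end coordinates

section slices

variable (f : SmoothFn D) (z : D)

theorem hasDerivAt_slice_x :
    HasDerivAt (fun s => f.extend (s, (z : 𝕜 × 𝕜 × 𝕜).2.1, (z : 𝕜 × 𝕜 × 𝕜).2.2)) (dx f z)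
      (z : 𝕜 × 𝕜 × 𝕜).1 := by
  have h := (f.hasFDerivAt_extend z).comp_hasDerivAt_of_eq (z : 𝕜 × 𝕜 × 𝕜).1
    ((hasDerivAt_id _).prodMk (hasDerivAt_const (z : 𝕜 × 𝕜 × 𝕜).1 (z : 𝕜 × 𝕜 × 𝕜).2)) rfl
  exact h

theorem hasDerivAt_slice_t :
    HasDerivAt (fun s => f.extend ((z : 𝕜 × 𝕜 × 𝕜).1, s, (z : 𝕜 × 𝕜 × 𝕜).2.2)) (dt f z)
      (z : 𝕜 × 𝕜 × 𝕜).2.1 := by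
  have h := (f.hasFDerivAt_extend z).comp_hasDerivAt_of_eq (z : 𝕜 × 𝕜 × 𝕜).2.1
    ((hasDerivAt_const _ (z : 𝕜 × 𝕜 × 𝕜).1).prodMk ((hasDerivAt_id (z : 𝕜 × 𝕜 × 𝕜).2.1).prodMk
      (hasDerivAt_const (z : 𝕜 × 𝕜 × 𝕜).2.1 (z : 𝕜 × 𝕜 × 𝕜).2.2))) rfl
  exact h

theorem hasDerivAt_slice_u :
    HasDerivAt (fun s => f.extend ((z : 𝕜 × 𝕜 × 𝕜).1, (z : 𝕜 × 𝕜 × 𝕜).2.1, s)) (du f z)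
      (z : 𝕜 × 𝕜 × 𝕜).2.2 := by
  have h := (f.hasFDerivAt_extend z).comp_hasDerivAt_of_eq (z : 𝕜 × 𝕜 × 𝕜).2.2
    ((hasDerivAt_const _ (z : 𝕜 × 𝕜 × 𝕜).1).prodMk
      ((hasDerivAt_const (z : 𝕜 × 𝕜 × 𝕜).2.2 (z : 𝕜 × 𝕜 × 𝕜).2.1).prodMk
      (hasDerivAt_id (z : 𝕜 × 𝕜 × 𝕜).2.2))) rfl
  exact h

end slices

end SmoothFn

namespace SmoothFn

variable {𝕜 : Type*} [RCLike 𝕜] {D : TopologicalSpace.Opens (𝕜 × 𝕜 × 𝕜)}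

/-! ### Linear systems of differential equations -/

/-- A family of smooth functions on a convex set that satisfies a linear homogeneous first-order
system of total differential equations vanishes as soon as it vanishes at one point. -/
theorem eq_zero_of_linear_system (hD : Convex ℝ (D : Set (𝕜 × 𝕜 × 𝕜))) {ι : Type*} [Fintype ι]
    (v : ι → SmoothFn D) (a b c : ι → ι → SmoothFn D)
    (ha : ∀ i, dx (v i) = ∑ j, a i j * v j) (hb : ∀ i, dt (v i) = ∑ j, b i j * v j)
    (hc : ∀ i, du (v i) = ∑ j, c i j * v j) (z₀ : D) (h₀ : ∀ i, v i z₀ = 0) (i : ι) :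
    v i = 0 := by
  ext z₁
  -- `w` is the family restricted to the segment from `z₀` to `z₁`
  set e : 𝕜 × 𝕜 × 𝕜 := (z₁ : 𝕜 × 𝕜 × 𝕜) - z₀ with he
  set γ : ℝ → 𝕜 × 𝕜 × 𝕜 := fun s => (z₀ : 𝕜 × 𝕜 × 𝕜) + s • e with hγ
  have hmem : ∀ s ∈ Set.Icc (0 : ℝ) 1, γ s ∈ D := by
    intro s hs
    exact hD.add_smul_sub_mem z₀.2 z₁.2 hs
  set M : ι → ι → 𝕜 × 𝕜 × 𝕜 → 𝕜 := fun i j z =>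
    e.1 * (a i j).extend z + e.2.1 * (b i j).extend z + e.2.2 * (c i j).extend z with hM
  have hMc : ∀ i j, ContinuousOn (fun s => ‖M i j (γ s)‖) (Set.Icc (0 : ℝ) 1) := by
    intro i j
    have hγc : ContinuousOn γ (Set.Icc (0 : ℝ) 1) := by
      apply Continuous.continuousOn
      fun_prop
    have hcont : ∀ f : SmoothFn D, ContinuousOn (fun s => f.extend (γ s)) (Set.Icc (0 : ℝ) 1) :=
      fun f => f.contDiffOn_extend.continuousOn.comp hγc hmem
    exact (((continuousOn_const.mul (hcont _)).add (continuousOn_const.mul (hcont _))).add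
      (continuousOn_const.mul (hcont _))).norm
  have hK : ∀ i j, ∃ K : ℝ, ∀ s ∈ Set.Icc (0 : ℝ) 1, ‖M i j (γ s)‖ ≤ K := by
    intro i j
    obtain ⟨K, hK⟩ := (isCompact_Icc.image_of_continuousOn (hMc i j)).bddAbove
    exact ⟨K, fun s hs => hK (Set.mem_image_of_mem _ hs)⟩
  choose K hK using hK
  set w : ℝ → ι → 𝕜 := fun s i => (v i).extend (γ s) with hw
  have hderiv : ∀ s ∈ Set.Icc (0 : ℝ) 1,
      HasDerivAt w (fun i => ∑ j, M i j (γ s) * w s j) s := by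
    intro s hs
    rw [hasDerivAt_pi]
    intro i
    have h1 := ((v i).hasFDerivAt_extend ⟨γ s, hmem s hs⟩).restrictScalars ℝ
    have h2 : HasDerivAt γ e s :=
      (((hasDerivAt_id s).smul_const e).const_add (z₀ : 𝕜 × 𝕜 × 𝕜)).congr_deriv (one_smul _ _)
    have h3 := h1.comp_hasDerivAt s h2
    refine h3.congr_deriv ?_
    change fderiv 𝕜 (v i).extend (γ s) e = _
    rw [fderiv_extend (v i) ⟨γ s, hmem s hs⟩ e, ha, hb, hc]
    simp only [coe_sum, coe_mul, Finset.mul_sum, ← Finset.sum_add_distrib, hM, hw]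
    refine Finset.sum_congr rfl fun j _ => ?_
    have hx : ∀ f : SmoothFn D, f.extend (γ s) = f ⟨γ s, hmem s hs⟩ := fun f =>
      extend_apply f ⟨γ s, hmem s hs⟩
    simp only [hx]
    ring
  have hbound : ∀ s ∈ Set.Ico (0 : ℝ) 1,
      ‖(fun i => ∑ j, M i j (γ s) * w s j : ι → 𝕜)‖ ≤ (∑ i, ∑ j, K i j) * ‖w s‖ := by
    intro s hs
    have hs' := Set.Ico_subset_Icc_self hs
    have hK0 : ∀ i j, 0 ≤ K i j := fun i j => (norm_nonneg _).trans (hK i j s hs')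
    refine (pi_norm_le_iff_of_nonneg (mul_nonneg (Finset.sum_nonneg fun i _ =>
      Finset.sum_nonneg fun j _ => hK0 i j) (norm_nonneg _))).2 fun i => ?_
    calc ‖∑ j, M i j (γ s) * w s j‖ ≤ ∑ j, ‖M i j (γ s) * w s j‖ := norm_sum_le _ _
      _ ≤ ∑ j, K i j * ‖w s‖ := by
        refine Finset.sum_le_sum fun j _ => ?_
        rw [norm_mul]
        exact mul_le_mul (hK i j s hs') (norm_le_pi_norm _ _) (norm_nonneg _) (hK0 i j)
      _ = (∑ j, K i j) * ‖w s‖ := (Finset.sum_mul ..).symm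
      _ ≤ _ := by
        refine mul_le_mul_of_nonneg_right ?_ (norm_nonneg _)
        exact Finset.single_le_sum (f := fun i => ∑ j, K i j)
          (fun i _ => Finset.sum_nonneg fun j _ => hK0 i j) (Finset.mem_univ i)
  have hcontw : ContinuousOn w (Set.Icc 0 1) := fun s hs =>
    (hderiv s hs).continuousAt.continuousWithinAt
  have hx : ∀ f : SmoothFn D, f.extend (γ 0) = f z₀ := fun f => by
    have : γ 0 = z₀ := by simp [hγ]
    rw [this, extend_apply]
  have h1 := eq_zero_of_abs_deriv_le_mul_abs_self_of_eq_zero_right hcontw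
    (fun s hs => (hderiv s (Set.Ico_subset_Icc_self hs)).hasDerivWithinAt)
    (by ext i; simp [hw, hx, h₀]) hbound 1 (by simp)
  have h2 := congrFun h1 i
  have : γ 1 = z₁ := by simp [hγ, he]
  simp only [hw, this, extend_apply] at h2
  simpa using h2

/-- The case of one unknown function in `eq_zero_of_linear_system`. -/
theorem eq_zero_of_logDeriv (hD : Convex ℝ (D : Set (𝕜 × 𝕜 × 𝕜))) (f a b c : SmoothFn D)
    (ha : dx f = a * f) (hb : dt f = b * f) (hc : du f = c * f) (z₀ : D) (h₀ : f z₀ = 0) :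
    f = 0 :=
  eq_zero_of_linear_system hD (fun _ : Unit => f) (fun _ _ => a) (fun _ _ => b) (fun _ _ => c)
    (by simpa) (by simpa) (by simpa) z₀ (by simpa) ()

theorem exists_const (hD : Convex ℝ (D : Set (𝕜 × 𝕜 × 𝕜))) (hne : Nonempty D) (f : SmoothFn D)
    (ha : dx f = 0) (hb : dt f = 0) (hc : du f = 0) : ∃ c : 𝕜, f = algebraMap 𝕜 _ c := by
  obtain ⟨z₀⟩ := hne
  refine ⟨f z₀, sub_eq_zero.1 (eq_zero_of_logDeriv hD _ 0 0 0 ?_ ?_ ?_ z₀ ?_)⟩ <;> simp [*]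

/-! ### Restriction, zero divisors and polynomial identities -/

/-- The restriction of smooth functions to a smaller open set. -/
noncomputable def restrict {D' : TopologicalSpace.Opens (𝕜 × 𝕜 × 𝕜)} (h : D' ≤ D) :
    SmoothFn D →ₐ[𝕜] SmoothFn D' :=
  have key : ∀ (f : SmoothFn D) (z : D'),
      (mk f.extend (f.contDiffOn_extend.mono h) : SmoothFn D') z = f ⟨z, h z.2⟩ :=
    fun f z => extend_apply f ⟨z, h z.2⟩
  { toFun := fun f => mk f.extend (f.contDiffOn_extend.mono h)
    map_one' := by ext z; rw [key, coe_one, coe_one]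
    map_mul' := fun f g => by ext z; rw [key, coe_mul, coe_mul, key, key]
    map_zero' := by ext z; rw [key, coe_zero, coe_zero]
    map_add' := fun f g => by ext z; rw [key, coe_add, coe_add, key, key]
    commutes' := fun c => by ext z; rw [key, coe_algebraMap, coe_algebraMap] }

section restrict

variable {D' : TopologicalSpace.Opens (𝕜 × 𝕜 × 𝕜)} (h : D' ≤ D)

@[simp] theorem restrict_apply (f : SmoothFn D) (z : D') : restrict h f z = f ⟨z, h z.2⟩ :=
  extend_apply f ⟨z, h z.2⟩

theorem der_restrict (e : 𝕜 × 𝕜 × 𝕜) (f : SmoothFn D) :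
    der e (restrict h f) = restrict h (der e f) := by
  ext z
  rw [restrict_apply]
  exact der_eq_of_hasFDerivAt _ (fun _ => rfl) z (f.hasFDerivAt_extend ⟨z, h z.2⟩) e

theorem dx_restrict (f : SmoothFn D) : dx (restrict h f) = restrict h (dx f) := der_restrict h _ f
theorem dt_restrict (f : SmoothFn D) : dt (restrict h f) = restrict h (dt f) := der_restrict h _ f
theorem du_restrict (f : SmoothFn D) : du (restrict h f) = restrict h (du f) := der_restrict h _ f

end restrict

/-- The open subset of `D` where a smooth function does not vanish. -/
def support (f : SmoothFn D) : TopologicalSpace.Opens (𝕜 × 𝕜 × 𝕜) :=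
  ⟨{z | ∃ h : z ∈ D, f ⟨z, h⟩ ≠ 0}, by
    have h1 : {z | ∃ h : z ∈ D, f ⟨z, h⟩ ≠ 0} = (D : Set (𝕜 × 𝕜 × 𝕜)) ∩ f.extend ⁻¹' {0}ᶜ := by
      ext z
      constructor
      · rintro ⟨h, hz⟩
        exact ⟨h, by simpa [extend_apply f ⟨z, h⟩] using hz⟩
      · rintro ⟨h, hz⟩
        exact ⟨h, by simpa [extend_apply f ⟨z, h⟩] using hz⟩
    rw [h1]
    exact f.contDiffOn_extend.continuousOn.isOpen_inter_preimage D.isOpen isOpen_compl_singleton⟩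

theorem support_le (f : SmoothFn D) : f.support ≤ D := fun _ h => h.1

/-- The ring of smooth functions has zero divisors; this and the next lemma replace cancellation. -/
theorem mul_eq_zero_of_ne {f g : SmoothFn D} (h : f * g = 0) {z : D} (hz : f z ≠ 0) :
    g z = 0 := by
  have := congrArg (fun f : SmoothFn D => f z) h
  simpa [hz] using this

/-- If `f * g = 0`, then the derivatives of `g` vanish where `f` does not. -/
theorem mul_der_eq_zero {f g : SmoothFn D} (h : f * g = 0) (e : 𝕜 × 𝕜 × 𝕜) :
    f * der e g = 0 := by
  ext z
  by_cases hz : f z = 0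
  · simp [hz]
  · have h1 := congrArg (fun F => F z) (congrArg (der e) h)
    simp [mul_eq_zero_of_ne h hz] at h1
    simpa [hz] using h1

instance : IsReduced (SmoothFn D) := by
  refine ⟨fun f ⟨n, hn⟩ => ?_⟩
  ext z
  have := congrArg (fun f : SmoothFn D => f z) hn
  simp only [coe_pow, coe_zero] at this
  simpa using eq_zero_of_pow_eq_zero this

theorem natCast_mul_eq_zero {n : ℕ} (hn : n ≠ 0) {f : SmoothFn D} (h : (n : SmoothFn D) * f = 0) :
    f = 0 := by
  ext z
  have := congrArg (fun f : SmoothFn D => f z) h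
  simpa [hn] using this

theorem algebraMap_mul_eq_zero {c : 𝕜} (hc : c ≠ 0) {f : SmoothFn D}
    (h : algebraMap 𝕜 (SmoothFn D) c * f = 0) : f = 0 := by
  ext z
  have := congrArg (fun f : SmoothFn D => f z) h
  simpa [hc] using this

/-- A polynomial in `w` with `d w = 1` whose coefficients are killed by the derivation `d`
vanishes only if all of its coefficients do. -/
theorem coeff_eq_zero (d : Derivation 𝕜 (SmoothFn D) (SmoothFn D)) {w : SmoothFn D}
    (hw : d w = 1) (n : ℕ) (a : ℕ → SmoothFn D) (ha : ∀ i, d (a i) = 0)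
    (h : ∑ i ∈ Finset.range (n + 1), a i * w ^ i = 0) : ∀ i ≤ n, a i = 0 := by
  induction n generalizing a with
  | zero =>
    intro i hi
    obtain rfl : i = 0 := by omega
    simpa using h
  | succ n ih =>
    have h1 := congrArg d h
    rw [map_sum, Finset.sum_range_succ'] at h1
    simp only [Derivation.leibniz, Derivation.leibniz_pow, ha, hw, smul_eq_mul, map_zero,
      nsmul_eq_mul, pow_zero, mul_one, mul_zero, add_zero] at h1
    have h2 := ih (fun i => ((i + 1 : ℕ) : SmoothFn D) * a (i + 1)) (fun i => by simp [ha]) (by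
      rw [← h1]
      refine Finset.sum_congr rfl fun i _ => ?_
      simp
      ring)
    have h3 : ∀ i ≤ n, a (i + 1) = 0 := fun i hi =>
      natCast_mul_eq_zero (Nat.succ_ne_zero i) (h2 i hi)
    intro i hi
    rcases i with _ | i
    · rw [Finset.sum_range_succ', Finset.sum_eq_zero] at h
      · simpa using h
      · intro j hj
        rw [h3 j (by simpa [Nat.lt_succ_iff] using hj), zero_mul]
    · exact h3 i (by omega)

end SmoothFn

/-! ### Jet polynomials -/

/-- Polynomials in the jet coordinates whose coefficients are smooth functions of `(x, t, u)`. -/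
abbrev JetPoly {𝕜 : Type*} [RCLike 𝕜] (D : TopologicalSpace.Opens (𝕜 × 𝕜 × 𝕜)) :=
  MvPolynomial (ℕ × ℕ) (SmoothFn D)

namespace JetPoly

open MvPolynomial SmoothFn

variable {𝕜 : Type*} [RCLike 𝕜] {D : TopologicalSpace.Opens (𝕜 × 𝕜 × 𝕜)}

/-- The ring homomorphism to the dual numbers whose `ε`-part is the derivation `jetDerivation`. -/
noncomputable def dualHom (c : Derivation 𝕜 (SmoothFn D) (JetPoly D)) (b : ℕ × ℕ → JetPoly D) :
    JetPoly D →+* TrivSqZeroExt (JetPoly D) (JetPoly D) :=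
  eval₂Hom
    { toFun := fun f => TrivSqZeroExt.inl (C f) + TrivSqZeroExt.inr (c f)
      map_one' := by ext <;> simp
      map_zero' := by ext <;> simp
      map_add' := fun f g => by ext <;> simp
      map_mul' := fun f g => by
        apply TrivSqZeroExt.ext
        · simp
        · simp [MvPolynomial.smul_eq_C_mul, mul_comm] }
    fun k => TrivSqZeroExt.inl (X k) + TrivSqZeroExt.inr (b k)

theorem fst_dualHom (c : Derivation 𝕜 (SmoothFn D) (JetPoly D)) (b : ℕ × ℕ → JetPoly D)
    (P : JetPoly D) : (dualHom c b P).fst = P := by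
  have h : (TrivSqZeroExt.fstHom (JetPoly D) (JetPoly D) (JetPoly D)).toRingHom.comp
      (dualHom c b) = RingHom.id _ := by
    apply MvPolynomial.ringHom_ext
    · intro f
      simp [dualHom]
    · intro k
      simp [dualHom]
  exact congrArg (fun f : JetPoly D →+* JetPoly D => f P) h

/-- The derivation of the ring of jet polynomials with prescribed values on the coefficients and
on the jet coordinates. -/
noncomputable def jetDerivation (c : Derivation 𝕜 (SmoothFn D) (JetPoly D))
    (b : ℕ × ℕ → JetPoly D) : Derivation 𝕜 (JetPoly D) (JetPoly D) :=
  Derivation.mk'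
    { toFun := fun P => (dualHom c b P).snd
      map_add' := fun P Q => by simp
      map_smul' := fun a P => by
        have h : a • P = C (algebraMap 𝕜 _ a) * P := by
          rw [← MvPolynomial.smul_eq_C_mul, algebraMap_smul]
        have h2 : (dualHom c b (C (algebraMap 𝕜 _ a))).snd = 0 := by simp [dualHom]
        rw [h, map_mul, TrivSqZeroExt.snd_mul, fst_dualHom, fst_dualHom, h2, smul_zero, add_zero,
          smul_eq_mul, RingHom.id_apply, ← MvPolynomial.smul_eq_C_mul, algebraMap_smul] }
    fun P Q => by
      change (dualHom c b (P * Q)).snd = P • (dualHom c b Q).snd + Q • (dualHom c b P).snd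
      rw [map_mul, TrivSqZeroExt.snd_mul, fst_dualHom, fst_dualHom, op_smul_eq_smul]

@[simp] theorem jetDerivation_C (c : Derivation 𝕜 (SmoothFn D) (JetPoly D))
    (b : ℕ × ℕ → JetPoly D) (f : SmoothFn D) : jetDerivation c b (C f) = c f := by
  change (dualHom c b (C f)).snd = _
  simp [dualHom]

@[simp] theorem jetDerivation_X (c : Derivation 𝕜 (SmoothFn D) (JetPoly D))
    (b : ℕ × ℕ → JetPoly D) (k : ℕ × ℕ) : jetDerivation c b (X k) = b k := by
  change (dualHom c b (X k)).snd = _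
  simp [dualHom]

/-- A derivation of the coefficients, with values in jet polynomials. -/
noncomputable def coeffDerivation (d : Derivation 𝕜 (SmoothFn D) (SmoothFn D)) :
    Derivation 𝕜 (SmoothFn D) (JetPoly D) :=
  (Algebra.linearMap (SmoothFn D) (JetPoly D)).compDer d

@[simp] theorem coeffDerivation_apply (d : Derivation 𝕜 (SmoothFn D) (SmoothFn D))
    (f : SmoothFn D) : coeffDerivation d f = C (d f) := rfl

/-- `∂/∂x` on jet polynomials. -/
noncomputable def pX : Derivation 𝕜 (JetPoly D) (JetPoly D) := jetDerivation (coeffDerivation dx) 0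

/-- `∂/∂t` on jet polynomials. -/
noncomputable def pT : Derivation 𝕜 (JetPoly D) (JetPoly D) := jetDerivation (coeffDerivation dt) 0

/-- `∂/∂u_{ij}` on jet polynomials. The coordinate `u = u₀₀` also occurs in the coefficients. -/
noncomputable def pJet (k : ℕ × ℕ) : Derivation 𝕜 (JetPoly D) (JetPoly D) :=
  jetDerivation (if k = (0, 0) then coeffDerivation du else 0) (Pi.single k 1)

/-- The total derivative `Dₓ` on jet polynomials of order at most four. -/
noncomputable def DX : Derivation 𝕜 (JetPoly D) (JetPoly D) :=
  pX + ∑ n ∈ Finset.range 5, ∑ k ∈ Finset.HasAntidiagonal.antidiagonal n,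
    (X (k.1 + 1, k.2) : JetPoly D) • pJet k

/-- The total derivative `Dₜ` on jet polynomials of order at most four. -/
noncomputable def DT : Derivation 𝕜 (JetPoly D) (JetPoly D) :=
  pT + ∑ n ∈ Finset.range 5, ∑ k ∈ Finset.HasAntidiagonal.antidiagonal n,
    (X (k.1, k.2 + 1) : JetPoly D) • pJet k

theorem sum_apply {ι : Type*} (s : Finset ι) (d : ι → Derivation 𝕜 (JetPoly D) (JetPoly D))
    (P : JetPoly D) : (∑ i ∈ s, d i) P = ∑ i ∈ s, d i P := by
  classical
  induction s using Finset.induction_on with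
  | empty => simp
  | insert a s ha ih => rw [Finset.sum_insert ha, Finset.sum_insert ha, Derivation.add_apply, ih]

theorem sum_pJet_X (g : ℕ × ℕ → JetPoly D) (k : ℕ × ℕ) (hk : k.1 + k.2 < 5) :
    ∑ n ∈ Finset.range 5, ∑ k' ∈ Finset.HasAntidiagonal.antidiagonal n,
      g k' * pJet k' (X k : JetPoly D) = g k := by
  rw [Finset.sum_eq_single (k.1 + k.2), Finset.sum_eq_single k]
  · simp [pJet]
  · intro k' _ hne
    simp [pJet, hne.symm]
  · intro h
    simp at h
  · intro n _ hn
    refine Finset.sum_eq_zero fun k' hk' => ?_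
    have : k ≠ k' := by
      rintro rfl
      exact hn (Finset.HasAntidiagonal.mem_antidiagonal.1 hk').symm
    simp [pJet, this]
  · intro h
    simp at h
    omega

theorem sum_pJet_C (g : ℕ × ℕ → JetPoly D) (f : SmoothFn D) :
    ∑ n ∈ Finset.range 5, ∑ k' ∈ Finset.HasAntidiagonal.antidiagonal n,
      g k' * pJet k' (C f : JetPoly D) = g (0, 0) * C (du f) := by
  rw [Finset.sum_eq_single 0, Finset.sum_eq_single (0, 0)]
  · simp [pJet]
  · intro k' _ hne
    simp [pJet, hne]
  · intro h
    simp at h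
  · intro n _ hn
    refine Finset.sum_eq_zero fun k' hk' => ?_
    have : k' ≠ (0, 0) := by
      rintro rfl
      exact hn (Finset.HasAntidiagonal.mem_antidiagonal.1 hk').symm
    simp [pJet, this]
  · intro h
    simp at h

@[simp] theorem pX_C (f : SmoothFn D) : pX (C f : JetPoly D) = C (dx f) := by simp [pX]
@[simp] theorem pX_X (k : ℕ × ℕ) : pX (X k : JetPoly D) = 0 := by simp [pX]
@[simp] theorem pT_C (f : SmoothFn D) : pT (C f : JetPoly D) = C (dt f) := by simp [pT]
@[simp] theorem pT_X (k : ℕ × ℕ) : pT (X k : JetPoly D) = 0 := by simp [pT]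

theorem DX_C (f : SmoothFn D) : DX (C f : JetPoly D) = C (dx f) + X (1, 0) * C (du f) := by
  simp only [DX, Derivation.add_apply, sum_apply, Derivation.smul_apply, smul_eq_mul, pX_C]
  rw [sum_pJet_C fun k => X (k.1 + 1, k.2)]

theorem DT_C (f : SmoothFn D) : DT (C f : JetPoly D) = C (dt f) + X (0, 1) * C (du f) := by
  simp only [DT, Derivation.add_apply, sum_apply, Derivation.smul_apply, smul_eq_mul, pT_C]
  rw [sum_pJet_C fun k => X (k.1, k.2 + 1)]

theorem DX_X (i j : ℕ) (h : i + j < 5) : DX (X (i, j) : JetPoly D) = X (i + 1, j) := by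
  simp only [DX, Derivation.add_apply, sum_apply, Derivation.smul_apply, smul_eq_mul, pX_X]
  rw [sum_pJet_X (fun k => X (k.1 + 1, k.2)) (i, j) h, zero_add]

theorem DT_X (i j : ℕ) (h : i + j < 5) : DT (X (i, j) : JetPoly D) = X (i, j + 1) := by
  simp only [DT, Derivation.add_apply, sum_apply, Derivation.smul_apply, smul_eq_mul, pT_X]
  rw [sum_pJet_X (fun k => X (k.1, k.2 + 1)) (i, j) h, zero_add]

/-- The coefficient of `∂/∂u_{ij}` in the prolongation of `ξ ∂ₓ + τ ∂ₜ + φ ∂ᵤ`. -/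
noncomputable def coeff (ξ τ φ : SmoothFn D) (k : ℕ × ℕ) : JetPoly D :=
  DX^[k.1] (DT^[k.2] (-(C ξ * X (1, 0) + C τ * X (0, 1) - C φ))) + C ξ * X (k.1 + 1, k.2)
    + C τ * X (k.1, k.2 + 1)

/-- The fourth prolongation of `ξ ∂ₓ + τ ∂ₜ + φ ∂ᵤ`, as a derivation. -/
noncomputable def PR (ξ τ φ : SmoothFn D) : Derivation 𝕜 (JetPoly D) (JetPoly D) :=
  (C ξ : JetPoly D) • pX + (C τ : JetPoly D) • pT +
    ∑ n ∈ Finset.range 5, ∑ k ∈ Finset.HasAntidiagonal.antidiagonal n,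
      coeff ξ τ φ k • pJet k

theorem coeff_zero (ξ τ φ : SmoothFn D) : coeff ξ τ φ (0, 0) = C φ := by
  simp [coeff]
  ring

theorem PR_C (ξ τ φ f : SmoothFn D) :
    PR ξ τ φ (C f) = C (ξ * dx f + τ * dt f + φ * du f) := by
  simp only [PR, Derivation.add_apply, sum_apply, Derivation.smul_apply, smul_eq_mul, pX_C, pT_C]
  rw [sum_pJet_C, coeff_zero]
  simp

theorem PR_X (ξ τ φ : SmoothFn D) (i j : ℕ) (h : i + j < 5) :
    PR ξ τ φ (X (i, j)) = coeff ξ τ φ (i, j) := by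
  simp only [PR, Derivation.add_apply, sum_apply, Derivation.smul_apply, smul_eq_mul, pX_X, pT_X]
  rw [sum_pJet_X _ _ h]
  simp

/-- The characteristic `W = φ - ξ uₓ` of the invariant surface condition `uₜ = W`. -/
noncomputable def characteristic (ξ φ : SmoothFn D) : JetPoly D := C φ - C ξ * X (1, 0)

/-- The `t`-derivative on functions of `x, t, u, uₓ, …` computed by means of `uₜ = φ - ξ uₓ`. -/
noncomputable def ET (ξ φ : SmoothFn D) : Derivation 𝕜 (JetPoly D) (JetPoly D) :=
  pT + ∑ i ∈ Finset.range 5, DX^[i] (characteristic ξ φ) • pJet (i, 0)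

theorem ET_C (ξ φ f : SmoothFn D) :
    ET ξ φ (C f) = C (dt f) + characteristic ξ φ * C (du f) := by
  simp only [ET, Derivation.add_apply, sum_apply, Derivation.smul_apply, smul_eq_mul, pT_C]
  simp [Finset.sum_range_succ, pJet]

theorem ET_X_one (ξ φ : SmoothFn D) :
    ET ξ φ (X (1, 0)) = DX (characteristic ξ φ) := by
  simp only [ET, Derivation.add_apply, sum_apply, Derivation.smul_apply, smul_eq_mul, pT_X]
  simp [Finset.sum_range_succ, pJet]

/-! ### Jet polynomials as functions on jet space -/

/-- The value of a jet polynomial at a point of jet space over `D`. -/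
noncomputable def ev (z : D) (p : ℕ × ℕ → 𝕜) : JetPoly D →+* 𝕜 :=
  eval₂Hom (evalAt z : SmoothFn D →+* 𝕜) p

@[simp] theorem ev_C (z : D) (p : ℕ × ℕ → 𝕜) (f : SmoothFn D) : ev z p (C f) = f z := by
  simp [ev, evalAt_apply]

@[simp] theorem ev_X (z : D) (p : ℕ × ℕ → 𝕜) (k : ℕ × ℕ) : ev z p (X k) = p k := by
  simp [ev]

open Classical in
/-- The function on jet space defined by a jet polynomial (zero away from the jets over `D`). -/
noncomputable def toJetFun (P : JetPoly D) : JetFun 𝕜 := fun x t p =>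
  if h : (x, t, p (0, 0)) ∈ D then ev ⟨_, h⟩ p P else 0

/-- The function `F` agrees with the jet polynomial `P` at all jets over `D`. -/
def Represents (F : JetFun 𝕜) (P : JetPoly D) : Prop :=
  ∀ x t p, (x, t, p (0, 0)) ∈ D → F x t p = toJetFun P x t p

theorem toJetFun_of_mem (P : JetPoly D) {x t : 𝕜} {p : ℕ × ℕ → 𝕜}
    (h : (x, t, p (0, 0)) ∈ D) : toJetFun P x t p = ev ⟨_, h⟩ p P := dif_pos h

theorem toJetFun_C (f : SmoothFn D) (x t : 𝕜) (p : ℕ × ℕ → 𝕜) :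
    toJetFun (C f) x t p = f.extend (x, t, p (0, 0)) := by
  by_cases h : (x, t, p (0, 0)) ∈ D
  · rw [toJetFun_of_mem _ h, ev_C]
    exact (extend_apply f ⟨_, h⟩).symm
  · rw [toJetFun, dif_neg h, extend, Function.extend_apply']
    · rfl
    · rintro ⟨⟨z, hz⟩, rfl⟩
      exact h hz

theorem toJetFun_add (P Q : JetPoly D) (x t : 𝕜) (p : ℕ × ℕ → 𝕜) :
    toJetFun (P + Q) x t p = toJetFun P x t p + toJetFun Q x t p := by
  by_cases h : (x, t, p (0, 0)) ∈ D <;> simp [toJetFun, h]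

theorem toJetFun_mul (P Q : JetPoly D) (x t : 𝕜) (p : ℕ × ℕ → 𝕜) :
    toJetFun (P * Q) x t p = toJetFun P x t p * toJetFun Q x t p := by
  by_cases h : (x, t, p (0, 0)) ∈ D <;> simp [toJetFun, h]

/-- Along a curve in jet space a derivation acts on jet polynomials as `d/ds`, if it does so on
the coefficients and on the jet coordinates. -/
theorem hasDerivAt_curve (d : Derivation 𝕜 (JetPoly D) (JetPoly D)) (x t : 𝕜 → 𝕜)
    (p : 𝕜 → ℕ × ℕ → 𝕜) (s₀ : 𝕜)
    (hnhds : ∀ᶠ s in nhds s₀, (x s, t s, p s (0, 0)) ∈ D)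
    (hC : ∀ f : SmoothFn D, HasDerivAt (fun s => f.extend (x s, t s, p s (0, 0)))
      (toJetFun (d (C f)) (x s₀) (t s₀) (p s₀)) s₀)
    (hX : ∀ k, HasDerivAt (fun s => p s k) (toJetFun (d (X k)) (x s₀) (t s₀) (p s₀)) s₀)
    (P : JetPoly D) :
    HasDerivAt (fun s => toJetFun P (x s) (t s) (p s))
      (toJetFun (d P) (x s₀) (t s₀) (p s₀)) s₀ := by
  have hXe : ∀ k, HasDerivAt (fun s => toJetFun (X k : JetPoly D) (x s) (t s) (p s))
      (toJetFun (d (X k)) (x s₀) (t s₀) (p s₀)) s₀ := by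
    intro k
    refine (hX k).congr_of_eventuallyEq ?_
    filter_upwards [hnhds] with s hs
    rw [toJetFun_of_mem _ hs, ev_X]
  induction P using MvPolynomial.induction_on with
  | C f => simpa only [toJetFun_C] using hC f
  | add P Q hP hQ =>
    simp only [map_add, toJetFun_add]
    exact hP.add hQ
  | mul_X P k hP =>
    simp only [Derivation.leibniz, toJetFun_add, toJetFun_mul, smul_eq_mul]
    refine (hP.mul (hXe k)).congr_deriv ?_
    ring

theorem toJetFun_zero (x t : 𝕜) (p : ℕ × ℕ → 𝕜) : toJetFun (0 : JetPoly D) x t p = 0 := by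
  simp [toJetFun]

theorem hasDerivAt_pX (P : JetPoly D) (x t : 𝕜) (p : ℕ × ℕ → 𝕜) (h : (x, t, p (0, 0)) ∈ D) :
    HasDerivAt (fun s => toJetFun P s t p) (toJetFun (pX P) x t p) x := by
  refine hasDerivAt_curve pX (fun s => s) (fun _ => t) (fun _ => p) x ?_ ?_ ?_ P
  · exact (show Continuous fun s : 𝕜 => (s, t, p (0, 0)) by fun_prop).continuousAt.eventually_mem
      (D.isOpen.mem_nhds h)
  · intro f
    rw [pX_C, toJetFun_of_mem _ h, ev_C]
    exact hasDerivAt_slice_x f ⟨_, h⟩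
  · intro k
    rw [pX_X, toJetFun_zero]
    exact hasDerivAt_const _ _

theorem hasDerivAt_pT (P : JetPoly D) (x t : 𝕜) (p : ℕ × ℕ → 𝕜) (h : (x, t, p (0, 0)) ∈ D) :
    HasDerivAt (fun s => toJetFun P x s p) (toJetFun (pT P) x t p) t := by
  refine hasDerivAt_curve pT (fun _ => x) (fun s => s) (fun _ => p) t ?_ ?_ ?_ P
  · exact (show Continuous fun s : 𝕜 => (x, s, p (0, 0)) by fun_prop).continuousAt.eventually_mem
      (D.isOpen.mem_nhds h)
  · intro f
    rw [pT_C, toJetFun_of_mem _ h, ev_C]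
    exact hasDerivAt_slice_t f ⟨_, h⟩
  · intro k
    rw [pT_X, toJetFun_zero]
    exact hasDerivAt_const _ _

theorem hasDerivAt_pJet (k : ℕ × ℕ) (P : JetPoly D) (x t : 𝕜) (p : ℕ × ℕ → 𝕜)
    (h : (x, t, p (0, 0)) ∈ D) :
    HasDerivAt (fun s => toJetFun P x t (Function.update p k s)) (toJetFun (pJet k P) x t p)
      (p k) := by
  have h' : (x, t, Function.update p k (p k) (0, 0)) ∈ D := by simpa using h
  have hcont : Continuous fun s : 𝕜 => (x, t, Function.update p k s (0, 0)) := by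
    have : Continuous fun s : 𝕜 => Function.update p k s (0, 0) := by
      have := (continuous_const (y := p)).update k continuous_id
      exact (continuous_apply (0, 0)).comp this
    fun_prop
  have key := hasDerivAt_curve (pJet k) (fun _ => x) (fun _ => t)
    (fun s => Function.update p k s) (p k) (hcont.continuousAt.eventually_mem
      (D.isOpen.mem_nhds h')) ?_ ?_ P
  · simpa using key
  · intro f
    rw [Function.update_eq_self]
    by_cases hk : k = (0, 0)
    · subst hk
      simp only [pJet, if_true, jetDerivation_C, coeffDerivation_apply, Function.update_self]
      rw [toJetFun_of_mem _ h, ev_C]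
      exact hasDerivAt_slice_u f ⟨_, h⟩
    · simp only [pJet, if_neg hk, jetDerivation_C, Derivation.zero_apply, toJetFun_zero,
        Function.update_of_ne (Ne.symm hk)]
      exact hasDerivAt_const _ _
  · intro k'
    rw [Function.update_eq_self]
    by_cases hk : k' = k
    · subst hk
      simp only [pJet, jetDerivation_X, Pi.single_eq_same, Function.update_self]
      rw [toJetFun_of_mem _ h, map_one]
      exact hasDerivAt_id _
    · simp only [pJet, jetDerivation_X, Pi.single_eq_of_ne hk, Function.update_of_ne hk,
        toJetFun_zero]
      exact hasDerivAt_const _ _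

section Represents

variable {F G : JetFun 𝕜} {P Q : JetPoly D}

/-- The partial derivatives of functions on jet space are defined by `deriv`. On a represented
function they agree with the algebraic derivations, since jet polynomials are differentiable. -/
theorem Represents.partialX (h : Represents F P) : Represents (partialX F) (pX P) := by
  intro x t p hp
  refine HasDerivAt.deriv ((hasDerivAt_pX P x t p hp).congr_of_eventuallyEq ?_)
  filter_upwards [(show Continuous fun s : 𝕜 => (s, t, p (0, 0)) by
    fun_prop).continuousAt.eventually_mem (D.isOpen.mem_nhds hp)] with s hs
  exact h _ _ _ hs

theorem Represents.partialT (h : Represents F P) : Represents (partialT F) (pT P) := by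
  intro x t p hp
  refine HasDerivAt.deriv ((hasDerivAt_pT P x t p hp).congr_of_eventuallyEq ?_)
  filter_upwards [(show Continuous fun s : 𝕜 => (x, s, p (0, 0)) by
    fun_prop).continuousAt.eventually_mem (D.isOpen.mem_nhds hp)] with s hs
  exact h _ _ _ hs

theorem Represents.partialJet (h : Represents F P) (k : ℕ × ℕ) :
    Represents (partialJet k F) (pJet k P) := by
  intro x t p hp
  refine HasDerivAt.deriv ((hasDerivAt_pJet k P x t p hp).congr_of_eventuallyEq ?_)
  have hcont : Continuous fun s : 𝕜 => (x, t, Function.update p k s (0, 0)) := by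
    have : Continuous fun s : 𝕜 => Function.update p k s (0, 0) := by
      have := (continuous_const (y := p)).update k continuous_id
      exact (continuous_apply (0, 0)).comp this
    fun_prop
  filter_upwards [hcont.continuousAt.eventually_mem (D.isOpen.mem_nhds
    (by simpa using hp : (x, t, Function.update p k (p k) (0, 0)) ∈ D))] with s hs
  exact h _ _ _ hs

theorem Represents.eq (h : Represents F P) {x t : 𝕜} {p : ℕ × ℕ → 𝕜}
    (hp : (x, t, p (0, 0)) ∈ D) : F x t p = ev ⟨_, hp⟩ p P := by
  rw [h _ _ _ hp, toJetFun_of_mem]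

theorem represents_iff : Represents F P ↔
    ∀ x t p (h : (x, t, p (0, 0)) ∈ D), F x t p = ev ⟨_, h⟩ p P :=
  ⟨fun h _ _ _ hp => h.eq hp, fun h x t p hp => by rw [h x t p hp, toJetFun_of_mem]⟩

theorem Represents.totalX (h : Represents F P) : Represents (totalX F) (DX P) := by
  rw [represents_iff]
  intro x t p hp
  simp only [LieSym.totalX, DX, Derivation.add_apply, sum_apply, Derivation.smul_apply,
    smul_eq_mul, map_add, map_sum, map_mul, ev_X, h.partialX.eq hp, (h.partialJet _).eq hp]

theorem Represents.totalT (h : Represents F P) : Represents (totalT F) (DT P) := by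
  rw [represents_iff]
  intro x t p hp
  simp only [LieSym.totalT, DT, Derivation.add_apply, sum_apply, Derivation.smul_apply,
    smul_eq_mul, map_add, map_sum, map_mul, ev_X, h.partialT.eq hp, (h.partialJet _).eq hp]

theorem Represents.iterate_totalX (h : Represents F P) (n : ℕ) :
    Represents (LieSym.totalX^[n] F) (DX^[n] P) := by
  induction n with
  | zero => exact h
  | succ n ih =>
    rw [Function.iterate_succ_apply', Function.iterate_succ_apply']
    exact ih.totalX

theorem Represents.iterate_totalT (h : Represents F P) (n : ℕ) :
    Represents (LieSym.totalT^[n] F) (DT^[n] P) := by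
  induction n with
  | zero => exact h
  | succ n ih =>
    rw [Function.iterate_succ_apply', Function.iterate_succ_apply']
    exact ih.totalT

end Represents

section prolongation

variable {ξ τ φ : 𝕜 → 𝕜 → 𝕜 → 𝕜} {ξ' τ' φ' : SmoothFn D}
  (hξ : ∀ x t u (h : (x, t, u) ∈ D), ξ x t u = ξ' ⟨_, h⟩)
  (hτ : ∀ x t u (h : (x, t, u) ∈ D), τ x t u = τ' ⟨_, h⟩)
  (hφ : ∀ x t u (h : (x, t, u) ∈ D), φ x t u = φ' ⟨_, h⟩)
include hξ hτ hφ

/-- The coefficients of the prolongation are obtained by total derivatives from the surface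
condition, which is a jet polynomial. -/
theorem represents_prolongCoeff (k : ℕ × ℕ) :
    Represents (prolongCoeff ξ τ φ k) (coeff ξ' τ' φ' k) := by
  have h : Represents (fun x t p => -surfaceCondition ξ τ φ x t p)
      (-(C ξ' * X (1, 0) + C τ' * X (0, 1) - C φ') : JetPoly D) := by
    rw [represents_iff]
    intro x t p hp
    simp [surfaceCondition, hξ _ _ _ hp, hτ _ _ _ hp, hφ _ _ _ hp]
  rw [represents_iff]
  intro x t p hp
  simp only [prolongCoeff, coeff, map_add, map_mul, ev_C, ev_X, hξ _ _ _ hp, hτ _ _ _ hp,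
    ((h.iterate_totalT k.2).iterate_totalX k.1).eq hp]

theorem Represents.prolong {F : JetFun 𝕜} {P : JetPoly D} (h : Represents F P) :
    Represents (LieSym.prolong ξ τ φ F) (PR ξ' τ' φ' P) := by
  rw [represents_iff]
  intro x t p hp
  simp only [LieSym.prolong, PR, Derivation.add_apply, sum_apply, Derivation.smul_apply,
    smul_eq_mul, map_add, map_sum, map_mul, ev_C, h.partialX.eq hp, h.partialT.eq hp,
    (h.partialJet _).eq hp, hξ _ _ _ hp, hτ _ _ _ hp,
    (represents_prolongCoeff hξ hτ hφ _).eq hp]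

/-- The infinitesimal criterion of symmetry for a represented function, in terms of the algebraic
prolongation. -/
theorem isLieSymmetry_iff {E : JetFun 𝕜} {P : JetPoly D} (h : Represents E P) :
    IsLieSymmetry E ξ τ φ D ↔ ∀ (z : D) (p : ℕ × ℕ → 𝕜), p (0, 0) = (z : 𝕜 × 𝕜 × 𝕜).2.2 →
      ev z p P = 0 → ev z p (PR ξ' τ' φ' P) = 0 := by
  constructor
  · intro H z p hp h0
    have hmem : ((z : 𝕜 × 𝕜 × 𝕜).1, (z : 𝕜 × 𝕜 × 𝕜).2.1, p (0, 0)) ∈ D := by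
      rw [hp]
      exact z.2
    have hz : (⟨_, hmem⟩ : D) = z := Subtype.ext (by simp [hp])
    have := H _ _ p hmem (by rw [h.eq hmem, hz, h0])
    rwa [(h.prolong hξ hτ hφ).eq hmem, hz] at this
  · intro H x t p hp h0
    rw [(h.prolong hξ hτ hφ).eq hp]
    exact H _ p rfl (by rw [← h.eq hp, h0])

end prolongation

/-! ### The equation and the reduced equation -/

/-- A constant, as a jet polynomial. -/
noncomputable def cst (a : 𝕜) : JetPoly D := C (algebraMap 𝕜 _ a)

@[simp] theorem ev_cst (z : D) (p : ℕ × ℕ → 𝕜) (a : 𝕜) : ev z p (cst a) = a := by simp [cst]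

/-- The equation as a jet polynomial, with `u_tt` and `u_xxtt` left as arguments. -/
noncomputable def equationPoly (α β γ κ μ : 𝕜) (a b : JetPoly D) : JetPoly D :=
  a - cst κ * X (2, 0) - 2 * cst γ * (C u * X (2, 0) + X (1, 0) ^ 2) - C u * X (4, 0)
    - cst μ * b - cst α * X (1, 0) * X (3, 0) - cst β * X (2, 0) ^ 2

theorem represents_equation (α β γ κ μ : 𝕜) :
    Represents (equation α β γ κ μ)
      (equationPoly α β γ κ μ (X (0, 2)) (X (2, 2)) : JetPoly D) := by
  rw [represents_iff]
  intro x t p hp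
  simp [equation, equationWith, equationPoly, map_ofNat]

/-- The reduced equation as a jet polynomial. -/
noncomputable def reducedPoly (α β γ κ μ : 𝕜) (ξ φ : SmoothFn D) : JetPoly D :=
  equationPoly α β γ κ μ (ET ξ φ (characteristic ξ φ)) (DX (DX (ET ξ φ (characteristic ξ φ))))

theorem represents_reducedEquation (α β γ κ μ : 𝕜) {ξ φ : 𝕜 → 𝕜 → 𝕜 → 𝕜} {ξ' φ' : SmoothFn D}
    (hξ : ∀ x t u (h : (x, t, u) ∈ D), ξ x t u = ξ' ⟨_, h⟩)
    (hφ : ∀ x t u (h : (x, t, u) ∈ D), φ x t u = φ' ⟨_, h⟩) :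
    Represents (reducedEquation α β γ κ μ ξ φ) (reducedPoly α β γ κ μ ξ' φ') := by
  have hW : Represents (fun x t p => φ x t (p (0, 0)) - ξ x t (p (0, 0)) * p (1, 0))
      (characteristic ξ' φ') := by
    rw [represents_iff]
    intro x t p hp
    simp [characteristic, hξ _ _ _ hp, hφ _ _ _ hp]
  have hT : Represents (surfaceTT ξ φ) (ET ξ' φ' (characteristic ξ' φ')) := by
    rw [represents_iff]
    intro x t p hp
    simp only [surfaceTT, surfaceT, ET, Derivation.add_apply, sum_apply, Derivation.smul_apply,
      smul_eq_mul, map_add, map_sum, map_mul, hW.partialT.eq hp, (hW.partialJet _).eq hp,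
      (hW.iterate_totalX _).eq hp]
  rw [represents_iff]
  intro x t p hp
  simp [reducedEquation, equationWith, reducedPoly, equationPoly, map_ofNat, hT.eq hp,
    hT.totalX.totalX.eq hp]

end JetPoly

namespace JetPoly

open MvPolynomial SmoothFn

variable {𝕜 : Type*} [RCLike 𝕜] {D : TopologicalSpace.Opens (𝕜 × 𝕜 × 𝕜)}

/-! ### The determining equations for `ξ` independent of `u` -/

/-- The expression for `u_tt` on the invariant surface. -/
theorem ET_characteristic (ξ φ : SmoothFn D) :
    ET ξ φ (characteristic ξ φ) = C (ξ ^ 2) * X (2, 0) + C (2 * ξ * du ξ) * X (1, 0) ^ 2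
      - C (dt ξ + 2 * ξ * du φ + φ * du ξ - ξ * dx ξ) * X (1, 0)
      + C (dt φ + φ * du φ - ξ * dx φ) := by
  have h2 : (C 2 : JetPoly D) = 2 := rfl
  conv_lhs => rw [characteristic]
  simp only [map_sub, Derivation.leibniz, ET_C, ET_X_one, smul_eq_mul, characteristic, DX_C,
    DX_X 1 0 (by norm_num), map_add, map_mul, map_pow, h2]
  ring

/-- For `τ = 1` the coefficients of `∂/∂u`, `∂/∂u_x`, … contain no `t`-derivatives of `u`. -/
theorem coeff_x (ξ φ : SmoothFn D) (i : ℕ) (hi : i < 5) :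
    coeff ξ 1 φ (i, 0) = DX^[i] (C φ - C ξ * X (1, 0)) + C ξ * X (i + 1, 0) := by
  have h : ∀ j ≤ i, DX^[j] (-(C ξ * X (1, 0) + C 1 * X (0, 1) - C φ) : JetPoly D)
      = DX^[j] (C φ - C ξ * X (1, 0)) - X (j, 1) := by
    intro j
    induction j with
    | zero =>
      intro _
      simp
      ring
    | succ j ih =>
      intro hj
      rw [Function.iterate_succ_apply', Function.iterate_succ_apply', ih (by omega), map_sub,
        DX_X j 1 (by omega)]
  simp only [coeff, Function.iterate_zero, id]
  rw [h i le_rfl]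
  simp
  ring

section xiIndependent

variable (ξ φ : SmoothFn D) (hξ : du ξ = 0)
include hξ

theorem coeff_one : coeff ξ 1 φ (1, 0) = C (dx φ) + C (du φ - dx ξ) * X (1, 0) := by
  rw [coeff_x _ _ 1 (by norm_num)]
  simp only [Function.iterate_succ_apply', Function.iterate_zero, id, map_sub,
    Derivation.leibniz, DX_C, DX_X 1 0 (by norm_num), smul_eq_mul, hξ, map_zero, mul_zero,
    add_zero]
  ring

theorem coeff_two : coeff ξ 1 φ (2, 0) = C (dx (dx φ)) + C (2 * dx (du φ) - dx (dx ξ)) * X (1, 0)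
    + C (du (du φ)) * X (1, 0) ^ 2 + C (du φ - 2 * dx ξ) * X (2, 0) := by
  have h2 : (C 2 : JetPoly D) = 2 := rfl
  rw [coeff_x _ _ 2 (by norm_num)]
  simp only [Function.iterate_succ_apply', Function.iterate_zero, id, map_sub, map_add, map_mul,
    Derivation.leibniz, DX_C, DX_X 1 0 (by norm_num), DX_X 2 0 (by norm_num), smul_eq_mul, du_dx,
    hξ, map_zero, mul_zero, add_zero, h2]
  ring

theorem coeff_three : coeff ξ 1 φ (3, 0) = C (dx (dx (dx φ)))
    + C (3 * dx (dx (du φ)) - dx (dx (dx ξ))) * X (1, 0)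
    + C (3 * dx (du (du φ))) * X (1, 0) ^ 2 + C (du (du (du φ))) * X (1, 0) ^ 3
    + C (3 * dx (du φ) - 3 * dx (dx ξ)) * X (2, 0) + C (3 * du (du φ)) * X (1, 0) * X (2, 0)
    + C (du φ - 3 * dx ξ) * X (3, 0) := by
  have h3 : (C 3 : JetPoly D) = 3 := rfl
  rw [coeff_x _ _ 3 (by norm_num)]
  simp only [Function.iterate_succ_apply', Function.iterate_zero, id, map_sub, map_add, map_mul,
    Derivation.leibniz, DX_C, DX_X 1 0 (by norm_num), DX_X 2 0 (by norm_num),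
    DX_X 3 0 (by norm_num), smul_eq_mul, du_dx, hξ, map_zero, mul_zero, add_zero, h3]
  ring

theorem coeff_four : coeff ξ 1 φ (4, 0) = C (dx (dx (dx (dx φ))))
    + C (4 * dx (dx (dx (du φ))) - dx (dx (dx (dx ξ)))) * X (1, 0)
    + C (6 * dx (dx (du (du φ)))) * X (1, 0) ^ 2 + C (4 * dx (du (du (du φ)))) * X (1, 0) ^ 3
    + C (du (du (du (du φ)))) * X (1, 0) ^ 4
    + C (6 * dx (dx (du φ)) - 4 * dx (dx (dx ξ))) * X (2, 0)
    + C (12 * dx (du (du φ))) * X (1, 0) * X (2, 0)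
    + C (6 * du (du (du φ))) * X (1, 0) ^ 2 * X (2, 0) + C (3 * du (du φ)) * X (2, 0) ^ 2
    + C (4 * dx (du φ) - 6 * dx (dx ξ)) * X (3, 0) + C (4 * du (du φ)) * X (1, 0) * X (3, 0)
    + C (du φ - 4 * dx ξ) * X (4, 0) := by
  have h3 : (C 3 : JetPoly D) = 3 := rfl
  have h4 : (C 4 : JetPoly D) = 4 := rfl
  have h6 : (C 6 : JetPoly D) = 6 := rfl
  have h12 : (C 12 : JetPoly D) = 12 := rfl
  rw [coeff_x _ _ 4 (by norm_num)]
  simp only [Function.iterate_succ_apply', Function.iterate_zero, id, map_sub, map_add, map_mul,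
    Derivation.leibniz, DX_C, DX_X 1 0 (by norm_num), DX_X 2 0 (by norm_num),
    DX_X 3 0 (by norm_num), DX_X 4 0 (by norm_num), smul_eq_mul, du_dx, hξ, map_zero, mul_zero,
    add_zero, h3, h4, h6, h12]
  ring

end xiIndependent

/-- The coefficients of minus the reduced equation if `ξ` does not depend on `u`. They are the
coefficients of `u_xxxx`, `u_xxx`, `u_x u_xx`, `u_x³`, `u_xx`, `u_x²`, `u_x` and `1`; the remaining
monomials are `u_x u_xxx` and `u_xx²`, with coefficients `α` and `β`. -/
structure Coeffs (D : TopologicalSpace.Opens (𝕜 × 𝕜 × 𝕜)) where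
  /-- coefficient of `u_xxxx` -/
  w : SmoothFn D
  /-- coefficient of `u_xxx` -/
  L : SmoothFn D
  /-- coefficient of `u_x u_xx` -/
  a : SmoothFn D
  /-- coefficient of `u_x³` -/
  b : SmoothFn D
  /-- coefficient of `u_xx` -/
  M₂ : SmoothFn D
  /-- coefficient of `u_x²` -/
  c : SmoothFn D
  /-- coefficient of `u_x` -/
  M₁ : SmoothFn D
  /-- the term without derivatives of `u` -/
  M₀ : SmoothFn D

/-- A constant, as a smooth function. -/
noncomputable abbrev con (a : 𝕜) : SmoothFn D := algebraMap 𝕜 _ a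

/-- The coefficient of `u_x` in the expression for `u_tt`, if `ξ` does not depend on `u`. -/
noncomputable def qCoeff (ξ φ : SmoothFn D) : SmoothFn D := -(dt ξ + 2 * ξ * du φ - ξ * dx ξ)

/-- The term free of `u_x` in the expression for `u_tt`. -/
noncomputable def kCoeff (ξ φ : SmoothFn D) : SmoothFn D := dt φ + φ * du φ - ξ * dx φ

/-- The coefficients of minus the reduced equation if `ξ` does not depend on `u`. -/
noncomputable def coeffs (γ κ μ : 𝕜) (ξ φ : SmoothFn D) : Coeffs D where
  w := u + con μ * ξ ^ 2
  L := con μ * (2 * dx (ξ ^ 2) + qCoeff ξ φ)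
  a := 3 * con μ * du (qCoeff ξ φ)
  b := con μ * du (du (qCoeff ξ φ))
  M₂ := con μ * (dx (dx (ξ ^ 2)) + 2 * dx (qCoeff ξ φ) + du (kCoeff ξ φ)) - ξ ^ 2 + con κ
    + 2 * con γ * u
  c := 2 * con μ * dx (du (qCoeff ξ φ)) + con μ * du (du (kCoeff ξ φ)) + 2 * con γ
  M₁ := con μ * (dx (dx (qCoeff ξ φ)) + 2 * dx (du (kCoeff ξ φ))) - qCoeff ξ φ
  M₀ := con μ * dx (dx (kCoeff ξ φ)) - kCoeff ξ φ

/-- The jet polynomial with the given coefficients. -/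
noncomputable def Coeffs.poly (α β : 𝕜) (F : Coeffs D) : JetPoly D :=
  C F.w * X (4, 0) + cst α * X (1, 0) * X (3, 0) + cst β * X (2, 0) ^ 2 + C F.L * X (3, 0)
    + C F.a * X (1, 0) * X (2, 0) + C F.b * X (1, 0) ^ 3 + C F.M₂ * X (2, 0)
    + C F.c * X (1, 0) ^ 2 + C F.M₁ * X (1, 0) + C F.M₀

theorem reducedPoly_eq (α β γ κ μ : 𝕜) (ξ φ : SmoothFn D) (hξ : du ξ = 0) :
    reducedPoly α β γ κ μ ξ φ = -(coeffs γ κ μ ξ φ).poly α β := by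
  have h2 : (C 2 : JetPoly D) = 2 := rfl
  have h3 : (C 3 : JetPoly D) = 3 := rfl
  have hN : ET ξ φ (characteristic ξ φ) = C (ξ ^ 2) * X (2, 0) + C (qCoeff ξ φ) * X (1, 0)
      + C (kCoeff ξ φ) := by
    rw [ET_characteristic, qCoeff, kCoeff, hξ]
    simp
    ring
  have hP : du (ξ ^ 2) = 0 := by simp [Derivation.leibniz_pow, hξ]
  rw [reducedPoly, hN]
  simp only [equationPoly, Coeffs.poly, coeffs]
  generalize ξ ^ 2 = P at *
  generalize qCoeff ξ φ = Q
  generalize kCoeff ξ φ = K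
  simp only [map_sub, map_add, map_mul, Derivation.leibniz, DX_C, DX_X 1 0 (by norm_num),
    DX_X 2 0 (by norm_num), DX_X 3 0 (by norm_num), smul_eq_mul, du_dx, hP, map_zero, mul_zero,
    add_zero, h2, h3, cst]
  ring

/-- The action of `ξ ∂ₓ + ∂ₜ + φ ∂ᵤ` on functions of `(x, t, u)`. -/
noncomputable def vf (ξ φ f : SmoothFn D) : SmoothFn D := ξ * dx f + dt f + φ * du f

/-- The determining equations of the nonclassical method if `ξ` does not depend on `u`: the
coefficients of `w v(F) - Λ F`, where `F` is minus the reduced equation, `v` the prolonged vector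
field, `w` the coefficient of `u_xxxx` in `F`, and `Λ` is chosen such that `u_xxxx` cancels.
The names of the fields list the orders of the `x`-derivatives in the monomial. -/
structure Determining (α β : 𝕜) (ξ φ : SmoothFn D) (F : Coeffs D) (Λ : SmoothFn D) : Prop where
  e13 : 4 * F.w ^ 2 * du (du φ) + F.w * con α * (2 * du φ - 4 * dx ξ) - con α * Λ = 0
  e22 : 3 * F.w ^ 2 * du (du φ) + F.w * con β * (2 * du φ - 4 * dx ξ) - con β * Λ = 0
  e112 : 6 * F.w ^ 2 * du (du (du φ)) + F.w * (3 * con α + 2 * con β) * du (du φ) = 0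
  e1111 : F.w ^ 2 * du (du (du (du φ))) + F.w * con α * du (du (du φ)) = 0
  e111 : 4 * F.w ^ 2 * dx (du (du (du φ))) + 3 * F.w * con α * dx (du (du φ))
    + F.w * F.L * du (du (du φ)) + F.w * F.a * du (du φ)
    + F.w * (vf ξ φ F.b + 3 * F.b * (du φ - dx ξ)) - Λ * F.b = 0
  e12 : 12 * F.w ^ 2 * dx (du (du φ)) + 3 * F.w * con α * (dx (du φ) - dx (dx ξ))
    + 2 * F.w * con β * (2 * dx (du φ) - dx (dx ξ)) + 3 * F.w * F.L * du (du φ)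
    + F.w * (vf ξ φ F.a + F.a * (2 * du φ - 3 * dx ξ)) - Λ * F.a = 0
  e3 : F.w ^ 2 * (4 * dx (du φ) - 6 * dx (dx ξ)) + F.w * con α * dx φ
    + F.w * (vf ξ φ F.L + F.L * (du φ - 3 * dx ξ)) - Λ * F.L = 0
  e2 : F.w ^ 2 * (6 * dx (dx (du φ)) - 4 * dx (dx (dx ξ))) + 2 * F.w * con β * dx (dx φ)
    + 3 * F.w * F.L * (dx (du φ) - dx (dx ξ)) + F.w * F.a * dx φ
    + F.w * (vf ξ φ F.M₂ + F.M₂ * (du φ - 2 * dx ξ)) - Λ * F.M₂ = 0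
  e11 : 6 * F.w ^ 2 * dx (dx (du (du φ)))
    + F.w * con α * (3 * dx (dx (du φ)) - dx (dx (dx ξ))) + 3 * F.w * F.L * dx (du (du φ))
    + F.w * F.a * (2 * dx (du φ) - dx (dx ξ)) + 3 * F.w * F.b * dx φ + F.w * F.M₂ * du (du φ)
    + F.w * (vf ξ φ F.c + 2 * F.c * (du φ - dx ξ)) - Λ * F.c = 0
  e1 : F.w ^ 2 * (4 * dx (dx (dx (du φ))) - dx (dx (dx (dx ξ)))) + F.w * con α * dx (dx (dx φ))
    + F.w * F.L * (3 * dx (dx (du φ)) - dx (dx (dx ξ))) + F.w * F.a * dx (dx φ)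
    + F.w * F.M₂ * (2 * dx (du φ) - dx (dx ξ)) + 2 * F.w * F.c * dx φ
    + F.w * (vf ξ φ F.M₁ + F.M₁ * (du φ - dx ξ)) - Λ * F.M₁ = 0
  e0 : F.w ^ 2 * dx (dx (dx (dx φ))) + F.w * F.L * dx (dx (dx φ)) + F.w * F.M₂ * dx (dx φ)
    + F.w * F.M₁ * dx φ + F.w * vf ξ φ F.M₀ - Λ * F.M₀ = 0

theorem PR_C_eq (ξ φ f : SmoothFn D) : PR ξ 1 φ (C f) = C (vf ξ φ f) := by
  rw [PR_C, vf, one_mul]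

/-- The combination `w v(F) - Λ F` is free of `u_xxxx`. -/
theorem PR_poly (α β : 𝕜) (ξ φ : SmoothFn D) (hξ : du ξ = 0) (F : Coeffs D) (Λ : SmoothFn D)
    (hΛ : Λ = vf ξ φ F.w + F.w * (du φ - 4 * dx ξ)) :
    C F.w * PR ξ 1 φ (F.poly α β) - C Λ * F.poly α β =
    C (4 * F.w ^ 2 * du (du φ) + F.w * con α * (2 * du φ - 4 * dx ξ) - con α * Λ)
      * X (1, 0) * X (3, 0)
    + C (3 * F.w ^ 2 * du (du φ) + F.w * con β * (2 * du φ - 4 * dx ξ) - con β * Λ) * X (2, 0) ^ 2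
    + C (6 * F.w ^ 2 * du (du (du φ)) + F.w * (3 * con α + 2 * con β) * du (du φ))
      * X (1, 0) ^ 2 * X (2, 0)
    + C (F.w ^ 2 * du (du (du (du φ))) + F.w * con α * du (du (du φ))) * X (1, 0) ^ 4
    + C (4 * F.w ^ 2 * dx (du (du (du φ))) + 3 * F.w * con α * dx (du (du φ))
      + F.w * F.L * du (du (du φ)) + F.w * F.a * du (du φ)
      + F.w * (vf ξ φ F.b + 3 * F.b * (du φ - dx ξ)) - Λ * F.b) * X (1, 0) ^ 3
    + C (12 * F.w ^ 2 * dx (du (du φ)) + 3 * F.w * con α * (dx (du φ) - dx (dx ξ))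
      + 2 * F.w * con β * (2 * dx (du φ) - dx (dx ξ)) + 3 * F.w * F.L * du (du φ)
      + F.w * (vf ξ φ F.a + F.a * (2 * du φ - 3 * dx ξ)) - Λ * F.a) * X (1, 0) * X (2, 0)
    + C (F.w ^ 2 * (4 * dx (du φ) - 6 * dx (dx ξ)) + F.w * con α * dx φ
      + F.w * (vf ξ φ F.L + F.L * (du φ - 3 * dx ξ)) - Λ * F.L) * X (3, 0)
    + C (F.w ^ 2 * (6 * dx (dx (du φ)) - 4 * dx (dx (dx ξ))) + 2 * F.w * con β * dx (dx φ)
      + 3 * F.w * F.L * (dx (du φ) - dx (dx ξ)) + F.w * F.a * dx φ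
      + F.w * (vf ξ φ F.M₂ + F.M₂ * (du φ - 2 * dx ξ)) - Λ * F.M₂) * X (2, 0)
    + C (6 * F.w ^ 2 * dx (dx (du (du φ)))
      + F.w * con α * (3 * dx (dx (du φ)) - dx (dx (dx ξ))) + 3 * F.w * F.L * dx (du (du φ))
      + F.w * F.a * (2 * dx (du φ) - dx (dx ξ)) + 3 * F.w * F.b * dx φ + F.w * F.M₂ * du (du φ)
      + F.w * (vf ξ φ F.c + 2 * F.c * (du φ - dx ξ)) - Λ * F.c) * X (1, 0) ^ 2
    + C (F.w ^ 2 * (4 * dx (dx (dx (du φ))) - dx (dx (dx (dx ξ)))) + F.w * con α * dx (dx (dx φ))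
      + F.w * F.L * (3 * dx (dx (du φ)) - dx (dx (dx ξ))) + F.w * F.a * dx (dx φ)
      + F.w * F.M₂ * (2 * dx (du φ) - dx (dx ξ)) + 2 * F.w * F.c * dx φ
      + F.w * (vf ξ φ F.M₁ + F.M₁ * (du φ - dx ξ)) - Λ * F.M₁) * X (1, 0)
    + C (F.w ^ 2 * dx (dx (dx (dx φ))) + F.w * F.L * dx (dx (dx φ)) + F.w * F.M₂ * dx (dx φ)
      + F.w * F.M₁ * dx φ + F.w * vf ξ φ F.M₀ - Λ * F.M₀) := by
  have h2 : (C 2 : JetPoly D) = 2 := rfl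
  have h3 : (C 3 : JetPoly D) = 3 := rfl
  have h4 : (C 4 : JetPoly D) = 4 := rfl
  have h6 : (C 6 : JetPoly D) = 6 := rfl
  have h12 : (C 12 : JetPoly D) = 12 := rfl
  have hα : vf ξ φ (con α) = 0 := by simp [vf]
  have hβ : vf ξ φ (con β) = 0 := by simp [vf]
  have hw : vf ξ φ F.w = Λ - F.w * (du φ - 4 * dx ξ) := by rw [hΛ]; ring
  simp only [Coeffs.poly, cst, map_add, Derivation.leibniz, Derivation.leibniz_pow, smul_eq_mul,
    nsmul_eq_mul, PR_C_eq, hα, hβ, hw, PR_X ξ 1 φ 1 0 (by norm_num), PR_X ξ 1 φ 2 0 (by norm_num),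
    PR_X ξ 1 φ 3 0 (by norm_num), PR_X ξ 1 φ 4 0 (by norm_num), coeff_one ξ φ hξ,
    coeff_two ξ φ hξ, coeff_three ξ φ hξ, coeff_four ξ φ hξ]
  simp only [map_sub, map_add, map_mul, map_pow, map_zero, h2, h3, h4, h6, h12, Nat.cast_ofNat]
  ring

/-- A polynomial in three variables of the shape of the determining polynomial vanishes
identically only if its coefficients do. -/
theorem coeffs_eq_zero_of_forall {c₁₃ c₂₂ c₁₁₂ c₁₁₁₁ c₁₁₁ c₁₂ c₃ c₂ c₁₁ c₁ c₀ : 𝕜}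
    (h : ∀ a b c : 𝕜, c₁₃ * a * c + c₂₂ * b ^ 2 + c₁₁₂ * a ^ 2 * b + c₁₁₁₁ * a ^ 4 + c₁₁₁ * a ^ 3
      + c₁₂ * a * b + c₃ * c + c₂ * b + c₁₁ * a ^ 2 + c₁ * a + c₀ = 0) :
    c₁₃ = 0 ∧ c₂₂ = 0 ∧ c₁₁₂ = 0 ∧ c₁₁₁₁ = 0 ∧ c₁₁₁ = 0 ∧ c₁₂ = 0 ∧ c₃ = 0 ∧ c₂ = 0 ∧ c₁₁ = 0 ∧
      c₁ = 0 ∧ c₀ = 0 := by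
  have h0 : c₀ = 0 := by linear_combination h 0 0 0
  have h3 : c₃ = 0 := by linear_combination h 0 0 1 - h 0 0 0
  have h13 : c₁₃ = 0 := by linear_combination h 1 0 1 - h 1 0 0 - (h 0 0 1 - h 0 0 0)
  have h22 : c₂₂ = 0 := by linear_combination (h 0 1 0 + h 0 (-1) 0) / 2 - h 0 0 0
  have h2 : c₂ = 0 := by linear_combination (h 0 1 0 - h 0 (-1) 0) / 2
  have hA : c₁₁₂ + c₁₂ = 0 := by
    linear_combination h 1 1 0 - h 1 0 0 - h22 - h2
  have hB : c₁₁₂ - c₁₂ = 0 := by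
    linear_combination h (-1) 1 0 - h (-1) 0 0 - h22 - h2
  have h112 : c₁₁₂ = 0 := by linear_combination (hA + hB) / 2
  have h12 : c₁₂ = 0 := by linear_combination (hA - hB) / 2
  have hE1 : c₁₁₁₁ + c₁₁ = 0 := by linear_combination (h 1 0 0 + h (-1) 0 0) / 2 - h0
  have hE2 : 16 * c₁₁₁₁ + 4 * c₁₁ = 0 := by linear_combination (h 2 0 0 + h (-2) 0 0) / 2 - h0
  have hO1 : c₁₁₁ + c₁ = 0 := by linear_combination (h 1 0 0 - h (-1) 0 0) / 2
  have hO2 : 8 * c₁₁₁ + 2 * c₁ = 0 := by linear_combination (h 2 0 0 - h (-2) 0 0) / 2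
  refine ⟨h13, h22, h112, ?_, ?_, h12, h3, h2, ?_, ?_, h0⟩
  · linear_combination (hE2 - 4 * hE1) / 12
  · linear_combination (hO2 - 2 * hO1) / 6
  · linear_combination (16 * hE1 - hE2) / 12
  · linear_combination (8 * hO1 - hO2) / 6

/-- Suppose that `u_xxxx` cancels in `w P - Λ F`. As `w` vanishes nowhere, `F = 0` can be solved for
`u_xxxx` with `u_x`, `u_xx` and `u_xxx` arbitrary, so `P` vanishes at all jets with `F = 0` if and
only if the coefficients of `w P - Λ F` vanish. -/
theorem forall_ev_iff_of_eq (α β : 𝕜) (F : Coeffs D) (hF : ∀ z, F.w z ≠ 0) (P : JetPoly D)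
    (Λ c₁₃ c₂₂ c₁₁₂ c₁₁₁₁ c₁₁₁ c₁₂ c₃ c₂ c₁₁ c₁ c₀ : SmoothFn D)
    (key : C F.w * P - C Λ * F.poly α β = C c₁₃ * X (1, 0) * X (3, 0) + C c₂₂ * X (2, 0) ^ 2
      + C c₁₁₂ * X (1, 0) ^ 2 * X (2, 0) + C c₁₁₁₁ * X (1, 0) ^ 4 + C c₁₁₁ * X (1, 0) ^ 3
      + C c₁₂ * X (1, 0) * X (2, 0) + C c₃ * X (3, 0) + C c₂ * X (2, 0) + C c₁₁ * X (1, 0) ^ 2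
      + C c₁ * X (1, 0) + C c₀) :
    (∀ (z : D) (p : ℕ × ℕ → 𝕜), p (0, 0) = (z : 𝕜 × 𝕜 × 𝕜).2.2 →
      ev z p (F.poly α β) = 0 → ev z p P = 0) ↔
    c₁₃ = 0 ∧ c₂₂ = 0 ∧ c₁₁₂ = 0 ∧ c₁₁₁₁ = 0 ∧ c₁₁₁ = 0 ∧ c₁₂ = 0 ∧ c₃ = 0 ∧ c₂ = 0 ∧ c₁₁ = 0 ∧
      c₁ = 0 ∧ c₀ = 0 := by
  have key' := fun (z : D) (p : ℕ × ℕ → 𝕜) => congrArg (ev z p) key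
  simp only [map_add, map_sub, map_mul, map_pow, ev_C, ev_X] at key'
  have hval : ∀ (z : D) (p : ℕ × ℕ → 𝕜), ev z p (F.poly α β) = F.w z * p (4, 0)
      + α * p (1, 0) * p (3, 0) + β * p (2, 0) ^ 2 + F.L z * p (3, 0) + F.a z * p (1, 0) * p (2, 0)
      + F.b z * p (1, 0) ^ 3 + F.M₂ z * p (2, 0) + F.c z * p (1, 0) ^ 2 + F.M₁ z * p (1, 0)
      + F.M₀ z := by
    intro z p
    simp only [Coeffs.poly, map_add, map_mul, map_pow, ev_C, ev_X, ev_cst]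
  constructor
  · intro H
    have H' : ∀ z, _ := fun z => coeffs_eq_zero_of_forall (c₁₃ := c₁₃ z) (c₂₂ := c₂₂ z)
      (c₁₁₂ := c₁₁₂ z) (c₁₁₁₁ := c₁₁₁₁ z) (c₁₁₁ := c₁₁₁ z) (c₁₂ := c₁₂ z) (c₃ := c₃ z)
      (c₂ := c₂ z) (c₁₁ := c₁₁ z) (c₁ := c₁ z) (c₀ := c₀ z) (by
      intro a b c
      -- the jet over `z` with `u_x = a`, `u_xx = b`, `u_xxx = c` that satisfies the equation
      let p : ℕ × ℕ → 𝕜 := fun k => if k = (0, 0) then (z : 𝕜 × 𝕜 × 𝕜).2.2 else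
        if k = (1, 0) then a else if k = (2, 0) then b else if k = (3, 0) then c else
        -(α * a * c + β * b ^ 2 + F.L z * c + F.a z * a * b + F.b z * a ^ 3 + F.M₂ z * b
          + F.c z * a ^ 2 + F.M₁ z * a + F.M₀ z) / F.w z
      have h1 : p (1, 0) = a := rfl
      have h2 : p (2, 0) = b := rfl
      have h3 : p (3, 0) = c := rfl
      have h4 : F.w z * p (4, 0) = -(α * a * c + β * b ^ 2 + F.L z * c + F.a z * a * b
          + F.b z * a ^ 3 + F.M₂ z * b + F.c z * a ^ 2 + F.M₁ z * a + F.M₀ z) :=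
        mul_div_cancel₀ _ (hF z)
      have h0 : ev z p (F.poly α β) = 0 := by
        rw [hval, h4, h1, h2, h3]
        ring
      have hk := key' z p
      rw [h0, H z p rfl h0, mul_zero, mul_zero, sub_zero, h1, h2, h3] at hk
      exact hk.symm)
    refine ⟨?_, ?_, ?_, ?_, ?_, ?_, ?_, ?_, ?_, ?_, ?_⟩ <;> ext z <;> rw [SmoothFn.coe_zero]
    · exact (H' z).1
    · exact (H' z).2.1
    · exact (H' z).2.2.1
    · exact (H' z).2.2.2.1
    · exact (H' z).2.2.2.2.1
    · exact (H' z).2.2.2.2.2.1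
    · exact (H' z).2.2.2.2.2.2.1
    · exact (H' z).2.2.2.2.2.2.2.1
    · exact (H' z).2.2.2.2.2.2.2.2.1
    · exact (H' z).2.2.2.2.2.2.2.2.2.1
    · exact (H' z).2.2.2.2.2.2.2.2.2.2
  · rintro ⟨rfl, rfl, rfl, rfl, rfl, rfl, rfl, rfl, rfl, rfl, rfl⟩ z p _ h0
    have hk := key' z p
    rw [h0] at hk
    simpa [hF z] using hk

theorem forall_ev_iff_determining (α β : 𝕜) (ξ φ : SmoothFn D) (hξ : du ξ = 0) (F : Coeffs D)
    (hF : ∀ z, F.w z ≠ 0) :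
    (∀ (z : D) (p : ℕ × ℕ → 𝕜), p (0, 0) = (z : 𝕜 × 𝕜 × 𝕜).2.2 →
      ev z p (F.poly α β) = 0 → ev z p (PR ξ 1 φ (F.poly α β)) = 0) ↔
    Determining α β ξ φ F (vf ξ φ F.w + F.w * (du φ - 4 * dx ξ)) := by
  rw [forall_ev_iff_of_eq α β F hF _ _ _ _ _ _ _ _ _ _ _ _ _ (PR_poly α β ξ φ hξ F _ rfl)]
  constructor
  · rintro ⟨h1, h2, h3, h4, h5, h6, h7, h8, h9, h10, h11⟩
    exact ⟨h1, h2, h3, h4, h5, h6, h7, h8, h9, h10, h11⟩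
  · rintro ⟨h1, h2, h3, h4, h5, h6, h7, h8, h9, h10, h11⟩
    exact ⟨h1, h2, h3, h4, h5, h6, h7, h8, h9, h10, h11⟩

/-- The criterion of the nonclassical method for jet polynomials. -/
theorem isNonclassical_iff (α β γ κ μ : 𝕜) {ξ φ : 𝕜 → 𝕜 → 𝕜 → 𝕜}
    {ξ' φ' : SmoothFn D} (hξ : ∀ x t u (h : (x, t, u) ∈ D), ξ x t u = ξ' ⟨_, h⟩)
    (hφ : ∀ x t u (h : (x, t, u) ∈ D), φ x t u = φ' ⟨_, h⟩) :
    IsNonclassical α β γ κ μ ξ φ D ↔ ∀ (z : D) (p : ℕ × ℕ → 𝕜),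
      p (0, 0) = (z : 𝕜 × 𝕜 × 𝕜).2.2 → ev z p (reducedPoly α β γ κ μ ξ' φ') = 0 →
      ev z p (PR ξ' 1 φ' (reducedPoly α β γ κ μ ξ' φ')) = 0 :=
  isLieSymmetry_iff hξ (τ := fun _ _ _ => 1) (τ' := 1) (fun _ _ _ _ => rfl) hφ
    (represents_reducedEquation α β γ κ μ hξ hφ)

/-- The nonclassical determining equations for `ξ` independent of `u`. -/
theorem isNonclassical_iff_determining (α β γ κ μ : 𝕜) {ξ φ : 𝕜 → 𝕜 → 𝕜 → 𝕜}
    {ξ' φ' : SmoothFn D} (hξ : ∀ x t u (h : (x, t, u) ∈ D), ξ x t u = ξ' ⟨_, h⟩)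
    (hφ : ∀ x t u (h : (x, t, u) ∈ D), φ x t u = φ' ⟨_, h⟩) (hu : du ξ' = 0)
    (hw : ∀ z, (coeffs γ κ μ ξ' φ').w z ≠ 0) :
    IsNonclassical α β γ κ μ ξ φ D ↔ Determining α β ξ' φ' (coeffs γ κ μ ξ' φ')
      (vf ξ' φ' (coeffs γ κ μ ξ' φ').w + (coeffs γ κ μ ξ' φ').w * (du φ' - 4 * dx ξ')) := by
  rw [← forall_ev_iff_determining α β ξ' φ' hu _ hw, isNonclassical_iff α β γ κ μ hξ hφ,
    reducedPoly_eq _ _ _ _ _ _ _ hu]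
  simp only [map_neg, neg_eq_zero]

end JetPoly

namespace JetPoly

open MvPolynomial SmoothFn

variable {𝕜 : Type*} [RCLike 𝕜] {D : TopologicalSpace.Opens (𝕜 × 𝕜 × 𝕜)}

/-! ### Generic case: `ξ` does not depend on `u` -/

/-- The reduced equation, where `u_tt = P u_xx + q u_x² + Q u_x + K`. -/
theorem reducedPoly_eq_of_eq (α β γ κ μ : 𝕜) (ξ φ P q Q K : SmoothFn D)
    (hN : ET ξ φ (characteristic ξ φ) = C P * X (2, 0) + C q * X (1, 0) ^ 2 + C Q * X (1, 0)
      + C K) :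
    reducedPoly α β γ κ μ ξ φ = C P * X (2, 0) + C q * X (1, 0) ^ 2 + C Q * X (1, 0) + C K
      - cst κ * X (2, 0) - 2 * cst γ * (C u * X (2, 0) + X (1, 0) ^ 2) - C u * X (4, 0)
      - cst α * X (1, 0) * X (3, 0) - cst β * X (2, 0) ^ 2 - cst μ * (
        C P * X (4, 0) + 2 * (C (dx P) + C (du P) * X (1, 0)) * X (3, 0)
        + (C (dx (dx P)) + 2 * C (dx (du P)) * X (1, 0) + C (du (du P)) * X (1, 0) ^ 2
          + C (du P) * X (2, 0)) * X (2, 0)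
        + C q * (2 * X (2, 0) ^ 2 + 2 * X (1, 0) * X (3, 0))
        + 4 * (C (dx q) + C (du q) * X (1, 0)) * X (1, 0) * X (2, 0)
        + (C (dx (dx q)) + 2 * C (dx (du q)) * X (1, 0) + C (du (du q)) * X (1, 0) ^ 2
          + C (du q) * X (2, 0)) * X (1, 0) ^ 2
        + C Q * X (3, 0) + 2 * (C (dx Q) + C (du Q) * X (1, 0)) * X (2, 0)
        + (C (dx (dx Q)) + 2 * C (dx (du Q)) * X (1, 0) + C (du (du Q)) * X (1, 0) ^ 2
          + C (du Q) * X (2, 0)) * X (1, 0)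
        + (C (dx (dx K)) + 2 * C (dx (du K)) * X (1, 0) + C (du (du K)) * X (1, 0) ^ 2
          + C (du K) * X (2, 0))) := by
  rw [reducedPoly, hN]
  simp only [equationPoly, map_add, Derivation.leibniz, Derivation.leibniz_pow, DX_C,
    DX_X 1 0 (by norm_num), DX_X 2 0 (by norm_num), DX_X 3 0 (by norm_num), smul_eq_mul,
    nsmul_eq_mul, du_dx, Nat.cast_ofNat, Nat.reduceSub, pow_one]
  have h2 : DX (2 : JetPoly D) = 0 := by simpa using (DX (D := D)).map_natCast 2
  simp only [h2]
  ring

set_option maxHeartbeats 1600000 in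
/-- In the generic case `ξ` does not depend on `u`: the coefficient of `u_xx u_xxx` in
`w v(F) - Λ F` is a multiple of `w² ∂ξ/∂u`. -/
theorem du_xi_eq_zero (α β γ κ μ : 𝕜) {ξ φ : 𝕜 → 𝕜 → 𝕜 → 𝕜} {ξ' φ' : SmoothFn D}
    (hξ : ∀ x t u (h : (x, t, u) ∈ D), ξ x t u = ξ' ⟨_, h⟩)
    (hφ : ∀ x t u (h : (x, t, u) ∈ D), φ x t u = φ' ⟨_, h⟩)
    (hw : ∀ z : D, (u + con μ * ξ' ^ 2 : SmoothFn D) z ≠ 0) (H : IsNonclassical α β γ κ μ ξ φ D) :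
    du ξ' = 0 := by
  rw [isNonclassical_iff α β γ κ μ hξ hφ] at H
  obtain ⟨Q, hQ⟩ : ∃ Q, Q = -(dt ξ' + 2 * ξ' * du φ' + φ' * du ξ' - ξ' * dx ξ') := ⟨_, rfl⟩
  obtain ⟨K, hK⟩ : ∃ K, K = dt φ' + φ' * du φ' - ξ' * dx φ' := ⟨_, rfl⟩
  have hN : ET ξ' φ' (characteristic ξ' φ') = C (ξ' ^ 2) * X (2, 0)
      + C (2 * ξ' * du ξ') * X (1, 0) ^ 2 + C Q * X (1, 0) + C K := by
    rw [ET_characteristic, hQ, hK, map_neg]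
    ring
  rw [reducedPoly_eq_of_eq α β γ κ μ _ _ _ _ _ _ hN] at H
  obtain ⟨P, hP⟩ : ∃ P, P = ξ' ^ 2 := ⟨_, rfl⟩
  obtain ⟨q, hq⟩ : ∃ q, q = 2 * ξ' * du ξ' := ⟨_, rfl⟩
  rw [← hP] at H hw
  rw [← hq] at H
  have h2 : PR ξ' 1 φ' (2 : JetPoly D) = 0 := by simpa using (PR ξ' 1 φ').map_natCast 2
  have h4 : PR ξ' 1 φ' (4 : JetPoly D) = 0 := by simpa using (PR ξ' 1 φ').map_natCast 4
  have hc : ∀ a : 𝕜, PR ξ' 1 φ' (cst a) = 0 := fun a => by simp [cst, PR_C]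
  have hu : vf ξ' φ' u = φ' := by simp [vf]
  have e1 := coeff_x ξ' φ' 1 (by norm_num)
  have e2 := coeff_x ξ' φ' 2 (by norm_num)
  have e3 := coeff_x ξ' φ' 3 (by norm_num)
  have e4 := coeff_x ξ' φ' 4 (by norm_num)
  simp only [Function.iterate_succ_apply', Function.iterate_zero, id, map_sub, map_add,
    Derivation.leibniz, DX_C, DX_X 1 0 (by norm_num), DX_X 2 0 (by norm_num),
    DX_X 3 0 (by norm_num), DX_X 4 0 (by norm_num), smul_eq_mul, du_dx, Nat.reduceAdd]
    at e1 e2 e3 e4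
  ext z
  -- the criterion at the jets with `u_x = 0`, `u_xx = b`, `u_xxx = c`, `u_xxxx = d`
  have key : ∀ b c d : 𝕜, (u + con μ * P : SmoothFn D) z * d = P z * b + K z - κ * b
      - 2 * γ * u z * b - β * b ^ 2 - μ * (2 * dx P z * c + (dx (dx P) z + du P z * b) * b
      + 2 * q z * b ^ 2 + Q z * c + 2 * dx Q z * b + dx (dx K) z + du K z * b) → _ :=
      fun b c d hd => by
    let p : ℕ × ℕ → 𝕜 := fun k => if k = (0, 0) then (z : 𝕜 × 𝕜 × 𝕜).2.2 else
        if k = (1, 0) then 0 else if k = (2, 0) then b else if k = (3, 0) then c else d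
    have h1 : p (1, 0) = 0 := rfl
    have h2' : p (2, 0) = b := rfl
    have h3' : p (3, 0) = c := rfl
    have h4' : p (4, 0) = d := rfl
    have := H z p rfl (by
      simp only [map_add, map_sub, map_mul, map_pow, ev_C, ev_X, ev_cst, h1, h2', h3', h4',
        map_ofNat]
      simp only [SmoothFn.coe_add, SmoothFn.coe_mul, coe_algebraMap] at hd
      linear_combination -hd)
    simp only [map_add, map_sub, Derivation.leibniz, Derivation.leibniz_pow, smul_eq_mul,
      nsmul_eq_mul, PR_C_eq, h2, h4, hc, hu, PR_X ξ' 1 φ' 1 0 (by norm_num),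
      PR_X ξ' 1 φ' 2 0 (by norm_num), PR_X ξ' 1 φ' 3 0 (by norm_num),
      PR_X ξ' 1 φ' 4 0 (by norm_num), e1, e2, e3, e4, map_mul (ev z p), map_pow (ev z p), ev_C,
      ev_X, ev_cst, h1, h2', h3', h4', map_ofNat, mul_zero, zero_mul, add_zero, zero_add,
      Nat.reduceSub, pow_one, ne_eq, OfNat.ofNat_ne_zero, not_false_eq_true, zero_pow,
      Nat.cast_ofNat] at this
    exact this
  have hd : ∀ b c : 𝕜, ∃ d : 𝕜, (u + con μ * P : SmoothFn D) z * d = P z * b + K z - κ * b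
      - 2 * γ * u z * b - β * b ^ 2 - μ * (2 * dx P z * c + (dx (dx P) z + du P z * b) * b
      + 2 * q z * b ^ 2 + Q z * c + 2 * dx Q z * b + dx (dx K) z + du K z * b) :=
    fun b c => ⟨_, mul_div_cancel₀ _ (hw z)⟩
  obtain ⟨d₁, h₁⟩ := hd 1 1
  obtain ⟨d₂, h₂⟩ := hd 1 0
  obtain ⟨d₃, h₃⟩ := hd 0 1
  obtain ⟨d₄, h₄⟩ := hd 0 0
  have k₁ := key 1 1 d₁ h₁
  have k₂ := key 1 0 d₂ h₂
  have k₃ := key 0 1 d₃ h₃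
  have k₄ := key 0 0 d₄ h₄
  have hz := hw z
  simp only [SmoothFn.coe_add, SmoothFn.coe_mul, coe_algebraMap] at h₁ h₂ h₃ h₄ hz
  have h10 : (u z + μ * P z) ^ 2 * (10 * du ξ' z) = 0 := by
    linear_combination (u z + μ * P z) * (k₁ - k₂ - k₃ + k₄)
      + (φ' z + μ * vf ξ' φ' P z + (u z + μ * P z) * (du φ' z - 4 * dx ξ' z)) * (h₁ - h₂ - h₃ + h₄)
  exact (mul_eq_zero.1 ((mul_eq_zero.1 h10).resolve_left (pow_ne_zero 2 hz))).resolve_left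
    (by norm_num)

end JetPoly

namespace JetPoly

open MvPolynomial SmoothFn

variable {𝕜 : Type*} [RCLike 𝕜] {D : TopologicalSpace.Opens (𝕜 × 𝕜 × 𝕜)}

/-! ### Generic case: `φ` is affine in `u` -/

/-- A nowhere vanishing smooth function has a smooth inverse. -/
theorem _root_.SmoothFn.exists_inv {w : SmoothFn D} (hw : ∀ z, w z ≠ 0) :
    ∃ v : SmoothFn D, ∀ z, v z = (w z)⁻¹ := by
  refine ⟨SmoothFn.mk (fun z => (w.extend z)⁻¹) (w.contDiffOn_extend.inv fun z hz => ?_),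
    fun z => ?_⟩
  · rw [extend_apply w ⟨z, hz⟩]
    exact hw _
  · rw [SmoothFn.mk_apply, extend_apply]

theorem _root_.SmoothFn.der_inv {w v : SmoothFn D} (hw : ∀ z, w z ≠ 0)
    (hv : ∀ z, v z = (w z)⁻¹) (d : Derivation 𝕜 (SmoothFn D) (SmoothFn D)) :
    d v = -(v ^ 2 * d w) := by
  have h1 : w * v = 1 := by
    ext z
    simp [hv, hw z]
  have h2 := congrArg d h1
  simp only [Derivation.leibniz, smul_eq_mul, Derivation.map_one_eq_zero] at h2
  linear_combination v * h2 - d v * h1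

theorem _root_.SmoothFn.mul_left_cancel_of_ne {w f : SmoothFn D} (hw : ∀ z, w z ≠ 0)
    (h : w * f = 0) : f = 0 := by
  ext z
  exact mul_eq_zero_of_ne h (hw z)

/-- If `φ` is not affine in `u`, then `α = 4` and `β = 3`, and `φ_uu` is a multiple of `w⁻³`. -/
theorem du_du_eq_zero_or {α β γ κ μ : 𝕜} {ξ φ : SmoothFn D} (hξ : du ξ = 0)
    (hw : ∀ z, (coeffs γ κ μ ξ φ).w z ≠ 0)
    (H : Determining α β ξ φ (coeffs γ κ μ ξ φ)
      (vf ξ φ (coeffs γ κ μ ξ φ).w + (coeffs γ κ μ ξ φ).w * (du φ - 4 * dx ξ))) :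
    du (du φ) = 0 ∨ (α = 4 ∧ β = 3 ∧
    (coeffs γ κ μ ξ φ).w * du (du (du φ)) = -3 * du (du φ) ∧
    (coeffs γ κ μ ξ φ).w ^ 2 * du (du φ)
      + ((coeffs γ κ μ ξ φ).w * du φ - vf ξ φ (coeffs γ κ μ ξ φ).w) = 0) := by
  obtain ⟨w, hwdef⟩ : ∃ w, w = (coeffs γ κ μ ξ φ).w := ⟨_, rfl⟩
  have hwu : du w = 1 := by
    simp [hwdef, coeffs, Derivation.leibniz_pow, hξ]
  have hvu : du (vf ξ φ w) = du φ := by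
    have h1 : du (dx w) = 0 := by rw [du_dx, hwu]; simp
    have h2 : du (dt w) = 0 := by rw [du_dt, hwu]; simp
    simp [vf, Derivation.leibniz, hξ, h1, h2, hwu]
  rw [← hwdef] at hw ⊢
  have e13 := H.e13
  have e22 := H.e22
  have e112 := H.e112
  rw [← hwdef] at e13 e22 e112
  obtain ⟨f, hf⟩ : ∃ f, f = du (du φ) := ⟨_, rfl⟩
  rw [← hf] at e13 e22 e112 ⊢
  have k1 : w * (4 * w * f) + con α * (w * du φ - vf ξ φ w) = 0 := by linear_combination e13
  have k2 : w * (3 * w * f) + con β * (w * du φ - vf ξ φ w) = 0 := by linear_combination e22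
  have d1 := congrArg du k1
  have d2 := congrArg du k2
  simp only [map_add, map_sub, Derivation.leibniz, hwu, hvu, derivation_ofNat,
    Derivation.map_algebraMap, smul_eq_mul, map_zero, ← hf] at d1 d2
  have l1 : 4 * w * du f + (8 + con α) * f = 0 := by
    refine mul_left_cancel_of_ne hw ?_
    linear_combination d1
  have l2 : 3 * w * du f + (6 + con β) * f = 0 := by
    refine mul_left_cancel_of_ne hw ?_
    linear_combination d2
  have l3 : 6 * w * du f + (3 * con α + 2 * con β) * f = 0 := by
    refine mul_left_cancel_of_ne hw ?_
    linear_combination e112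
  by_cases hα : α = 4
  · by_cases hβ : β = 3
    · right
      have h4 : (con α : SmoothFn D) = 4 := by rw [hα]; exact map_ofNat _ 4
      have h3 : (con β : SmoothFn D) = 3 := by rw [hβ]; exact map_ofNat _ 3
      rw [h4] at k1 l1
      refine ⟨hα, hβ, ?_, ?_⟩
      · refine mul_left_cancel_of_ne (w := 4) (by simp) ?_ |> sub_eq_zero.1
        linear_combination l1
      · refine mul_left_cancel_of_ne (w := 4) (by simp) ?_
        linear_combination k1
    · left
      refine algebraMap_mul_eq_zero (c := 4 * β - 3 * α) ?_ ?_
      · rw [hα]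
        intro h
        apply hβ
        linear_combination h / 4
      · have h4 : (algebraMap 𝕜 (SmoothFn D) (4 * β - 3 * α)) = 4 * con β - 3 * con α := by
          ext z
          simp
        rw [h4]
        linear_combination 4 * l2 - 3 * l1
  · left
    refine algebraMap_mul_eq_zero (c := 12 - 3 * α) ?_ ?_
    · intro h
      apply hα
      linear_combination -h / 3
    · have h4 : (algebraMap 𝕜 (SmoothFn D) (12 - 3 * α)) = 12 - 3 * con α := by
        ext z
        simp
      rw [h4]
      linear_combination 2 * l2 - l3

/-- The shape of `φ` in the exceptional case of `du_du_eq_zero_or`. -/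
theorem exists_shape {γ κ μ : 𝕜} {ξ φ : SmoothFn D} (hξ : du ξ = 0)
    (hw : ∀ z, (coeffs γ κ μ ξ φ).w z ≠ 0)
    (h1 : (coeffs γ κ μ ξ φ).w * du (du (du φ)) = -3 * du (du φ))
    (h2 : (coeffs γ κ μ ξ φ).w ^ 2 * du (du φ)
      + ((coeffs γ κ μ ξ φ).w * du φ - vf ξ φ (coeffs γ κ μ ξ φ).w) = 0) :
    ∃ v c A : SmoothFn D, (∀ z, v z = ((coeffs γ κ μ ξ φ).w z)⁻¹) ∧ du c = 0 ∧ du A = 0 ∧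
      φ = c * v + A * (coeffs γ κ μ ξ φ).w - con μ * (ξ * dx (ξ ^ 2) + dt (ξ ^ 2)) ∧
      du (du φ) = 2 * c * v ^ 3 := by
  obtain ⟨v, hv⟩ := exists_inv hw
  obtain ⟨w, hwdef⟩ : ∃ w, w = (coeffs γ κ μ ξ φ).w := ⟨_, rfl⟩
  have hwu : du w = 1 := by
    simp [hwdef, coeffs, Derivation.leibniz_pow, hξ]
  have hvw : vf ξ φ w = φ + con μ * (ξ * dx (ξ ^ 2) + dt (ξ ^ 2)) := by
    simp only [hwdef, coeffs, vf, map_add, dx_u, dt_u, du_u, Derivation.leibniz,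
      Derivation.leibniz_pow, Derivation.map_algebraMap, hξ]
    simp
    ring
  rw [← hwdef] at h1 h2 hw hv ⊢
  have hwv : w * v = 1 := by
    ext z
    simp [hv, hw z]
  have hh : (con (1 / 2) : SmoothFn D) * 2 = 1 := by
    ext z
    simp
  refine ⟨v, con (1 / 2) * w ^ 3 * du (du φ), du φ + con (1 / 2) * w * du (du φ), hv, ?_, ?_,
    ?_, ?_⟩
  · simp only [Derivation.leibniz, Derivation.leibniz_pow, Derivation.map_algebraMap, hwu,
      smul_eq_mul, nsmul_eq_mul]
    simp
    linear_combination algebraMap 𝕜 (SmoothFn D) 2⁻¹ * w ^ 2 * h1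
  · simp only [map_add, Derivation.leibniz, Derivation.map_algebraMap, hwu, smul_eq_mul]
    linear_combination con (1 / 2) * h1 - du (du φ) * hh
  · rw [hvw] at h2
    linear_combination -h2 - con (1 / 2) * w ^ 2 * du (du φ) * hwv - w ^ 2 * du (du φ) * hh
  · linear_combination -du (du φ) * hh
      - du (du φ) * (con (1 / 2) * 2) * (w ^ 2 * v ^ 2 + w * v + 1) * hwv

/-- In the exceptional case the coefficient of the lowest power of `w` in the determining equation
of `u_xxx` shows that `φ_uu ≠ 0` is possible only where `ξ = 0`. -/
theorem xi_mul_eq_zero {β γ κ μ : 𝕜} (hμ : μ ≠ 0) {ξ φ : SmoothFn D} (hξ : du ξ = 0)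
    (hw : ∀ z, (coeffs γ κ μ ξ φ).w z ≠ 0)
    (H : Determining 4 β ξ φ (coeffs γ κ μ ξ φ)
      (vf ξ φ (coeffs γ κ μ ξ φ).w + (coeffs γ κ μ ξ φ).w * (du φ - 4 * dx ξ)))
    {v c A : SmoothFn D} (hv : ∀ z, v z = ((coeffs γ κ μ ξ φ).w z)⁻¹) (hc : du c = 0)
    (hA : du A = 0)
    (hφ : φ = c * v + A * (coeffs γ κ μ ξ φ).w - con μ * (ξ * dx (ξ ^ 2) + dt (ξ ^ 2))) :
    ξ * c = 0 := by
  have h3 := H.e3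
  obtain ⟨w, hwdef⟩ : ∃ w, w = (coeffs γ κ μ ξ φ).w := ⟨_, rfl⟩
  have hL : (coeffs γ κ μ ξ φ).L
    = con μ * (2 * dx (ξ ^ 2) - dt ξ - 2 * ξ * du φ + ξ * dx ξ) := by
    simp only [coeffs, qCoeff]
    ring
  rw [hL] at h3
  rw [← hwdef] at hw hv hφ h3
  obtain ⟨P, hP⟩ : ∃ P, P = ξ ^ 2 := ⟨_, rfl⟩
  have hPu : du P = 0 := by simp [hP, Derivation.leibniz_pow, hξ]
  have hw1 : w = u + con μ * P := by rw [hwdef, hP]; rfl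
  have hwx : dx w = con μ * dx P := by simp [hw1, Derivation.leibniz]
  have hwt : dt w = con μ * dt P := by simp [hw1, Derivation.leibniz]
  have hwu : du w = 1 := by simp [hw1, Derivation.leibniz, hPu]
  have hvx := der_inv hw hv dx
  have hvt := der_inv hw hv dt
  have hvu := der_inv hw hv du
  rw [hwx] at hvx
  rw [hwt] at hvt
  rw [hwu] at hvu
  rw [← hP] at hφ h3
  obtain ⟨m, hm⟩ : ∃ m, m = con μ * (ξ * dx P + dt P) := ⟨_, rfl⟩
  have hmu : du m = 0 := by simp [hm, Derivation.leibniz, hξ, du_dx, du_dt, hPu]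
  rw [← hm] at hφ
  have hφu : du φ = A - c * v ^ 2 := by
    rw [hφ]
    simp [Derivation.leibniz, hc, hA, hvu, hwu, hmu]
    ring
  have hφx : dx φ = dx c * v - c * v ^ 2 * (con μ * dx P) + dx A * w + A * (con μ * dx P)
      - dx m := by
    conv_lhs => rw [hφ]
    simp [Derivation.leibniz, hvx, hwx]
    ring
  have hzu : ∀ d : Derivation 𝕜 (SmoothFn D) (SmoothFn D), d 2 = 0 := fun d => by simp
  simp only [hφu, hφx, vf, hwx, hwt, hwu, map_add, map_sub, Derivation.leibniz,
    Derivation.leibniz_pow,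
    Derivation.map_algebraMap, smul_eq_mul, nsmul_eq_mul, hzu, hvx, hvt, hvu, hc, hA, hξ, du_dx,
    du_dt, hPu, map_zero, mul_zero, add_zero, sub_zero, mul_one, Nat.cast_ofNat,
    Nat.reduceSub, pow_one, dt_dx] at h3
  have hpoly := coeff_eq_zero du hwu 5 (fun i =>
    if i = 0 then -(6 * con μ * ξ * c ^ 2) else
    if i = 2 then 4 * c * (con μ * dx P) + 2 * con μ * (ξ * (ξ * dx c + c * dx ξ)
      + (ξ * dt c + c * dt ξ)) - 4 * con μ * ξ * c * A + 2 * con μ * ξ * c * (dx ξ - A)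
      - con μ * (2 * dx P - dt ξ - 2 * ξ * A + ξ * dx ξ) * c else
    if i = 4 then 4 * (A * (con μ * dx P) - dx m)
      + con μ * (ξ * dx (2 * dx P - dt ξ - 2 * ξ * A + ξ * dx ξ)
        + dt (2 * dx P - dt ξ - 2 * ξ * A + ξ * dx ξ))
      + con μ * (2 * dx P - dt ξ - 2 * ξ * A + ξ * dx ξ) * (dx ξ - A) else
    if i = 5 then 8 * dx A - 6 * dx (dx ξ) else 0)
    (fun i => by
      split_ifs <;> simp [Derivation.leibniz, Derivation.leibniz_pow, hc, hA, hξ, du_dx, du_dt,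
        hPu, hmu])
    (by
      simp only [Finset.sum_range_succ, Finset.sum_range_zero]
      norm_num
      ext z
      have hz := hw z
      have h4 := congrArg (fun f : SmoothFn D => f z) h3
      have h5 := congrArg (fun f : SmoothFn D => f z) hφ
      have h6 := congrArg (fun f : SmoothFn D => f z) hm
      simp only [SmoothFn.coe_add, SmoothFn.coe_sub, SmoothFn.coe_mul, SmoothFn.coe_neg,
        SmoothFn.coe_pow, SmoothFn.coe_zero, SmoothFn.coe_ofNat,
        SmoothFn.coe_algebraMap, hv, dt_dx] at h4 h5 h6 ⊢
      rw [h5, h6] at h4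
      field_simp at h4 ⊢
      linear_combination h4)
  have h0 := hpoly 0 (by norm_num)
  simp only [if_true] at h0
  have h1 : (ξ * c) ^ 2 = 0 := by
    refine algebraMap_mul_eq_zero (c := -(6 * μ)) (by simpa using hμ) ?_
    have : algebraMap 𝕜 (SmoothFn D) (-(6 * μ)) = -(6 * con μ) := by
      ext z
      simp
    rw [this]
    linear_combination ξ * h0
  exact pow_eq_zero_iff (two_ne_zero) |>.1 h1

/-- If `ξ = 0`, then the coefficient of the lowest power of `w` in the determining equation of
`u_xx` rules out the exceptional case. -/
theorem shape_coeff_eq_zero {γ κ μ : 𝕜} (hμ : μ ≠ 0) {φ : SmoothFn D}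
    (hw : ∀ z, (coeffs γ κ μ 0 φ).w z ≠ 0)
    (H : Determining 4 3 0 φ (coeffs γ κ μ 0 φ)
      (vf 0 φ (coeffs γ κ μ 0 φ).w + (coeffs γ κ μ 0 φ).w * (du φ - 4 * dx 0)))
    {v c A : SmoothFn D} (hv : ∀ z, v z = ((coeffs γ κ μ 0 φ).w z)⁻¹) (hc : du c = 0)
    (hA : du A = 0)
    (hφ : φ = c * v + A * (coeffs γ κ μ 0 φ).w) : c = 0 := by
  have h2 := H.e2
  obtain ⟨w, hwdef⟩ : ∃ w, w = (coeffs γ κ μ 0 φ).w := ⟨_, rfl⟩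
  have hw1 : w = u := by simp [hwdef, coeffs]
  have hL : (coeffs γ κ μ 0 φ).L = 0 := by simp [coeffs, qCoeff]
  have ha : (coeffs γ κ μ 0 φ).a = 0 := by simp [coeffs, qCoeff]
  have hM : (coeffs γ κ μ 0 φ).M₂ = con μ * du (dt φ + φ * du φ) + con κ + 2 * con γ * w := by
    rw [hw1]
    simp [coeffs, qCoeff, kCoeff]
  rw [hL, ha, hM] at h2
  rw [← hwdef] at hw hv hφ h2
  have hwx : dx w = 0 := by simp [hw1]
  have hwt : dt w = 0 := by simp [hw1]
  have hwu : du w = 1 := by simp [hw1]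
  have hvx : dx v = 0 := by simp [der_inv hw hv dx, hwx]
  have hvt : dt v = 0 := by simp [der_inv hw hv dt, hwt]
  have hvu : du v = -v ^ 2 := by simp [der_inv hw hv du, hwu]
  have hφu : du φ = A - c * v ^ 2 := by
    rw [hφ]
    simp [Derivation.leibniz, hc, hA, hvu, hwu]
    ring
  have hφx : dx (dx φ) = dx (dx c) * v + dx (dx A) * w := by
    rw [hφ]
    simp [Derivation.leibniz, hvx, hwx]
    ring
  have hφt : dt φ = dt c * v + dt A * w := by
    rw [hφ]
    simp [Derivation.leibniz, hvt, hwt]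
    ring
  have hzu : ∀ d : Derivation 𝕜 (SmoothFn D) (SmoothFn D), d 2 = 0 := fun d => by simp
  have h3 : (con 3 : SmoothFn D) = 3 := map_ofNat _ 3
  simp only [hφu, hφx, hφt, vf, hwx, hwt, hwu, h3, map_add, map_sub, map_neg, Derivation.leibniz,
    Derivation.leibniz_pow, Derivation.map_algebraMap, smul_eq_mul, nsmul_eq_mul, hzu, hvx, hvt,
    hvu, hc, hA, du_dt, map_zero, mul_zero, zero_mul, add_zero, sub_zero, zero_add,
    mul_one, Nat.cast_ofNat, Nat.reduceSub, pow_one] at h2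
  have hpoly := coeff_eq_zero du hwu 7 (fun i =>
    if i = 0 then -(15 * con μ * c ^ 3) else
    if i = 2 then con μ * (9 * c * dt c - 15 * A * c ^ 2) else
    if i = 4 then con μ * (-dt (dt c) + 3 * A * dt c - c * (dt A + A ^ 2)) - con κ * c else
    if i = 6 then con μ * (dt (dt A) + 2 * A * dt A) - A * (con μ * (dt A + A ^ 2) + con κ) else
    if i = 7 then 12 * dx (dx A) else 0)
    (fun i => by
      split_ifs <;> simp [Derivation.leibniz, Derivation.leibniz_pow, hc, hA, du_dx, du_dt])
    (by
      simp only [Finset.sum_range_succ, Finset.sum_range_zero]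
      norm_num
      ext z
      have hz := hw z
      have h4 := congrArg (fun f : SmoothFn D => f z) h2
      have h5 := congrArg (fun f : SmoothFn D => f z) hφ
      simp only [SmoothFn.coe_add, SmoothFn.coe_sub, SmoothFn.coe_mul, SmoothFn.coe_neg,
        SmoothFn.coe_pow, SmoothFn.coe_zero, SmoothFn.coe_ofNat, SmoothFn.coe_algebraMap, hv]
        at h4 h5 ⊢
      rw [h5] at h4
      field_simp at h4 ⊢
      linear_combination h4)
  have h0 := hpoly 0 (by norm_num)
  simp only [if_true] at h0
  have h1 : c ^ 3 = 0 := by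
    refine algebraMap_mul_eq_zero (c := -(15 * μ)) (by simpa using hμ) ?_
    have : algebraMap 𝕜 (SmoothFn D) (-(15 * μ)) = -(15 * con μ) := by
      ext z
      simp
    rw [this]
    linear_combination h0
  exact pow_eq_zero_iff (three_ne_zero) |>.1 h1

/-- In the generic case the infinitesimal `φ` is affine in `u`. -/
theorem du_du_phi_eq_zero {α β γ κ μ : 𝕜} (hμ : μ ≠ 0) {ξ φ : 𝕜 → 𝕜 → 𝕜 → 𝕜}
    {ξ' φ' : SmoothFn D} (hξ : ∀ x t u (h : (x, t, u) ∈ D), ξ x t u = ξ' ⟨_, h⟩)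
    (hφ : ∀ x t u (h : (x, t, u) ∈ D), φ x t u = φ' ⟨_, h⟩) (hu : du ξ' = 0)
    (hw : ∀ z, (coeffs γ κ μ ξ' φ').w z ≠ 0) (H : IsNonclassical α β γ κ μ ξ φ D) :
    du (du φ') = 0 := by
  have H' := (isNonclassical_iff_determining α β γ κ μ hξ hφ hu hw).1 H
  rcases du_du_eq_zero_or hu hw H' with h | ⟨rfl, rfl, h1, h2⟩
  · exact h
  obtain ⟨v, c, A, hv, hc, hA, hshape, hf⟩ := exists_shape hu hw h1 h2
  have hξc := xi_mul_eq_zero hμ hu hw H' hv hc hA hshape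
  suffices c = 0 by rw [hf, this]; simp
  ext z
  by_contra hz
  rw [SmoothFn.coe_zero] at hz
  -- on the set where `c` does not vanish the previous lemma applies
  have hle := support_le c
  have hξ0 : restrict hle ξ' = 0 := by
    ext y
    have hy : c ⟨y, hle y.2⟩ ≠ 0 := y.2.2
    rw [restrict_apply, SmoothFn.coe_zero]
    exact mul_eq_zero_of_ne (by rw [mul_comm]; exact hξc) hy
  have hrw : ∀ y, (coeffs γ κ μ 0 (restrict hle φ')).w y
      = (coeffs γ κ μ ξ' φ').w ⟨y, hle y.2⟩ := by
    intro y
    have := congrArg (fun f : SmoothFn _ => f y) hξ0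
    simp only [restrict_apply, SmoothFn.coe_zero] at this
    simp [coeffs, this]
  have Hr : IsNonclassical 4 3 γ κ μ ξ φ c.support := fun x t p h => H x t p (hle h)
  have Hr' := (isNonclassical_iff_determining (D := c.support) 4 3 γ κ μ (ξ' := 0)
    (φ' := restrict hle φ')
    (fun x t u h => by
      rw [hξ x t u (hle h), ← hξ0, restrict_apply])
    (fun x t u h => by rw [hφ x t u (hle h), restrict_apply]) (by simp)
    (fun y => by rw [hrw]; exact hw _)).1 Hr
  have h0 := shape_coeff_eq_zero hμ (fun y => by rw [hrw]; exact hw _) Hr' (v := restrict hle v)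
    (c := restrict hle c) (A := restrict hle A) (fun y => by rw [hrw, restrict_apply, hv])
    (by rw [du_restrict, hc, map_zero])
    (by rw [du_restrict, hA, map_zero])
    (by
      ext y
      have h3 := congrArg (fun f : SmoothFn _ => f y) hξ0
      have h5 : ∀ d : Derivation 𝕜 (SmoothFn D) (SmoothFn D),
          d (ξ' ^ 2) ⟨y, hle y.2⟩ = 0 := by
        intro d
        simp only [restrict_apply, SmoothFn.coe_zero] at h3
        simp [Derivation.leibniz_pow, h3]
      have h4 := congrArg (fun f : SmoothFn _ => f ⟨y, hle y.2⟩) hshape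
      simp only [SmoothFn.coe_add, SmoothFn.coe_mul, SmoothFn.coe_sub, hrw, restrict_apply,
        h5, mul_zero, add_zero, sub_zero] at h4 ⊢
      exact h4)
  have := congrArg (fun f : SmoothFn c.support => f ⟨z, ⟨z.2, hz⟩⟩) h0
  simp only [restrict_apply, SmoothFn.coe_zero] at this
  exact hz this

end JetPoly

namespace JetPoly

open MvPolynomial SmoothFn

variable {𝕜 : Type*} [RCLike 𝕜] {D : TopologicalSpace.Opens (𝕜 × 𝕜 × 𝕜)}

/-! ### The determining equations for `φ = A u + B` -/

/-- The action of `ξ ∂ₓ + ∂ₜ` on functions of `(x, t)`. -/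
noncomputable def tr (ξ f : SmoothFn D) : SmoothFn D := ξ * dx f + dt f

/-- The coefficient of `u_x` in `u_tt`, if `φ_u = A`. -/
noncomputable def qA (ξ A : SmoothFn D) : SmoothFn D := -(dt ξ + 2 * ξ * A - ξ * dx ξ)

/-- The coefficient of `u` in `u_tt`, if `φ_u = A`. -/
noncomputable def rA (ξ A : SmoothFn D) : SmoothFn D := dt A + A ^ 2 - ξ * dx A

/-- The term of `u_tt` without `u`, if `φ = A u + B`. -/
noncomputable def sAB (ξ A B : SmoothFn D) : SmoothFn D := dt B + A * B - ξ * dx B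

/-- The coefficient of `u_xxx` in the reduced equation is `-μ` times this function. -/
noncomputable def cL (ξ A : SmoothFn D) : SmoothFn D := 2 * dx (ξ ^ 2) + qA ξ A

/-- The coefficient of `u_xx` in minus the reduced equation is this function plus `2 γ w`. -/
noncomputable def cM₂ (γ κ μ : 𝕜) (ξ A : SmoothFn D) : SmoothFn D :=
  con μ * (dx (dx (ξ ^ 2)) + 2 * dx (qA ξ A) + rA ξ A) - ξ ^ 2 + con κ
    - 2 * con γ * con μ * ξ ^ 2

/-- The coefficient of `u_x` in minus the reduced equation. -/
noncomputable def cM₁ (μ : 𝕜) (ξ A : SmoothFn D) : SmoothFn D :=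
  con μ * (dx (dx (qA ξ A)) + 2 * dx (rA ξ A)) - qA ξ A

/-- The term of minus the reduced equation without derivatives of `u` is `cM₀ * w + cN`. -/
noncomputable def cM₀ (μ : 𝕜) (ξ A : SmoothFn D) : SmoothFn D :=
  con μ * dx (dx (rA ξ A)) - rA ξ A

/-- The term of minus the reduced equation without derivatives of `u` is `cM₀ * w + cN`. -/
noncomputable def cN (μ : 𝕜) (ξ A B : SmoothFn D) : SmoothFn D :=
  con μ * dx (dx (sAB ξ A B)) - sAB ξ A B - con μ * ξ ^ 2 * cM₀ μ ξ A

/-- The value of `ξ w_x + w_t + φ w_u` at `w = 0`, where `w = u + μ ξ²`. -/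
noncomputable def defect (μ : 𝕜) (ξ A B : SmoothFn D) : SmoothFn D :=
  B + con μ * (tr ξ (ξ ^ 2) - A * ξ ^ 2)

/-- The determining equations for `φ = A u + B`, where `ξ`, `A` and `B` do not depend on `u`:
the coefficients of the powers of `w = u + μ ξ²` in `Determining`. The names of the fields list
the orders of the `x`-derivatives in the monomial, followed by the power of `w`. -/
structure Core (α β γ κ μ : 𝕜) (ξ A B : SmoothFn D) : Prop where
  e13_0 : con α * defect μ ξ A B = 0
  e22_0 : con β * defect μ ξ A B = 0
  e11_0 : con γ * defect μ ξ A B = 0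
  e3_0 : cL ξ A * defect μ ξ A B = 0
  e2_0 : cM₂ γ κ μ ξ A * defect μ ξ A B = 0
  e1_0 : cM₁ μ ξ A * defect μ ξ A B = 0
  e0_0 : cN μ ξ A B * defect μ ξ A B = 0
  e3_2 : (4 + con α) * dx A = 6 * dx (dx ξ)
  e12_1 : (3 * con α + 4 * con β) * dx A = (3 * con α + 2 * con β) * dx (dx ξ)
  e11_1 : con α * (3 * dx (dx A) - dx (dx (dx ξ))) + 4 * con γ * dx ξ = 0
  e2_2 : (6 + 2 * con β) * dx (dx A) - 4 * dx (dx (dx ξ)) + 4 * con γ * dx ξ = 0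
  e1_2 : (4 + con α) * dx (dx (dx A)) - dx (dx (dx (dx ξ)))
    + 2 * con γ * (4 * dx A - dx (dx ξ)) = 0
  e0_3 : dx (dx (dx (dx A))) + 2 * con γ * dx (dx A) = 0
  e3_1 : con α * (dx B - con μ * ξ ^ 2 * dx A)
    + con μ * (tr ξ (cL ξ A) - cL ξ A * (A - dx ξ)) = 0
  e2_1 : 2 * con β * (dx (dx B) - con μ * ξ ^ 2 * dx (dx A))
    + 3 * con μ * cL ξ A * (dx A - dx (dx ξ))
    + tr ξ (cM₂ γ κ μ ξ A) - cM₂ γ κ μ ξ A * (A - 2 * dx ξ) = 0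
  e1_1 : con α * (dx (dx (dx B)) - con μ * ξ ^ 2 * dx (dx (dx A)))
    + con μ * cL ξ A * (3 * dx (dx A) - dx (dx (dx ξ)))
    + cM₂ γ κ μ ξ A * (2 * dx A - dx (dx ξ))
    + 4 * con γ * (dx B - con μ * ξ ^ 2 * dx A)
    + tr ξ (cM₁ μ ξ A) - cM₁ μ ξ A * (A - 3 * dx ξ) = 0
  e0_2 : dx (dx (dx (dx B))) + con μ * cL ξ A * dx (dx (dx A)) + cM₂ γ κ μ ξ A * dx (dx A)
    + 2 * con γ * dx (dx B) + cM₁ μ ξ A * dx A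
    + tr ξ (cM₀ μ ξ A) - cM₀ μ ξ A * (A - 4 * dx ξ) = 0
  e0_1 : con μ * cL ξ A * (dx (dx (dx B)) - con μ * ξ ^ 2 * dx (dx (dx A)))
    + cM₂ γ κ μ ξ A * (dx (dx B) - con μ * ξ ^ 2 * dx (dx A))
    + cM₁ μ ξ A * (dx B - con μ * ξ ^ 2 * dx A)
    + tr ξ (cN μ ξ A B) - (2 * A - 4 * dx ξ) * cN μ ξ A B = 0

section split

variable {w : SmoothFn D} (hw : du w = 1)
include hw

theorem affine_eq_zero_iff {a b : SmoothFn D} (ha : du a = 0) (hb : du b = 0) :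
    a * w + b = 0 ↔ a = 0 ∧ b = 0 := by
  constructor
  · intro h
    have h1 := congrArg du h
    simp only [map_add, Derivation.leibniz, ha, hb, hw, smul_eq_mul, map_zero, mul_zero,
      add_zero, mul_one] at h1
    exact ⟨h1, by simpa [h1] using h⟩
  · rintro ⟨rfl, rfl⟩
    simp

theorem quadratic_eq_zero_iff {a b c : SmoothFn D} (ha : du a = 0) (hb : du b = 0)
    (hc : du c = 0) : a * w ^ 2 + b * w + c = 0 ↔ a = 0 ∧ b = 0 ∧ c = 0 := by
  constructor
  · intro h
    have h0 := coeff_eq_zero du hw 2 (fun i => if i = 0 then c else if i = 1 then b else a)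
      (fun i => by split_ifs <;> assumption)
      (by simp [Finset.sum_range_succ]; linear_combination h)
    exact ⟨by simpa using h0 2 le_rfl, by simpa using h0 1 (by norm_num),
      by simpa using h0 0 (by norm_num)⟩
  · rintro ⟨rfl, rfl, rfl⟩
    simp

theorem cubic_eq_zero_iff {a b c e : SmoothFn D} (ha : du a = 0) (hb : du b = 0)
    (hc : du c = 0) (he : du e = 0) :
    a * w ^ 3 + b * w ^ 2 + c * w + e = 0 ↔ a = 0 ∧ b = 0 ∧ c = 0 ∧ e = 0 := by
  constructor
  · intro h
    have h0 := coeff_eq_zero du hw 3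
      (fun i => if i = 0 then e else if i = 1 then c else if i = 2 then b else a)
      (fun i => by split_ifs <;> assumption)
      (by simp [Finset.sum_range_succ]; linear_combination h)
    exact ⟨by simpa using h0 3 le_rfl, by simpa using h0 2 (by norm_num),
      by simpa using h0 1 (by norm_num), by simpa using h0 0 (by norm_num)⟩
  · rintro ⟨rfl, rfl, rfl, rfl⟩
    simp

end split

/-- As `φ = A u + B = A w + (B - μ A ξ²)`, every determining equation is a polynomial in `w` whose
coefficients do not depend on `u`, and `∂w/∂u = 1`. -/
theorem determining_iff_core {α β γ κ μ : 𝕜} (hμ : μ ≠ 0) {ξ A B : SmoothFn D} (hξ : du ξ = 0)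
    (hA : du A = 0) (hB : du B = 0) :
    Determining α β ξ (A * u + B) (coeffs γ κ μ ξ (A * u + B))
      (vf ξ (A * u + B) (coeffs γ κ μ ξ (A * u + B)).w
        + (coeffs γ κ μ ξ (A * u + B)).w * (du (A * u + B) - 4 * dx ξ)) ↔
    Core α β γ κ μ ξ A B := by
  obtain ⟨φ, hφ⟩ : ∃ φ, φ = A * u + B := ⟨_, rfl⟩
  rw [← hφ]
  have hφu : du φ = A := by simp [hφ, Derivation.leibniz, hA, hB]
  have hq : qCoeff ξ φ = qA ξ A := by rw [qCoeff, hφu, qA]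
  have hqu : du (qA ξ A) = 0 := by simp [qA, Derivation.leibniz, hξ, hA, du_dx, du_dt]
  have hru : du (rA ξ A) = 0 := by simp [rA, Derivation.leibniz, Derivation.leibniz_pow, hξ, hA,
    du_dx, du_dt]
  have hsu : du (sAB ξ A B) = 0 := by simp [sAB, Derivation.leibniz, hξ, hA, hB, du_dx, du_dt]
  have hk : kCoeff ξ φ = rA ξ A * u + sAB ξ A B := by
    rw [kCoeff, hφu, hφ]
    simp [rA, sAB, Derivation.leibniz]
    ring
  have hku : du (kCoeff ξ φ) = rA ξ A := by
    simp only [hk, map_add, Derivation.leibniz, hru, hsu]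
    simp
  obtain ⟨w, hw⟩ : ∃ w, w = u + con μ * ξ ^ 2 := ⟨_, rfl⟩
  have hwu : du w = 1 := by simp [hw, Derivation.leibniz_pow, hξ]
  have h1 : (coeffs γ κ μ ξ φ).w = w := hw.symm
  have h2 : (coeffs γ κ μ ξ φ).L = con μ * cL ξ A := by simp only [coeffs, hq, cL]
  have h3 : (coeffs γ κ μ ξ φ).a = 0 := by simp only [coeffs, hq, hqu, mul_zero]
  have h4 : (coeffs γ κ μ ξ φ).b = 0 := by simp only [coeffs, hq, hqu, mul_zero, map_zero]
  have h5 : (coeffs γ κ μ ξ φ).M₂ = 2 * con γ * w + cM₂ γ κ μ ξ A := by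
    simp only [coeffs, hq, hku, cM₂, hw]
    ring
  have h6 : (coeffs γ κ μ ξ φ).c = 2 * con γ := by
    simp only [coeffs, hq, hku, hru, hqu]
    simp
  have h7 : (coeffs γ κ μ ξ φ).M₁ = cM₁ μ ξ A := by simp only [coeffs, hq, hku, cM₁]
  have h8 : (coeffs γ κ μ ξ φ).M₀ = cM₀ μ ξ A * w + cN μ ξ A B := by
    simp only [coeffs, hk, cM₀, cN, hw]
    generalize rA ξ A = r
    generalize sAB ξ A B = s
    simp [Derivation.leibniz]
    ring
  have hφ1 : dx φ = dx A * w + (dx B - con μ * ξ ^ 2 * dx A) := by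
    simp [hφ, hw, Derivation.leibniz]
    ring
  have hφ2 : dx (dx A * w + (dx B - con μ * ξ ^ 2 * dx A))
      = dx (dx A) * w + (dx (dx B) - con μ * ξ ^ 2 * dx (dx A)) := by
    simp [hw, Derivation.leibniz]
    ring
  have hφ3 : dx (dx (dx A) * w + (dx (dx B) - con μ * ξ ^ 2 * dx (dx A)))
      = dx (dx (dx A)) * w + (dx (dx (dx B)) - con μ * ξ ^ 2 * dx (dx (dx A))) := by
    simp [hw, Derivation.leibniz]
    ring
  have hφ4 : dx (dx (dx (dx A)) * w + (dx (dx (dx B)) - con μ * ξ ^ 2 * dx (dx (dx A))))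
      = dx (dx (dx (dx A))) * w
        + (dx (dx (dx (dx B))) - con μ * ξ ^ 2 * dx (dx (dx (dx A)))) := by
    simp [hw, Derivation.leibniz]
    ring
  have hvw : vf ξ φ w = A * w + defect μ ξ A B := by
    simp only [vf, hwu, defect, tr]
    simp only [hw, hφ]
    simp [Derivation.leibniz]
    ring
  have hvf : ∀ f, du f = 0 → vf ξ φ f = tr ξ f := fun f hf => by simp [vf, hf, tr]
  have hPu : du (ξ ^ 2) = 0 := by simp [Derivation.leibniz_pow, hξ]
  have hdu : du (defect μ ξ A B) = 0 := by
    simp [defect, tr, Derivation.leibniz, Derivation.leibniz_pow, hξ, hA, hB, du_dx, du_dt]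
  have hLu : du (cL ξ A) = 0 := by
    simp only [cL, map_add, Derivation.leibniz, du_dx, hqu, hPu]
    simp
  have hM2u : du (cM₂ γ κ μ ξ A) = 0 := by
    simp only [cM₂, map_add, map_sub, Derivation.leibniz, du_dx, hqu, hPu, hru]
    simp
  have hM1u : du (cM₁ μ ξ A) = 0 := by
    simp only [cM₁, map_add, map_sub, Derivation.leibniz, du_dx, hqu, hru]
    simp
  have hM0u : du (cM₀ μ ξ A) = 0 := by
    simp only [cM₀, map_sub, Derivation.leibniz, du_dx, hru]
    simp
  have hNu : du (cN μ ξ A B) = 0 := by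
    rw [cN]
    simp only [map_sub, Derivation.leibniz, du_dx, hsu, hM0u, hPu]
    simp
  have hvM2 : vf ξ φ (2 * con γ * w + cM₂ γ κ μ ξ A)
      = 2 * con γ * (A * w + defect μ ξ A B) + tr ξ (cM₂ γ κ μ ξ A) := by
    rw [← hvw, ← hvf _ hM2u]
    simp only [vf, map_add, Derivation.leibniz]
    simp
    ring
  have hvc : vf ξ φ (2 * con γ) = 0 := by simp [vf]
  have hvM0 : vf ξ φ (cM₀ μ ξ A * w + cN μ ξ A B)
      = tr ξ (cM₀ μ ξ A) * w + cM₀ μ ξ A * (A * w + defect μ ξ A B) + tr ξ (cN μ ξ A B) := by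
    rw [← hvw, ← hvf _ hM0u, ← hvf _ hNu]
    simp only [vf, map_add, Derivation.leibniz, smul_eq_mul]
    ring
  have hv0 : vf ξ φ 0 = 0 := by simp [vf]
  have hvL : vf ξ φ (con μ * cL ξ A) = con μ * tr ξ (cL ξ A) := by
    rw [← hvf _ hLu]
    simp only [vf, Derivation.leibniz, Derivation.map_algebraMap, smul_eq_mul]
    ring
  have htr : ∀ f, du f = 0 → du (tr ξ f) = 0 := fun f hf => by
    simp [tr, Derivation.leibniz, hξ, hf, du_dx, du_dt]
  have hvM1 := hvf _ hM1u
  have hT1 := htr _ hLu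
  have hT2 := htr _ hM2u
  have hT3 := htr _ hM1u
  have hT4 := htr _ hM0u
  have hT5 := htr _ hNu
  generalize coeffs γ κ μ ξ φ = F at *
  obtain ⟨w', L, a, b, M₂, c, M₁, M₀⟩ := F
  simp only at h1 h2 h3 h4 h5 h6 h7 h8
  subst h1 h2 h3 h4 h5 h6 h7 h8
  rw [hvw, hφu]
  constructor
  · rintro ⟨e13, e22, -, -, -, e12, e3, e2, e11, e1, e0⟩
    simp only [hφu, hA, hvL, hvM2, hvc, hvM0, hvM1, hv0, hφ1, hφ2, hφ3, hφ4, map_zero]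
      at e13 e22 e12 e3 e2 e11 e1 e0
    obtain ⟨-, i13⟩ := (affine_eq_zero_iff hwu (a := 0) (b := con α * defect μ ξ A B)
      (by simp [*]) (by simp [*])).1 (by linear_combination -e13)
    obtain ⟨-, i22⟩ := (affine_eq_zero_iff hwu (a := 0) (b := con β * defect μ ξ A B)
      (by simp [*]) (by simp [*])).1 (by linear_combination -e22)
    obtain ⟨i12, -⟩ := (affine_eq_zero_iff hwu
      (a := (3 * con α + 4 * con β) * dx A - (3 * con α + 2 * con β) * dx (dx ξ)) (b := 0)
      (by simp [*, du_dx]) (by simp [*])).1 (by linear_combination e12)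
    obtain ⟨i11, j11⟩ := (affine_eq_zero_iff hwu
      (a := con α * (3 * dx (dx A) - dx (dx (dx ξ))) + 4 * con γ * dx ξ)
      (b := -(2 * (con γ * defect μ ξ A B)))
      (by simp [*, du_dx]) (by simp [*])).1 (by linear_combination e11)
    obtain ⟨i3, j3, k3⟩ := (quadratic_eq_zero_iff hwu
      (a := (4 + con α) * dx A - 6 * dx (dx ξ))
      (b := con α * (dx B - con μ * ξ ^ 2 * dx A)
        + con μ * (tr ξ (cL ξ A) - cL ξ A * (A - dx ξ)))
      (c := -(con μ * (cL ξ A * defect μ ξ A B)))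
      (by simp [*, du_dx]) (by simp [*, du_dx]) (by simp [*])).1 (by linear_combination e3)
    obtain ⟨i2, j2, k2⟩ := (quadratic_eq_zero_iff hwu
      (a := (6 + 2 * con β) * dx (dx A) - 4 * dx (dx (dx ξ)) + 4 * con γ * dx ξ)
      (b := 2 * con β * (dx (dx B) - con μ * ξ ^ 2 * dx (dx A))
        + 3 * con μ * cL ξ A * (dx A - dx (dx ξ))
        + tr ξ (cM₂ γ κ μ ξ A) - cM₂ γ κ μ ξ A * (A - 2 * dx ξ))
      (c := -(cM₂ γ κ μ ξ A * defect μ ξ A B))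
      (by simp [*, du_dx]) (by simp [*, du_dx]) (by simp [*])).1 (by linear_combination e2)
    obtain ⟨i1, j1, k1⟩ := (quadratic_eq_zero_iff hwu
      (a := (4 + con α) * dx (dx (dx A)) - dx (dx (dx (dx ξ)))
        + 2 * con γ * (4 * dx A - dx (dx ξ)))
      (b := con α * (dx (dx (dx B)) - con μ * ξ ^ 2 * dx (dx (dx A)))
        + con μ * cL ξ A * (3 * dx (dx A) - dx (dx (dx ξ)))
        + cM₂ γ κ μ ξ A * (2 * dx A - dx (dx ξ))
        + 4 * con γ * (dx B - con μ * ξ ^ 2 * dx A)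
        + tr ξ (cM₁ μ ξ A) - cM₁ μ ξ A * (A - 3 * dx ξ))
      (c := -(cM₁ μ ξ A * defect μ ξ A B))
      (by simp [*, du_dx]) (by simp [*, du_dx]) (by simp [*])).1 (by linear_combination e1)
    obtain ⟨i0, j0, k0, l0⟩ := (cubic_eq_zero_iff hwu
      (a := dx (dx (dx (dx A))) + 2 * con γ * dx (dx A))
      (b := dx (dx (dx (dx B))) - con μ * ξ ^ 2 * dx (dx (dx (dx A)))
        + con μ * cL ξ A * dx (dx (dx A)) + cM₂ γ κ μ ξ A * dx (dx A)
        + 2 * con γ * (dx (dx B) - con μ * ξ ^ 2 * dx (dx A)) + cM₁ μ ξ A * dx A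
        + tr ξ (cM₀ μ ξ A) - cM₀ μ ξ A * (A - 4 * dx ξ))
      (c := con μ * cL ξ A * (dx (dx (dx B)) - con μ * ξ ^ 2 * dx (dx (dx A)))
        + cM₂ γ κ μ ξ A * (dx (dx B) - con μ * ξ ^ 2 * dx (dx A))
        + cM₁ μ ξ A * (dx B - con μ * ξ ^ 2 * dx A)
        + tr ξ (cN μ ξ A B) - (2 * A - 4 * dx ξ) * cN μ ξ A B)
      (e := -(cN μ ξ A B * defect μ ξ A B))
      (by simp [*, du_dx]) (by simp [*, du_dx]) (by simp [*, du_dx]) (by simp [*])).1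
      (by linear_combination e0)
    exact
      { e13_0 := i13
        e22_0 := i22
        e11_0 := natCast_mul_eq_zero (n := 2) two_ne_zero (by linear_combination -j11)
        e3_0 := algebraMap_mul_eq_zero hμ (by linear_combination -k3)
        e2_0 := by linear_combination -k2
        e1_0 := by linear_combination -k1
        e0_0 := by linear_combination -l0
        e3_2 := by linear_combination i3
        e12_1 := by linear_combination i12
        e11_1 := i11
        e2_2 := i2
        e1_2 := i1
        e0_3 := i0
        e3_1 := j3
        e2_1 := j2
        e1_1 := j1
        e0_2 := by linear_combination j0 + con μ * ξ ^ 2 * i0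
        e0_1 := k0 }
  · intro H
    constructor <;> simp only [hφu, hA, hvL, hvM2, hvc, hvM0, hvM1, hv0, hφ1, hφ2, hφ3, hφ4,
      map_zero]
    · linear_combination -H.e13_0
    · linear_combination -H.e22_0
    · ring
    · ring
    · ring
    · linear_combination w' * H.e12_1
    · linear_combination w' ^ 2 * H.e3_2 + w' * H.e3_1 - con μ * H.e3_0
    · linear_combination w' ^ 2 * H.e2_2 + w' * H.e2_1 - H.e2_0
    · linear_combination w' * H.e11_1 - 2 * H.e11_0
    · linear_combination w' ^ 2 * H.e1_2 + w' * H.e1_1 - H.e1_0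
    · linear_combination w' ^ 3 * H.e0_3 + w' ^ 2 * (H.e0_2 - con μ * ξ ^ 2 * H.e0_3)
        + w' * H.e0_1 - H.e0_0

end JetPoly

namespace JetPoly

open MvPolynomial SmoothFn

variable {𝕜 : Type*} [RCLike 𝕜] {D : TopologicalSpace.Opens (𝕜 × 𝕜 × 𝕜)}

/-! ### The dependence of the infinitesimals on `x` -/

namespace Core

variable {α β γ κ μ : 𝕜} {ξ A B : SmoothFn D}

/-- For `γ ≠ 0` the coefficients of the highest power of `w`, together with their `x`-derivatives,
are linear relations among the `x`-derivatives of `ξ` and `A` that leave no dependence on `x`. -/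
theorem dx_eq_zero_of_ne (H : Core α β γ κ μ ξ A B) (hγ : γ ≠ 0) : dx ξ = 0 ∧ dx A = 0 := by
  have pt : ∀ {f g : SmoothFn D}, f = g → ∀ z, f z = g z := fun h z => h ▸ rfl
  have a0 := H.e3_2
  have a1 := congrArg dx a0
  have a2 := congrArg dx a1
  have a3 := congrArg dx a2
  have c0 := H.e11_1
  have d0 := H.e2_2
  have d1 := congrArg dx d0
  have d2 := congrArg dx d1
  have e0 := H.e1_2
  have e1 := congrArg dx e0
  have f0 := H.e0_3
  simp only [Derivation.leibniz, map_add, map_sub, Derivation.map_algebraMap, derivation_ofNat,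
    smul_eq_mul, mul_zero, add_zero, map_zero] at a1 a2 a3 d1 d2 e1
  have hx : dx ξ = 0 := by
    ext z
    have a1 := pt a1 z
    have a3 := pt a3 z
    have c0 := pt c0 z
    have d0 := pt d0 z
    have d2 := pt d2 z
    have e1 := pt e1 z
    have f0 := pt f0 z
    simp only [SmoothFn.coe_add, SmoothFn.coe_sub, SmoothFn.coe_mul, SmoothFn.coe_zero,
      SmoothFn.coe_ofNat, SmoothFn.coe_algebraMap] at a1 a3 c0 d0 d2 e1 f0 ⊢
    -- `y`, `y2`, `y4` and `b2`, `b4` are the values of derivatives of `ξ` and `A`; the last step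
    -- in each case is the relation `γ y = 0`
    generalize (dx (dx (dx (dx (dx ξ))))) z = y4 at *
    generalize (dx (dx (dx ξ))) z = y2 at *
    generalize (dx ξ) z = y at *
    generalize (dx (dx (dx (dx A)))) z = b4 at *
    generalize (dx (dx A)) z = b2 at *
    by_cases hα : 4 + α = 0
    · have h2 : y2 = 0 := by linear_combination -a1 / 6 + b2 / 6 * hα
      have h4 : y4 = 0 := by linear_combination -a3 / 6 + b4 / 6 * hα
      have hb : γ * b2 = 0 := by linear_combination e1 / 8 + h4 / 8 + γ / 4 * h2 - b4 / 8 * hα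
      have hb' : b2 = 0 := (mul_eq_zero.1 hb).resolve_left hγ
      have hy : γ * y = 0 := by linear_combination d0 / 4 - (6 + 2 * β) / 4 * hb' + h2
      exact (mul_eq_zero.1 hy).resolve_left hγ
    · by_cases h2 : y2 = 0
      · have hb' : b2 = 0 := (mul_eq_zero.1 (by linear_combination a1 + 6 * h2 :
          (4 + α) * b2 = 0)).resolve_left hα
        have hy : γ * y = 0 := by linear_combination d0 / 4 - (6 + 2 * β) / 4 * hb' + h2
        exact (mul_eq_zero.1 hy).resolve_left hγ
      · have h4 : y4 = -2 * γ * y2 := by linear_combination (4 + α) / 6 * f0 - a3 / 6 - γ / 3 * a1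
        have h5 : α = 0 := by
          have : (γ * y2) * α = 0 := by
            linear_combination (4 + α) / 12 * (-e1) + 8 * γ / 12 * a1 + 5 * (4 + α) / 12 * h4
              + (4 + α) / 12 * a3
          exact (mul_eq_zero.1 this).resolve_left (mul_ne_zero hγ h2)
        have hy : γ * y = 0 := by linear_combination c0 / 4 - (3 * b2 - y2) / 4 * h5
        exact (mul_eq_zero.1 hy).resolve_left hγ
  refine ⟨hx, ?_⟩
  simp only [hx, map_zero, mul_zero, sub_zero] at a0 e0
  ext z
  have a0 := pt a0 z
  have a2 := pt a2 z
  have e0 := pt e0 z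
  simp only [hx, map_zero, SmoothFn.coe_add, SmoothFn.coe_mul, SmoothFn.coe_zero, mul_zero,
    SmoothFn.coe_ofNat, SmoothFn.coe_algebraMap] at a0 a2 e0 ⊢
  have : γ * (dx A) z = 0 := by linear_combination e0 / 8 - a2 / 8
  exact (mul_eq_zero.1 this).resolve_left hγ

/-- For `γ = 0` the functions `ξ` and `A` are quadratic and affine in `x`. -/
theorem dx_dx_eq_zero_of_eq (H : Core α β 0 κ μ ξ A B) :
    dx (dx (dx ξ)) = 0 ∧ dx (dx A) = 0 := by
  have pt : ∀ {f g : SmoothFn D}, f = g → ∀ z, f z = g z := fun h z => h ▸ rfl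
  have a1 := congrArg dx H.e3_2
  have b1 := congrArg dx H.e12_1
  have c0 := H.e11_1
  have d0 := H.e2_2
  simp only [Derivation.leibniz, map_add, Derivation.map_algebraMap, derivation_ofNat,
    smul_eq_mul, mul_zero, add_zero, map_zero, zero_mul] at a1 b1 c0 d0
  have key : ∀ z, (dx (dx (dx ξ))) z = 0 ∧ (dx (dx A)) z = 0 := by
    intro z
    have a1 := pt a1 z
    have b1 := pt b1 z
    have c0 := pt c0 z
    have d0 := pt d0 z
    simp only [SmoothFn.coe_add, SmoothFn.coe_sub, SmoothFn.coe_mul, SmoothFn.coe_zero,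
      SmoothFn.coe_ofNat, SmoothFn.coe_algebraMap] at a1 b1 c0 d0
    generalize (dx (dx (dx ξ))) z = y2 at *
    generalize (dx (dx A)) z = b2 at *
    by_cases hα : α = 0
    · subst hα
      have h1 : y2 = 2 / 3 * b2 := by linear_combination -a1 / 6
      have h3 : β * b2 = 0 := by linear_combination 3 / 8 * (b1 + 2 * β * h1)
      have h2 : b2 = 0 := by linear_combination 3 / 10 * (d0 + 4 * h1) - 3 / 5 * h3
      exact ⟨by rw [h1, h2, mul_zero], h2⟩
    · have h1 : y2 = 3 * b2 := by
        have := (mul_eq_zero.1 c0).resolve_left hα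
        linear_combination -this
      by_cases h2 : b2 = 0
      · exact ⟨by rw [h1, h2, mul_zero], h2⟩
      · exfalso
        have hα' : α = 14 := by
          refine mul_right_cancel₀ h2 ?_
          linear_combination a1 + 6 * h1
        have hβ : β = 3 := by
          refine mul_right_cancel₀ h2 ?_
          linear_combination (d0 + 4 * h1) / 2
        subst hα' hβ
        apply h2
        linear_combination (-b1 - 48 * h1) / 90
  exact ⟨by ext z; exact (key z).1, by ext z; exact (key z).2⟩

theorem dx_dx_dt {f : SmoothFn D} (h : dx (dx f) = 0) : dx (dx (dt f)) = 0 := by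
  rw [← dt_dx, ← dt_dx, h, map_zero]

theorem dx_dx_dx_dt {f : SmoothFn D} (h : dx (dx (dx f)) = 0) : dx (dx (dx (dt f))) = 0 := by
  rw [← dt_dx, dx_dx_dt h]

/-- For `γ = 0` and vanishing defect, the leading coefficients of the determining equations as
polynomials in `x` show that `ξ` is affine in `x`. -/
theorem dx_dx_xi_eq_zero (hμ : μ ≠ 0) (H : Core α β 0 κ μ ξ A B)
    (hB : defect μ ξ A B = 0) : dx (dx ξ) = 0 := by
  obtain ⟨hξ, hA⟩ := H.dx_dx_eq_zero_of_eq
  have hξt := dx_dx_dx_dt hξ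
  have hξtt := dx_dx_dx_dt hξt
  have hAt := dx_dx_dt hA
  have hB' : B = -(con μ * (tr ξ (ξ ^ 2) - A * ξ ^ 2)) := by
    rw [defect] at hB
    linear_combination hB
  have hAtt := dx_dx_dt hAt
  have hg := congrArg (fun f => dx (dx (dx (dx f)))) H.e3_1
  have hh := congrArg (fun f => dx (dx (dx (dx (dx f))))) H.e2_1
  simp only [hB', tr, cL, cM₂, qA, rA, Derivation.leibniz, Derivation.leibniz_pow, map_add, map_sub,
    map_neg, Derivation.map_algebraMap, derivation_ofNat, smul_eq_mul, nsmul_eq_mul, dt_dx,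
    mul_zero, zero_mul, add_zero, zero_add, map_zero, sub_zero, neg_zero,
    Nat.cast_ofNat, Nat.reduceSub, pow_one, hξ, hA, hξt, hξtt, hAt, hAtt] at hg hh
  have h1 : dx (dx ξ) ^ 2 * (dx A - 4 * dx (dx ξ)) = 0 := by
    refine natCast_mul_eq_zero (n := 30) (by norm_num) ?_
    push_cast
    linear_combination hh
  have h2 : dx (dx ξ) * (5 * dx (dx ξ) - 2 * dx A)
      * (5 * dx (dx ξ) - 2 * dx A - 2 * con α * dx (dx ξ)) = 0 := by
    refine algebraMap_mul_eq_zero hμ (natCast_mul_eq_zero (n := 6) (by norm_num) ?_)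
    push_cast
    linear_combination hg
  have a0 := H.e3_2
  have pt : ∀ {f g : SmoothFn D}, f = g → ∀ z, f z = g z := fun h z => h ▸ rfl
  ext z
  have h1 := pt h1 z
  have h2 := pt h2 z
  have a0 := pt a0 z
  simp only [SmoothFn.coe_add, SmoothFn.coe_sub, SmoothFn.coe_mul, SmoothFn.coe_zero,
    SmoothFn.coe_ofNat, SmoothFn.coe_algebraMap, SmoothFn.coe_pow] at h1 h2 a0 ⊢
  by_contra hz
  generalize (dx (dx ξ)) z = a at *
  generalize (dx A) z = b at *
  have h3 : b = 4 * a := by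
    have := (mul_eq_zero.1 h1).resolve_left (pow_ne_zero 2 hz)
    linear_combination this
  have h4 : 2 * α = -3 := by
    subst h3
    have h5 : (-3 * a ^ 2) * ((-3 - 2 * α) * a) = 0 := by linear_combination h2
    have h6 := (mul_eq_zero.1 h5).resolve_left (by simpa using hz)
    have := (mul_eq_zero.1 h6).resolve_right hz
    linear_combination -this
  apply hz
  subst h3
  linear_combination a0 / 4 - a / 2 * h4

/-- For `γ = 0` and vanishing defect, `A` does not depend on `x`. -/
theorem dx_A_eq_zero (hμ : μ ≠ 0) (H : Core α β 0 κ μ ξ A B)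
    (hB : defect μ ξ A B = 0) : dx A = 0 := by
  obtain ⟨-, hA⟩ := H.dx_dx_eq_zero_of_eq
  have hξ := H.dx_dx_xi_eq_zero hμ hB
  have hξt := dx_dx_dt hξ
  have hξtt := dx_dx_dt hξt
  have hAt := dx_dx_dt hA
  have hB' : B = -(con μ * (tr ξ (ξ ^ 2) - A * ξ ^ 2)) := by
    rw [defect] at hB
    linear_combination hB
  have hAtt := dx_dx_dt hAt
  have hg := congrArg (fun f => dx (dx (dx f))) H.e3_1
  have hh := congrArg (fun f => dx (dx (dx f))) H.e2_1
  simp only [hB', tr, cL, cM₂, qA, rA, Derivation.leibniz, Derivation.leibniz_pow, map_add, map_sub,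
    map_neg, Derivation.map_algebraMap, derivation_ofNat, smul_eq_mul, nsmul_eq_mul, dt_dx,
    mul_zero, zero_mul, add_zero, zero_add, map_zero, sub_zero, neg_zero,
    Nat.cast_ofNat, Nat.reduceSub, pow_one, hξ, hA, hξt, hξtt, hAt, hAtt] at hg hh
  have h1 : dx ξ * dx A ^ 2 = 0 := by
    refine algebraMap_mul_eq_zero hμ (natCast_mul_eq_zero (n := 12) (by norm_num) ?_)
    push_cast
    linear_combination hg
  have h2 : dx A ^ 4 = 0 := by
    refine algebraMap_mul_eq_zero hμ (natCast_mul_eq_zero (n := 6) (by norm_num) ?_)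
    push_cast
    linear_combination -dx A * hh + 6 * dx ξ * h1
  exact pow_eq_zero_iff four_ne_zero |>.1 h2

end Core

end JetPoly

namespace JetPoly

open MvPolynomial SmoothFn

variable {𝕜 : Type*} [RCLike 𝕜] {D : TopologicalSpace.Opens (𝕜 × 𝕜 × 𝕜)}

namespace Core

variable {α β γ κ μ : 𝕜} {ξ A B : SmoothFn D}

/-! ### Infinitesimals with `ξ_x ≠ 0` -/

/-- If `ξ_x` vanishes nowhere, then the determining equations leave only the infinitesimals
`ξ = b (x + c₁)`, `φ = 4 b u + 2 μ b ξ²` with `4 μ b² = κ`. -/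
theorem of_dx_xi_ne (hμ : μ ≠ 0) (H : Core α β 0 κ μ ξ A B) (hB : defect μ ξ A B = 0)
    (hξ : dx (dx ξ) = 0) (hA : dx A = 0) (hne : ∀ z, (dx ξ) z ≠ 0) :
    2 * con α + 3 = (0 : SmoothFn D) ∧ con β = (2 : SmoothFn D) ∧
      con κ = 4 * con μ * dx ξ ^ 2 ∧ dt ξ = 0 ∧ A = 4 * dx ξ := by
  have hB' : B = -(con μ * (tr ξ (ξ ^ 2) - A * ξ ^ 2)) := by
    rw [defect] at hB
    linear_combination hB
  obtain ⟨b, hb⟩ : ∃ b, dx ξ = b := ⟨_, rfl⟩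
  rw [hb] at hne ⊢ hξ
  have hbt : dx (dt b) = 0 := by rw [← dt_dx, hξ, map_zero]
  have hbtt : dx (dt (dt b)) = 0 := by rw [← dt_dx, hbt, map_zero]
  have hAt : dx (dt A) = 0 := by rw [← dt_dx, hA, map_zero]
  have hAtt : dx (dt (dt A)) = 0 := by rw [← dt_dx, hAt, map_zero]
  have hxt : dx (dt ξ) = dt b := by rw [← dt_dx, hb]
  have hxtt : dx (dt (dt ξ)) = dt (dt b) := by rw [← dt_dx, hxt]
  have hg := H.e3_1
  have hi := H.e1_1
  have hh := H.e2_1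
  simp only [hB', tr, cL, cM₂, cM₁, qA, rA, Derivation.leibniz, Derivation.leibniz_pow, map_add,
    map_sub, map_neg, Derivation.map_algebraMap, derivation_ofNat, smul_eq_mul, nsmul_eq_mul,
    dt_dx, mul_zero, zero_mul, add_zero, zero_add, map_zero, sub_zero, neg_zero, hb,
    Nat.cast_ofNat, Nat.reduceSub, pow_one, hξ, hA, hbt, hbtt, hAt, hAtt, hxt, hxtt] at hg hh hi
  have hG : con α * (2 * (A - 2 * b) * b * ξ - 2 * b * dt ξ - 2 * ξ * dt b) + 6 * b ^ 2 * ξ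
      + 4 * ξ * dt b + 6 * b * dt ξ = 0 := by
    refine algebraMap_mul_eq_zero hμ ?_
    linear_combination hg + con μ * hi
  have hGx := congrArg dx hG
  have hHx := congrArg dx hh
  simp only [Derivation.leibniz, Derivation.leibniz_pow, map_add, map_sub, map_neg,
    Derivation.map_algebraMap, derivation_ofNat, smul_eq_mul, nsmul_eq_mul,
    mul_zero, zero_mul, add_zero, zero_add, map_zero, sub_zero, neg_zero, hb,
    Nat.cast_ofNat, Nat.reduceSub, pow_one, hξ, hA, hbt, hbtt, hAt, hAtt, hxt, hxtt] at hGx hHx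
  have hHx' : 2 * (A - 2 * b) * b * ξ - 2 * b * dt ξ - 2 * ξ * dt b = 4 * b ^ 2 * ξ := by
    linear_combination hHx
  have hHxx := congrArg dx hHx'
  simp only [Derivation.leibniz, Derivation.leibniz_pow, map_add, map_sub, map_neg,
    Derivation.map_algebraMap, derivation_ofNat, smul_eq_mul, nsmul_eq_mul,
    mul_zero, zero_mul, add_zero, zero_add, map_zero, sub_zero, neg_zero, hb,
    Nat.cast_ofNat, Nat.reduceSub, pow_one, hξ, hA, hbt, hbtt, hAt, hAtt, hxt, hxtt] at hHxx
  have h1 : A * b - 4 * b ^ 2 - 2 * dt b = 0 := by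
    refine mul_left_cancel_of_ne hne (natCast_mul_eq_zero (n := 2) two_ne_zero ?_)
    push_cast
    linear_combination hHxx
  have h2 : 5 * dt b + (2 * con α + 3) * b ^ 2 = 0 := by
    refine mul_left_cancel_of_ne hne (natCast_mul_eq_zero (n := 2) two_ne_zero ?_)
    push_cast
    linear_combination hGx - con α * hHxx
  -- with this constant `b = ξ_x` satisfies `b_t = e b²`; the equation free of `u` forces `e = 0`
  obtain ⟨e, he⟩ : ∃ e : SmoothFn D, e = con (-(2 * α + 3) / 5) := ⟨_, rfl⟩
  have he5 : 5 * e = -(2 * con α + 3) := by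
    ext z
    simp [he]
    ring
  have hed : ∀ d : Derivation 𝕜 (SmoothFn D) (SmoothFn D), d e = 0 := fun d => by simp [he]
  have hb1 : dt b = e * b ^ 2 := by
    refine sub_eq_zero.1 (natCast_mul_eq_zero (n := 5) (by norm_num) ?_)
    push_cast
    linear_combination h2 - b ^ 2 * he5
  have hAb : A = (4 + 2 * e) * b := by
    refine sub_eq_zero.1 (mul_left_cancel_of_ne hne ?_)
    linear_combination h1 + 2 * hb1
  have hy : dt ξ = e * b * ξ := by
    refine sub_eq_zero.1 (mul_left_cancel_of_ne hne (natCast_mul_eq_zero (n := 6) (by norm_num) ?_))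
    push_cast
    linear_combination hG - con α * hHx' - 4 * ξ * hb1 - 2 * b ^ 2 * ξ * he5
  have hk := H.e0_1
  simp only [hB', hAb, cN, cM₀, sAB, tr, cL, cM₂, cM₁, qA, rA, Derivation.leibniz,
    Derivation.leibniz_pow, map_add,
    map_sub, map_neg, Derivation.map_algebraMap, derivation_ofNat, smul_eq_mul, nsmul_eq_mul,
    dt_dx, mul_zero, zero_mul, add_zero, zero_add, map_zero, sub_zero, neg_zero, hb,
    Nat.cast_ofNat, Nat.reduceSub, pow_one, hξ, hb1, hy, hed] at hk
  have hk' : b ^ 2 * (-(3 * e ^ 2 * ξ ^ 2) + (con κ + con μ * b ^ 2 * (6 * e ^ 2 - 10 * e - 4)))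
      = 0 := by
    refine mul_left_cancel_of_ne hne
      (algebraMap_mul_eq_zero hμ (natCast_mul_eq_zero (n := 4) (by norm_num) ?_))
    push_cast
    linear_combination hk
  have hk1 : e ^ 2 * ξ = 0 := by
    have h3 := congrArg dx hk'
    simp only [Derivation.leibniz, Derivation.leibniz_pow, map_add, map_sub, map_neg,
      Derivation.map_algebraMap, derivation_ofNat, smul_eq_mul, nsmul_eq_mul,
      mul_zero, zero_mul, add_zero, zero_add, map_zero, sub_zero, neg_zero, hb,
      Nat.cast_ofNat, Nat.reduceSub, pow_one, hξ, hed] at h3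
    refine mul_left_cancel_of_ne hne (mul_left_cancel_of_ne hne (mul_left_cancel_of_ne hne
      (natCast_mul_eq_zero (n := 6) (by norm_num) ?_)))
    push_cast
    linear_combination -h3
  have he0 : e = 0 := by
    have h3 := congrArg dx hk1
    simp only [Derivation.leibniz, Derivation.leibniz_pow, smul_eq_mul, nsmul_eq_mul,
      mul_zero, add_zero, map_zero, hb, hed] at h3
    refine pow_eq_zero_iff two_ne_zero |>.1 (mul_left_cancel_of_ne hne ?_)
    linear_combination h3
  have hκ : con κ = 4 * con μ * b ^ 2 := by
    refine sub_eq_zero.1 (mul_left_cancel_of_ne hne (mul_left_cancel_of_ne hne ?_))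
    rw [he0] at hk'
    linear_combination hk'
  rw [he0] at hb1 hAb hy he5
  rw [zero_mul] at hb1
  rw [zero_mul, zero_mul] at hy
  rw [mul_zero, add_zero] at hAb
  have hβ : con β = (2 : SmoothFn D) := by
    simp only [hb1, hAb, hy, hκ, Derivation.leibniz, Derivation.leibniz_pow, map_add, map_sub,
      map_neg, Derivation.map_algebraMap, derivation_ofNat, smul_eq_mul, nsmul_eq_mul,
      mul_zero, zero_mul, add_zero, zero_add, map_zero, sub_zero, neg_zero, hb,
      Nat.cast_ofNat, Nat.reduceSub, pow_one, hξ] at hh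
    refine sub_eq_zero.1 (mul_left_cancel_of_ne hne (mul_left_cancel_of_ne hne
      (mul_left_cancel_of_ne hne
      (algebraMap_mul_eq_zero hμ (natCast_mul_eq_zero (n := 8) (by norm_num) ?_)))))
    push_cast
    linear_combination hh
  exact ⟨by linear_combination he5, hβ, hκ, by linear_combination hy,
    by linear_combination hAb⟩

theorem restrict {D' : TopologicalSpace.Opens (𝕜 × 𝕜 × 𝕜)} (h : D' ≤ D)
    (H : Core α β γ κ μ ξ A B) :
    Core α β γ κ μ (SmoothFn.restrict h ξ) (SmoothFn.restrict h A) (SmoothFn.restrict h B) := by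
  obtain ⟨h1, h2, h3, h4, h5, h6, h7, h8, h9, h10, h11, h12, h13, h14, h15, h16, h17, h18⟩ := H
  have hr : ∀ {f g : SmoothFn D}, f = g → SmoothFn.restrict h f = SmoothFn.restrict h g :=
    fun h => h ▸ rfl
  constructor
  · simpa only [map_mul, map_add, map_sub, map_neg, map_pow, map_ofNat, map_zero,
      AlgHom.commutes, ← dx_restrict, ← dt_restrict, defect, tr, cL, cM₂, cM₁, cM₀, cN, qA, rA,
      sAB] using hr h1
  · simpa only [map_mul, map_add, map_sub, map_neg, map_pow, map_ofNat, map_zero,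
      AlgHom.commutes, ← dx_restrict, ← dt_restrict, defect, tr, cL, cM₂, cM₁, cM₀, cN, qA, rA,
      sAB] using hr h2
  · simpa only [map_mul, map_add, map_sub, map_neg, map_pow, map_ofNat, map_zero,
      AlgHom.commutes, ← dx_restrict, ← dt_restrict, defect, tr, cL, cM₂, cM₁, cM₀, cN, qA, rA,
      sAB] using hr h3
  · simpa only [map_mul, map_add, map_sub, map_neg, map_pow, map_ofNat, map_zero,
      AlgHom.commutes, ← dx_restrict, ← dt_restrict, defect, tr, cL, cM₂, cM₁, cM₀, cN, qA, rA,
      sAB] using hr h4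
  · simpa only [map_mul, map_add, map_sub, map_neg, map_pow, map_ofNat, map_zero,
      AlgHom.commutes, ← dx_restrict, ← dt_restrict, defect, tr, cL, cM₂, cM₁, cM₀, cN, qA, rA,
      sAB] using hr h5
  · simpa only [map_mul, map_add, map_sub, map_neg, map_pow, map_ofNat, map_zero,
      AlgHom.commutes, ← dx_restrict, ← dt_restrict, defect, tr, cL, cM₂, cM₁, cM₀, cN, qA, rA,
      sAB] using hr h6
  · simpa only [map_mul, map_add, map_sub, map_neg, map_pow, map_ofNat, map_zero,
      AlgHom.commutes, ← dx_restrict, ← dt_restrict, defect, tr, cL, cM₂, cM₁, cM₀, cN, qA, rA,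
      sAB] using hr h7
  · simpa only [map_mul, map_add, map_sub, map_neg, map_pow, map_ofNat, map_zero,
      AlgHom.commutes, ← dx_restrict, ← dt_restrict, defect, tr, cL, cM₂, cM₁, cM₀, cN, qA, rA,
      sAB] using hr h8
  · simpa only [map_mul, map_add, map_sub, map_neg, map_pow, map_ofNat, map_zero,
      AlgHom.commutes, ← dx_restrict, ← dt_restrict, defect, tr, cL, cM₂, cM₁, cM₀, cN, qA, rA,
      sAB] using hr h9
  · simpa only [map_mul, map_add, map_sub, map_neg, map_pow, map_ofNat, map_zero,
      AlgHom.commutes, ← dx_restrict, ← dt_restrict, defect, tr, cL, cM₂, cM₁, cM₀, cN, qA, rA,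
      sAB] using hr h10
  · simpa only [map_mul, map_add, map_sub, map_neg, map_pow, map_ofNat, map_zero,
      AlgHom.commutes, ← dx_restrict, ← dt_restrict, defect, tr, cL, cM₂, cM₁, cM₀, cN, qA, rA,
      sAB] using hr h11
  · simpa only [map_mul, map_add, map_sub, map_neg, map_pow, map_ofNat, map_zero,
      AlgHom.commutes, ← dx_restrict, ← dt_restrict, defect, tr, cL, cM₂, cM₁, cM₀, cN, qA, rA,
      sAB] using hr h12
  · simpa only [map_mul, map_add, map_sub, map_neg, map_pow, map_ofNat, map_zero,
      AlgHom.commutes, ← dx_restrict, ← dt_restrict, defect, tr, cL, cM₂, cM₁, cM₀, cN, qA, rA,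
      sAB] using hr h13
  · simpa only [map_mul, map_add, map_sub, map_neg, map_pow, map_ofNat, map_zero,
      AlgHom.commutes, ← dx_restrict, ← dt_restrict, defect, tr, cL, cM₂, cM₁, cM₀, cN, qA, rA,
      sAB] using hr h14
  · simpa only [map_mul, map_add, map_sub, map_neg, map_pow, map_ofNat, map_zero,
      AlgHom.commutes, ← dx_restrict, ← dt_restrict, defect, tr, cL, cM₂, cM₁, cM₀, cN, qA, rA,
      sAB] using hr h15
  · simpa only [map_mul, map_add, map_sub, map_neg, map_pow, map_ofNat, map_zero,
      AlgHom.commutes, ← dx_restrict, ← dt_restrict, defect, tr, cL, cM₂, cM₁, cM₀, cN, qA, rA,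
      sAB] using hr h16
  · simpa only [map_mul, map_add, map_sub, map_neg, map_pow, map_ofNat, map_zero,
      AlgHom.commutes, ← dx_restrict, ← dt_restrict, defect, tr, cL, cM₂, cM₁, cM₀, cN, qA, rA,
      sAB] using hr h17
  · simpa only [map_mul, map_add, map_sub, map_neg, map_pow, map_ofNat, map_zero,
      AlgHom.commutes, ← dx_restrict, ← dt_restrict, defect, tr, cL, cM₂, cM₁, cM₀, cN, qA, rA,
      sAB] using hr h18

end Core

end JetPoly

namespace JetPoly

open MvPolynomial SmoothFn

variable {𝕜 : Type*} [RCLike 𝕜] {D : TopologicalSpace.Opens (𝕜 × 𝕜 × 𝕜)}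

/-! ### Infinitesimals independent of `x` -/

/-- The solutions of the determining equations, as differential equations for `ξ`, `A` and `B`,
where `φ = A u + B`. Apart from the classical infinitesimals, the constructors correspond to
`FamilyI`, …, `FamilyVII`; the infinitesimals of `FamilyVI` are those of `FamilyIV` with `ξ = 0`. -/
inductive NormalForm (α β γ κ μ : 𝕜) (ξ A B : SmoothFn D) : Prop
  | classical (h₁ : dx ξ = 0) (h₂ : dx A = 0) (h₃ : B = 0) (h₄ : 2 * dt A = A ^ 2)
    (h₅ : 2 * dt ξ = A * ξ) (h₆ : con κ * A = 0)
  | one (h₁ : κ = 0) (h₂ : ξ = 0) (h₃ : dx A = 0) (h₄ : B = 0)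
    (h₅ : dt (dt A) = A ^ 3 - A * dt A)
  | two (h₁ : 1 + 2 * γ * μ = 0) (h₂ : dx ξ = 0) (h₃ : A = 0) (h₄ : dt (dt ξ) = 0)
    (h₅ : B = -(2 * con μ * ξ * dt ξ))
  | three (h₁ : κ = 0) (h₂ : 1 + 2 * γ * μ = 0) (h₃ : dx ξ = 0) (h₄ : dx A = 0)
    (h₅ : dt A = -A ^ 2) (h₆ : ∀ z, A z ≠ 0) (h₇ : dt ξ = 2 * A * ξ)
    (h₈ : B = -(3 * con μ * A * ξ ^ 2))
  | four (hα : α = 0) (hβ : β = 0) (hγ : γ = 0) (h₁ : dx ξ = 0) (h₂ : dt ξ = 0)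
    (h₃ : ξ ^ 2 = con κ) (h₄ : A = 0) (h₅ : dt B = ξ * dx B) (h₆ : dx (dx (dx (dx B))) = 0)
  | five (hα : α = -3 / 2) (hβ : β = 2) (hγ : γ = 0) (h₁ : dx (dx ξ) = 0) (h₂ : dt ξ = 0)
    (h₃ : A = 4 * dx ξ) (h₄ : B = 2 * con μ * dx ξ * ξ ^ 2)
    (h₅ : con κ = 4 * con μ * dx ξ ^ 2)
  | seven (hα : α = 0) (hβ : β = 0) (hγ : γ = 0) (h₁ : κ = 0) (h₂ : ξ = 0) (h₃ : dx A = 0)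
    (h₄ : dt A = -A ^ 2) (h₅ : ∀ z, A z ≠ 0) (h₆ : dt B = -(A * B))
    (h₇ : dx (dx (dx (dx B))) = 0)

/-- A solution of a linear ordinary differential equation in `t` that vanishes at one point. -/
theorem eq_zero_or_ne (hD : Convex ℝ (D : Set (𝕜 × 𝕜 × 𝕜))) {f a : SmoothFn D} (hx : dx f = 0)
    (ht : dt f = a * f) (hu : du f = 0) : f = 0 ∨ ∀ z, f z ≠ 0 := by
  by_cases h : ∃ z, f z = 0
  · obtain ⟨z, hz⟩ := h
    exact Or.inl (eq_zero_of_logDeriv hD f 0 a 0 (by simp [hx]) ht (by simp [hu]) z hz)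
  · exact Or.inr fun z hz => h ⟨z, hz⟩

/-- The determining equations if `ξ` and `A` depend on `t` only. -/
structure Ode (γ κ μ : 𝕜) (ξ A B : SmoothFn D) : Prop where
  dx_xi : dx ξ = 0
  dx_A : dx A = 0
  dtt_xi : dt (dt ξ) = -A * dt ξ - 2 * ξ * (dt A - A ^ 2)
  dtt_A : dt (dt A) = A ^ 3 - A * dt A
  mul_B : con (1 + 2 * γ * μ) * B = con μ * con κ * A
  B_eq : B = con μ * (A * ξ ^ 2 - 2 * ξ * dt ξ)
  dtt_B : dt (dt B) - A * dt B + (2 * dt A - A ^ 2) * B = 0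

variable {α β γ κ μ : 𝕜} {ξ A B : SmoothFn D}

/-- If `ξ` and `A` do not depend on `x` and the defect vanishes, then neither does `B`, and the
determining equations are ordinary differential equations in `t`. -/
theorem Core.ode (hμ : μ ≠ 0) (H : Core α β γ κ μ ξ A B) (hB : defect μ ξ A B = 0)
    (hξ : dx ξ = 0) (hA : dx A = 0) : Ode γ κ μ ξ A B := by
  have hB' : B = con μ * (A * ξ ^ 2 - 2 * ξ * dt ξ) := by
    have h := hB
    simp only [defect, tr, Derivation.leibniz_pow, hξ] at h
    simp at h
    linear_combination h
  have hxt : dx (dt ξ) = 0 := by rw [← dt_dx, hξ, map_zero]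
  have hxtt : dx (dt (dt ξ)) = 0 := by rw [← dt_dx, hxt, map_zero]
  have hAt : dx (dt A) = 0 := by rw [← dt_dx, hA, map_zero]
  have hBx : dx B = 0 := by
    rw [hB']
    simp [Derivation.leibniz, hξ, hA, hxt]
  have hBt : dx (dt B) = 0 := by rw [← dt_dx, hBx, map_zero]
  have hg := H.e3_1
  have hh := H.e2_1
  have hj := H.e0_2
  have hk := H.e0_1
  simp only [tr, cL, cM₂, cM₁, cM₀, cN, qA, rA, sAB, Derivation.leibniz, Derivation.leibniz_pow,
    map_add, map_sub, map_neg, Derivation.map_algebraMap, derivation_ofNat, smul_eq_mul,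
    nsmul_eq_mul, dt_dx, mul_zero, zero_mul, add_zero, zero_add, map_zero, sub_zero, zero_sub,
    neg_zero, neg_neg, Nat.cast_ofNat, Nat.reduceSub, pow_one, hξ, hA, hxt, hxtt, hAt, hBx, hBt]
    at hg hh hj hk
  have hξtt : dt (dt ξ) = -A * dt ξ - 2 * ξ * (dt A - A ^ 2) := by
    refine sub_eq_zero.1 (algebraMap_mul_eq_zero hμ ?_)
    linear_combination -hg
  have hAtt : dt (dt A) = A ^ 3 - A * dt A := by linear_combination -hj
  have hB1 : con (1 + 2 * γ * μ) * B = con μ * con κ * A := by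
    have : (con (1 + 2 * γ * μ) : SmoothFn D) = 1 + 2 * con γ * con μ := by
      ext z
      simp
    rw [this, hB']
    linear_combination con μ * hh - con μ ^ 2 * hAtt
  exact ⟨hξ, hA, hξtt, hAtt, hB1, hB', by
    linear_combination -hk + con μ * ξ ^ 2 * hAtt + (dt A + A ^ 2) * hB'⟩

namespace Ode

theorem restrict {D' : TopologicalSpace.Opens (𝕜 × 𝕜 × 𝕜)} (h : D' ≤ D)
    (H : Ode γ κ μ ξ A B) :
    Ode γ κ μ (SmoothFn.restrict h ξ) (SmoothFn.restrict h A) (SmoothFn.restrict h B) := by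
  obtain ⟨h1, h2, h3, h4, h5, h6, h7⟩ := H
  have hr : ∀ {f g : SmoothFn D}, f = g → SmoothFn.restrict h f = SmoothFn.restrict h g :=
    fun h => h ▸ rfl
  constructor
  · simpa only [map_zero, ← dx_restrict] using hr h1
  · simpa only [map_zero, ← dx_restrict] using hr h2
  · simpa only [map_mul, map_neg, map_sub, map_pow, map_ofNat, ← dt_restrict] using hr h3
  · simpa only [map_mul, map_neg, map_sub, map_pow, map_ofNat, ← dt_restrict] using hr h4
  · simpa only [map_mul, AlgHom.commutes] using hr h5
  · simpa only [map_mul, map_sub, map_pow, map_ofNat, AlgHom.commutes, ← dt_restrict] using hr h6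
  · simpa only [map_mul, map_add, map_sub, map_pow, map_ofNat, map_zero, ← dt_restrict]
      using hr h7

/-- The case `κ ≠ 0`, `1 + 2 γ μ ≠ 0`: eliminating `ξ_t` and `A_t` leaves a polynomial equation
with constant coefficients for `ξ²` wherever `A` does not vanish. -/
theorem A_eq_zero (H : Ode γ κ μ ξ A B) (hμ : μ ≠ 0) (hκ : κ ≠ 0) (hn : 1 + 2 * γ * μ ≠ 0) :
    A = 0 := by
  have hk0 : κ / (1 + 2 * γ * μ) ≠ 0 := div_ne_zero hκ hn
  obtain ⟨k, hk⟩ : ∃ k : SmoothFn D, k = con (κ / (1 + 2 * γ * μ)) := ⟨_, rfl⟩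
  have hkd : ∀ d : Derivation 𝕜 (SmoothFn D) (SmoothFn D), d k = 0 := fun d => by simp [hk]
  have hk1 : con (1 + 2 * γ * μ) * k = con κ := by
    rw [hk, ← map_mul, mul_div_cancel₀ _ hn]
  have hkne : ∀ z, k z ≠ 0 := fun z => by simpa [hk] using ⟨hκ, hn⟩
  have h1 : 2 * ξ * dt ξ = A * (ξ ^ 2 - k) := by
    refine sub_eq_zero.1 (algebraMap_mul_eq_zero hμ (algebraMap_mul_eq_zero hn ?_))
    linear_combination con (1 + 2 * γ * μ) * H.B_eq - H.mul_B + con μ * A * hk1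
  have h2 := congrArg dt h1
  simp only [Derivation.leibniz, Derivation.leibniz_pow, map_sub, hkd, H.dtt_xi, derivation_ofNat,
    smul_eq_mul, nsmul_eq_mul, mul_zero, add_zero, sub_zero, Nat.cast_ofNat, Nat.reduceSub,
    pow_one] at h2
  -- `z` stands for `ξ²`
  obtain ⟨z, hz⟩ : ∃ z, z = ξ ^ 2 := ⟨_, rfl⟩
  have hzt : dt z = A * (z - k) := by
    rw [hz, ← h1, Derivation.leibniz_pow]
    simp
    ring
  have h3 : dt A * (10 * z ^ 2 - 2 * k * z) = A ^ 2 * (5 * z ^ 2 + 2 * k * z + k ^ 2) := by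
    rw [hz]
    linear_combination -2 * ξ ^ 2 * h2
      + (2 * ξ * dt ξ + A * (ξ ^ 2 - k) - 4 * ξ ^ 2 * A) * h1
  have h4 := congrArg dt h3
  simp only [Derivation.leibniz, Derivation.leibniz_pow, map_add, map_sub, hkd, H.dtt_A, hzt,
    derivation_ofNat, smul_eq_mul, nsmul_eq_mul, mul_zero, zero_mul, add_zero, sub_zero,
    Nat.cast_ofNat, Nat.reduceSub, pow_one] at h4
  have h5 : A ^ 3 * (k * z * (15 * z ^ 2 + 10 * k * z + 7 * k ^ 2)) = 0 := by
    refine natCast_mul_eq_zero (n := 4) (by norm_num) ?_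
    push_cast
    linear_combination -(10 * z ^ 2 - 2 * k * z) * h4 + h3 * (-A * (10 * z ^ 2 - 2 * k * z)
      + A * (20 * z - 2 * k) * (z - k) - 2 * A * (5 * z ^ 2 + 2 * k * z + k ^ 2))
  have h6 : A * (15 * z ^ 2 + 10 * k * z + 7 * k ^ 2) = 0 := by
    ext y
    have h3 := congrArg (fun f : SmoothFn D => f y) h3
    have h5 := congrArg (fun f : SmoothFn D => f y) h5
    have hky := hkne y
    simp only [SmoothFn.coe_add, SmoothFn.coe_sub, SmoothFn.coe_mul, SmoothFn.coe_zero,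
      SmoothFn.coe_ofNat, SmoothFn.coe_pow, mul_eq_zero, pow_eq_zero_iff three_ne_zero] at h3 h5 ⊢
    rcases h5 with h | h | h
    · exact Or.inl h
    · rcases h with h | h
      · exact absurd h hky
      · left
        rw [h] at h3
        have h8 : (A y * k y) ^ 2 = 0 := by linear_combination -h3
        have h9 := pow_eq_zero_iff two_ne_zero |>.1 h8
        exact (mul_eq_zero.1 h9).resolve_right hky
    · exact Or.inr h
  have h7 := mul_der_eq_zero h6 (0, 1, 0)
  change A * dt _ = 0 at h7
  simp only [Derivation.leibniz, Derivation.leibniz_pow, map_add, hkd, hzt,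
    derivation_ofNat, smul_eq_mul, nsmul_eq_mul, mul_zero, zero_mul, add_zero, sub_zero,
    Nat.cast_ofNat, Nat.reduceSub, pow_one] at h7
  ext y
  have h6 := congrArg (fun f : SmoothFn D => f y) h6
  have h7 := congrArg (fun f : SmoothFn D => f y) h7
  have hky := hkne y
  simp only [SmoothFn.coe_add, SmoothFn.coe_sub, SmoothFn.coe_mul, SmoothFn.coe_zero,
    SmoothFn.coe_ofNat, SmoothFn.coe_pow] at h6 h7 ⊢
  by_contra hA
  have h8 := (mul_eq_zero.1 h6).resolve_left hA
  have h9 : A y * (10 * ((z y - k y) * (3 * z y + k y))) = 0 := by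
    linear_combination (mul_eq_zero.1 h7).resolve_left hA
  have h10 := (mul_eq_zero.1 ((mul_eq_zero.1 h9).resolve_left hA)).resolve_left (by norm_num)
  apply hky
  refine pow_eq_zero_iff two_ne_zero |>.1 ?_
  rcases mul_eq_zero.1 h10 with h | h
  · linear_combination h8 / 32 - (15 * z y + 25 * k y) / 32 * h
  · linear_combination 3 / 16 * h8 - (15 * z y + 5 * k y) / 16 * h

end Ode

end JetPoly

namespace JetPoly

open MvPolynomial SmoothFn

variable {𝕜 : Type*} [RCLike 𝕜] {D : TopologicalSpace.Opens (𝕜 × 𝕜 × 𝕜)}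

/-! ### Integration of the equations for `ξ` and `A` as functions of `t` -/

theorem con_zero : (con 0 : SmoothFn D) = 0 := map_zero _

namespace Ode

variable {γ κ μ : 𝕜} {ξ A B : SmoothFn D}

/-- For `κ = 0` and `1 + 2 γ μ = 0` the equation for `B` is an equation for `ξ` and `A`. -/
theorem quadratic (H : Ode γ κ μ ξ A B) (hμ : μ ≠ 0) :
    A * (10 * dt ξ ^ 2) + (18 * dt A - 22 * A ^ 2) * ξ * dt ξ
      + (16 * A ^ 3 - 24 * A * dt A) * ξ ^ 2 = 0 := by
  have h := H.dtt_B
  simp only [H.B_eq, H.dtt_xi, H.dtt_A, Derivation.leibniz, Derivation.leibniz_pow, map_add,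
    map_sub, map_neg, Derivation.map_algebraMap, derivation_ofNat, smul_eq_mul, nsmul_eq_mul,
    mul_zero, zero_mul, add_zero, zero_add, map_zero, sub_zero, neg_zero, Nat.cast_ofNat,
    Nat.reduceSub, pow_one] at h
  refine algebraMap_mul_eq_zero hμ ?_
  linear_combination h

/-- In the ratios `r = A_t / A²` and `m = ξ_t / (A ξ)` the equation `quadratic` is a curve, which
is not invariant under the flow of `r` and `m`. -/
theorem false_of_ne (H : Ode γ κ μ ξ A B) (hμ : μ ≠ 0) (z : D) (hA : ∀ y, A y ≠ 0)
    (hξ : ∀ y, ξ y ≠ 0) (hR : ∀ y, (dt A) y + A y ^ 2 ≠ 0) (hV : ∀ y, 2 * (dt A) y - A y ^ 2 ≠ 0) :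
    False := by
  obtain ⟨a, ha⟩ := exists_inv hA
  obtain ⟨x, hx⟩ := exists_inv hξ
  have hat := der_inv hA ha dt
  have hxt := der_inv hξ hx dt
  have ha1 : A * a = 1 := by
    ext y
    simp [ha, hA y]
  have hx1 : ξ * x = 1 := by
    ext y
    simp [hx, hξ y]
  obtain ⟨r, hr⟩ : ∃ r, r = dt A * a ^ 2 := ⟨_, rfl⟩
  obtain ⟨m, hm⟩ : ∃ m, m = dt ξ * a * x := ⟨_, rfl⟩
  have hr' : dt A = r * A ^ 2 := by
    rw [hr]
    linear_combination -dt A * (A * a + 1) * ha1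
  have hm' : dt ξ = m * A * ξ := by
    rw [hm]
    linear_combination -dt ξ * x * ξ * ha1 - dt ξ * hx1
  have hf : 10 * m ^ 2 + (18 * r - 22) * m + 16 - 24 * r = 0 := by
    have h := H.quadratic hμ
    rw [hr', hm'] at h
    refine mul_left_cancel_of_ne hA (mul_left_cancel_of_ne hA (mul_left_cancel_of_ne hA
      (mul_left_cancel_of_ne hξ (mul_left_cancel_of_ne hξ ?_))))
    linear_combination h
  have hrt : dt r = A * ((1 - 2 * r) * (1 + r)) := by
    have h := congrArg dt hr'
    rw [H.dtt_A] at h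
    simp only [Derivation.leibniz, Derivation.leibniz_pow, hr', smul_eq_mul, nsmul_eq_mul,
      Nat.cast_ofNat, Nat.reduceSub, pow_one] at h
    refine sub_eq_zero.1 (mul_left_cancel_of_ne hA (mul_left_cancel_of_ne hA ?_))
    linear_combination -h
  have hmt : dt m = A * (-m - 2 * r + 2 - r * m - m ^ 2) := by
    have h := congrArg dt hm'
    rw [H.dtt_xi] at h
    simp only [Derivation.leibniz, Derivation.leibniz_pow, hr', hm', smul_eq_mul, nsmul_eq_mul,
      Nat.cast_ofNat, Nat.reduceSub, pow_one] at h
    refine sub_eq_zero.1 (mul_left_cancel_of_ne hA (mul_left_cancel_of_ne hξ ?_))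
    linear_combination -h
  have hg : (20 * m + 18 * r - 22) * (-m - 2 * r + 2 - r * m - m ^ 2)
      + (18 * m - 24) * ((1 - 2 * r) * (1 + r)) = 0 := by
    have h := congrArg dt hf
    simp only [Derivation.leibniz, Derivation.leibniz_pow, map_add, map_sub, hrt, hmt,
      derivation_ofNat, smul_eq_mul, nsmul_eq_mul, mul_zero, add_zero, map_zero, sub_zero,
      Nat.cast_ofNat, Nat.reduceSub, pow_one] at h
    refine mul_left_cancel_of_ne hA ?_
    linear_combination h
  -- the resultant of the two polynomials with respect to `r`
  have hres : (m - 2) ^ 2 * (2 * m - 1) * (21 * m ^ 2 - 24 * m + 8) = 0 := by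
    refine natCast_mul_eq_zero (n := 120) (by norm_num) ?_
    push_cast
    linear_combination -(18 * m - 24) ^ 2 * hg
      + hf * (18 * ((-m + 2 - m ^ 2) * (18 * m - 24) - r * (18 * m - 24) * (2 + m))
        - ((20 * m - 22) * (18 * m - 24) + 18 * (-10 * m ^ 2 + 22 * m - 16)) * (2 + m)
        - (18 * m - 24) * (18 * m - 24 + 2 * r * (18 * m - 24)
          + 2 * (-10 * m ^ 2 + 22 * m - 16)))
  have hRV : ∀ y, r y ≠ -1 ∧ 2 * r y ≠ 1 := by
    intro y
    have h1 := hR y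
    have h2 := hV y
    rw [hr'] at h1 h2
    simp only [SmoothFn.coe_add, SmoothFn.coe_sub, SmoothFn.coe_mul, SmoothFn.coe_ofNat,
      SmoothFn.coe_pow] at h1 h2
    refine ⟨fun h => h1 ?_, fun h => h2 ?_⟩
    · linear_combination A y ^ 2 * h
    · linear_combination A y ^ 2 * h
  have hG : 21 * m ^ 2 - 24 * m + 8 = 0 := by
    ext y
    have h1 := congrArg (fun f : SmoothFn D => f y) hf
    have h2 := congrArg (fun f : SmoothFn D => f y) hres
    simp only [SmoothFn.coe_add, SmoothFn.coe_sub, SmoothFn.coe_mul, SmoothFn.coe_zero,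
      SmoothFn.coe_ofNat, SmoothFn.coe_pow, SmoothFn.coe_one, mul_eq_zero,
      pow_eq_zero_iff two_ne_zero] at h1 h2 ⊢
    rcases h2 with (h | h) | h
    · exfalso
      apply (hRV y).1
      linear_combination h1 / 12 - (10 * m y + 18 * r y - 2) / 12 * h
    · exfalso
      apply (hRV y).2
      linear_combination -2 / 15 * h1 + (5 * m y + 9 * r y - 17 / 2) * 2 / 15 * h
    · exact h
  have hmt0 : dt m = 0 := by
    have h := congrArg dt hG
    simp only [Derivation.leibniz, Derivation.leibniz_pow, map_add, map_sub,
      derivation_ofNat, smul_eq_mul, nsmul_eq_mul, mul_zero, add_zero, map_zero, sub_zero,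
      Nat.cast_ofNat, Nat.reduceSub, pow_one] at h
    refine natCast_mul_eq_zero (n := 48) (by norm_num) ?_
    push_cast
    -- the discriminant of the quadratic polynomial is not zero
    linear_combination 42 * dt m * hG - (21 * m - 12) * h
  have hr0 : (3 * m - 4) * dt r = 0 := by
    have h := congrArg dt hf
    simp only [Derivation.leibniz, Derivation.leibniz_pow, map_add, map_sub, hmt0,
      derivation_ofNat, smul_eq_mul, nsmul_eq_mul, mul_zero, add_zero, map_zero, sub_zero,
      Nat.cast_ofNat, Nat.reduceSub, pow_one] at h
    refine natCast_mul_eq_zero (n := 6) (by norm_num) ?_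
    push_cast
    linear_combination h
  rw [hrt] at hr0
  have h1 := congrArg (fun f : SmoothFn D => f z) hr0
  have h2 := congrArg (fun f : SmoothFn D => f z) hG
  simp only [SmoothFn.coe_add, SmoothFn.coe_sub, SmoothFn.coe_mul, SmoothFn.coe_zero,
    SmoothFn.coe_ofNat, SmoothFn.coe_pow, SmoothFn.coe_one, mul_eq_zero, hA z, false_or]
    at h1 h2
  rcases h1 with h | h | h
  · have h3 : (40 / 3 : 𝕜) = 0 := by linear_combination h2 - (7 * m z + 4 / 3) * h
    norm_num at h3
  · exact (hRV z).2 (by linear_combination -h)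
  · exact (hRV z).1 (by linear_combination h)

/-- The case distinction is on whether `1 + 2 γ μ` and `κ` vanish and, if both do, on whether
`A_t + A²` and `2 A_t - A²` vanish. These functions satisfy linear differential equations, so each
of them vanishes identically or nowhere. -/
theorem normalForm (hD : Convex ℝ (D : Set (𝕜 × 𝕜 × 𝕜))) (hμ : μ ≠ 0) (hξu : du ξ = 0)
    (hAu : du A = 0) (H : Ode γ κ μ ξ A B) (α β : 𝕜) : NormalForm α β γ κ μ ξ A B := by
  have hξt0 : ξ * dt ξ = 0 → dt ξ = 0 := by
    intro h
    have h1 := mul_der_eq_zero h (0, 1, 0)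
    change ξ * dt (dt ξ) = 0 at h1
    have h2 := congrArg dt h
    simp only [Derivation.leibniz, smul_eq_mul, map_zero, h1] at h2
    refine pow_eq_zero_iff two_ne_zero |>.1 ?_
    linear_combination h2
  by_cases hn : 1 + 2 * γ * μ = 0
  · have hκA : con κ * A = 0 := by
      have h := H.mul_B
      rw [hn, con_zero, zero_mul] at h
      refine algebraMap_mul_eq_zero hμ ?_
      linear_combination -h
    have two : A = 0 → NormalForm α β γ κ μ ξ A B := by
      intro hA0
      refine .two hn H.dx_xi hA0 ?_ ?_
      · rw [H.dtt_xi, hA0]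
        simp
      · rw [H.B_eq, hA0]
        ring
    by_cases hκ : κ = 0
    swap
    · exact two (algebraMap_mul_eq_zero hκ hκA)
    have hAtx : dx (dt A) = 0 := by rw [← dt_dx, H.dx_A, map_zero]
    have hAtu : du (dt A) = 0 := by rw [du_dt, hAu, map_zero]
    obtain hR | hR := eq_zero_or_ne hD (f := dt A + A ^ 2) (a := A)
      (by simp [Derivation.leibniz_pow, hAtx, H.dx_A])
      (by
        simp only [map_add, Derivation.leibniz_pow, H.dtt_A]
        simp
        ring)
      (by simp [Derivation.leibniz_pow, hAtu, hAu])
    · have hAt : dt A = -A ^ 2 := by linear_combination hR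
      obtain hA | hA := eq_zero_or_ne hD (f := A) (a := -A) H.dx_A
        (by linear_combination hAt) hAu
      · exact two hA
      have hξt : dt ξ = 2 * A * ξ := by
        have h := H.quadratic hμ
        rw [hAt] at h
        refine sub_eq_zero.1 (pow_eq_zero_iff two_ne_zero |>.1 (mul_left_cancel_of_ne hA
          (natCast_mul_eq_zero (n := 10) (by norm_num) ?_)))
        push_cast
        linear_combination h
      refine .three hκ hn H.dx_xi H.dx_A hAt hA hξt ?_
      rw [H.B_eq, hξt]
      ring
    · have hVt : dt (2 * dt A - A ^ 2) = -2 * A * (2 * dt A - A ^ 2) := by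
        simp only [map_sub, Derivation.leibniz, Derivation.leibniz_pow, H.dtt_A]
        simp
        ring
      obtain hV | hV := eq_zero_or_ne hD (f := 2 * dt A - A ^ 2) (a := -2 * A)
        (by simp [Derivation.leibniz, Derivation.leibniz_pow, hAtx, H.dx_A]) hVt
        (by simp [Derivation.leibniz, Derivation.leibniz_pow, hAtu, hAu])
      · have hAt : 2 * dt A = A ^ 2 := by linear_combination hV
        have hA : ∀ y, A y ≠ 0 := by
          intro y hy
          have h := congrArg (fun f : SmoothFn D => f y) hAt
          simp only [SmoothFn.coe_mul, SmoothFn.coe_pow, SmoothFn.coe_ofNat, hy] at h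
          apply hR y
          simp only [SmoothFn.coe_add, SmoothFn.coe_pow, hy]
          linear_combination h / 2
        have h1 : (2 * dt ξ - A * ξ) * (5 * dt ξ - 4 * A * ξ) = 0 := by
          refine mul_left_cancel_of_ne hA ?_
          linear_combination H.quadratic hμ - (9 * ξ * dt ξ - 12 * A * ξ ^ 2) * hAt
        have h2 := mul_der_eq_zero h1 (0, 1, 0)
        change (2 * dt ξ - A * ξ) * dt _ = 0 at h2
        simp only [map_sub, Derivation.leibniz, H.dtt_xi, derivation_ofNat, smul_eq_mul, mul_zero,
          add_zero] at h2
        have h3 : (2 * dt ξ - A * ξ) * (-(3 * dt ξ) + A * ξ) = 0 := by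
          refine mul_left_cancel_of_ne hA (natCast_mul_eq_zero (n := 3) (by norm_num) ?_)
          push_cast
          linear_combination h2 + (2 * dt ξ - A * ξ) * 7 * ξ * hAt
        -- on the second factor of `h1` the flow of the equation leaves only `ξ = 0`
        have h4 : 2 * dt ξ - A * ξ = 0 := by
          refine pow_eq_zero_iff two_ne_zero |>.1 (natCast_mul_eq_zero (n := 7) (by norm_num) ?_)
          push_cast
          linear_combination h1 - 3 * h3
        exact .classical H.dx_xi H.dx_A (by rw [H.B_eq]; linear_combination -con μ * ξ * h4) hAt
          (by linear_combination h4) (by rw [hκ, con_zero, zero_mul])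
      · have hAξ : A * ξ = 0 := by
          ext z
          by_contra hz
          rw [SmoothFn.coe_zero] at hz
          have hle := support_le (A * ξ)
          have hmul : ∀ y : (A * ξ).support, A ⟨y, hle y.2⟩ ≠ 0 ∧ ξ ⟨y, hle y.2⟩ ≠ 0 := by
            intro y
            have hy : (A * ξ) ⟨y, hle y.2⟩ ≠ 0 := y.2.2
            rwa [SmoothFn.coe_mul, mul_ne_zero_iff] at hy
          refine (H.restrict hle).false_of_ne hμ ⟨z, ⟨z.2, hz⟩⟩ (fun y => ?_) (fun y => ?_)
            (fun y => ?_) (fun y => ?_)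
          · rw [restrict_apply]
            exact (hmul y).1
          · rw [restrict_apply]
            exact (hmul y).2
          · rw [dt_restrict, restrict_apply, restrict_apply]
            simpa using hR ⟨y, hle y.2⟩
          · rw [dt_restrict, restrict_apply, restrict_apply]
            simpa using hV ⟨y, hle y.2⟩
        have h1 := mul_der_eq_zero (f := ξ) (g := A) (by linear_combination hAξ) (0, 1, 0)
        change ξ * dt A = 0 at h1
        have hξ0 : ξ = 0 := by
          refine mul_left_cancel_of_ne hR ?_
          linear_combination h1 + A * hAξ
        refine .one hκ hξ0 H.dx_A ?_ H.dtt_A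
        rw [H.B_eq, hξ0]
        simp
  · by_cases hκ : κ = 0
    · have hB0 : B = 0 := by
        have h := H.mul_B
        rw [hκ, con_zero, mul_zero, zero_mul] at h
        exact algebraMap_mul_eq_zero hn h
      have h1 : A * ξ ^ 2 - 2 * ξ * dt ξ = 0 :=
        algebraMap_mul_eq_zero hμ (H.B_eq.symm.trans hB0)
      obtain hz | hz := eq_zero_or_ne hD (f := ξ ^ 2) (a := A)
        (by simp [Derivation.leibniz_pow, H.dx_xi])
        (by
          rw [Derivation.leibniz_pow]
          simp
          linear_combination -h1)
        (by simp [Derivation.leibniz_pow, hξu])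
      · have hξ0 : ξ = 0 := pow_eq_zero_iff two_ne_zero |>.1 hz
        exact .one hκ hξ0 H.dx_A hB0 H.dtt_A
      · have hne : ∀ y, ξ y ≠ 0 := fun y hy => hz y (by rw [SmoothFn.coe_pow, hy]; simp)
        have h2 : 2 * dt ξ = A * ξ := by
          refine sub_eq_zero.1 (mul_left_cancel_of_ne hne ?_)
          linear_combination -h1
        refine .classical H.dx_xi H.dx_A hB0 ?_ h2 (by rw [hκ]; simp)
        have h3 := congrArg dt h2
        simp only [Derivation.leibniz, H.dtt_xi, derivation_ofNat, smul_eq_mul, mul_zero,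
          add_zero] at h3
        refine sub_eq_zero.1 (mul_left_cancel_of_ne hne
          (natCast_mul_eq_zero (n := 5) (by norm_num) ?_))
        push_cast
        linear_combination -2 * h3 - 3 * A * h2
    · have hA0 := H.A_eq_zero hμ hκ hn
      have hB0 : B = 0 := by
        have h := H.mul_B
        rw [hA0, mul_zero] at h
        exact algebraMap_mul_eq_zero hn h
      have h1 : ξ * dt ξ = 0 := by
        have h := H.B_eq
        rw [hA0, hB0] at h
        refine algebraMap_mul_eq_zero hμ (natCast_mul_eq_zero (n := 2) (by norm_num) ?_)
        push_cast
        linear_combination h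
      have h2 := hξt0 h1
      exact .classical H.dx_xi H.dx_A hB0 (by rw [hA0]; simp) (by rw [hA0, h2]; simp)
        (by rw [hA0]; simp)

end Ode

namespace Core

variable {α β γ κ μ : 𝕜} {ξ A B : SmoothFn D}

/-- If `ξ_x` does not vanish identically, then `of_dx_xi_ne` applies where `ξ_x ≠ 0`. It shows that
`ξ_x²` is a constant, so `ξ_x` vanishes nowhere. -/
theorem normalForm_of_defect (hD : Convex ℝ (D : Set (𝕜 × 𝕜 × 𝕜))) (hμ : μ ≠ 0) (hξu : du ξ = 0)
    (hAu : du A = 0) (H : Core α β γ κ μ ξ A B) (hB : defect μ ξ A B = 0) :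
    NormalForm α β γ κ μ ξ A B := by
  by_cases hx : dx ξ = 0
  · refine (H.ode hμ hB hx ?_).normalForm hD hμ hξu hAu α β
    by_cases hγ : γ = 0
    · subst hγ
      exact H.dx_A_eq_zero hμ hB
    · exact (H.dx_eq_zero_of_ne hγ).2
  · have hγ : γ = 0 := by
      by_contra hγ
      exact hx (H.dx_eq_zero_of_ne hγ).1
    subst hγ
    have hξ := H.dx_dx_xi_eq_zero hμ hB
    have hA := H.dx_A_eq_zero hμ hB
    have hle := support_le (dx ξ)
    obtain ⟨z, hz⟩ : ∃ z, (dx ξ) z ≠ 0 := by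
      by_contra! h
      exact hx (by ext z; simpa using h z)
    have hloc := (H.restrict hle).of_dx_xi_ne hμ
      (by
        have := congrArg (SmoothFn.restrict hle) hB
        simpa only [map_mul, map_add, map_sub, map_pow, map_zero, AlgHom.commutes, ← dx_restrict,
          ← dt_restrict, defect, tr] using this)
      (by rw [dx_restrict, dx_restrict, hξ, map_zero]) (by rw [dx_restrict, hA, map_zero])
      (fun y => by
        rw [dx_restrict, restrict_apply]
        exact y.2.2)
    obtain ⟨h1, h2, h3, h4, h5⟩ := hloc
    have hz' : (z : 𝕜 × 𝕜 × 𝕜) ∈ (dx ξ).support := ⟨z.2, hz⟩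
    have pt : ∀ {f g : SmoothFn (dx ξ).support}, f = g → ∀ y, f y = g y := fun h y => h ▸ rfl
    have hα : α = -3 / 2 := by
      have := pt h1 ⟨z, hz'⟩
      simp only [SmoothFn.coe_add, SmoothFn.coe_mul, SmoothFn.coe_zero, SmoothFn.coe_ofNat,
        SmoothFn.coe_algebraMap] at this
      linear_combination this / 2
    have hβ : β = 2 := by simpa using pt h2 ⟨z, hz'⟩
    have hloc : ∀ y, (dx ξ) y ≠ 0 → κ = 4 * μ * (dx ξ) y ^ 2 ∧ (dt ξ) y = 0 ∧
        A y = 4 * (dx ξ) y := by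
      intro y hy
      have hy' : (y : 𝕜 × 𝕜 × 𝕜) ∈ (dx ξ).support := ⟨y.2, hy⟩
      have e1 := pt h3 ⟨y, hy'⟩
      have e2 := pt h4 ⟨y, hy'⟩
      have e3 := pt h5 ⟨y, hy'⟩
      simp only [dx_restrict, dt_restrict, SmoothFn.coe_mul, SmoothFn.coe_zero,
        SmoothFn.coe_ofNat, SmoothFn.coe_algebraMap, SmoothFn.coe_pow, restrict_apply]
        at e1 e2 e3
      exact ⟨e1, e2, e3⟩
    -- `ξ_x` is locally constant where it does not vanish, hence constant
    have hbt : dx ξ * dt ξ = 0 := by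
      ext y
      rw [SmoothFn.coe_mul, SmoothFn.coe_zero, mul_eq_zero]
      by_cases hy : (dx ξ) y = 0
      · exact Or.inl hy
      · exact Or.inr (hloc y hy).2.1
    have hbt' : dx ξ * dt (dx ξ) = 0 := by
      have := congrArg dx hbt
      simp only [Derivation.leibniz, hξ, smul_eq_mul, mul_zero, add_zero, map_zero] at this
      rw [dt_dx]
      exact this
    have hsq : ∀ y, (dx ξ) y ≠ 0 := by
      obtain ⟨c, hc⟩ := exists_const hD ⟨z⟩ (dx ξ ^ 2)
        (by simp [Derivation.leibniz_pow, hξ])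
        (by rw [Derivation.leibniz_pow]; simp [hbt'])
        (by simp [Derivation.leibniz_pow, du_dx, hξu])
      intro y hy
      have e1 := congrArg (fun f : SmoothFn D => f z) hc
      have e2 := congrArg (fun f : SmoothFn D => f y) hc
      simp only [SmoothFn.coe_pow, SmoothFn.coe_algebraMap, hy] at e1 e2
      rw [← e2] at e1
      exact hz (by simpa using e1)
    have hξt : dt ξ = 0 := by ext y; exact (hloc y (hsq y)).2.1
    have hA4 : A = 4 * dx ξ := by ext y; exact (hloc y (hsq y)).2.2
    refine .five hα hβ rfl hξ hξt hA4 ?_ (by ext y; simpa using (hloc y (hsq y)).1)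
    have h := hB
    simp only [defect, tr, Derivation.leibniz_pow, hξt, hA4] at h
    simp at h
    linear_combination h

end Core

end JetPoly

namespace SmoothFn

variable {𝕜 : Type*} [RCLike 𝕜] {D : TopologicalSpace.Opens (𝕜 × 𝕜 × 𝕜)}

/-! ### Infinitesimals with nonvanishing defect -/

/-- A solution of a linear transport equation that is a polynomial in `x` and vanishes on a
nonempty open set vanishes: its `x`-derivatives satisfy a linear homogeneous system. -/
theorem eq_zero_of_transport (hD : Convex ℝ (D : Set (𝕜 × 𝕜 × 𝕜))) {f p ξ ε : SmoothFn D}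
    {n : ℕ} (hn : dx^[n] f = 0) (ht : dt f = p * f - ξ * dx f) (hu : du f = 0)
    (hε : f * ε = 0) {z₀ : D} (hz₀ : ε z₀ ≠ 0) : f = 0 := by
  obtain ⟨v, hv⟩ : ∃ v : Fin (n + 1) → SmoothFn D, ∀ i, v i = dx^[(i : ℕ)] f :=
    ⟨fun i => dx^[(i : ℕ)] f, fun _ => rfl⟩
  have hlast : dx^[n + 1] f = 0 := by
    rw [Function.iterate_succ_apply', hn, map_zero]
  have hmem : ∀ k, dx^[k] f ∈ Ideal.span (Set.range v) := by
    intro k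
    by_cases hk : k < n + 1
    · rw [← hv ⟨k, hk⟩]
      exact Ideal.subset_span ⟨_, rfl⟩
    · have : dx^[k] f = 0 := by
        obtain ⟨j, rfl⟩ := Nat.exists_eq_add_of_le' (not_lt.1 hk)
        rw [Function.iterate_add_apply, hlast, iterate_map_zero]
      rw [this]
      exact zero_mem _
  have hdx : ∀ g ∈ Ideal.span (Set.range v), dx g ∈ Ideal.span (Set.range v) := by
    intro g hg
    induction hg using Submodule.span_induction with
    | mem g hg =>
      obtain ⟨i, rfl⟩ := hg
      rw [hv, ← Function.iterate_succ_apply' (f := dx)]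
      exact hmem _
    | zero => simp
    | add a b _ _ ha hb => rw [map_add]; exact add_mem ha hb
    | smul a b hb ih =>
      rw [smul_eq_mul, Derivation.leibniz, smul_eq_mul, smul_eq_mul]
      exact add_mem (Ideal.mul_mem_left _ _ ih) (Ideal.mul_mem_right _ _ hb)
  have hiter : ∀ k, ∀ g ∈ Ideal.span (Set.range v), dx^[k] g ∈ Ideal.span (Set.range v) := by
    intro k
    induction k with
    | zero => exact fun g hg => hg
    | succ k ih =>
      intro g hg
      rw [Function.iterate_succ_apply']
      exact hdx _ (ih g hg)
  have hdt : ∀ k, dt (dx^[k] f) = dx^[k] (dt f) := by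
    intro k
    induction k with
    | zero => rfl
    | succ k ih => rw [Function.iterate_succ_apply', Function.iterate_succ_apply', dt_dx, ih]
  have hdu : ∀ k, du (dx^[k] f) = 0 := by
    intro k
    induction k with
    | zero => exact hu
    | succ k ih => rw [Function.iterate_succ_apply', du_dx, ih, map_zero]
  have hz : ∀ k, ε * dx^[k] f = 0 := by
    intro k
    induction k with
    | zero => rw [mul_comm]; exact hε
    | succ k ih =>
      rw [Function.iterate_succ_apply']
      exact mul_der_eq_zero ih _
  have ha : ∀ i, ∃ a : Fin (n + 1) → SmoothFn D, ∑ j, a j * v j = dx (v i) := fun i =>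
    Ideal.mem_span_range_iff_exists_fun.1 (hdx _ (Ideal.subset_span ⟨i, rfl⟩))
  have hb : ∀ i, ∃ a : Fin (n + 1) → SmoothFn D, ∑ j, a j * v j = dt (v i) := fun i =>
    Ideal.mem_span_range_iff_exists_fun.1 (by
      rw [hv, hdt, ht]
      refine hiter _ _ (sub_mem (Ideal.mul_mem_left _ _ (hmem 0)) (Ideal.mul_mem_left _ _ (hmem 1))))
  choose a ha using ha
  choose b hb using hb
  have h := eq_zero_of_linear_system hD v a b 0 (fun i => (ha i).symm) (fun i => (hb i).symm)
    (fun i => by rw [hv, hdu]; simp) z₀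
    (fun i => by rw [hv]; exact mul_eq_zero_of_ne (hz i) hz₀) 0
  rwa [hv] at h

end SmoothFn

namespace JetPoly

open MvPolynomial SmoothFn

variable {𝕜 : Type*} [RCLike 𝕜] {D : TopologicalSpace.Opens (𝕜 × 𝕜 × 𝕜)}

namespace Core

variable {κ μ : 𝕜} {ξ A B : SmoothFn D}

/-- If the defect does not vanish identically, then `ξ² = κ` and `φ` is one of the infinitesimals
of a linear equation. -/
theorem of_defect_ne (hD : Convex ℝ (D : Set (𝕜 × 𝕜 × 𝕜))) (hμ : μ ≠ 0) (hξu : du ξ = 0)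
    (hAu : du A = 0) (hBu : du B = 0) (H : Core 0 0 0 κ μ ξ A B) {z₀ : D}
    (hz₀ : (defect μ ξ A B) z₀ ≠ 0) :
    dx ξ = 0 ∧ dt ξ = 0 ∧ ξ ^ 2 = con κ ∧ dx A = 0 ∧ dt A = -A ^ 2 ∧ con κ * A = 0 ∧ A * ξ = 0 ∧
      dt B = ξ * dx B - A * B ∧ dx (dx (dx (dx B))) = 0 := by
  have hξ3 : dx (dx (dx ξ)) = 0 ∧ dx (dx A) = 0 := H.dx_dx_eq_zero_of_eq
  obtain ⟨hξ, hA⟩ := hξ3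
  have hξt := dx_dx_dx_dt hξ
  have hAt := dx_dx_dt hA
  have a0 := H.e3_2
  have d0 := H.e3_1
  have d1 := H.e2_1
  have d2 := H.e1_1
  simp only [con_zero, zero_mul, zero_add, mul_zero, add_zero, hξ, hA, map_zero, sub_zero]
    at a0 d0 d1 d2
  have hLu : du (cL ξ A) = 0 := by
    simp [cL, qA, Derivation.leibniz, Derivation.leibniz_pow, hξu, hAu, du_dx, du_dt]
  have hM2u : du (cM₂ 0 κ μ ξ A) = 0 := by
    simp [cM₂, qA, rA, Derivation.leibniz, Derivation.leibniz_pow, hξu, hAu, du_dx, du_dt]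
  have hM1u : du (cM₁ μ ξ A) = 0 := by
    simp [cM₁, qA, rA, Derivation.leibniz, Derivation.leibniz_pow, hξu, hAu, du_dx, du_dt]
  have hNu : du (cN μ ξ A B) = 0 := by
    simp [cN, cM₀, sAB, qA, rA, Derivation.leibniz, Derivation.leibniz_pow, hξu, hAu, hBu, du_dx,
      du_dt]
  have hL4 : dx^[4] (cL ξ A) = 0 := by
    simp [cL, qA, Derivation.leibniz, Derivation.leibniz_pow, hξ, hA, hξt]
  have hM4 : dx^[5] (cM₂ 0 κ μ ξ A) = 0 := by
    simp [cM₂, qA, rA, Derivation.leibniz, Derivation.leibniz_pow, hξ, hA, hξt, hAt]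
  have hM14 : dx^[4] (cM₁ μ ξ A) = 0 := by
    simp [cM₁, qA, rA, Derivation.leibniz, Derivation.leibniz_pow, hξ, hA, hξt, hAt]
  have hL : cL ξ A = 0 := by
    refine eq_zero_of_transport hD (p := A - dx ξ) (ξ := ξ) hL4 ?_ hLu H.e3_0 hz₀
    rw [tr] at d0
    refine sub_eq_zero.1 (algebraMap_mul_eq_zero hμ ?_)
    linear_combination d0
  have hM2 : cM₂ 0 κ μ ξ A = 0 := by
    refine eq_zero_of_transport hD (p := A - 2 * dx ξ) (ξ := ξ) hM4 ?_ hM2u H.e2_0 hz₀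
    rw [hL, tr] at d1
    linear_combination d1
  have hM1 : cM₁ μ ξ A = 0 := by
    refine eq_zero_of_transport hD (p := A - 3 * dx ξ) (ξ := ξ) hM14 ?_ hM1u H.e1_0 hz₀
    rw [hM2, tr] at d2
    linear_combination d2
  -- the three identities leave no dependence on `x`
  obtain ⟨P, hP⟩ : ∃ P, P = ξ ^ 2 := ⟨_, rfl⟩
  have hP5 : dx (dx (dx (dx (dx P)))) = 0 := by
    simp [hP, Derivation.leibniz, Derivation.leibniz_pow, hξ]
  have hQ : qA ξ A = -2 * dx P := by
    rw [cL, ← hP] at hL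
    linear_combination hL
  have hM2x := congrArg dx hM2
  rw [cM₁, hQ] at hM1
  rw [cM₂, hQ, ← hP] at hM2x
  simp only [con_zero, map_add, map_sub, map_neg, Derivation.leibniz, Derivation.map_algebraMap,
    derivation_ofNat, smul_eq_mul, mul_zero, zero_mul, add_zero, sub_zero, map_zero] at hM1 hM2x
  have hPx1 : dx P = -(con μ * dx (dx (dx P))) := by
    refine sub_eq_zero.1 (natCast_mul_eq_zero (n := 4) (by norm_num) ?_)
    push_cast
    linear_combination hM1 - 2 * hM2x
  have hPx : dx P = 0 := by
    have h3 : dx (dx (dx P)) = 0 := by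
      have := congrArg (fun f => dx (dx f)) hPx1
      simp only [map_neg, Derivation.leibniz, Derivation.map_algebraMap, hP5, smul_eq_mul,
        mul_zero, add_zero, neg_zero] at this
      exact this
    rw [hPx1, h3]
    simp
  have hξx : dx ξ = 0 := by
    have h1 : ξ * dx ξ = 0 := by
      rw [hP, Derivation.leibniz_pow] at hPx
      refine natCast_mul_eq_zero (n := 2) (by norm_num) ?_
      simpa using hPx
    have h2 := mul_der_eq_zero h1 (1, 0, 0)
    change ξ * dx (dx ξ) = 0 at h2
    have h3 := congrArg dx h1
    simp only [Derivation.leibniz, smul_eq_mul, map_zero, h2] at h3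
    refine pow_eq_zero_iff two_ne_zero |>.1 ?_
    linear_combination h3
  have hAx : dx A = 0 := by
    rw [hξx, map_zero, mul_zero] at a0
    exact natCast_mul_eq_zero (n := 4) (by norm_num) (by push_cast; exact a0)
  have hξt' : dt ξ = -(2 * ξ * A) := by
    rw [qA, hPx, hξx] at hQ
    linear_combination -hQ
  obtain ⟨r, hr⟩ : ∃ r, r = dt A + A ^ 2 := ⟨_, rfl⟩
  have hrA : rA ξ A = r := by rw [rA, hAx, hr]; ring
  have hAtx : dx (dt A) = 0 := by rw [← dt_dx, hAx, map_zero]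
  have hrx : dx r = 0 := by simp [hr, Derivation.leibniz_pow, hAtx, hAx]
  have hrtx : dx (dt r) = 0 := by rw [← dt_dx, hrx, map_zero]
  have hμr : con μ * r = P - con κ := by
    rw [cM₂, hQ, ← hP, hrA, hPx, con_zero] at hM2
    simp only [map_zero, mul_zero, zero_mul, add_zero, zero_add, sub_zero] at hM2
    linear_combination hM2
  have hPt : dt P = -(4 * A * P) := by
    rw [hP, Derivation.leibniz_pow, hξt']
    simp
    ring
  have hM0 : cM₀ μ ξ A = -r := by
    rw [cM₀, hrA, hrx]
    simp
  have hB4 : dx (dx (dx (dx B))) = dt r - A * r := by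
    have h := H.e0_2
    rw [hM0, hAx, hξx] at h
    simp only [tr, con_zero, map_neg, hrx, map_zero, mul_zero, zero_mul, add_zero, sub_zero,
      neg_zero, zero_add] at h
    linear_combination h
  have hB5 : dx (dx (dx (dx (dx B)))) = 0 := by
    rw [hB4]
    simp [Derivation.leibniz, hrtx, hrx, hAx]
  have hB5t : dx (dx (dx (dx (dx (dt B))))) = 0 := by
    rw [← dt_dx, ← dt_dx, ← dt_dx, ← dt_dx, ← dt_dx, hB5, map_zero]
  obtain ⟨s, hs⟩ : ∃ s, s = sAB ξ A B := ⟨_, rfl⟩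
  have hs5 : dx (dx (dx (dx (dx s)))) = 0 := by
    simp [hs, sAB, Derivation.leibniz, hB5, hB5t, hAx, hξx]
  have hN : cN μ ξ A B = con μ * dx (dx s) - s + con μ * P * r := by
    rw [cN, hM0, ← hs, hP]
    ring
  have hN5 : dx^[5] (cN μ ξ A B) = 0 := by
    rw [hN]
    simp [Derivation.leibniz, hs5, hPx, hrx]
  have hN0 : cN μ ξ A B = 0 := by
    refine eq_zero_of_transport hD (p := 2 * A) (ξ := ξ) hN5 ?_ hNu H.e0_0 hz₀
    have h := H.e0_1
    rw [hL, cM₁, hQ, hrA, hM2, hξx, hPx] at h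
    simp only [tr, mul_zero, zero_mul, add_zero, zero_add, map_zero, sub_zero, hrx, neg_zero] at h
    linear_combination h
  rw [hN] at hN0
  have hs4 : dx (dx (dx (dx s))) = 0 := by
    have h := congrArg (fun f => dx (dx (dx (dx f)))) hN0
    simp only [map_add, map_sub, Derivation.leibniz, Derivation.map_algebraMap, hs5, hPx, hrx,
      smul_eq_mul, mul_zero, zero_mul, add_zero, map_zero] at h
    linear_combination -h
  have hs2 : dx (dx s) = 0 := by
    have h := congrArg (fun f => dx (dx f)) hN0
    simp only [map_add, map_sub, Derivation.leibniz, Derivation.map_algebraMap, hs4, hPx, hrx,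
      smul_eq_mul, mul_zero, zero_mul, add_zero, map_zero] at h
    linear_combination -h
  have hsP : s = con μ * P * r := by
    rw [hs2] at hN0
    linear_combination -hN0
  have hμA : con μ * dt A = P - con κ - con μ * A ^ 2 := by
    rw [hr] at hμr
    linear_combination hμr
  have hμrt : con μ * dt r = -(4 * A * P) := by
    have h := congrArg dt hμr
    simp only [map_sub, Derivation.leibniz, Derivation.map_algebraMap, hPt, smul_eq_mul, mul_zero,
      add_zero, sub_zero] at h
    exact h
  -- the equation for `∂ₓ⁴ B` is an algebraic relation between `A` and `P = ξ²`
  have h1 : (con κ - 5 * P) * (P - con κ) + 20 * con μ * A ^ 2 * P = 0 := by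
    have h := hs4
    rw [hs, sAB] at h
    simp only [map_add, map_sub, Derivation.leibniz, hAx, hξx, hB5, smul_eq_mul, mul_zero,
      add_zero, sub_zero, map_zero] at h
    obtain ⟨E, hE⟩ : ∃ E, E = dt r - A * r := ⟨_, rfl⟩
    rw [← dt_dx, ← dt_dx, ← dt_dx, ← dt_dx, hB4, ← hE] at h
    have h2 : con μ * E = con κ * A - 5 * A * P := by
      rw [hE]
      linear_combination hμrt - A * hμr
    have h3 := congrArg dt h2
    simp only [map_sub, Derivation.leibniz, Derivation.map_algebraMap, derivation_ofNat, hPt,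
      smul_eq_mul, mul_zero, add_zero] at h3
    linear_combination con μ ^ 2 * h - con μ * h3 - con μ * A * h2 - (con κ - 5 * P) * hμA
  -- the derivative of this relation along `t`, reduced by the equations for `A_t` and `P_t`
  have h2 : A * P * (25 * P ^ 2 - 14 * con κ * P - 3 * con κ ^ 2) = 0 := by
    have h := congrArg dt h1
    simp only [map_add, map_sub, Derivation.leibniz, Derivation.leibniz_pow,
      Derivation.map_algebraMap, derivation_ofNat, hPt, smul_eq_mul, nsmul_eq_mul, mul_zero,
      add_zero, zero_sub, sub_zero, map_zero, Nat.cast_ofNat, Nat.reduceSub, pow_one] at h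
    refine natCast_mul_eq_zero (n := 2) (by norm_num) ?_
    push_cast
    linear_combination 6 * A * P * h1 + P * h - 40 * A * P ^ 2 * hμA
  have hAP : A * P = 0 := by
    have h := mul_der_eq_zero h2 (0, 1, 0)
    change A * P * dt _ = 0 at h
    simp only [map_sub, Derivation.leibniz, Derivation.leibniz_pow,
      Derivation.map_algebraMap, derivation_ofNat, hPt, smul_eq_mul, nsmul_eq_mul, mul_zero,
      add_zero, map_zero, Nat.cast_ofNat, Nat.reduceSub, pow_one] at h
    ext z
    by_contra hz
    have h2 := congrArg (fun f : SmoothFn D => f z) h2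
    have h := congrArg (fun f : SmoothFn D => f z) h
    simp only [SmoothFn.coe_add, SmoothFn.coe_sub, SmoothFn.coe_neg, SmoothFn.coe_mul,
      SmoothFn.coe_zero, SmoothFn.coe_ofNat, SmoothFn.coe_pow, SmoothFn.coe_algebraMap]
      at h h2 hz
    have hP0 : P z ≠ 0 := fun h => hz (by rw [h, mul_zero])
    have e1 := (mul_eq_zero.1 h2).resolve_left hz
    have e2 : A z * P z * (A z * P z * (25 * P z - 7 * κ)) = 0 := by
      linear_combination -h / 8
    have e3 := (mul_eq_zero.1 ((mul_eq_zero.1 e2).resolve_left hz)).resolve_left hz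
    have e4 : κ ^ 2 = 0 := by
      linear_combination -25 / 124 * e1 + (25 * P z - 7 * κ) / 124 * e3
    have e5 : κ = 0 := pow_eq_zero_iff two_ne_zero |>.1 e4
    rw [e5] at e3
    exact hP0 (by linear_combination e3 / 25)
  have hPκ : P = con κ := by
    have h3 := mul_der_eq_zero (f := P) (g := A) (by linear_combination hAP) (0, 1, 0)
    change P * dt A = 0 at h3
    ext z
    by_contra hz
    have h1 := congrArg (fun f : SmoothFn D => f z) h1
    have h3 := congrArg (fun f : SmoothFn D => f z) h3
    have h4 := congrArg (fun f : SmoothFn D => f z) hAP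
    have h5 := congrArg (fun f : SmoothFn D => f z) hμA
    simp only [SmoothFn.coe_add, SmoothFn.coe_sub, SmoothFn.coe_mul,
      SmoothFn.coe_zero, SmoothFn.coe_ofNat, SmoothFn.coe_pow, SmoothFn.coe_algebraMap]
      at h1 h3 h4 h5 hz
    have e1 : (P z - κ) * (κ - 5 * P z) = 0 := by linear_combination h1 - 20 * μ * A z * h4
    have e2 := (mul_eq_zero.1 e1).resolve_left (sub_ne_zero.2 hz)
    have hP0 : P z ≠ 0 := fun h => hz (by rw [h] at e2 ⊢; linear_combination -e2)
    have e3 := (mul_eq_zero.1 h3).resolve_left hP0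
    have e4 := (mul_eq_zero.1 h4).resolve_right hP0
    apply hz
    rw [e3, e4] at h5
    linear_combination -h5
  have hr0 : r = 0 := by
    refine algebraMap_mul_eq_zero hμ ?_
    rw [hμr, hPκ, sub_self]
  have hAξ : A * ξ = 0 := by
    refine pow_eq_zero_iff two_ne_zero |>.1 ?_
    rw [hP] at hAP
    linear_combination A * hAP
  refine ⟨hξx, by linear_combination hξt' - 2 * hAξ, by rw [← hP, hPκ], hAx,
    by linear_combination hr0 - hr, by rw [← hPκ]; linear_combination hAP, hAξ, ?_,
    by rw [hB4, hr0]; simp⟩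
  rw [hr0, mul_zero, hs, sAB] at hsP
  linear_combination hsP

/-- The products of the defect with `α`, `β` and `γ` vanish, so it is zero or `α = β = γ = 0`. -/
theorem normalForm {α β γ : 𝕜} (hD : Convex ℝ (D : Set (𝕜 × 𝕜 × 𝕜))) (hμ : μ ≠ 0)
    (hξu : du ξ = 0) (hAu : du A = 0) (hBu : du B = 0) (H : Core α β γ κ μ ξ A B) :
    NormalForm α β γ κ μ ξ A B := by
  by_cases hB : defect μ ξ A B = 0
  · exact H.normalForm_of_defect hD hμ hξu hAu hB
  obtain ⟨z₀, hz₀⟩ : ∃ z, (defect μ ξ A B) z ≠ 0 := by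
    by_contra! h
    exact hB (by ext z; simpa using h z)
  have hc : ∀ {c : 𝕜}, con c * defect μ ξ A B = 0 → c = 0 := by
    intro c h
    by_contra hc
    exact hB (algebraMap_mul_eq_zero hc h)
  obtain rfl := hc H.e13_0
  obtain rfl := hc H.e22_0
  obtain rfl := hc H.e11_0
  obtain ⟨h1, h2, h3, h4, h5, h6, h7, h8, h9⟩ := H.of_defect_ne hD hμ hξu hAu hBu hz₀
  obtain hA | hA := eq_zero_or_ne hD (f := A) (a := -A) h4 (by linear_combination h5) hAu
  · exact .four rfl rfl rfl h1 h2 h3 hA (by rw [h8, hA]; simp) h9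
  · have hξ0 : ξ = 0 := mul_left_cancel_of_ne hA h7
    have hκ : κ = 0 := by
      by_contra hκ
      exact hA z₀ (by rw [algebraMap_mul_eq_zero hκ h6, SmoothFn.coe_zero])
    exact .seven rfl rfl rfl hκ hξ0 h4 h5 hA (by rw [h8, hξ0]; ring) h9

end Core

end JetPoly

namespace JetPoly

open MvPolynomial SmoothFn

variable {𝕜 : Type*} [RCLike 𝕜] {D : TopologicalSpace.Opens (𝕜 × 𝕜 × 𝕜)}

/-! ### The normal forms satisfy the determining equations -/

namespace Core

variable {α β γ κ μ : 𝕜} {ξ A B : SmoothFn D}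

theorem of_classical {a : SmoothFn D} (h₁ : dx ξ = 0) (h₂ : dx a = 0) (h₄ : dt a = a ^ 2)
    (h₅ : dt ξ = a * ξ) (h₆ : con κ * a = 0) : Core α β γ κ μ ξ (2 * a) 0 := by
  constructor <;> simp only [defect, cN, cM₀, cM₁, cM₂, cL, sAB, qA, rA, tr, Derivation.leibniz,
    Derivation.leibniz_pow, map_add, map_sub, map_neg, Derivation.map_algebraMap,
    derivation_ofNat, smul_eq_mul, nsmul_eq_mul, mul_zero, zero_mul, add_zero, zero_add,
    map_zero, sub_zero, zero_sub, neg_zero, neg_neg, Nat.cast_ofNat, Nat.reduceSub, pow_one,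
    con_zero, zero_pow two_ne_zero, h₁, h₂, h₄, h₅]
  all_goals first | ring1 | linear_combination -2 * h₆

theorem of_one (h₃ : dx A = 0) (h₅ : dt (dt A) = A ^ 3 - A * dt A) : Core α β γ 0 μ 0 A 0 := by
  have h : dx (dt A) = 0 := by rw [← dt_dx, h₃, map_zero]
  constructor <;> simp only [defect, cN, cM₀, cM₁, cM₂, cL, sAB, qA, rA, tr, Derivation.leibniz,
    Derivation.leibniz_pow, map_add, map_sub, map_neg, Derivation.map_algebraMap,
    derivation_ofNat, smul_eq_mul, nsmul_eq_mul, mul_zero, zero_mul, add_zero, zero_add,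
    map_zero, sub_zero, zero_sub, neg_zero, neg_neg, Nat.cast_ofNat, Nat.reduceSub, pow_one,
    con_zero, zero_pow two_ne_zero, h₃, h₅, h]
  all_goals ring1

theorem of_two (h₁ : 1 + 2 * γ * μ = 0) (h₂ : dx ξ = 0) (h₄ : dt (dt ξ) = 0) :
    Core α β γ κ μ ξ 0 (-(2 * con μ * ξ * dt ξ)) := by
  have hn : 1 + 2 * con γ * con μ = (0 : SmoothFn D) := by
    ext z
    simpa using h₁
  have h : dx (dt ξ) = 0 := by rw [← dt_dx, h₂, map_zero]
  constructor <;> simp only [defect, cN, cM₀, cM₁, cM₂, cL, sAB, qA, rA, tr, Derivation.leibniz,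
    Derivation.leibniz_pow, map_add, map_sub, map_neg, Derivation.map_algebraMap,
    derivation_ofNat, smul_eq_mul, nsmul_eq_mul, mul_zero, zero_mul, add_zero, zero_add,
    map_zero, sub_zero, zero_sub, neg_zero, neg_neg, Nat.cast_ofNat, Nat.reduceSub, pow_one,
    con_zero, zero_pow two_ne_zero, h₂, h₄, h]
  all_goals first | ring1 | linear_combination -2 * ξ * dt ξ * hn

theorem of_three (h₂ : 1 + 2 * γ * μ = 0) (h₃ : dx ξ = 0) (h₄ : dx A = 0) (h₅ : dt A = -A ^ 2)
    (h₇ : dt ξ = 2 * A * ξ) : Core α β γ 0 μ ξ A (-(3 * con μ * A * ξ ^ 2)) := by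
  have hn : 1 + 2 * con γ * con μ = (0 : SmoothFn D) := by
    ext z
    simpa using h₂
  constructor <;> simp only [defect, cN, cM₀, cM₁, cM₂, cL, sAB, qA, rA, tr, Derivation.leibniz,
    Derivation.leibniz_pow, map_add, map_sub, map_neg, Derivation.map_algebraMap,
    derivation_ofNat, smul_eq_mul, nsmul_eq_mul, mul_zero, zero_mul, add_zero, zero_add,
    map_zero, sub_zero, zero_sub, neg_zero, neg_neg, Nat.cast_ofNat, Nat.reduceSub, pow_one,
    con_zero, zero_pow two_ne_zero, h₃, h₄, h₅, h₇]
  all_goals first | ring1 | linear_combination -3 * A * ξ ^ 2 * hn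

theorem of_four (h₁ : dx ξ = 0) (h₂ : dt ξ = 0) (h₃ : ξ ^ 2 = con κ) (h₅ : dt B = ξ * dx B)
    (h₆ : dx (dx (dx (dx B))) = 0) : Core 0 0 0 κ μ ξ 0 B := by
  constructor <;> simp only [defect, cN, cM₀, cM₁, cM₂, cL, sAB, qA, rA, tr, Derivation.leibniz,
    Derivation.leibniz_pow, map_add, map_sub, map_neg, Derivation.map_algebraMap,
    derivation_ofNat, smul_eq_mul, nsmul_eq_mul, mul_zero, zero_mul, add_zero, zero_add,
    map_zero, sub_zero, zero_sub, neg_zero, neg_neg, Nat.cast_ofNat, Nat.reduceSub, pow_one,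
    con_zero, zero_pow two_ne_zero, h₁, h₂, h₃, h₅, h₆]
  all_goals ring1

theorem of_five (h₁ : dx (dx ξ) = 0) (h₂ : dt ξ = 0) (h₅ : con κ = 4 * con μ * dx ξ ^ 2) :
    Core (-3 / 2) 2 0 κ μ ξ (4 * dx ξ) (2 * con μ * dx ξ * ξ ^ 2) := by
  have hα : 2 * con (-3 / 2) = (-3 : SmoothFn D) := by
    ext z
    rw [SmoothFn.coe_mul, SmoothFn.coe_ofNat, SmoothFn.coe_algebraMap, SmoothFn.coe_neg,
      SmoothFn.coe_ofNat]
    norm_num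
  have h2 : con 2 = (2 : SmoothFn D) := map_ofNat _ 2
  constructor <;> simp only [defect, cN, cM₀, cM₁, cM₂, cL, sAB, qA, rA, tr, Derivation.leibniz,
    Derivation.leibniz_pow, map_add, map_sub, map_neg, Derivation.map_algebraMap,
    derivation_ofNat, smul_eq_mul, nsmul_eq_mul, mul_zero, zero_mul, add_zero, zero_add,
    map_zero, sub_zero, zero_sub, neg_zero, neg_neg, Nat.cast_ofNat, Nat.reduceSub, pow_one,
    con_zero, zero_pow two_ne_zero, h₁, h₂, h₅, h2, dt_dx]
  all_goals first | ring1 | linear_combination 2 * con μ * dx ξ ^ 2 * ξ * hα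

theorem of_seven (h₃ : dx A = 0) (h₄ : dt A = -A ^ 2) (h₆ : dt B = -(A * B))
    (h₇ : dx (dx (dx (dx B))) = 0) : Core 0 0 0 0 μ 0 A B := by
  constructor <;> simp only [defect, cN, cM₀, cM₁, cM₂, cL, sAB, qA, rA, tr, Derivation.leibniz,
    Derivation.leibniz_pow, map_add, map_sub, map_neg, Derivation.map_algebraMap,
    derivation_ofNat, smul_eq_mul, nsmul_eq_mul, mul_zero, zero_mul, add_zero, zero_add,
    map_zero, sub_zero, zero_sub, neg_zero, neg_neg, Nat.cast_ofNat, Nat.reduceSub, pow_one,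
    con_zero, zero_pow two_ne_zero, h₃, h₄, h₆, h₇]
  all_goals ring1

end Core

end JetPoly

namespace SmoothFn

variable {𝕜 : Type*} [RCLike 𝕜] {D : TopologicalSpace.Opens (𝕜 × 𝕜 × 𝕜)}

/-! ### Functions of `t` -/

theorem isOpen_times : IsOpen (times (D : Set (𝕜 × 𝕜 × 𝕜))) := by
  have h : times (D : Set (𝕜 × 𝕜 × 𝕜)) = (fun z : 𝕜 × 𝕜 × 𝕜 => z.2.1) '' D := by
    ext t
    constructor
    · rintro ⟨x, u, h⟩
      exact ⟨_, h, rfl⟩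
    · rintro ⟨z, h, rfl⟩
      exact ⟨z.1, z.2.2, h⟩
  rw [h]
  exact (isOpenMap_fst.comp isOpenMap_snd) _ D.isOpen

theorem t_mem_times (z : D) : (z : 𝕜 × 𝕜 × 𝕜).2.1 ∈ times (D : Set (𝕜 × 𝕜 × 𝕜)) :=
  ⟨_, _, z.2⟩

/-- A function of `t`, as a function of `(x, t, u)`. -/
def ofTime (g : 𝕜 → 𝕜) (hg : ContDiffOn 𝕜 ∞ g (times (D : Set (𝕜 × 𝕜 × 𝕜)))) : SmoothFn D :=
  mk (fun z => g z.2.1) (hg.comp (contDiff_fst.comp contDiff_snd).contDiffOn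
    fun z hz => ⟨z.1, z.2.2, hz⟩)

section ofTime

variable {g : 𝕜 → 𝕜} (hg : ContDiffOn 𝕜 ∞ g (times (D : Set (𝕜 × 𝕜 × 𝕜))))

@[simp] theorem ofTime_apply (z : D) : ofTime g hg z = g (z : 𝕜 × 𝕜 × 𝕜).2.1 := rfl

theorem der_ofTime (e : 𝕜 × 𝕜 × 𝕜) (z : D) :
    der e (ofTime g hg) z = deriv g (z : 𝕜 × 𝕜 × 𝕜).2.1 * e.2.1 := by
  have h1 : HasDerivAt g (deriv g (z : 𝕜 × 𝕜 × 𝕜).2.1) (z : 𝕜 × 𝕜 × 𝕜).2.1 :=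
    ((hg.contDiffAt (isOpen_times.mem_nhds (t_mem_times z))).differentiableAt
      (by simp)).hasDerivAt
  have h2 : HasFDerivAt (fun z : 𝕜 × 𝕜 × 𝕜 => z.2.1) ((ContinuousLinearMap.fst 𝕜 𝕜 𝕜).comp
      (ContinuousLinearMap.snd 𝕜 𝕜 (𝕜 × 𝕜))) (z : 𝕜 × 𝕜 × 𝕜) :=
    hasFDerivAt_fst.comp (z : 𝕜 × 𝕜 × 𝕜) hasFDerivAt_snd
  have h3 := h1.comp_hasFDerivAt (z : 𝕜 × 𝕜 × 𝕜) h2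
  rw [der_eq_of_hasFDerivAt _ (F := g ∘ fun z => z.2.1) (fun _ => rfl) z h3]
  simp

theorem dx_ofTime : dx (ofTime g hg) = 0 := by
  ext z
  simp [dx, der_ofTime]

theorem du_ofTime : du (ofTime g hg) = 0 := by
  ext z
  simp [du, der_ofTime]

theorem dt_ofTime : dt (ofTime g hg) = ofTime (deriv g)
    ((contDiffOn_infty_iff_deriv_of_isOpen isOpen_times).1 hg).2 := by
  ext z
  simp [dt, der_ofTime]

end ofTime

/-- On a convex set, a function that does not depend on `x` and `u` is a function of `t`. -/
theorem exists_ofTime (hD : Convex ℝ (D : Set (𝕜 × 𝕜 × 𝕜))) {f : SmoothFn D} (hx : dx f = 0)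
    (hu : du f = 0) :
    ∃ (g : 𝕜 → 𝕜) (hg : ContDiffOn 𝕜 ∞ g (times (D : Set (𝕜 × 𝕜 × 𝕜)))), f = ofTime g hg := by
  classical
  have key : ∀ z₀ z₁ : D, (z₀ : 𝕜 × 𝕜 × 𝕜).2.1 = (z₁ : 𝕜 × 𝕜 × 𝕜).2.1 → f z₁ = f z₀ := by
    intro z₀ z₁ h
    set e : 𝕜 × 𝕜 × 𝕜 := (z₁ : 𝕜 × 𝕜 × 𝕜) - z₀ with he
    set γ : ℝ → 𝕜 × 𝕜 × 𝕜 := fun s => (z₀ : 𝕜 × 𝕜 × 𝕜) + s • e with hγ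
    have hmem : ∀ s ∈ Set.Icc (0 : ℝ) 1, γ s ∈ D := fun s hs =>
      hD.add_smul_sub_mem z₀.2 z₁.2 hs
    have he0 : e.2.1 = 0 := by simp [he, h]
    have hderiv : ∀ s ∈ Set.Icc (0 : ℝ) 1, HasDerivAt (fun s => f.extend (γ s)) 0 s := by
      intro s hs
      have h1 := (f.hasFDerivAt_extend ⟨γ s, hmem s hs⟩).restrictScalars ℝ
      have h2 : HasDerivAt γ e s :=
        (((hasDerivAt_id s).smul_const e).const_add (z₀ : 𝕜 × 𝕜 × 𝕜)).congr_deriv (one_smul _ _)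
      refine (h1.comp_hasDerivAt s h2).congr_deriv ?_
      change fderiv 𝕜 f.extend (γ s) e = _
      rw [fderiv_extend f ⟨γ s, hmem s hs⟩ e, hx, hu, he0]
      simp
    have h1 := constant_of_has_deriv_right_zero
      (fun s hs => (hderiv s hs).continuousAt.continuousWithinAt)
      (fun s hs => (hderiv s (Set.Ico_subset_Icc_self hs)).hasDerivWithinAt) 1 (by simp)
    have e1 : γ 1 = z₁ := by simp [hγ, he]
    have e0 : γ 0 = z₀ := by simp [hγ]
    simpa only [e1, e0, extend_apply] using h1
  let g : 𝕜 → 𝕜 := fun s => if h : ∃ z : D, (z : 𝕜 × 𝕜 × 𝕜).2.1 = s then f h.choose else 0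
  have hg : ∀ z : D, f z = g (z : 𝕜 × 𝕜 × 𝕜).2.1 := by
    intro z
    have h : ∃ z' : D, (z' : 𝕜 × 𝕜 × 𝕜).2.1 = (z : 𝕜 × 𝕜 × 𝕜).2.1 := ⟨z, rfl⟩
    simp only [g, dif_pos h]
    exact key _ _ h.choose_spec
  refine ⟨g, ?_, ext hg⟩
  rintro s ⟨a, b, hs⟩
  have hcont : Continuous fun r : 𝕜 => (a, r, b) := by fun_prop
  have hc : ContDiffAt 𝕜 ∞ (fun r : 𝕜 => (a, r, b)) s :=
    contDiffAt_const.prodMk (contDiffAt_id.prodMk contDiffAt_const)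
  refine ContDiffAt.contDiffWithinAt (((f.contDiffAt_extend ⟨_, hs⟩).comp s hc).congr_of_eventuallyEq
    ?_)
  filter_upwards [hcont.continuousAt.eventually_mem (D.isOpen.mem_nhds hs)] with r hr
  simp only [Function.comp_apply]
  rw [extend_apply f ⟨_, hr⟩, hg]

end SmoothFn

namespace JetPoly

open MvPolynomial SmoothFn

variable {𝕜 : Type*} [RCLike 𝕜] {D : TopologicalSpace.Opens (𝕜 × 𝕜 × 𝕜)}

/-! ### The normal forms as families of infinitesimals -/

theorem con_eq_zero (hne : Nonempty D) {a : 𝕜} (h : (con a : SmoothFn D) = 0) : a = 0 := by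
  obtain ⟨z⟩ := hne
  simpa using congrArg (fun f : SmoothFn D => f z) h

/-- The determining equations of the generic case, integrated with respect to `u`. -/
theorem isNonclassical_iff_normalForm (hD : Convex ℝ (D : Set (𝕜 × 𝕜 × 𝕜))) {α β γ κ μ : 𝕜}
    (hμ : μ ≠ 0) {ξ φ : 𝕜 → 𝕜 → 𝕜 → 𝕜} {ξ' φ' : SmoothFn D}
    (hξ : ∀ x t u (h : (x, t, u) ∈ D), ξ x t u = ξ' ⟨_, h⟩)
    (hφ : ∀ x t u (h : (x, t, u) ∈ D), φ x t u = φ' ⟨_, h⟩)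
    (hw : ∀ z : D, (u + con μ * ξ' ^ 2 : SmoothFn D) z ≠ 0) :
    IsNonclassical α β γ κ μ ξ φ D ↔ ∃ A B, du ξ' = 0 ∧ du A = 0 ∧ du B = 0 ∧
      φ' = A * u + B ∧ NormalForm α β γ κ μ ξ' A B := by
  constructor
  · intro H
    have h1 := du_xi_eq_zero α β γ κ μ hξ hφ hw H
    have h2 := du_du_phi_eq_zero hμ hξ hφ h1 hw H
    rw [isNonclassical_iff_determining α β γ κ μ hξ hφ h1 hw] at H
    obtain ⟨A, hA⟩ : ∃ A, A = du φ' := ⟨_, rfl⟩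
    obtain ⟨B, hB⟩ : ∃ B, φ' = A * u + B := ⟨φ' - A * u, by ring⟩
    rw [← hA] at h2
    have hBu : du B = 0 := by
      have h := congrArg du hB
      simp only [map_add, Derivation.leibniz, h2, ← hA, du_u, smul_eq_mul] at h
      linear_combination -h
    rw [hB] at H
    exact ⟨A, B, h1, h2, hBu, hB,
      ((determining_iff_core hμ h1 h2 hBu).1 H).normalForm hD hμ h1 h2 hBu⟩
  · rintro ⟨A, B, h1, h2, hB, rfl, H⟩
    rw [isNonclassical_iff_determining α β γ κ μ hξ hφ h1 hw, determining_iff_core hμ h1 h2 hB]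
    cases H with
    | classical k₁ k₂ k₃ k₄ k₅ k₆ =>
      have h4 : (con 4 : SmoothFn D) = 4 := map_ofNat _ 4
      have h2' : 2 * con (1 / 2) = (1 : SmoothFn D) := by
        ext z
        rw [SmoothFn.coe_mul, SmoothFn.coe_ofNat, SmoothFn.coe_algebraMap, SmoothFn.coe_one]
        norm_num
      obtain ⟨a, ha⟩ : ∃ a, a = con (1 / 2) * A := ⟨_, rfl⟩
      have hA : A = 2 * a := by
        rw [ha]
        linear_combination -A * h2'
      subst k₃
      rw [hA]
      have hc : ∀ f g : SmoothFn D, 2 * f = 2 * g → f = g := fun f g h => by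
        refine sub_eq_zero.1 (natCast_mul_eq_zero two_ne_zero ?_)
        push_cast
        linear_combination h
      refine Core.of_classical k₁ ?_ ?_ ?_ ?_
      · simp [ha, Derivation.leibniz, k₂]
      · rw [hA] at k₄
        simp only [Derivation.leibniz, derivation_ofNat, smul_eq_mul, mul_zero, add_zero] at k₄
        exact hc _ _ (hc _ _ (by linear_combination k₄))
      · rw [hA] at k₅
        exact hc _ _ (by linear_combination k₅)
      · rw [hA] at k₆
        exact hc _ _ (by linear_combination k₆)
    | one k₁ k₂ k₃ k₄ k₅ =>
      subst k₁ k₂ k₄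
      exact Core.of_one k₃ k₅
    | two k₁ k₂ k₃ k₄ k₅ =>
      subst k₃ k₅
      exact Core.of_two k₁ k₂ k₄
    | three k₁ k₂ k₃ k₄ k₅ k₆ k₇ k₈ =>
      subst k₁ k₈
      exact Core.of_three k₂ k₃ k₄ k₅ k₇
    | four kα kβ kγ k₁ k₂ k₃ k₄ k₅ k₆ =>
      subst kα kβ kγ k₄
      exact Core.of_four k₁ k₂ k₃ k₅ k₆
    | five kα kβ kγ k₁ k₂ k₃ k₄ k₅ =>
      subst kα kβ kγ k₃ k₄
      exact Core.of_five k₁ k₂ k₅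
    | seven kα kβ kγ k₁ k₂ k₃ k₄ k₅ k₆ k₇ =>
      subst kα kβ kγ k₁ k₂
      exact Core.of_seven k₃ k₄ k₆ k₇

section families

variable {α β γ κ μ : 𝕜} {ξ φ : 𝕜 → 𝕜 → 𝕜 → 𝕜} {ξ' φ' : SmoothFn D}

theorem exists_cubic (hD : Convex ℝ (D : Set (𝕜 × 𝕜 × 𝕜))) (hne : Nonempty D) {B : SmoothFn D}
    (s : 𝕜) (hu : du B = 0) (ht : dt B = con s * dx B) (hx : dx (dx (dx (dx B))) = 0) :
    ∃ c : Fin 4 → 𝕜, ∀ z : D, B z = cubic c ((z : 𝕜 × 𝕜 × 𝕜).1 + s * (z : 𝕜 × 𝕜 × 𝕜).2.1) := by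
  have hB1 : dt (dx B) = con s * dx (dx B) := by rw [dt_dx, ht]; simp
  have hB2 : dt (dx (dx B)) = con s * dx (dx (dx B)) := by rw [dt_dx, hB1]; simp
  have hB3 : dt (dx (dx (dx B))) = con s * dx (dx (dx (dx B))) := by rw [dt_dx, hB2]; simp
  obtain ⟨y, hy⟩ : ∃ y : SmoothFn D, y = x + con s * t := ⟨_, rfl⟩
  have hyx : dx y = 1 := by simp [hy]
  have hyt : dt y = con s := by simp [hy]
  have hyu : du y = 0 := by simp [hy]
  obtain ⟨c₃, h₃⟩ := exists_const hD hne (dx (dx (dx B))) hx (by rw [hB3, hx, mul_zero])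
    (by simp [du_dx, hu])
  obtain ⟨c₂, h₂⟩ := exists_const hD hne (dx (dx B) - con c₃ * y)
    (by simp [Derivation.leibniz, h₃, hyx])
    (by simp [Derivation.leibniz, h₃, hB2, hyt]; ring) (by simp [du_dx, hu, hyu])
  rw [sub_eq_iff_eq_add] at h₂
  obtain ⟨c₁, h₁⟩ := exists_const hD hne (2 * dx B - con c₃ * y ^ 2 - 2 * con c₂ * y)
    (by simp [Derivation.leibniz, Derivation.leibniz_pow, h₂, hyx]; ring)
    (by simp [Derivation.leibniz, Derivation.leibniz_pow, h₂, hB1, hyt]; ring)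
    (by simp [Derivation.leibniz, Derivation.leibniz_pow, du_dx, hu, hyu])
  obtain ⟨c₀, h₀⟩ := exists_const hD hne
    (6 * B - con c₃ * y ^ 3 - 3 * con c₂ * y ^ 2 - 3 * con c₁ * y)
    (by
      simp [Derivation.leibniz, Derivation.leibniz_pow, hyx]
      linear_combination 3 * h₁)
    (by
      simp [Derivation.leibniz, Derivation.leibniz_pow, ht, hyt]
      linear_combination 3 * con s * h₁)
    (by simp [Derivation.leibniz, Derivation.leibniz_pow, hu, hyu])
  refine ⟨![c₀ / 6, c₁ / 2, c₂ / 2, c₃ / 6], fun z => ?_⟩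
  have h := congrArg (fun f : SmoothFn D => f z) h₀
  simp [hy] at h
  simp [cubic]
  linear_combination h / 6

end families

end JetPoly

namespace JetPoly

open MvPolynomial SmoothFn

variable {𝕜 : Type*} [RCLike 𝕜] {D : TopologicalSpace.Opens (𝕜 × 𝕜 × 𝕜)}

section families

variable {α β γ κ μ : 𝕜} {ξ φ : 𝕜 → 𝕜 → 𝕜 → 𝕜} {ξ' φ' A B : SmoothFn D}

/-- If `f_t = -f²`, then `1 / f` is a translate of `t`. -/
theorem exists_inv_eq_t_add (hD : Convex ℝ (D : Set (𝕜 × 𝕜 × 𝕜))) (hne : Nonempty D)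
    (hx : dx A = 0) (hu : du A = 0) (ht : dt A = -A ^ 2) (h₀ : ∀ z, A z ≠ 0) :
    ∃ c : 𝕜, A * (t + con c) = 1 := by
  obtain ⟨v, hv⟩ := exists_inv h₀
  have h1 : A * v = 1 := by
    ext z
    simp [hv, h₀ z]
  obtain ⟨c, hc⟩ := exists_const hD hne (v - t) (by simp [der_inv h₀ hv, hx])
    (by
      simp only [map_sub, der_inv h₀ hv, ht, dt_t]
      linear_combination (v * A + 1) * h1) (by simp [der_inv h₀ hv, hu])
  have hc' : v - t = con c := hc
  exact ⟨c, by linear_combination h1 - A * hc'⟩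

theorem eq_inv_of_mul_eq_one {c : 𝕜} (h : A * (t + con c) = 1) (z : D) :
    (z : 𝕜 × 𝕜 × 𝕜).2.1 + c ≠ 0 ∧ A z = ((z : 𝕜 × 𝕜 × 𝕜).2.1 + c)⁻¹ := by
  have h1 := congrArg (fun f : SmoothFn D => f z) h
  simp at h1
  exact ⟨right_ne_zero_of_mul_eq_one h1, eq_inv_of_mul_eq_one_left h1⟩

/-- The function `1 / (t + c)`. -/
theorem exists_inv_t_add {c : 𝕜} (h : ∀ z : D, (z : 𝕜 × 𝕜 × 𝕜).2.1 + c ≠ 0) :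
    ∃ A : SmoothFn D, A * (t + con c) = 1 ∧ dx A = 0 ∧ du A = 0 ∧ dt A = -A ^ 2 := by
  have h' : ∀ z : D, (t + con c : SmoothFn D) z ≠ 0 := h
  obtain ⟨v, hv⟩ := exists_inv h'
  refine ⟨v, ?_, ?_, ?_, ?_⟩
  · ext z
    simp [hv, h z]
  all_goals simp [der_inv h' hv]

variable (hξ : ∀ x t u (h : (x, t, u) ∈ D), ξ x t u = ξ' ⟨_, h⟩)
  (hφ : ∀ x t u (h : (x, t, u) ∈ D), φ x t u = φ' ⟨_, h⟩)
include hξ hφ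

theorem exists_familyI (hD : Convex ℝ (D : Set (𝕜 × 𝕜 × 𝕜))) (hAu : du A = 0)
    (hA : φ' = A * u) (h₁ : κ = 0) (h₂ : ξ' = 0) (h₃ : dx A = 0)
    (h₅ : dt (dt A) = A ^ 3 - A * dt A) : ∃ g, FamilyI κ ξ φ D g := by
  obtain ⟨g, hg, rfl⟩ := exists_ofTime hD h₃ hAu
  refine ⟨g, h₁, hg, fun t ht => ?_, fun x t u hz => ?_⟩
  · obtain ⟨x, u, hz⟩ := ht
    rw [dt_ofTime, dt_ofTime] at h₅
    have h := congrArg (fun f : SmoothFn D => f ⟨_, hz⟩) h₅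
    simp at h
    linear_combination h
  · rw [hξ _ _ _ hz, hφ _ _ _ hz, h₂, hA]
    simp

theorem exists_of_familyI {g : 𝕜 → 𝕜} (H : FamilyI κ ξ φ D g) :
    ∃ A : SmoothFn D, du A = 0 ∧ φ' = A * u ∧ ξ' = 0 ∧ dx A = 0 ∧
      dt (dt A) = A ^ 3 - A * dt A ∧ ∀ z : D, A z = g (z : 𝕜 × 𝕜 × 𝕜).2.1 := by
  obtain ⟨-, hg, hode, h⟩ := H
  refine ⟨ofTime g hg, du_ofTime hg, ?_, ?_, dx_ofTime hg, ?_, fun z => rfl⟩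
  · ext z
    rw [← hφ _ _ _ z.2, (h _ _ _ z.2).2]
    simp
  · ext z
    rw [← hξ _ _ _ z.2, (h _ _ _ z.2).1]
    simp
  · rw [dt_ofTime, dt_ofTime]
    ext z
    have := hode _ (t_mem_times z)
    simp
    linear_combination this

theorem exists_familyII (hD : Convex ℝ (D : Set (𝕜 × 𝕜 × 𝕜))) (hne : Nonempty D)
    (hξu : du ξ' = 0) (hB : φ' = -(2 * con μ * ξ' * dt ξ')) (h₁ : 1 + 2 * γ * μ = 0)
    (h₂ : dx ξ' = 0) (h₄ : dt (dt ξ') = 0) : ∃ c₁ c₂, FamilyII γ μ ξ φ D c₁ c₂ := by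
  obtain ⟨c₁, hc₁⟩ := exists_const hD hne (dt ξ') (by rw [← dt_dx, h₂, map_zero]) h₄
    (by rw [du_dt, hξu, map_zero])
  obtain ⟨c₂, hc₂⟩ := exists_const hD hne (ξ' - con c₁ * t) (by simp [h₂]) (by simp [hc₁])
    (by simp [hξu])
  rw [sub_eq_iff_eq_add] at hc₂
  refine ⟨c₁, c₂, h₁, fun x t u hz => ?_⟩
  rw [hξ _ _ _ hz, hφ _ _ _ hz, hB, hc₁, hc₂]
  simp
  constructor <;> ring

theorem of_familyII {c₁ c₂ : 𝕜} (H : FamilyII γ μ ξ φ D c₁ c₂) :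
    du ξ' = 0 ∧ φ' = -(2 * con μ * ξ' * dt ξ') ∧ dx ξ' = 0 ∧ dt ξ' = con c₁ := by
  have h1 : ξ' = con c₁ * t + con c₂ := by
    ext z
    rw [← hξ _ _ _ z.2, (H.2 _ _ _ z.2).1]
    simp
  have h2 : dt ξ' = con c₁ := by simp [h1]
  refine ⟨by simp [h1], ?_, by simp [h1], h2⟩
  rw [h2, h1]
  ext z
  rw [← hφ _ _ _ z.2, (H.2 _ _ _ z.2).2]
  simp
  ring

theorem exists_familyIII (hD : Convex ℝ (D : Set (𝕜 × 𝕜 × 𝕜))) (hne : Nonempty D)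
    (hξu : du ξ' = 0) (hAu : du A = 0) (hB : φ' = A * u - 3 * con μ * A * ξ' ^ 2) (h₁ : κ = 0)
    (h₂ : 1 + 2 * γ * μ = 0) (h₃ : dx ξ' = 0) (h₄ : dx A = 0) (h₅ : dt A = -A ^ 2)
    (h₆ : ∀ z, A z ≠ 0) (h₇ : dt ξ' = 2 * A * ξ') : ∃ c₁ c₂, FamilyIII γ κ μ ξ φ D c₁ c₂ := by
  obtain ⟨c₁, hc₁⟩ := exists_inv_eq_t_add hD hne h₄ hAu h₅ h₆
  obtain ⟨c₂, hc₂⟩ := exists_const hD hne (ξ' * A ^ 2)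
    (by simp [Derivation.leibniz, Derivation.leibniz_pow, h₃, h₄])
    (by simp [Derivation.leibniz, Derivation.leibniz_pow, h₅, h₇]; ring)
    (by simp [Derivation.leibniz, Derivation.leibniz_pow, hξu, hAu])
  have h8 : ξ' = con c₂ * (t + con c₁) ^ 2 := by
    have hc₂' : ξ' * A ^ 2 = con c₂ := hc₂
    linear_combination (t + con c₁) ^ 2 * hc₂' - ξ' * (A * (t + con c₁) + 1) * hc₁
  refine ⟨c₁, c₂, h₁, h₂, fun x t u hz => ?_⟩
  obtain ⟨h9, h10⟩ := eq_inv_of_mul_eq_one hc₁ ⟨_, hz⟩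
  refine ⟨h9, ?_, ?_⟩
  · rw [hξ _ _ _ hz, h8]
    simp
  · rw [hφ _ _ _ hz, hB, h8]
    simp only [SmoothFn.coe_sub, SmoothFn.coe_mul, SmoothFn.coe_pow, SmoothFn.coe_add, h10,
      SmoothFn.coe_ofNat, coe_algebraMap, t_apply, u_apply]
    field_simp

theorem exists_of_familyIII {c₁ c₂ : 𝕜} (H : FamilyIII γ κ μ ξ φ D c₁ c₂) :
    ∃ A : SmoothFn D, du ξ' = 0 ∧ du A = 0 ∧ φ' = A * u - 3 * con μ * A * ξ' ^ 2 ∧ dx ξ' = 0 ∧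
      dx A = 0 ∧ dt A = -A ^ 2 ∧ (∀ z, A z ≠ 0) ∧ dt ξ' = 2 * A * ξ' := by
  obtain ⟨-, -, H⟩ := H
  obtain ⟨A, hA, hx, hu, ht⟩ := exists_inv_t_add (D := D) (c := c₁) fun z => (H _ _ _ z.2).1
  have h1 : ξ' = con c₂ * (t + con c₁) ^ 2 := by
    ext z
    rw [← hξ _ _ _ z.2, (H _ _ _ z.2).2.1]
    simp
  have h0 : ∀ z, A z ≠ 0 := fun z => by
    rw [(eq_inv_of_mul_eq_one hA z).2]
    exact inv_ne_zero (H _ _ _ z.2).1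
  refine ⟨A, by simp [h1, Derivation.leibniz_pow], hu, ?_, by simp [h1, Derivation.leibniz_pow],
    hx, ht, h0, ?_⟩
  · ext z
    obtain ⟨h9, h10⟩ := eq_inv_of_mul_eq_one hA z
    rw [← hφ _ _ _ z.2, (H _ _ _ z.2).2.2, h1]
    simp only [SmoothFn.coe_sub, SmoothFn.coe_mul, SmoothFn.coe_pow, SmoothFn.coe_add, h10,
      SmoothFn.coe_ofNat, coe_algebraMap, t_apply, u_apply]
    field_simp
  · simp only [h1, Derivation.leibniz, Derivation.leibniz_pow, Derivation.map_algebraMap, map_add,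
      dt_t, smul_eq_mul, nsmul_eq_mul]
    push_cast
    linear_combination -2 * con c₂ * (t + con c₁) * hA

theorem exists_familyIV (hD : Convex ℝ (D : Set (𝕜 × 𝕜 × 𝕜))) (hne : Nonempty D)
    (hξu : du ξ' = 0) (hBu : du φ' = 0) (hα : α = 0) (hβ : β = 0) (hγ : γ = 0) (h₁ : dx ξ' = 0)
    (h₂ : dt ξ' = 0) (h₃ : ξ' ^ 2 = con κ) (h₅ : dt φ' = ξ' * dx φ')
    (h₆ : dx (dx (dx (dx φ'))) = 0) : ∃ s c, FamilyIV α β γ κ ξ φ D s c := by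
  obtain ⟨s, rfl⟩ := exists_const hD hne ξ' h₁ h₂ hξu
  obtain ⟨c, hc⟩ := exists_cubic hD hne s hBu h₅ h₆
  refine ⟨s, c, hα, hβ, hγ, ?_, fun x t u hz => ⟨?_, ?_⟩⟩
  · rw [← map_pow, ← sub_eq_zero, ← map_sub] at h₃
    exact sub_eq_zero.1 (con_eq_zero hne h₃)
  · rw [hξ _ _ _ hz, coe_algebraMap]
  · rw [hφ _ _ _ hz, hc]

theorem of_familyIV {s : 𝕜} {c : Fin 4 → 𝕜} (H : FamilyIV α β γ κ ξ φ D s c) :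
    ξ' = con s ∧ φ' = con (c 3) * (x + con s * t) ^ 3 + con (c 2) * (x + con s * t) ^ 2
      + con (c 1) * (x + con s * t) + con (c 0) := by
  obtain ⟨-, -, -, -, H⟩ := H
  constructor <;> ext z
  · rw [← hξ _ _ _ z.2, (H _ _ _ z.2).1, coe_algebraMap]
  · rw [← hφ _ _ _ z.2, (H _ _ _ z.2).2]
    simp [cubic]

theorem exists_familyV (hD : Convex ℝ (D : Set (𝕜 × 𝕜 × 𝕜))) (hne : Nonempty D)
    (hξu : du ξ' = 0) (hB : φ' = 4 * dx ξ' * u + 2 * con μ * dx ξ' * ξ' ^ 2)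
    (hα : α = -3 / 2) (hβ : β = 2) (hγ : γ = 0) (h₁ : dx (dx ξ') = 0) (h₂ : dt ξ' = 0)
    (h₅ : con κ = 4 * con μ * dx ξ' ^ 2) (h₀ : dx ξ' ≠ 0) :
    ∃ s c₁, FamilyV α β γ κ μ ξ φ D s c₁ := by
  obtain ⟨b, hb⟩ := exists_const hD hne (dx ξ') h₁ (by rw [dt_dx, h₂, map_zero])
    (by rw [du_dx, hξu, map_zero])
  obtain ⟨e, he⟩ := exists_const hD hne (ξ' - con b * x) (by simp [hb]) (by simp [h₂])
    (by simp [hξu])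
  rw [sub_eq_iff_eq_add] at he
  have hb0 : b ≠ 0 := by
    rintro rfl
    exact h₀ (by rw [hb, map_zero])
  refine ⟨2 * b, e / b, hα, hβ, hγ, ?_, fun x t u hz => ⟨?_, ?_⟩⟩
  · obtain ⟨z⟩ := hne
    have h := congrArg (fun f : SmoothFn D => f z) h₅
    simp only [hb, coe_algebraMap, SmoothFn.coe_mul, SmoothFn.coe_pow, SmoothFn.coe_ofNat] at h
    rw [h]
    ring
  · rw [hξ _ _ _ hz, he]
    simp
    field_simp
    ring
  · rw [hφ _ _ _ hz, hB, hb, he]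
    simp
    field_simp
    ring

theorem of_familyV {s c₁ : 𝕜} (H : FamilyV α β γ κ μ ξ φ D s c₁) :
    ∃ b : 𝕜, s = 2 * b ∧ dx ξ' = con b ∧ dt ξ' = 0 ∧ du ξ' = 0 ∧
      φ' = 4 * dx ξ' * u + 2 * con μ * dx ξ' * ξ' ^ 2 := by
  obtain ⟨-, -, -, -, H⟩ := H
  have h1 : ξ' = con (s / 2) * (x + con c₁) := by
    ext z
    rw [← hξ _ _ _ z.2, (H _ _ _ z.2).1]
    simp
  have h2 : dx ξ' = con (s / 2) := by simp [h1]
  refine ⟨s / 2, by ring, h2, by simp [h1], by simp [h1], ?_⟩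
  rw [h2, h1]
  ext z
  rw [← hφ _ _ _ z.2, (H _ _ _ z.2).2]
  simp only [SmoothFn.coe_mul, SmoothFn.coe_pow, SmoothFn.coe_add, SmoothFn.coe_ofNat,
    coe_algebraMap, x_apply, u_apply]
  ring

theorem exists_familyVII (hD : Convex ℝ (D : Set (𝕜 × 𝕜 × 𝕜))) (hne : Nonempty D)
    (hAu : du A = 0) (hBu : du B = 0) (hB : φ' = A * u + B) (hα : α = 0) (hβ : β = 0)
    (hγ : γ = 0) (h₁ : κ = 0) (h₂ : ξ' = 0) (h₃ : dx A = 0) (h₄ : dt A = -A ^ 2)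
    (h₅ : ∀ z, A z ≠ 0) (h₆ : dt B = -(A * B)) (h₇ : dx (dx (dx (dx B))) = 0) :
    ∃ c c₄, FamilyVII α β γ κ ξ φ D c c₄ := by
  obtain ⟨c₄, hc₄⟩ := exists_inv_eq_t_add hD hne h₃ hAu h₄ h₅
  obtain ⟨c, hc⟩ := exists_cubic hD hne (B := B * (t + con c₄)) 0
    (by simp [Derivation.leibniz, hBu])
    (by
      simp [Derivation.leibniz, h₆]
      linear_combination -B * hc₄)
    (by simp [Derivation.leibniz, h₇])
  refine ⟨c, c₄, hα, hβ, hγ, h₁, fun x t u hz => ?_⟩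
  obtain ⟨h9, h10⟩ := eq_inv_of_mul_eq_one hc₄ ⟨_, hz⟩
  have h11 := hc ⟨_, hz⟩
  simp at h9 h10 h11
  refine ⟨h9, ?_, ?_⟩
  · rw [hξ _ _ _ hz, h₂, SmoothFn.coe_zero]
  · rw [hφ _ _ _ hz, hB, ← h11]
    simp [h10]
    field_simp

theorem exists_of_familyVII {c : Fin 4 → 𝕜} {c₄ : 𝕜} (H : FamilyVII α β γ κ ξ φ D c c₄) :
    ∃ A B : SmoothFn D, du A = 0 ∧ du B = 0 ∧ φ' = A * u + B ∧ ξ' = 0 ∧ dx A = 0 ∧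
      dt A = -A ^ 2 ∧ (∀ z, A z ≠ 0) ∧ dt B = -(A * B) ∧ dx (dx (dx (dx B))) = 0 := by
  obtain ⟨-, -, -, -, H⟩ := H
  obtain ⟨A, hA, hx, hu, ht⟩ := exists_inv_t_add (D := D) (c := c₄) fun z => (H _ _ _ z.2).1
  have h0 : ∀ z, A z ≠ 0 := fun z => by
    rw [(eq_inv_of_mul_eq_one hA z).2]
    exact inv_ne_zero (H _ _ _ z.2).1
  obtain ⟨P, hP⟩ : ∃ P : SmoothFn D,
      P = con (c 3) * x ^ 3 + con (c 2) * x ^ 2 + con (c 1) * x + con (c 0) := ⟨_, rfl⟩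
  have hPu : du P = 0 := by simp [hP, Derivation.leibniz, Derivation.leibniz_pow]
  have hPt : dt P = 0 := by simp [hP, Derivation.leibniz, Derivation.leibniz_pow]
  have hPx : dx (dx (dx (dx P))) = 0 := by
    simp [hP, Derivation.leibniz, Derivation.leibniz_pow]
  refine ⟨A, A * P, hu, by simp [Derivation.leibniz, hu, hPu], ?_, ?_, hx, ht, h0, ?_, ?_⟩
  · ext z
    rw [← hφ _ _ _ z.2, (H _ _ _ z.2).2.2]
    simp [hP, (eq_inv_of_mul_eq_one hA z).2, cubic]
    ring
  · ext z
    rw [← hξ _ _ _ z.2, (H _ _ _ z.2).2.1, SmoothFn.coe_zero]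
  · simp [Derivation.leibniz, hPt, ht]
    ring
  · simp [Derivation.leibniz, hx, hPx]

omit hξ hφ in
theorem familyIV_of_familyVI {c : Fin 4 → 𝕜} (H : FamilyVI α β γ κ ξ φ D c) :
    FamilyIV α β γ κ ξ φ D 0 c := by
  obtain ⟨h1, h2, h3, h4, H⟩ := H
  exact ⟨h1, h2, h3, by simp [h4], fun x t u hz => by simpa using H x t u hz⟩

end families

end JetPoly

namespace JetPoly

open MvPolynomial SmoothFn

variable {𝕜 : Type*} [RCLike 𝕜] {D : TopologicalSpace.Opens (𝕜 × 𝕜 × 𝕜)}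

/-! ### Classical symmetries -/

/-- The prolongation applied to the equation. -/
theorem PR_equationPoly (α β γ κ μ : 𝕜) (ξ τ φ : SmoothFn D) :
    PR ξ τ φ (equationPoly α β γ κ μ (X (0, 2)) (X (2, 2))) = coeff ξ τ φ (0, 2)
      - cst κ * coeff ξ τ φ (2, 0) - 2 * cst γ * (C φ * X (2, 0) + C u * coeff ξ τ φ (2, 0)
        + 2 * X (1, 0) * coeff ξ τ φ (1, 0)) - C φ * X (4, 0) - C u * coeff ξ τ φ (4, 0)
      - cst μ * coeff ξ τ φ (2, 2) - cst α * (coeff ξ τ φ (1, 0) * X (3, 0)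
        + X (1, 0) * coeff ξ τ φ (3, 0)) - 2 * cst β * X (2, 0) * coeff ξ τ φ (2, 0) := by
  have h2 : PR ξ τ φ (2 : JetPoly D) = 0 := by simpa using (PR ξ τ φ).map_natCast 2
  have hc : ∀ a : 𝕜, PR ξ τ φ (cst a) = 0 := fun a => by simp [cst, PR_C]
  have hu : PR ξ τ φ (C u) = C φ := by simp [PR_C]
  simp only [equationPoly, map_sub, map_add, Derivation.leibniz, Derivation.leibniz_pow,
    smul_eq_mul, nsmul_eq_mul, hc, h2, hu, PR_X ξ τ φ 0 2 (by norm_num),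
    PR_X ξ τ φ 2 0 (by norm_num), PR_X ξ τ φ 1 0 (by norm_num), PR_X ξ τ φ 4 0 (by norm_num),
    PR_X ξ τ φ 2 2 (by norm_num), PR_X ξ τ φ 3 0 (by norm_num), Nat.cast_ofNat, Nat.reduceSub,
    pow_one]
  ring

theorem u_mul_cancel {f : SmoothFn D} (h : u * f = 0) : f = 0 := by
  have h1 := mul_der_eq_zero h (0, 0, 1)
  change u * du f = 0 at h1
  have h2 := congrArg du h
  simp only [Derivation.leibniz, du_u, smul_eq_mul, mul_one, h1, map_zero] at h2
  simpa using h2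

variable {α β γ κ μ : 𝕜} {ξ τ φ : SmoothFn D}

set_option maxHeartbeats 1600000 in
/-- The coefficient of `u_xxxt` in the prolongation contains the total derivatives `D_x τ` and
`D_t ξ`, with factors `4 u` and `2 μ`. -/
theorem classical_xi_tau (hμ : μ ≠ 0)
    (H : ∀ (z : D) (p : ℕ × ℕ → 𝕜), p (0, 0) = (z : 𝕜 × 𝕜 × 𝕜).2.2 →
      ev z p (equationPoly α β γ κ μ (X (0, 2)) (X (2, 2))) = 0 →
      ev z p (PR ξ τ φ (equationPoly α β γ κ μ (X (0, 2)) (X (2, 2)))) = 0) :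
    du ξ = 0 ∧ dt ξ = 0 ∧ du τ = 0 ∧ dx τ = 0 := by
  have key : ∀ (z : D) (a b : 𝕜),
      4 * u z * (dx τ z + a * du τ z) + 2 * μ * (dt ξ z + b * du ξ z) = 0 := by
    intro z a b
    -- the jet over `z` with `u_x = a`, `u_t = b`, `u_xxxt = c` and all other coordinates zero, except
    -- for `u_tt`, which the equation determines
    have h : ∀ c : 𝕜, _ := fun c => by
      let p : ℕ × ℕ → 𝕜 := fun k => if k = (0, 0) then (z : 𝕜 × 𝕜 × 𝕜).2.2 else
          if k = (1, 0) then a else if k = (0, 1) then b else if k = (3, 1) then c else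
          if k = (0, 2) then 2 * γ * a ^ 2 else 0
      have e10 : p (1, 0) = a := rfl
      have e01 : p (0, 1) = b := rfl
      have e31 : p (3, 1) = c := rfl
      have e02 : p (0, 2) = 2 * γ * a ^ 2 := rfl
      have e20 : p (2, 0) = 0 := rfl
      have e30 : p (3, 0) = 0 := rfl
      have e40 : p (4, 0) = 0 := rfl
      have e50 : p (5, 0) = 0 := rfl
      have e11 : p (1, 1) = 0 := rfl
      have e12 : p (1, 2) = 0 := rfl
      have e21 : p (2, 1) = 0 := rfl
      have e22 : p (2, 2) = 0 := rfl
      have e03 : p (0, 3) = 0 := rfl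
      have e13 : p (1, 3) = 0 := rfl
      have e23 : p (2, 3) = 0 := rfl
      have e32 : p (3, 2) = 0 := rfl
      have e41 : p (4, 1) = 0 := rfl
      have := H z p rfl (by
        simp only [equationPoly, map_sub, map_add, map_mul, map_pow, ev_C, ev_X, ev_cst, e10, e02,
          e20, e30, e40, e22, map_ofNat]
        ring)
      simp only [PR_equationPoly, coeff, Function.iterate_succ_apply', Function.iterate_zero, id,
        map_sub, map_add, map_neg, Derivation.leibniz, DX_C, DT_C, smul_eq_mul,
        DX_X 1 0 (by norm_num), DX_X 2 0 (by norm_num), DX_X 3 0 (by norm_num),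
        DX_X 4 0 (by norm_num), DX_X 0 1 (by norm_num), DX_X 1 1 (by norm_num),
        DX_X 2 1 (by norm_num), DX_X 3 1 (by norm_num), DX_X 0 2 (by norm_num),
        DX_X 1 2 (by norm_num), DX_X 2 2 (by norm_num), DX_X 0 3 (by norm_num),
        DX_X 1 3 (by norm_num), DT_X 1 0 (by norm_num), DT_X 0 1 (by norm_num),
        DT_X 1 1 (by norm_num), DT_X 0 2 (by norm_num), du_dx, du_dt, dt_dx, Nat.reduceAdd,
        ev_C, ev_X, ev_cst, map_mul (ev z p), map_ofNat, e10, e01, e31, e02, e20, e30, e40, e50,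
        e11, e12, e21, e22, e03, e13, e23, e32, e41, mul_zero, zero_mul, add_zero, zero_add] at this
      exact this
    have h1 := h 1
    have h0 := h 0
    linear_combination h1 - h0
  have k0 := fun z => key z 0 0
  have k1 := fun z => key z 1 0
  have k2 := fun z => key z 0 1
  have hτu : du τ = 0 := by
    refine u_mul_cancel ?_
    ext z
    simp only [SmoothFn.coe_mul, SmoothFn.coe_zero]
    linear_combination (k1 z - k0 z) / 4
  have hξu : du ξ = 0 := by
    refine algebraMap_mul_eq_zero hμ ?_
    ext z
    simp only [SmoothFn.coe_mul, SmoothFn.coe_zero, coe_algebraMap]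
    linear_combination (k2 z - k0 z) / 2
  have k3 : 2 * (u * dx τ) + con μ * dt ξ = 0 := by
    ext z
    simp only [SmoothFn.coe_mul, SmoothFn.coe_add, SmoothFn.coe_zero, coe_algebraMap,
      SmoothFn.coe_ofNat]
    linear_combination k0 z / 2
  have k4 := congrArg du k3
  simp only [Derivation.leibniz, map_add, du_dx, du_dt, hτu, hξu, map_zero, smul_eq_mul, mul_zero,
    du_u, mul_one, zero_add, add_zero, derivation_ofNat, Derivation.map_algebraMap] at k4
  have hτx : dx τ = 0 := natCast_mul_eq_zero two_ne_zero (by push_cast; linear_combination k4)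
  refine ⟨hξu, algebraMap_mul_eq_zero hμ ?_, hτu, hτx⟩
  rw [hτx] at k3
  linear_combination k3

set_option maxHeartbeats 1600000 in
/-- The coefficient of `u_xt²` in the prolongation is a multiple of `μ ∂²φ/∂u²`. -/
theorem classical_phi (hμ : μ ≠ 0) (hξu : du ξ = 0) (hξt : dt ξ = 0) (hτu : du τ = 0)
    (hτx : dx τ = 0)
    (H : ∀ (z : D) (p : ℕ × ℕ → 𝕜), p (0, 0) = (z : 𝕜 × 𝕜 × 𝕜).2.2 →
      ev z p (equationPoly α β γ κ μ (X (0, 2)) (X (2, 2))) = 0 →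
      ev z p (PR ξ τ φ (equationPoly α β γ κ μ (X (0, 2)) (X (2, 2)))) = 0) :
    du (du φ) = 0 := by
  refine algebraMap_mul_eq_zero hμ ?_
  ext z
  -- the jet over `z` with `u_xt = c` and all other coordinates zero satisfies the equation
  have h : ∀ c : 𝕜, _ := fun c => by
    let p : ℕ × ℕ → 𝕜 := fun k => if k = (0, 0) then (z : 𝕜 × 𝕜 × 𝕜).2.2 else
        if k = (1, 1) then c else 0
    have e10 : p (1, 0) = 0 := rfl
    have e01 : p (0, 1) = 0 := rfl
    have e31 : p (3, 1) = 0 := rfl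
    have e02 : p (0, 2) = 0 := rfl
    have e20 : p (2, 0) = 0 := rfl
    have e30 : p (3, 0) = 0 := rfl
    have e40 : p (4, 0) = 0 := rfl
    have e50 : p (5, 0) = 0 := rfl
    have e11 : p (1, 1) = c := rfl
    have e12 : p (1, 2) = 0 := rfl
    have e21 : p (2, 1) = 0 := rfl
    have e22 : p (2, 2) = 0 := rfl
    have e03 : p (0, 3) = 0 := rfl
    have e13 : p (1, 3) = 0 := rfl
    have e23 : p (2, 3) = 0 := rfl
    have e32 : p (3, 2) = 0 := rfl
    have e41 : p (4, 1) = 0 := rfl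
    have := H z p rfl (by
      simp only [equationPoly, map_sub, map_add, map_mul, map_pow, ev_C, ev_X, ev_cst, e10, e02,
        e20, e30, e40, e22, map_ofNat]
      ring)
    simp only [PR_equationPoly, coeff, Function.iterate_succ_apply', Function.iterate_zero, id,
      map_sub, map_add, map_neg, Derivation.leibniz, DX_C, DT_C, smul_eq_mul,
      DX_X 1 0 (by norm_num), DX_X 2 0 (by norm_num), DX_X 3 0 (by norm_num),
      DX_X 4 0 (by norm_num), DX_X 0 1 (by norm_num), DX_X 1 1 (by norm_num),
      DX_X 2 1 (by norm_num), DX_X 3 1 (by norm_num), DX_X 0 2 (by norm_num),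
      DX_X 1 2 (by norm_num), DX_X 2 2 (by norm_num), DX_X 0 3 (by norm_num),
      DX_X 1 3 (by norm_num), DT_X 1 0 (by norm_num), DT_X 0 1 (by norm_num),
      DT_X 1 1 (by norm_num), DT_X 0 2 (by norm_num), du_dx, du_dt, dt_dx, hξu, hξt, hτu, hτx,
      map_zero, Nat.reduceAdd,
      ev_C, ev_X, ev_cst, map_mul (ev z p), map_ofNat, e10, e01, e31, e02, e20, e30, e40, e50,
      e11, e12, e21, e22, e03, e13, e23, e32, e41, mul_zero, zero_mul, add_zero, zero_add] at this
    exact this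
  -- the second difference in `c` isolates the coefficient of `u_xt²`
  have h1 := h 1
  have h2 := h (-1)
  have h0 := h 0
  simp only [SmoothFn.coe_mul, SmoothFn.coe_zero, coe_algebraMap]
  linear_combination (2 * h0 - h1 - h2) / 4

end JetPoly

namespace JetPoly

open MvPolynomial SmoothFn

variable {𝕜 : Type*} [RCLike 𝕜] {D : TopologicalSpace.Opens (𝕜 × 𝕜 × 𝕜)}
variable {α β γ κ μ : 𝕜} {ξ τ A B : SmoothFn D}

set_option maxHeartbeats 1600000 in
/-! ### Classical symmetries affine in `u` -/

/-- The prolongation of a vector field whose coefficients are affine in `u`, applied to the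
equation. -/
theorem PR_equationPoly_affine (hξu : du ξ = 0) (hξt : dt ξ = 0) (hτu : du τ = 0) (hτx : dx τ = 0)
    (hA : du A = 0) (hB : du B = 0) :
    PR ξ τ (A * u + B) (equationPoly α β γ κ μ (X (0, 2)) (X (2, 2))) =
      (C A * X (0, 2) + 2 * C (dt A) * X (0, 1) + C (dt (dt A) * u + dt (dt B))
        - 2 * C (dt τ) * X (0, 2) - C (dt (dt τ)) * X (0, 1))
      - (cst κ + 2 * cst γ * C u + 2 * cst β * X (2, 0)) *
        (C A * X (2, 0) + 2 * C (dx A) * X (1, 0) + C (dx (dx A) * u + dx (dx B))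
          - 2 * C (dx ξ) * X (2, 0) - C (dx (dx ξ)) * X (1, 0))
      - C (A * u + B) * (2 * cst γ * X (2, 0) + X (4, 0))
      - (4 * cst γ * X (1, 0) + cst α * X (3, 0)) *
        (C A * X (1, 0) + C (dx A * u + dx B) - C (dx ξ) * X (1, 0))
      - cst α * X (1, 0) * (C A * X (3, 0) + 3 * C (dx A) * X (2, 0) + 3 * C (dx (dx A)) * X (1, 0)
        + C (dx (dx (dx A)) * u + dx (dx (dx B))) - 3 * C (dx ξ) * X (3, 0)
        - 3 * C (dx (dx ξ)) * X (2, 0) - C (dx (dx (dx ξ))) * X (1, 0))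
      - C u * (C A * X (4, 0) + 4 * C (dx A) * X (3, 0) + 6 * C (dx (dx A)) * X (2, 0)
        + 4 * C (dx (dx (dx A))) * X (1, 0)
        + C (dx (dx (dx (dx A))) * u + dx (dx (dx (dx B)))) - 4 * C (dx ξ) * X (4, 0)
        - 6 * C (dx (dx ξ)) * X (3, 0) - 4 * C (dx (dx (dx ξ))) * X (2, 0)
        - C (dx (dx (dx (dx ξ)))) * X (1, 0))
      - cst μ * (C A * X (2, 2) + 2 * C (dx A) * X (1, 2) + C (dx (dx A)) * X (0, 2)
        + 2 * C (dt A) * X (2, 1) + 4 * C (dx (dt A)) * X (1, 1)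
        + 2 * C (dx (dx (dt A))) * X (0, 1) + C (dt (dt A)) * X (2, 0)
        + 2 * C (dx (dt (dt A))) * X (1, 0)
        + C (dx (dx (dt (dt A))) * u + dx (dx (dt (dt B)))) - 2 * C (dx ξ) * X (2, 2)
        - C (dx (dx ξ)) * X (1, 2) - 2 * C (dt τ) * X (2, 2) - C (dt (dt τ)) * X (2, 1)) := by
  have hτtx : dx (dt τ) = 0 := by rw [← dt_dx, hτx, map_zero]
  have hτttx : dx (dt (dt τ)) = 0 := by rw [← dt_dx, hτtx, map_zero]
  simp only [PR_equationPoly, coeff, Function.iterate_succ_apply', Function.iterate_zero, id,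
      map_sub, map_add, map_neg, map_mul C, Derivation.leibniz, DX_C, DT_C, smul_eq_mul,
      DX_X 1 0 (by norm_num), DX_X 2 0 (by norm_num), DX_X 3 0 (by norm_num),
      DX_X 4 0 (by norm_num), DX_X 0 1 (by norm_num), DX_X 1 1 (by norm_num),
      DX_X 2 1 (by norm_num), DX_X 3 1 (by norm_num), DX_X 0 2 (by norm_num),
      DX_X 1 2 (by norm_num), DX_X 2 2 (by norm_num), DX_X 0 3 (by norm_num),
      DX_X 1 3 (by norm_num), DT_X 1 0 (by norm_num), DT_X 0 1 (by norm_num),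
      DT_X 1 1 (by norm_num), DT_X 0 2 (by norm_num), du_dx, du_dt, dt_dx, hξu, hξt, hτu, hτx,
      hτtx, hτttx, hA, hB, dx_u, dt_u, du_u, map_one,
      map_zero, Nat.reduceAdd, mul_zero, zero_mul, add_zero, zero_add, mul_one]
  ring

/-- The coefficients of `u_xxt`, `u_xtt`, `u_xxtt`, `u_xxxx` and `u_xx` determine the classical
symmetries. -/
theorem classical_affine (hμ : μ ≠ 0) (hξu : du ξ = 0) (hξt : dt ξ = 0) (hτu : du τ = 0)
    (hτx : dx τ = 0) (hA : du A = 0) (hB : du B = 0)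
    (H : ∀ (z : D) (p : ℕ × ℕ → 𝕜), p (0, 0) = (z : 𝕜 × 𝕜 × 𝕜).2.2 →
      ev z p (equationPoly α β γ κ μ (X (0, 2)) (X (2, 2))) = 0 →
      ev z p (PR ξ τ (A * u + B) (equationPoly α β γ κ μ (X (0, 2)) (X (2, 2)))) = 0) :
    dx ξ = 0 ∧ dt (dt τ) = 0 ∧ A = -2 * dt τ ∧ B = 0 ∧ con κ * dt τ = 0 := by
  -- the criterion at the jets with prescribed `u_xxt`, `u_xtt`, `u_xxtt`, `u_xxxx`, `u_xx`;
  -- the equation determines `u_tt`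
  have key : ∀ (z : D) (a b c d e : 𝕜), _ := fun z a b c d e => by
    let p : ℕ × ℕ → 𝕜 := fun k => if k = (0, 0) then (z : 𝕜 × 𝕜 × 𝕜).2.2 else
        if k = (2, 1) then a else if k = (1, 2) then b else if k = (2, 2) then c else
        if k = (4, 0) then d else if k = (2, 0) then e else
        if k = (0, 2) then μ * c + u z * d + (κ + 2 * γ * u z) * e + β * e ^ 2 else 0
    have e10 : p (1, 0) = 0 := rfl
    have e01 : p (0, 1) = 0 := rfl
    have e02 : p (0, 2) = μ * c + u z * d + (κ + 2 * γ * u z) * e + β * e ^ 2 := rfl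
    have e20 : p (2, 0) = e := rfl
    have e30 : p (3, 0) = 0 := rfl
    have e40 : p (4, 0) = d := rfl
    have e11 : p (1, 1) = 0 := rfl
    have e12 : p (1, 2) = b := rfl
    have e21 : p (2, 1) = a := rfl
    have e22 : p (2, 2) = c := rfl
    have := H z p rfl (by
      simp only [equationPoly, map_sub, map_add, map_mul, map_pow, ev_C, ev_X, ev_cst, e10, e02,
        e20, e30, e40, e22, map_ofNat]
      ring)
    simp only [PR_equationPoly_affine hξu hξt hτu hτx hA hB, map_sub (ev z p), map_add (ev z p),
      map_mul (ev z p), map_ofNat, ev_C, ev_X, ev_cst, e10, e01, e02, e20, e30, e40, e11, e12, e21,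
      e22, mul_zero, add_zero, sub_zero, zero_add, SmoothFn.coe_add, SmoothFn.coe_mul] at this
    exact this
  have k0 := fun z => key z 0 0 0 0 0
  have k1 := fun z => key z 1 0 0 0 0
  have k2 := fun z => key z 0 1 0 0 0
  have k3 := fun z => key z 0 0 1 0 0
  have k4 := fun z => key z 0 0 0 1 0
  have k5 := fun z => key z 0 0 0 0 1
  have k6 := fun z => key z 0 0 0 0 (-1)
  have two_cancel : ∀ f : SmoothFn D, 2 * f = 0 → f = 0 := fun f h =>
    natCast_mul_eq_zero two_ne_zero (by push_cast; exact h)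
  have h1 : 2 * dt A - dt (dt τ) = 0 := by
    refine algebraMap_mul_eq_zero hμ ?_
    ext z
    simp only [SmoothFn.coe_mul, SmoothFn.coe_sub, SmoothFn.coe_zero, coe_algebraMap,
      SmoothFn.coe_ofNat]
    linear_combination k0 z - k1 z
  have h2 : 2 * dx A - dx (dx ξ) = 0 := by
    refine algebraMap_mul_eq_zero hμ ?_
    ext z
    simp only [SmoothFn.coe_mul, SmoothFn.coe_sub, SmoothFn.coe_zero, coe_algebraMap,
      SmoothFn.coe_ofNat]
    linear_combination k0 z - k2 z
  have h3 : 2 * dx ξ - con μ * dx (dx A) = 0 := by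
    refine algebraMap_mul_eq_zero hμ ?_
    ext z
    simp only [SmoothFn.coe_mul, SmoothFn.coe_sub, SmoothFn.coe_zero, coe_algebraMap,
      SmoothFn.coe_ofNat]
    linear_combination k3 z - k0 z
  have h4 : (4 * dx ξ - A - 2 * dt τ - con μ * dx (dx A)) * u - B = 0 := by
    ext z
    simp only [SmoothFn.coe_mul, SmoothFn.coe_sub, SmoothFn.coe_zero, coe_algebraMap,
      SmoothFn.coe_ofNat]
    linear_combination k4 z - k0 z
  have h4u := congrArg du h4
  simp only [map_sub, Derivation.leibniz, du_dx, du_dt, hτu, hξu, hA, hB, map_zero, smul_eq_mul,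
    mul_zero, du_u, mul_one, add_zero, sub_zero, derivation_ofNat, Derivation.map_algebraMap]
    at h4u
  have hB0 : B = 0 := by linear_combination u * h4u - h4
  have h5 : A = 2 * dx ξ - 2 * dt τ := by linear_combination h3 - h4u
  have hξxt : dx (dt ξ) = 0 := by rw [hξt, map_zero]
  have hτtx : dx (dt τ) = 0 := by rw [← dt_dx, hτx, map_zero]
  have h6 := congrArg dt h5
  have h7 := congrArg dx h5
  simp only [map_sub, Derivation.leibniz, smul_eq_mul, derivation_ofNat, mul_zero, add_zero, dt_dx,
    hξxt, hτtx, zero_sub, sub_zero] at h6 h7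
  have hτtt : dt (dt τ) = 0 := by
    refine natCast_mul_eq_zero (n := 5) (by norm_num) ?_
    push_cast
    linear_combination 2 * h6 - h1
  have hAx : dx A = 0 := by
    refine natCast_mul_eq_zero (n := 3) (by norm_num) ?_
    push_cast
    linear_combination 2 * h2 - h7
  have hξx : dx ξ = 0 := two_cancel _ (by
    rw [hAx, map_zero] at h3
    linear_combination h3)
  refine ⟨hξx, hτtt, by rw [h5, hξx]; ring, hB0, two_cancel _ ?_⟩
  have hA' : A = -2 * dt τ := by rw [h5, hξx]; ring
  ext z
  have e1 := k5 z
  have e2 := k6 z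
  simp only [hA', hB0, hξx, map_mul, map_neg, Derivation.leibniz, hτtx, hτtt, map_zero, smul_eq_mul,
    mul_zero, derivation_ofNat, SmoothFn.coe_zero, SmoothFn.coe_mul, SmoothFn.coe_neg,
    SmoothFn.coe_ofNat, neg_zero, add_zero] at e1 e2
  simp only [SmoothFn.coe_mul, SmoothFn.coe_zero, coe_algebraMap, SmoothFn.coe_ofNat]
  linear_combination (e2 - e1) / 2

/-- The scaling `u ↦ u / λ²`, `t ↦ λ t`, for `κ = 0`, and the translations are symmetries: the
prolongation multiplies the equation by `-4 τ_t` up to a multiple of `κ τ_t`. -/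
theorem classical_converse (hξx : dx ξ = 0) (hξt : dt ξ = 0) (hξu : du ξ = 0) (hτx : dx τ = 0)
    (hτu : du τ = 0) (hτtt : dt (dt τ) = 0) (hκ : con κ * dt τ = 0) (z : D) (p : ℕ × ℕ → 𝕜)
    (h : ev z p (equationPoly α β γ κ μ (X (0, 2)) (X (2, 2))) = 0) :
    ev z p (PR ξ τ (-2 * dt τ * u) (equationPoly α β γ κ μ (X (0, 2)) (X (2, 2)))) = 0 := by
  have hτtx : dx (dt τ) = 0 := by rw [← dt_dx, hτx, map_zero]
  have hτtu : du (dt τ) = 0 := by rw [du_dt, hτu, map_zero]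
  have hA : du (-2 * dt τ) = 0 := by simp [Derivation.leibniz, hτtu]
  have hAx : dx (-2 * dt τ) = 0 := by simp [Derivation.leibniz, hτtx]
  have hAt : dt (-2 * dt τ) = 0 := by simp [Derivation.leibniz, hτtt]
  have h0 : (0 : SmoothFn D) z = 0 := rfl
  have key := PR_equationPoly_affine (α := α) (β := β) (γ := γ) (κ := κ) (μ := μ) hξu hξt hτu hτx
    hA (map_zero du)
  rw [add_zero] at key
  rw [key]
  have hκz := congrArg (fun f : SmoothFn D => f z) hκ
  simp only [SmoothFn.coe_mul, SmoothFn.coe_zero, coe_algebraMap] at hκz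
  simp only [equationPoly, map_sub, map_add, map_mul, map_pow, ev_C, ev_X, ev_cst, map_ofNat] at h
  simp only [hAx, hAt, hξx, hτtt, map_zero, map_sub (ev z p), map_add (ev z p), map_mul (ev z p),
    map_pow (ev z p), map_ofNat, ev_C, ev_X, ev_cst, zero_mul, mul_zero, add_zero, sub_zero,
    SmoothFn.coe_mul, SmoothFn.coe_add, SmoothFn.coe_neg, SmoothFn.coe_ofNat, SmoothFn.coe_zero]
  linear_combination -4 * dt τ z * h - 2 * p (2, 0) * hκz

end JetPoly

namespace JetPoly

open MvPolynomial SmoothFn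

variable {𝕜 : Type*} [RCLike 𝕜] {D : TopologicalSpace.Opens (𝕜 × 𝕜 × 𝕜)}
variable {α β γ κ μ : 𝕜} {ξ φ : 𝕜 → 𝕜 → 𝕜 → 𝕜} {ξ' φ' A B : SmoothFn D}

/-! ### Classical infinitesimals and the classification -/

/-- The conditions on `(ξ, φ)` with `φ = A u` that characterise the classical infinitesimals: they
say that `ξ = c / (a t + b)` and `A = -2 a / (a t + b)` with constants `a, b, c`, and `a κ = 0`. -/
structure ClassicalForm (κ : 𝕜) (ξ φ A : SmoothFn D) : Prop where
  du_xi : du ξ = 0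
  dx_xi : dx ξ = 0
  du_A : du A = 0
  dx_A : dx A = 0
  phi_eq : φ = A * u
  dt_A : 2 * dt A = A ^ 2
  dt_xi : 2 * dt ξ = A * ξ
  kappa_mul : con κ * A = 0

theorem half_add_half : 2 * con (1 / 2) = (1 : SmoothFn D) := by
  ext z
  rw [SmoothFn.coe_mul, SmoothFn.coe_ofNat, SmoothFn.coe_algebraMap, SmoothFn.coe_one]
  norm_num

theorem smoothOn_extend (f : SmoothFn D) : SmoothOn D fun x t u => f.extend (x, t, u) :=
  f.contDiffOn_extend

/-- A vector field of the shape found by the classical method gives a classical infinitesimal. -/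
theorem isClassical_of (hξ : ∀ x t u (h : (x, t, u) ∈ D), ξ x t u = ξ' ⟨_, h⟩)
    (hφ : ∀ x t u (h : (x, t, u) ∈ D), φ x t u = φ' ⟨_, h⟩) {X T V : SmoothFn D}
    (hV : T * V = 1) (hX : ξ' = X * V) (hF : φ' = -2 * dt T * u * V) (hXx : dx X = 0)
    (hXt : dt X = 0) (hXu : du X = 0) (hTx : dx T = 0) (hTu : du T = 0) (hTtt : dt (dt T) = 0)
    (hκ : con κ * dt T = 0) : IsClassical α β γ κ μ ξ φ D := by
  refine ⟨_, _, _, smoothOn_extend X, smoothOn_extend T, smoothOn_extend (-2 * dt T * u), ?_,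
    fun x t u hz => ?_⟩
  · exact (isLieSymmetry_iff (fun x t u h => extend_apply _ ⟨_, h⟩)
      (fun x t u h => extend_apply _ ⟨_, h⟩) (fun x t u h => extend_apply _ ⟨_, h⟩)
      (represents_equation α β γ κ μ)).2 fun z p _ h0 =>
        classical_converse hXx hXt hXu hTx hTu hTtt hκ z p h0
  · have h := congrArg (fun f : SmoothFn D => f ⟨_, hz⟩) hV
    simp only [SmoothFn.coe_mul, SmoothFn.coe_one] at h
    rw [hξ _ _ _ hz, hφ _ _ _ hz, extend_apply _ ⟨_, hz⟩, extend_apply _ ⟨_, hz⟩,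
      extend_apply _ ⟨_, hz⟩, hX, hF, SmoothFn.coe_mul, SmoothFn.coe_mul _ V,
      eq_inv_of_mul_eq_one_right h, div_eq_mul_inv, div_eq_mul_inv]
    exact ⟨left_ne_zero_of_mul_eq_one h, rfl, rfl⟩

/-- If `X ∂ₓ + T ∂ₜ + F ∂ᵤ` is a classical symmetry with `T ≠ 0`, then `X` is a constant, `T` is
affine in `t` and `F = -2 T_t u`; division by `T` gives `ClassicalForm`. Conversely `A` vanishes identically
or nowhere on the convex set `D`, and `T = 1` or `T = 1 / A` gives a symmetry. -/
theorem isClassical_iff (hD : Convex ℝ (D : Set (𝕜 × 𝕜 × 𝕜))) (hμ : μ ≠ 0)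
    (hξ : ∀ x t u (h : (x, t, u) ∈ D), ξ x t u = ξ' ⟨_, h⟩)
    (hφ : ∀ x t u (h : (x, t, u) ∈ D), φ x t u = φ' ⟨_, h⟩) :
    IsClassical α β γ κ μ ξ φ D ↔ ∃ A, ClassicalForm κ ξ' φ' A := by
  constructor
  · rintro ⟨ξ₀, τ₀, φ₀, h₁, h₂, h₃, H, h⟩
    obtain ⟨X, hX⟩ : ∃ X : SmoothFn D, ∀ x t u (h : (x, t, u) ∈ D), ξ₀ x t u = X ⟨_, h⟩ :=
      ⟨SmoothFn.mk _ h₁, fun _ _ _ _ => rfl⟩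
    obtain ⟨T, hT⟩ : ∃ T : SmoothFn D, ∀ x t u (h : (x, t, u) ∈ D), τ₀ x t u = T ⟨_, h⟩ :=
      ⟨SmoothFn.mk _ h₂, fun _ _ _ _ => rfl⟩
    obtain ⟨F, hF⟩ : ∃ F : SmoothFn D, ∀ x t u (h : (x, t, u) ∈ D), φ₀ x t u = F ⟨_, h⟩ :=
      ⟨SmoothFn.mk _ h₃, fun _ _ _ _ => rfl⟩
    rw [isLieSymmetry_iff hX hT hF (represents_equation α β γ κ μ)] at H
    obtain ⟨hXu, hXt, hTu, hTx⟩ := classical_xi_tau hμ H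
    have hFu := classical_phi hμ hXu hXt hTu hTx H
    obtain ⟨B, hB⟩ : ∃ B, F = du F * u + B := ⟨F - du F * u, by ring⟩
    have hBu : du B = 0 := by
      have h := congrArg du hB
      simp only [map_add, Derivation.leibniz, hFu, du_u, smul_eq_mul] at h
      linear_combination -h
    rw [hB] at H
    obtain ⟨hXx, hTtt, hA, hB0, hκ⟩ := classical_affine hμ hXu hXt hTu hTx hFu hBu H
    have hT0 : ∀ z, T z ≠ 0 := fun z => by
      rw [← hT _ _ _ z.2]
      exact (h _ _ _ z.2).1
    obtain ⟨v, hv⟩ := exists_inv hT0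
    have hTv : T * v = 1 := by
      ext z
      simp [hv, hT0 z]
    have hξv : ξ' = X * v := by
      ext z
      rw [← hξ _ _ _ z.2, (h _ _ _ z.2).2.1, hX _ _ _ z.2, hT _ _ _ z.2, SmoothFn.coe_mul, hv,
        div_eq_mul_inv]
    have hφv : φ' = F * v := by
      ext z
      rw [← hφ _ _ _ z.2, (h _ _ _ z.2).2.2, hF _ _ _ z.2, hT _ _ _ z.2, SmoothFn.coe_mul, hv,
        div_eq_mul_inv]
    have hTtx : dx (dt T) = 0 := by rw [← dt_dx, hTx, map_zero]
    have hTtu : du (dt T) = 0 := by rw [du_dt, hTu, map_zero]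
    refine ⟨-2 * dt T * v, ?_, ?_, ?_, ?_, ?_, ?_, ?_, ?_⟩
    · simp [hξv, Derivation.leibniz, der_inv hT0 hv, hXu, hTu]
    · simp [hξv, Derivation.leibniz, der_inv hT0 hv, hXx, hTx]
    · simp [Derivation.leibniz, der_inv hT0 hv, hTu, hTtu]
    · simp [Derivation.leibniz, der_inv hT0 hv, hTx, hTtx]
    · rw [hφv, hB, hA, hB0]
      ring
    · simp only [Derivation.leibniz, der_inv hT0 hv, hTtt, smul_eq_mul, map_neg, derivation_ofNat]
      ring
    · simp only [hξv, Derivation.leibniz, der_inv hT0 hv, hXt, smul_eq_mul]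
      ring
    · linear_combination -2 * v * hκ
  · rintro ⟨A, h₁, h₂, h₃, h₄, h₅, h₆, h₇, h₈⟩
    rcases eq_zero_or_ne hD (a := con (1 / 2) * A) h₄
      (by linear_combination con (1 / 2) * h₆ - dt A * half_add_half (𝕜 := 𝕜) (D := D)) h₃ with h₀ | h₀
    · subst h₀
      refine isClassical_of hξ hφ (X := ξ') (T := 1) (V := 1) (by simp) (by simp) (by simp [h₅])
        h₂ ?_ h₁ (by simp) (by simp) (by simp) (by simp)
      exact natCast_mul_eq_zero two_ne_zero (by push_cast; linear_combination h₇)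
    · obtain ⟨v, hv⟩ := exists_inv h₀
      have hAv : A * v = 1 := by
        ext z
        simp [hv, h₀ z]
      have hvt : 2 * dt v = -1 := by
        rw [der_inv h₀ hv]
        linear_combination -v ^ 2 * h₆ - (A * v + 1) * hAv
      have two_cancel : ∀ f : SmoothFn D, 2 * f = 0 → f = 0 := fun f h =>
        natCast_mul_eq_zero two_ne_zero (by push_cast; exact h)
      refine isClassical_of hξ hφ (X := ξ' * v) (T := v) (V := A) (by rw [mul_comm, hAv])
        (by linear_combination -ξ' * hAv) ?_ ?_ ?_ ?_ ?_ ?_ ?_ ?_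
      · rw [h₅]
        linear_combination u * A * hvt
      · simp [Derivation.leibniz, der_inv h₀ hv, h₂, h₄]
      · refine two_cancel _ ?_
        simp only [Derivation.leibniz, smul_eq_mul]
        linear_combination ξ' * hvt + v * h₇ + ξ' * hAv
      · simp [Derivation.leibniz, der_inv h₀ hv, h₁, h₃]
      · simp [der_inv h₀ hv, h₄]
      · simp [der_inv h₀ hv, h₃]
      · have h := congrArg dt hvt
        simp only [Derivation.leibniz, derivation_ofNat, smul_eq_mul, map_neg,
          Derivation.map_one_eq_zero] at h
        exact two_cancel _ (by linear_combination h)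
      · linear_combination v * dt v * h₈ - con κ * dt v * hAv

theorem ClassicalForm.normalForm (H : ClassicalForm κ ξ' φ' A) :
    NormalForm α β γ κ μ ξ' A 0 :=
  .classical H.dx_xi H.dx_A rfl H.dt_A H.dt_xi H.kappa_mul

/-- The decomposition `φ = A u + B` with `A` and `B` independent of `u` is unique. -/
theorem affine_unique {A' B' : SmoothFn D} (hA : du A = 0) (hB : du B = 0) (hA' : du A' = 0)
    (hB' : du B' = 0) (h : A * u + B = A' * u + B') : A = A' ∧ B = B' := by
  have := (affine_eq_zero_iff (du_u (D := D)) (a := A - A') (b := B - B') (by simp [hA, hA'])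
    (by simp [hB, hB'])).1 (by linear_combination h)
  exact ⟨sub_eq_zero.1 this.1, sub_eq_zero.1 this.2⟩

/-- An infinitesimal `φ = A u + B` is classical only if `B = 0`. -/
theorem isClassical_iff_of_affine (hD : Convex ℝ (D : Set (𝕜 × 𝕜 × 𝕜))) (hμ : μ ≠ 0)
    (hξ : ∀ x t u (h : (x, t, u) ∈ D), ξ x t u = ξ' ⟨_, h⟩)
    (hφ : ∀ x t u (h : (x, t, u) ∈ D), φ x t u = φ' ⟨_, h⟩) (hA : du A = 0) (hB : du B = 0)
    (h : φ' = A * u + B) :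
    IsClassical α β γ κ μ ξ φ D ↔ B = 0 ∧ ClassicalForm κ ξ' φ' A := by
  rw [isClassical_iff hD hμ hξ hφ]
  constructor
  · rintro ⟨A', H⟩
    obtain ⟨h1, h2⟩ := affine_unique hA hB H.du_A (map_zero du) (by rw [← h, H.phi_eq, add_zero])
    exact ⟨h2, h1 ▸ H⟩
  · rintro ⟨-, H⟩
    exact ⟨A, H⟩

/-- The normal form `five` with `ξ_x = 0` is classical; it is a member of `FamilyV` otherwise. -/
theorem isNonclassical_iff_families (hD : Convex ℝ (D : Set (𝕜 × 𝕜 × 𝕜))) (hne : Nonempty D)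
    (hμ : μ ≠ 0)
    (hξ : ∀ x t u (h : (x, t, u) ∈ D), ξ x t u = ξ' ⟨_, h⟩)
    (hφ : ∀ x t u (h : (x, t, u) ∈ D), φ x t u = φ' ⟨_, h⟩)
    (hw : ∀ z : D, (u + con μ * ξ' ^ 2 : SmoothFn D) z ≠ 0) :
    IsNonclassical α β γ κ μ ξ φ D ↔
        IsClassical α β γ κ μ ξ φ D ∨
        (∃ g, FamilyI κ ξ φ D g) ∨
        (∃ c₁ c₂, FamilyII γ μ ξ φ D c₁ c₂) ∨
        (∃ c₁ c₂, FamilyIII γ κ μ ξ φ D c₁ c₂) ∨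
        (∃ s c, FamilyIV α β γ κ ξ φ D s c) ∨
        (∃ s c₁, FamilyV α β γ κ μ ξ φ D s c₁) ∨
        (∃ c, FamilyVI α β γ κ ξ φ D c) ∨
        (∃ c c₄, FamilyVII α β γ κ ξ φ D c c₄) := by
  rw [isNonclassical_iff_normalForm hD hμ hξ hφ hw]
  constructor
  · rintro ⟨A, B, h1, h2, h3, h4, H⟩
    cases H with
    | classical k₁ k₂ k₃ k₄ k₅ k₆ =>
      subst k₃
      exact .inl ((isClassical_iff hD hμ hξ hφ).2
        ⟨A, h1, k₁, h2, k₂, by rw [h4, add_zero], k₄, k₅, k₆⟩)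
    | one k₁ k₂ k₃ k₄ k₅ =>
      exact .inr (.inl (exists_familyI hξ hφ hD h2 (by rw [h4, k₄, add_zero]) k₁ k₂ k₃ k₅))
    | two k₁ k₂ k₃ k₄ k₅ =>
      exact .inr (.inr (.inl (exists_familyII hξ hφ hD hne h1
        (by rw [h4, k₃, k₅]; ring) k₁ k₂ k₄)))
    | three k₁ k₂ k₃ k₄ k₅ k₆ k₇ k₈ =>
      exact .inr (.inr (.inr (.inl (exists_familyIII hξ hφ hD hne h1 h2
        (by rw [h4, k₈]; ring) k₁ k₂ k₃ k₄ k₅ k₆ k₇))))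
    | four kα kβ kγ k₁ k₂ k₃ k₄ k₅ k₆ =>
      obtain rfl : φ' = B := by rw [h4, k₄]; ring
      exact .inr (.inr (.inr (.inr (.inl (exists_familyIV hξ hφ hD hne h1 h3 kα kβ kγ k₁ k₂ k₃
        k₅ k₆)))))
    | five kα kβ kγ k₁ k₂ k₃ k₄ k₅ =>
      by_cases h0 : dx ξ' = 0
      · rw [h0] at k₃ k₄
        have hA : A = 0 := by rw [k₃, mul_zero]
        have hB : B = 0 := by rw [k₄]; ring
        refine .inl ((isClassical_iff hD hμ hξ hφ).2
          ⟨A, h1, h0, h2, ?_, ?_, ?_, ?_, ?_⟩) <;> simp [hA, hB, h4, k₂]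
      · exact .inr (.inr (.inr (.inr (.inr (.inl (exists_familyV hξ hφ hD hne h1
          (by rw [h4, k₄, k₃]) kα kβ kγ k₁ k₂ k₅ h0))))))
    | seven kα kβ kγ k₁ k₂ k₃ k₄ k₅ k₆ k₇ =>
      exact .inr (.inr (.inr (.inr (.inr (.inr (.inr (exists_familyVII hξ hφ hD hne h2 h3 h4
        kα kβ kγ k₁ k₂ k₃ k₄ k₅ k₆ k₇)))))))
  · have four : ∀ s c, FamilyIV α β γ κ ξ φ D s c → ∃ A B, du ξ' = 0 ∧ du A = 0 ∧ du B = 0 ∧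
        φ' = A * u + B ∧ NormalForm α β γ κ μ ξ' A B := by
      intro s c H
      obtain ⟨rfl, h⟩ := of_familyIV hξ hφ H
      refine ⟨0, φ', by simp, by simp, ?_, by simp, .four H.1 H.2.1 H.2.2.1 (by simp) (by simp)
        (by rw [← map_pow, H.2.2.2.1]) rfl ?_ ?_⟩
      · simp [h, Derivation.leibniz, Derivation.leibniz_pow]
      · simp [h, Derivation.leibniz, Derivation.leibniz_pow]
        ring
      · simp [h, Derivation.leibniz, Derivation.leibniz_pow]
    rintro (H | ⟨g, H⟩ | ⟨c₁, c₂, H⟩ | ⟨c₁, c₂, H⟩ | ⟨s, c, H⟩ | ⟨s, c₁, H⟩ | ⟨c, H⟩ |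
      ⟨c, c₄, H⟩)
    · obtain ⟨A, H⟩ := (isClassical_iff hD hμ hξ hφ).1 H
      exact ⟨A, 0, H.du_xi, H.du_A, map_zero _, by rw [H.phi_eq, add_zero], H.normalForm⟩
    · obtain ⟨A, h1, h2, h3, h4, h5, -⟩ := exists_of_familyI hξ hφ H
      exact ⟨A, 0, by simp [h3], h1, map_zero _, by rw [h2, add_zero], .one H.1 h3 h4 rfl h5⟩
    · obtain ⟨h1, h2, h3, h4⟩ := of_familyII hξ hφ H
      exact ⟨0, _, h1, by simp, by simp [Derivation.leibniz, h1, h4], by rw [h2]; ring,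
        .two H.1 h3 rfl (by simp [h4]) rfl⟩
    · obtain ⟨A, h1, h2, h3, h4, h5, h6, h7, h8⟩ := exists_of_familyIII hξ hφ H
      exact ⟨A, _, h1, h2, by simp [Derivation.leibniz, Derivation.leibniz_pow, h1, h2],
        by rw [h3]; ring, .three H.1 H.2.1 h4 h5 h6 h7 h8 rfl⟩
    · exact four s c H
    · obtain ⟨b, hs, h1, h2, h3, h4⟩ := of_familyV hξ hφ H
      refine ⟨_, _, h3, ?_, ?_, h4, .five H.1 H.2.1 H.2.2.1 (by simp [h1]) h2 rfl rfl ?_⟩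
      · simp [h1]
      · simp [Derivation.leibniz, Derivation.leibniz_pow, h1, h3]
      · rw [h1, ← H.2.2.2.1, hs]
        simp only [map_mul, map_pow, map_ofNat]
        ring
    · exact four 0 c (familyIV_of_familyVI H)
    · obtain ⟨A, B, h1, h2, h3, h4, h5, h6, h7, h8, h9⟩ := exists_of_familyVII hξ hφ H
      exact ⟨A, B, by simp [h4], h1, h2, h3,
        .seven H.1 H.2.1 H.2.2.1 H.2.2.2.1 h4 h5 h6 h7 h8 h9⟩

end JetPoly

namespace JetPoly

open MvPolynomial SmoothFn

variable {𝕜 : Type*} [RCLike 𝕜] {D : TopologicalSpace.Opens (𝕜 × 𝕜 × 𝕜)}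
variable {α β γ κ μ : 𝕜} {ξ φ : 𝕜 → 𝕜 → 𝕜 → 𝕜} {ξ' φ' A B : SmoothFn D}

/-! ### Which members of the families are classical -/

section

variable (hD : Convex ℝ (D : Set (𝕜 × 𝕜 × 𝕜))) (hμ : μ ≠ 0)
  (hξ : ∀ x t u (h : (x, t, u) ∈ D), ξ x t u = ξ' ⟨_, h⟩)
  (hφ : ∀ x t u (h : (x, t, u) ∈ D), φ x t u = φ' ⟨_, h⟩)
include hD hμ hξ hφ

theorem familyI_isClassical_iff {g : 𝕜 → 𝕜} (H : FamilyI κ ξ φ D g) :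
    IsClassical α β γ κ μ ξ φ D ↔ (∀ t ∈ times (D : Set (𝕜 × 𝕜 × 𝕜)), g t = 0) ∨
      ∃ d, ∀ t ∈ times (D : Set (𝕜 × 𝕜 × 𝕜)), t + d ≠ 0 ∧ g t = -2 / (t + d) := by
  obtain ⟨A, h1, h2, h3, h4, h5, h6⟩ := exists_of_familyI hξ hφ H
  have hκ := H.1
  rw [isClassical_iff_of_affine hD hμ hξ hφ h1 (map_zero du) (by rw [h2, add_zero])]
  constructor
  · rintro ⟨-, K⟩
    rcases eq_zero_or_ne hD (a := con (1 / 2) * A) h4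
      (by linear_combination con (1 / 2) * K.dt_A - dt A * half_add_half (𝕜 := 𝕜) (D := D)) h1
      with h₀ | h₀
    · left
      rintro t ⟨x, u, hz⟩
      simpa [h₀] using (h6 ⟨_, hz⟩).symm
    · right
      by_cases hne : Nonempty D
      · have hc : ∀ d : Derivation 𝕜 (SmoothFn D) (SmoothFn D), d (con (-1 / 2) * A)
            = con (-1 / 2) * d A := fun d => by simp [Derivation.leibniz]
        have hm : (2 * con (-1 / 2) : SmoothFn D) = -1 := by
          ext z
          rw [SmoothFn.coe_mul, SmoothFn.coe_ofNat, SmoothFn.coe_algebraMap, SmoothFn.coe_neg,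
            SmoothFn.coe_one]
          norm_num
        obtain ⟨d, hd⟩ := exists_inv_eq_t_add hD hne (A := con (-1 / 2) * A)
          (by rw [hc, h4, mul_zero]) (by rw [hc, h1, mul_zero])
          (by
            rw [hc]
            refine natCast_mul_eq_zero (n := 2) two_ne_zero ?_ |> sub_eq_zero.1
            push_cast
            linear_combination con (-1 / 2) * K.dt_A + con (-1 / 2) * A ^ 2 * hm)
          (fun z => by
            rw [SmoothFn.coe_mul, coe_algebraMap]
            exact mul_ne_zero (by norm_num) (h₀ z))
        refine ⟨d, ?_⟩
        rintro t ⟨x, u, hz⟩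
        obtain ⟨e1, e2⟩ := eq_inv_of_mul_eq_one hd ⟨_, hz⟩
        refine ⟨e1, ?_⟩
        rw [SmoothFn.coe_mul, coe_algebraMap, h6] at e2
        simp only at e1 e2
        rw [div_eq_mul_inv, ← e2]
        ring
      · refine ⟨0, ?_⟩
        rintro t ⟨x, u, hz⟩
        exact absurd ⟨⟨_, hz⟩⟩ hne
  · intro K
    refine ⟨rfl, by simp [h3], by simp [h3], h1, h4, h2, ?_, by simp [h3], by simp [hκ]⟩
    rcases K with K | ⟨d, K⟩
    · have : A = 0 := by
        ext z
        rw [h6, K _ (t_mem_times z), SmoothFn.coe_zero]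
      simp [this]
    · obtain ⟨v, hv, -, -, hvt⟩ := exists_inv_t_add (D := D) (c := d) fun z => (K _ (t_mem_times z)).1
      have : A = -2 * v := by
        ext z
        rw [h6, (K _ (t_mem_times z)).2, SmoothFn.coe_mul, (eq_inv_of_mul_eq_one hv z).2,
          SmoothFn.coe_neg, SmoothFn.coe_ofNat, div_eq_mul_inv]
      simp only [this, Derivation.leibniz, map_neg, derivation_ofNat, hvt, smul_eq_mul]
      ring

theorem familyII_isClassical_iff (hne : Nonempty D) {c₁ c₂ : 𝕜} (H : FamilyII γ μ ξ φ D c₁ c₂) :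
    IsClassical α β γ κ μ ξ φ D ↔ c₁ = 0 := by
  obtain ⟨h1, h2, h3, h4⟩ := of_familyII hξ hφ H
  rw [isClassical_iff_of_affine hD hμ hξ hφ (A := 0) (B := φ') (map_zero du)
    (by simp [h2, Derivation.leibniz, h1, h4]) (by ring)]
  constructor
  · rintro ⟨-, K⟩
    have h := K.dt_xi
    rw [zero_mul, h4] at h
    exact con_eq_zero hne (natCast_mul_eq_zero two_ne_zero (by push_cast; exact h))
  · rintro rfl
    have h5 : φ' = 0 := by simp [h2, h4]
    exact ⟨h5, h1, h3, by simp, by simp, by simp [h5], by simp, by simp [h4], by simp⟩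

/-- An infinitesimal `φ = A u + B` with `A_t = -A² ≠ 0` is not classical. -/
theorem not_isClassical_of_dt_eq (hne : Nonempty D) (hA : du A = 0) (hB : du B = 0)
    (h : φ' = A * u + B) (ht : dt A = -A ^ 2) (h₀ : ∀ z, A z ≠ 0) :
    ¬ IsClassical α β γ κ μ ξ φ D := by
  rw [isClassical_iff_of_affine hD hμ hξ hφ hA hB h]
  rintro ⟨-, K⟩
  obtain ⟨z⟩ := hne
  have h1 := congrArg (fun f : SmoothFn D => f z) K.dt_A
  rw [ht] at h1
  simp only [SmoothFn.coe_mul, SmoothFn.coe_neg, SmoothFn.coe_pow, SmoothFn.coe_ofNat] at h1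
  exact h₀ z (pow_eq_zero_iff two_ne_zero |>.1 (by linear_combination -h1 / 3))

theorem familyIV_isClassical_iff (hne : Nonempty D) {s : 𝕜} {c : Fin 4 → 𝕜}
    (H : FamilyIV α β γ κ ξ φ D s c) : IsClassical α β γ κ μ ξ φ D ↔ c = 0 := by
  obtain ⟨h1, h2⟩ := of_familyIV hξ hφ H
  rw [isClassical_iff_of_affine hD hμ hξ hφ (A := 0) (B := φ') (map_zero du)
    (by simp [h2, Derivation.leibniz, Derivation.leibniz_pow]) (by ring)]
  constructor
  · rintro ⟨h3, -⟩
    have h4 := coeff_eq_zero dx (w := x + con s * t) (by simp) 3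
      (fun i => if i = 0 then con (c 0) else if i = 1 then con (c 1) else if i = 2 then con (c 2)
        else con (c 3)) (fun i => by split_ifs <;> simp)
      (by
        rw [← h3, h2]
        simp [Finset.sum_range_succ]
        ring)
    have e0 := con_eq_zero hne (by simpa using h4 0 (by norm_num))
    have e1 := con_eq_zero hne (by simpa using h4 1 (by norm_num))
    have e2 := con_eq_zero hne (by simpa using h4 2 (by norm_num))
    have e3 := con_eq_zero hne (by simpa using h4 3 (by norm_num))
    ext i
    fin_cases i <;> assumption
  · rintro rfl
    have h5 : φ' = 0 := by simp [h2]
    exact ⟨h5, by simp [h1], by simp [h1], by simp, by simp, by simp [h5], by simp, by simp [h1],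
      by simp⟩

theorem familyV_isClassical_iff (hne : Nonempty D) {s c₁ : 𝕜}
    (H : FamilyV α β γ κ μ ξ φ D s c₁) : IsClassical α β γ κ μ ξ φ D ↔ κ = 0 := by
  obtain ⟨b, hs, h1, h2, h3, h4⟩ := of_familyV hξ hφ H
  have hκ := H.2.2.2.1
  rw [isClassical_iff_of_affine hD hμ hξ hφ (by simp [h1])
    (by simp [Derivation.leibniz, Derivation.leibniz_pow, h1, h3]) h4]
  constructor
  · rintro ⟨-, K⟩
    have hb : b = 0 := con_eq_zero hne (by rw [← h1, K.dx_xi])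
    rw [← hκ, hs, hb]
    ring
  · intro h
    have hb : b = 0 := by
      rw [h, hs] at hκ
      simpa [hμ] using hκ
    have h5 : dx ξ' = 0 := by rw [h1, hb, con_zero]
    rw [h5] at h4 ⊢
    exact ⟨by simp, h3, h5, by simp, by simp, by simp [h4], by simp, by simp [h2], by simp⟩

end

end JetPoly

/-- The generic case over both fields. -/
theorem generic_case (𝕜 : Type*) [RCLike 𝕜] (α β γ κ μ : 𝕜) (hμ : μ ≠ 0)
      (D : Set (𝕜 × 𝕜 × 𝕜)) (hDo : IsOpen D) (hD : Convex ℝ D) (hne : D.Nonempty)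
      (ξ φ : 𝕜 → 𝕜 → 𝕜 → 𝕜) (hξ : SmoothOn D ξ) (hφ : SmoothOn D φ)
      (hw : ∀ x t u, (x, t, u) ∈ D → u + μ * ξ x t u ^ 2 ≠ 0) :
      (IsNonclassical α β γ κ μ ξ φ D ↔
        IsClassical α β γ κ μ ξ φ D ∨
        (∃ g, FamilyI κ ξ φ D g) ∨
        (∃ c₁ c₂, FamilyII γ μ ξ φ D c₁ c₂) ∨
        (∃ c₁ c₂, FamilyIII γ κ μ ξ φ D c₁ c₂) ∨
        (∃ s c, FamilyIV α β γ κ ξ φ D s c) ∨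
        (∃ s c₁, FamilyV α β γ κ μ ξ φ D s c₁) ∨
        (∃ c, FamilyVI α β γ κ ξ φ D c) ∨
        (∃ c c₄, FamilyVII α β γ κ ξ φ D c c₄)) ∧
      (∀ g, FamilyI κ ξ φ D g →
        (IsClassical α β γ κ μ ξ φ D ↔
          (∀ t ∈ times D, g t = 0) ∨
            ∃ d, ∀ t ∈ times D, t + d ≠ 0 ∧ g t = -2 / (t + d))) ∧
      (∀ c₁ c₂, FamilyII γ μ ξ φ D c₁ c₂ → (IsClassical α β γ κ μ ξ φ D ↔ c₁ = 0)) ∧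
      (∀ c₁ c₂, FamilyIII γ κ μ ξ φ D c₁ c₂ → ¬ IsClassical α β γ κ μ ξ φ D) ∧
      (∀ s c, FamilyIV α β γ κ ξ φ D s c → (IsClassical α β γ κ μ ξ φ D ↔ c = 0)) ∧
      (∀ s c₁, FamilyV α β γ κ μ ξ φ D s c₁ → (IsClassical α β γ κ μ ξ φ D ↔ κ = 0)) ∧
      (∀ c, FamilyVI α β γ κ ξ φ D c → (IsClassical α β γ κ μ ξ φ D ↔ c = 0)) ∧
      (∀ c c₄, FamilyVII α β γ κ ξ φ D c c₄ → ¬ IsClassical α β γ κ μ ξ φ D) := by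
  obtain ⟨D', rfl⟩ : ∃ D' : TopologicalSpace.Opens (𝕜 × 𝕜 × 𝕜), (D' : Set (𝕜 × 𝕜 × 𝕜)) = D :=
    ⟨⟨D, hDo⟩, rfl⟩
  have hne' : Nonempty D' := hne.to_subtype
  have hξ' : ∀ x t u (h : (x, t, u) ∈ D'), ξ x t u = SmoothFn.mk (D := D') _ hξ ⟨_, h⟩ :=
    fun _ _ _ _ => rfl
  have hφ' : ∀ x t u (h : (x, t, u) ∈ D'), φ x t u = SmoothFn.mk (D := D') _ hφ ⟨_, h⟩ :=
    fun _ _ _ _ => rfl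
  refine ⟨JetPoly.isNonclassical_iff_families hD hne' hμ hξ' hφ' fun z => ?_, fun g H =>
    JetPoly.familyI_isClassical_iff hD hμ hξ' hφ' H, fun c₁ c₂ H =>
    JetPoly.familyII_isClassical_iff hD hμ hξ' hφ' hne' H, fun c₁ c₂ H => ?_, fun s c H =>
    JetPoly.familyIV_isClassical_iff hD hμ hξ' hφ' hne' H, fun s c₁ H =>
    JetPoly.familyV_isClassical_iff hD hμ hξ' hφ' hne' H, fun c H =>
    JetPoly.familyIV_isClassical_iff hD hμ hξ' hφ' hne' (JetPoly.familyIV_of_familyVI H),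
    fun c c₄ H => ?_⟩
  · exact hw _ _ _ z.2
  · obtain ⟨A, h1, h2, h3, -, -, h6, h7, -⟩ := JetPoly.exists_of_familyIII hξ' hφ' H
    exact JetPoly.not_isClassical_of_dt_eq hD hμ hξ' hφ' hne' h2 (B := -(3 * JetPoly.con μ * A *
      SmoothFn.mk (D := D') _ hξ ^ 2))
      (by simp [Derivation.leibniz, Derivation.leibniz_pow, h1, h2]) (by rw [h3]; ring) h6 h7
  · obtain ⟨A, B, h1, h2, h3, -, -, h6, h7, -⟩ := JetPoly.exists_of_familyVII hξ' hφ' H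
    exact JetPoly.not_isClassical_of_dt_eq hD hμ hξ' hφ' hne' h1 h2 h3 h6 h7

namespace JetPoly

open MvPolynomial SmoothFn

variable {𝕜 : Type*} [RCLike 𝕜] {D : TopologicalSpace.Opens (𝕜 × 𝕜 × 𝕜)}

/-! ### The criterion in the singular case -/

/-- The consequences of `u + μ ξ² = 0` for the derivatives of `ξ`. -/
theorem singular_xi {μ : 𝕜} (hμ : μ ≠ 0) {ξ : SmoothFn D} (hs : u + con μ * ξ ^ 2 = 0) :
    dx ξ = 0 ∧ dt ξ = 0 ∧ 2 * ξ * du ξ = -con μ⁻¹ := by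
  have hc : con μ⁻¹ * con μ = (1 : SmoothFn D) := by
    rw [← map_mul, inv_mul_cancel₀ hμ, map_one]
  have h : 2 * ξ * du ξ = -con μ⁻¹ := by
    have h := congrArg du hs
    simp [Derivation.leibniz, Derivation.leibniz_pow] at h
    linear_combination con μ⁻¹ * h - 2 * ξ * du ξ * hc
  have key : ∀ d : Derivation 𝕜 (SmoothFn D) (SmoothFn D), d u = 0 → d ξ = 0 := by
    intro d hd
    have h1 := congrArg d hs
    simp [Derivation.leibniz, Derivation.leibniz_pow, hd] at h1
    refine algebraMap_mul_eq_zero (inv_ne_zero hμ) ?_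
    linear_combination d ξ * h + 2 * ξ * du ξ * d ξ * hc - du ξ * con μ⁻¹ * h1
  exact ⟨key dx dx_u, key dt dt_u, h⟩

/-- The reduced equation in the singular case, where `u_xxxx` cancels. -/
theorem reducedPoly_singular (α β γ κ μ : 𝕜) (hμ : μ ≠ 0) {ξ φ J K : SmoothFn D}
    (hs : u + con μ * ξ ^ 2 = 0) (hJ : J = 2 * ξ * du φ + φ * du ξ)
    (hK : K = dt φ + φ * du φ - ξ * dx φ) :
    reducedPoly α β γ κ μ ξ φ = cst (4 - α) * X (1, 0) * X (3, 0) + C (con μ * J) * X (3, 0)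
      + cst (3 - β) * X (2, 0) ^ 2 + C (3 * con μ * du J) * X (1, 0) * X (2, 0)
      + C (2 * con μ * dx J - con μ * du K - con (μ⁻¹ + 2 * γ) * u - con κ) * X (2, 0)
      + C (con μ * du (du J)) * X (1, 0) ^ 3
      + C (2 * con μ * dx (du J) - con μ * du (du K) - con (μ⁻¹ + 2 * γ)) * X (1, 0) ^ 2
      + C (con μ * dx (dx J) - 2 * con μ * dx (du K) - J) * X (1, 0)
      + C (K - con μ * dx (dx K)) := by
  obtain ⟨h1, h2, h3⟩ := singular_xi hμ hs
  have hP : ξ ^ 2 = -(con μ⁻¹ * u) := by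
    have hc : con μ⁻¹ * con μ = (1 : SmoothFn D) := by
      rw [← map_mul, inv_mul_cancel₀ hμ, map_one]
    linear_combination con μ⁻¹ * hs - ξ ^ 2 * hc
  have hN : ET ξ φ (characteristic ξ φ) = C (-(con μ⁻¹ * u)) * X (2, 0)
      + C (-con μ⁻¹) * X (1, 0) ^ 2 + C (-J) * X (1, 0) + C K := by
    rw [ET_characteristic, hP, h3, h1, h2, hJ, hK, zero_add, mul_zero, sub_zero, map_neg C (_ + _)]
    ring
  have hμ' : cst μ * cst μ⁻¹ = (1 : JetPoly D) := by
    rw [cst, cst, ← map_mul, ← map_mul, mul_inv_cancel₀ hμ, map_one, map_one]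
  have n2 : (C 2 : JetPoly D) = 2 := rfl
  have n3 : (C 3 : JetPoly D) = 3 := rfl
  have n4 : algebraMap 𝕜 (SmoothFn D) 4 = 4 := map_ofNat _ 4
  have n3' : algebraMap 𝕜 (SmoothFn D) 3 = 3 := map_ofNat _ 3
  have n2' : algebraMap 𝕜 (SmoothFn D) 2 = 2 := map_ofNat _ 2
  have n4' : (C 4 : JetPoly D) = 4 := rfl
  rw [reducedPoly_eq_of_eq α β γ κ μ ξ φ _ _ _ _ hN]
  simp only [cst, con] at hμ' ⊢
  simp only [map_neg, map_add, map_sub, map_mul, Derivation.leibniz, Derivation.map_algebraMap,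
    dx_u, du_u, smul_eq_mul, mul_zero, mul_one, add_zero, map_zero, neg_zero, zero_mul, zero_add,
    n2, n3, n4, n3', n2', n4']
  linear_combination (C u * X (4, 0) + 4 * X (1, 0) * X (3, 0) + 3 * X (2, 0) ^ 2) * hμ'

/-- The coefficient of `∂/∂u_x` in the prolongation, if `ξ` depends on `u` only. -/
noncomputable def eta₁ (ξ φ : SmoothFn D) (z : D) (a : 𝕜) : 𝕜 :=
  dx φ z + du φ z * a - du ξ z * a ^ 2

/-- The coefficient of `∂/∂u_xx` in the prolongation, if `ξ` depends on `u` only. -/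
noncomputable def eta₂ (ξ φ : SmoothFn D) (z : D) (a b : 𝕜) : 𝕜 :=
  dx (dx φ) z + 2 * dx (du φ) z * a + du (du φ) z * a ^ 2 + du φ z * b - du (du ξ) z * a ^ 3
    - 3 * du ξ z * a * b

/-- The coefficient of `∂/∂u_xxx` in the prolongation, if `ξ` depends on `u` only. -/
noncomputable def eta₃ (ξ φ : SmoothFn D) (z : D) (a b c : 𝕜) : 𝕜 :=
  dx (dx (dx φ)) z + 3 * dx (dx (du φ)) z * a + 3 * dx (du (du φ)) z * a ^ 2
    + du (du (du φ)) z * a ^ 3 + 3 * dx (du φ) z * b + 3 * du (du φ) z * a * b + du φ z * c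
    - du (du (du ξ)) z * a ^ 4 - 6 * du (du ξ) z * a ^ 2 * b - 3 * du ξ z * b ^ 2
    - 4 * du ξ z * a * c

section

variable (ξ φ : SmoothFn D) (hξ : dx ξ = 0) (z : D) (p : ℕ × ℕ → 𝕜)
include hξ

theorem ev_coeff_one : ev z p (coeff ξ 1 φ (1, 0)) = eta₁ ξ φ z (p (1, 0)) := by
  rw [coeff_x _ _ 1 (by norm_num)]
  simp only [Function.iterate_succ_apply', Function.iterate_zero, id, map_sub, map_add,
    Derivation.leibniz, DX_C, DX_X 1 0 (by norm_num), smul_eq_mul, hξ, map_zero, ev_C, ev_X,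
    map_mul, eta₁, Nat.reduceAdd]
  ring

theorem ev_coeff_two : ev z p (coeff ξ 1 φ (2, 0)) = eta₂ ξ φ z (p (1, 0)) (p (2, 0)) := by
  have hξu : dx (du ξ) = 0 := by rw [← du_dx, hξ, map_zero]
  rw [coeff_x _ _ 2 (by norm_num)]
  simp only [Function.iterate_succ_apply', Function.iterate_zero, id, map_sub, map_add,
    Derivation.leibniz, DX_C, DX_X 1 0 (by norm_num), DX_X 2 0 (by norm_num), smul_eq_mul, hξ,
    hξu, du_dx, map_zero, ev_C, ev_X, map_mul (ev z p), eta₂, Nat.reduceAdd]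
  ring

theorem ev_coeff_three :
    ev z p (coeff ξ 1 φ (3, 0)) = eta₃ ξ φ z (p (1, 0)) (p (2, 0)) (p (3, 0)) := by
  have hξu : dx (du ξ) = 0 := by rw [← du_dx, hξ, map_zero]
  have hξuu : dx (du (du ξ)) = 0 := by rw [← du_dx, hξu, map_zero]
  rw [coeff_x _ _ 3 (by norm_num)]
  simp only [Function.iterate_succ_apply', Function.iterate_zero, id, map_sub, map_add,
    Derivation.leibniz, DX_C, DX_X 1 0 (by norm_num), DX_X 2 0 (by norm_num),
    DX_X 3 0 (by norm_num), smul_eq_mul, hξ, hξu, hξuu, du_dx, map_zero, ev_C, ev_X,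
    map_mul (ev z p), eta₃, Nat.reduceAdd]
  ring

theorem ev_PR_poly (a e : 𝕜) (b f g h i j k : SmoothFn D) :
    ev z p (PR ξ 1 φ (cst a * X (1, 0) * X (3, 0) + C b * X (3, 0) + cst e * X (2, 0) ^ 2
      + C f * X (1, 0) * X (2, 0) + C g * X (2, 0) + C h * X (1, 0) ^ 3 + C i * X (1, 0) ^ 2
      + C j * X (1, 0) + C k)) =
    a * (eta₁ ξ φ z (p (1, 0)) * p (3, 0)
        + p (1, 0) * eta₃ ξ φ z (p (1, 0)) (p (2, 0)) (p (3, 0)))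
      + vf ξ φ b z * p (3, 0) + b z * eta₃ ξ φ z (p (1, 0)) (p (2, 0)) (p (3, 0))
      + 2 * e * p (2, 0) * eta₂ ξ φ z (p (1, 0)) (p (2, 0))
      + vf ξ φ f z * p (1, 0) * p (2, 0) + f z * (eta₁ ξ φ z (p (1, 0)) * p (2, 0)
        + p (1, 0) * eta₂ ξ φ z (p (1, 0)) (p (2, 0)))
      + vf ξ φ g z * p (2, 0) + g z * eta₂ ξ φ z (p (1, 0)) (p (2, 0))
      + vf ξ φ h z * p (1, 0) ^ 3 + 3 * h z * p (1, 0) ^ 2 * eta₁ ξ φ z (p (1, 0))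
      + vf ξ φ i z * p (1, 0) ^ 2 + 2 * i z * p (1, 0) * eta₁ ξ φ z (p (1, 0))
      + vf ξ φ j z * p (1, 0) + j z * eta₁ ξ φ z (p (1, 0)) + vf ξ φ k z := by
  have hc : ∀ a : 𝕜, PR ξ 1 φ (cst a) = 0 := fun a => by simp [cst, PR_C]
  simp only [map_add, Derivation.leibniz, Derivation.leibniz_pow, smul_eq_mul, nsmul_eq_mul, hc,
    PR_C_eq, PR_X ξ 1 φ 1 0 (by norm_num), PR_X ξ 1 φ 2 0 (by norm_num),
    PR_X ξ 1 φ 3 0 (by norm_num), map_mul (ev z p), map_pow (ev z p), map_natCast, map_zero, ev_C, ev_X,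
    ev_cst, ev_coeff_one ξ φ hξ, ev_coeff_two ξ φ hξ, ev_coeff_three ξ φ hξ]
  push_cast
  ring

end

/-- The criterion of the nonclassical method for a reduced equation of third order that is affine
in `u_xxx`, at a point `z`, as a condition on `a = u_x`, `b = u_xx` and `c = u_xxx`. -/
theorem forall_ev_iff_of_third_order (ξ φ : SmoothFn D) (hξ : dx ξ = 0) (ε δ : 𝕜)
    (q f g h i j k : SmoothFn D) (P : JetPoly D)
    (hP : P = cst ε * X (1, 0) * X (3, 0) + C q * X (3, 0) + cst δ * X (2, 0) ^ 2
      + C f * X (1, 0) * X (2, 0) + C g * X (2, 0) + C h * X (1, 0) ^ 3 + C i * X (1, 0) ^ 2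
      + C j * X (1, 0) + C k) :
    (∀ (z : D) (p : ℕ × ℕ → 𝕜), p (0, 0) = (z : 𝕜 × 𝕜 × 𝕜).2.2 → ev z p P = 0 →
      ev z p (PR ξ 1 φ P) = 0) ↔
    ∀ (z : D) (a b c : 𝕜),
      ε * a * c + q z * c + δ * b ^ 2 + f z * a * b + g z * b + h z * a ^ 3 + i z * a ^ 2
        + j z * a + k z = 0 →
      ε * (eta₁ ξ φ z a * c + a * eta₃ ξ φ z a b c)
      + vf ξ φ q z * c + q z * eta₃ ξ φ z a b c + 2 * δ * b * eta₂ ξ φ z a b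
      + vf ξ φ f z * a * b + f z * (eta₁ ξ φ z a * b + a * eta₂ ξ φ z a b)
      + vf ξ φ g z * b + g z * eta₂ ξ φ z a b
      + vf ξ φ h z * a ^ 3 + 3 * h z * a ^ 2 * eta₁ ξ φ z a
      + vf ξ φ i z * a ^ 2 + 2 * i z * a * eta₁ ξ φ z a
      + vf ξ φ j z * a + j z * eta₁ ξ φ z a + vf ξ φ k z = 0 := by
  subst hP
  simp only [ev_PR_poly ξ φ hξ]
  simp only [map_add, map_mul, map_pow, ev_C, ev_X, ev_cst]
  constructor
  · intro H z a b c h0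
    exact H z (fun k => if k = (0, 0) then (z : 𝕜 × 𝕜 × 𝕜).2.2 else
      if k = (1, 0) then a else if k = (2, 0) then b else c) rfl h0
  · intro H z p _ h0
    exact H z _ _ _ h0

end JetPoly

namespace JetPoly

open MvPolynomial SmoothFn

variable {𝕜 : Type*} [RCLike 𝕜] {D : TopologicalSpace.Opens (𝕜 × 𝕜 × 𝕜)}

/-! ### The singular case: elimination of `u_xxx` -/

/-- The criterion of `forall_ev_iff_of_third_order` at the point `z`. -/
def ThirdOrderCriterion (ξ φ : SmoothFn D) (ε δ : 𝕜) (q f g h i j k : SmoothFn D) (z : D) : Prop :=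
  ∀ a b c : 𝕜,
      ε * a * c + q z * c + δ * b ^ 2 + f z * a * b + g z * b + h z * a ^ 3 + i z * a ^ 2
        + j z * a + k z = 0 →
      ε * (eta₁ ξ φ z a * c + a * eta₃ ξ φ z a b c)
      + vf ξ φ q z * c + q z * eta₃ ξ φ z a b c + 2 * δ * b * eta₂ ξ φ z a b
      + vf ξ φ f z * a * b + f z * (eta₁ ξ φ z a * b + a * eta₂ ξ φ z a b)
      + vf ξ φ g z * b + g z * eta₂ ξ φ z a b
      + vf ξ φ h z * a ^ 3 + 3 * h z * a ^ 2 * eta₁ ξ φ z a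
      + vf ξ φ i z * a ^ 2 + 2 * i z * a * eta₁ ξ φ z a
      + vf ξ φ j z * a + j z * eta₁ ξ φ z a + vf ξ φ k z = 0

variable {ξ φ : SmoothFn D} {ε δ : 𝕜} {q f g h i j k : SmoothFn D} {z : D}

/-- For `u_xx = 0` and large `u_x = 1 / s`, the criterion is dominated by `ε² ∂³ξ/∂u³`. -/
theorem ThirdOrderCriterion.eps_eq_zero (H : ThirdOrderCriterion ξ φ ε δ q f g h i j k z)
    (hξ : du (du (du ξ)) z ≠ 0) : ε = 0 := by
  by_contra hε
  let A : 𝕜 → 𝕜 := fun s => ε + q z * s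
  let N : 𝕜 → 𝕜 := fun s => h z + i z * s + j z * s ^ 2 + k z * s ^ 3
  let E₁ : 𝕜 → 𝕜 := fun s => dx φ z * s ^ 2 + du φ z * s - du ξ z
  let E₂ : 𝕜 → 𝕜 := fun s => dx (dx φ) z * s ^ 3 + 2 * dx (du φ) z * s ^ 2 + du (du φ) z * s
    - du (du ξ) z
  let T : 𝕜 → 𝕜 := fun s => dx (dx (dx φ)) z * s ^ 4 + 3 * dx (dx (du φ)) z * s ^ 3
    + 3 * dx (du (du φ)) z * s ^ 2 + du (du (du φ)) z * s - du (du (du ξ)) z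
  let F : 𝕜 → 𝕜 := fun s => ε * (-(s * E₁ s * N s) + T s * A s
      - s * (du φ z * s - 4 * du ξ z) * N s)
    - vf ξ φ q z * N s * s ^ 3
    + q z * (s * T s * A s - s ^ 2 * (du φ z * s - 4 * du ξ z) * N s)
    + f z * s * E₂ s * A s + g z * s ^ 2 * E₂ s * A s + vf ξ φ h z * s ^ 2 * A s
    + 3 * h z * s * E₁ s * A s + vf ξ φ i z * s ^ 3 * A s + 2 * i z * s ^ 2 * E₁ s * A s
    + vf ξ φ j z * s ^ 4 * A s + j z * s ^ 3 * E₁ s * A s + vf ξ φ k z * s ^ 5 * A s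
  have hF0 : F 0 = -(ε ^ 2 * du (du (du ξ)) z) := by
    simp only [F, T, A, N]
    ring
  have hcont : Continuous F := by
    simp only [F, T, A, N, E₁, E₂]
    fun_prop
  have hA : ∀ᶠ s in nhds (0 : 𝕜), A s ≠ 0 := by
    have : Continuous A := by
      simp only [A]
      fun_prop
    refine this.continuousAt.eventually_ne ?_
    simpa [A] using hε
  have hzero : ∀ᶠ s in nhdsWithin (0 : 𝕜) {0}ᶜ, F s = 0 := by
    filter_upwards [self_mem_nhdsWithin, nhdsWithin_le_nhds hA] with s hs hAs
    have hs' : s ≠ 0 := hs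
    obtain ⟨c, hc⟩ : ∃ c, A s * s ^ 2 * c = -N s :=
      ⟨-N s / (A s * s ^ 2), mul_div_cancel₀ _ (mul_ne_zero hAs (pow_ne_zero 2 hs'))⟩
    obtain ⟨a, ha⟩ : ∃ a, s * a = 1 := ⟨s⁻¹, mul_inv_cancel₀ hs'⟩
    have ha' : a = s⁻¹ := eq_inv_of_mul_eq_one_right ha
    have hc' : c = -N s / (A s * s ^ 2) := by
      rw [eq_div_iff (mul_ne_zero hAs (pow_ne_zero 2 hs'))]
      linear_combination hc
    have key := H a 0 c (by
      rw [ha', hc']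
      have e : A s = ε + q z * s := rfl
      field_simp
      simp only [N, e]
      field_simp
      ring)
    have e2 : F s = s ^ 5 * A s * (ε * (eta₁ ξ φ z a * c + a * eta₃ ξ φ z a 0 c)
      + vf ξ φ q z * c + q z * eta₃ ξ φ z a 0 c + 2 * δ * 0 * eta₂ ξ φ z a 0
      + vf ξ φ f z * a * 0 + f z * (eta₁ ξ φ z a * 0 + a * eta₂ ξ φ z a 0)
      + vf ξ φ g z * 0 + g z * eta₂ ξ φ z a 0
      + vf ξ φ h z * a ^ 3 + 3 * h z * a ^ 2 * eta₁ ξ φ z a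
      + vf ξ φ i z * a ^ 2 + 2 * i z * a * eta₁ ξ φ z a
      + vf ξ φ j z * a + j z * eta₁ ξ φ z a + vf ξ φ k z) := by
      simp only [F, eta₁, eta₂, eta₃, E₁, E₂, T, ha', hc']
      field_simp
      ring
    rw [e2, key, mul_zero]
  have h1 : Filter.Tendsto F (nhdsWithin (0 : 𝕜) {0}ᶜ) (nhds 0) :=
    (Filter.tendsto_congr' hzero).2 tendsto_const_nhds
  have h2 : Filter.Tendsto F (nhdsWithin (0 : 𝕜) {0}ᶜ) (nhds (F 0)) :=
    hcont.continuousAt.tendsto.mono_left nhdsWithin_le_nhds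
  have h3 := tendsto_nhds_unique h2 h1
  rw [hF0, neg_eq_zero, mul_eq_zero] at h3
  exact h3.elim (pow_ne_zero 2 hε) hξ

/-- If the reduced equation can be solved for `u_xxx`, the coefficients of `u_x u_xx²` and `u_xx²`
in the criterion cannot both vanish. -/
theorem ThirdOrderCriterion.q_eq_zero (H : ThirdOrderCriterion ξ φ 0 δ q f g h i j k z)
    (hξ : du ξ z ≠ 0) : q z = 0 := by
  by_contra hq
  have key : ∀ a b c : 𝕜, q z * c = -(δ * b ^ 2 + f z * a * b + g z * b + h z * a ^ 3
      + i z * a ^ 2 + j z * a + k z) → _ := fun a b c hc => by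
    have h1 := H a b c (by linear_combination hc)
    have h2 : vf ξ φ q z * (-(δ * b ^ 2 + f z * a * b + g z * b + h z * a ^ 3
        + i z * a ^ 2 + j z * a + k z)) + q z * (q z * (eta₃ ξ φ z a b 0)
        + (du φ z - 4 * du ξ z * a) * (-(δ * b ^ 2 + f z * a * b + g z * b + h z * a ^ 3
        + i z * a ^ 2 + j z * a + k z)) + 2 * δ * b * eta₂ ξ φ z a b
      + vf ξ φ f z * a * b + f z * (eta₁ ξ φ z a * b + a * eta₂ ξ φ z a b)
      + vf ξ φ g z * b + g z * eta₂ ξ φ z a b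
      + vf ξ φ h z * a ^ 3 + 3 * h z * a ^ 2 * eta₁ ξ φ z a
      + vf ξ φ i z * a ^ 2 + 2 * i z * a * eta₁ ξ φ z a
      + vf ξ φ j z * a + j z * eta₁ ξ φ z a + vf ξ φ k z) = 0 := by
      rw [← hc]
      simp only [eta₃] at h1 ⊢
      linear_combination q z * h1
    simp only [eta₁, eta₂, eta₃] at h2
    exact h2
  have k₁ := key 1 1 _ (mul_div_cancel₀ _ hq)
  have k₂ := key 1 (-1) _ (mul_div_cancel₀ _ hq)
  have k₃ := key 1 0 _ (mul_div_cancel₀ _ hq)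
  have k₄ := key 0 1 _ (mul_div_cancel₀ _ hq)
  have k₅ := key 0 (-1) _ (mul_div_cancel₀ _ hq)
  have k₆ := key 0 0 _ (mul_div_cancel₀ _ hq)
  have h1 : q z * du ξ z * δ = 0 := by
    linear_combination (-(k₁ + k₂ - 2 * k₃) + (k₄ + k₅ - 2 * k₆)) / 4
  have hδ : δ = 0 := (mul_eq_zero.1 h1).resolve_left (mul_ne_zero hq hξ)
  subst hδ
  have h2 : q z ^ 2 * du ξ z = 0 := by
    linear_combination -(k₄ + k₅ - 2 * k₆) / 6
  exact mul_ne_zero (pow_ne_zero 2 hq) hξ h2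

/-- A polynomial of degree three is not a zero divisor. -/
theorem quadratic_eq_zero_of_cubic_mul {a₀ a₁ a₂ a₃ d₀ d₁ d₂ : 𝕜} (ha : a₃ ≠ 0)
    (H : ∀ s : 𝕜, (a₃ * s ^ 3 + a₂ * s ^ 2 + a₁ * s + a₀) * (d₂ * s ^ 2 + d₁ * s + d₀) = 0) :
    d₂ = 0 ∧ d₁ = 0 ∧ d₀ = 0 := by
  let X : Polynomial 𝕜 := Polynomial.X
  have h1 : (Polynomial.C a₃ * X ^ 3 + Polynomial.C a₂ * X ^ 2 + Polynomial.C a₁ * X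
      + Polynomial.C a₀) * (Polynomial.C d₂ * X ^ 2 + Polynomial.C d₁ * X + Polynomial.C d₀) = 0 :=
    Polynomial.funext fun s => by simpa [X] using H s
  have h2 := (mul_eq_zero.1 h1).resolve_left fun h => ha <| by
    simpa [X, Polynomial.coeff_X, Polynomial.coeff_C] using congrArg (fun p => Polynomial.coeff p 3) h
  have key : ∀ n, _ := fun n => congrArg (fun p => Polynomial.coeff p n) h2
  have k₂ := key 2
  have k₁ := key 1
  have k₀ := key 0
  simp [X, Polynomial.coeff_X, Polynomial.coeff_C] at k₂ k₁ k₀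
  exact ⟨k₂, k₁, k₀⟩

/-- If `u_xxx` does not occur and the reduced equation is quadratic in `u_xx`, then both of its
roots satisfy an equation that is linear in `u_xx`, so its discriminant vanishes. -/
theorem ThirdOrderCriterion.discrim_eq_zero [IsAlgClosed 𝕜]
    (H : ThirdOrderCriterion ξ φ 0 δ 0 0 g 0 i j k z) (hδ : δ ≠ 0) (hξ : du (du ξ) z ≠ 0) :
    i z = 0 ∧ j z = 0 ∧ g z ^ 2 = 4 * δ * k z := by
  have hvf : vf ξ φ 0 z = 0 := by simp [vf]
  have key : ∀ a : 𝕜, (-2 * δ * du (du ξ) z * a ^ 3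
      + (2 * δ * du (du φ) z) * a ^ 2
      + (4 * δ * dx (du φ) z + 3 * du ξ z * g z) * a
      + (2 * δ * dx (dx φ) z - du φ z * g z + vf ξ φ g z)) *
      (-4 * δ * i z * a ^ 2 + (-4 * δ * j z) * a + (g z ^ 2 - 4 * δ * k z)) = 0 := by
    intro a
    obtain ⟨w, hw⟩ := IsAlgClosed.exists_pow_nat_eq
      (-4 * δ * i z * a ^ 2 + (-4 * δ * j z) * a + (g z ^ 2 - 4 * δ * k z)) two_pos
    have root : ∀ w : 𝕜, w ^ 2 = -4 * δ * i z * a ^ 2 + (-4 * δ * j z) * a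
          + (g z ^ 2 - 4 * δ * k z) →
        (-2 * δ * du (du ξ) z * a ^ 3 + (2 * δ * du (du φ) z) * a ^ 2
          + (4 * δ * dx (du φ) z + 3 * du ξ z * g z) * a
          + (2 * δ * dx (dx φ) z - du φ z * g z + vf ξ φ g z)) * (-g z + w)
        + 2 * δ * ((6 * du ξ z * a - 2 * du φ z) * (i z * a ^ 2 + j z * a + k z)
          + g z * (dx (dx φ) z + 2 * dx (du φ) z * a + du (du φ) z * a ^ 2 - du (du ξ) z * a ^ 3)
          + vf ξ φ i z * a ^ 2 + 2 * i z * a * eta₁ ξ φ z a + vf ξ φ j z * a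
          + j z * eta₁ ξ φ z a + vf ξ φ k z) = 0 := by
      intro w hw
      obtain ⟨b, hb⟩ : ∃ b, 2 * δ * b = -g z + w :=
        ⟨_, mul_div_cancel₀ _ (mul_ne_zero two_ne_zero hδ)⟩
      have h0 : δ * b ^ 2 + g z * b + i z * a ^ 2 + j z * a + k z = 0 := by
        have : 4 * δ * (δ * b ^ 2 + g z * b + i z * a ^ 2 + j z * a + k z) = 0 := by
          linear_combination (2 * δ * b + g z + w) * hb + hw
        exact (mul_eq_zero.1 this).resolve_left (mul_ne_zero (by norm_num) hδ)
      have h1 := H a b 0 (by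
        simp only [SmoothFn.coe_zero]
        linear_combination h0)
      simp only [SmoothFn.coe_zero, hvf, zero_mul, mul_zero, add_zero, zero_add] at h1
      simp only [eta₁, eta₂] at h1 ⊢
      rw [← hb]
      linear_combination (2 * δ) * h1 - 2 * δ * (2 * du φ z - 6 * du ξ z * a) * h0
    have h1 := root w hw
    have h2 := root (-w) (by rw [neg_sq, hw])
    rw [← hw]
    linear_combination w / 2 * (h1 - h2)
  obtain ⟨h1, h2, h3⟩ := quadratic_eq_zero_of_cubic_mul
    (mul_ne_zero (mul_ne_zero (by norm_num) hδ) hξ) key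
  refine ⟨?_, ?_, by linear_combination h3⟩
  · exact (mul_eq_zero.1 h1).resolve_left (mul_ne_zero (by norm_num) hδ)
  · exact (mul_eq_zero.1 h2).resolve_left (mul_ne_zero (by norm_num) hδ)

end JetPoly

namespace JetPoly

open MvPolynomial SmoothFn

variable {𝕜 : Type*} [RCLike 𝕜] {D : TopologicalSpace.Opens (𝕜 × 𝕜 × 𝕜)}

/-! ### The singular case: homogeneity in `u` -/

/-- Eigenvectors of a derivation with distinct constant eigenvalues are independent. -/
theorem eq_zero_of_sum_eigenvectors {ι : Type*} (d : Derivation 𝕜 (SmoothFn D) (SmoothFn D))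
    {l : ι → 𝕜} (hl : Function.Injective l) (s : Finset ι) (f : ι → SmoothFn D)
    (hf : ∀ i, d (f i) = con (l i) * f i) (h : ∑ i ∈ s, f i = 0) : ∀ i ∈ s, f i = 0 := by
  classical
  induction s using Finset.induction_on generalizing f with
  | empty => simp
  | insert a s ha ih =>
    have h1 := congrArg d h
    rw [map_sum, map_zero, Finset.sum_insert ha, hf a] at h1
    rw [Finset.sum_insert ha] at h
    have h2 := ih (fun i => con (l i - l a) * f i)
      (fun i => by
        simp only [Derivation.leibniz, Derivation.map_algebraMap, smul_eq_mul, hf]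
        ring)
      (by
        have h3 : ∑ i ∈ s, con (l i - l a) * f i = ∑ i ∈ s, d (f i) - con (l a) * ∑ i ∈ s, f i := by
          rw [Finset.mul_sum, ← Finset.sum_sub_distrib]
          refine Finset.sum_congr rfl fun i _ => ?_
          rw [hf, con, map_sub]
          ring
        rw [h3]
        linear_combination h1 - con (l a) * h)
    have h4 : ∀ i ∈ s, f i = 0 := fun i hi => by
      refine algebraMap_mul_eq_zero (sub_ne_zero.2 (hl.ne ?_)) (h2 i hi)
      rintro rfl
      exact ha hi
    intro i hi
    rcases Finset.mem_insert.1 hi with rfl | hi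
    · rw [Finset.sum_eq_zero h4, add_zero] at h
      exact h
    · exact h4 i hi

/-- The terms of `u g + m u² + κ u + μ u ∂K/∂u` are homogeneous in `u` of distinct degrees. -/
theorem singular_homogeneous {m κ μ : 𝕜} (hμ : μ ≠ 0) (hne : Nonempty D) {ξ φ g : SmoothFn D}
    (hs : u + con μ * ξ ^ 2 = 0) (hφ : 4 * (u * du φ) = -φ)
    (hg : g = -(con μ * du (dt φ + φ * du φ - ξ * dx φ)) - con m * u - con κ)
    (hgu : g * du (du ξ) = du g * du ξ) : g = 0 ∧ m = 0 ∧ κ = 0 ∧ φ = 0 := by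
  obtain ⟨-, -, hu⟩ := singular_xi hμ hs
  have hξ2 : ∀ z, 2 * ξ z * du ξ z = -μ⁻¹ := fun z => by
    have := congrArg (fun f : SmoothFn D => f z) hu
    simpa using this
  have hu0 : ∀ z, (u : SmoothFn D) z ≠ 0 := by
    intro z h0
    have h1 := congrArg (fun f : SmoothFn D => f z) hs
    simp only [SmoothFn.coe_add, SmoothFn.coe_mul, SmoothFn.coe_pow, coe_algebraMap,
      SmoothFn.coe_zero, h0, zero_add] at h1
    have h2 : ξ z = 0 := by simpa [hμ] using h1
    have h3 := hξ2 z
    rw [h2] at h3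
    simp [hμ] at h3
  have hξu0 : ∀ z, du ξ z ≠ 0 := by
    intro z h0
    have h3 := hξ2 z
    rw [h0] at h3
    simp [hμ] at h3
  obtain ⟨v, hv⟩ := exists_inv hu0
  have huv : u * v = 1 := by
    ext z
    simp only [SmoothFn.coe_mul, hv, SmoothFn.coe_one]
    exact mul_inv_cancel₀ (hu0 z)
  have hvu : du v = -(v ^ 2) := by rw [der_inv hu0 hv, du_u, mul_one]
  have hc : con μ⁻¹ * con μ = (1 : SmoothFn D) := by
    rw [← map_mul, inv_mul_cancel₀ hμ, map_one]
  have hξ1 : 2 * (u * du ξ) = ξ := by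
    linear_combination 2 * du ξ * hs - con μ * ξ * hu + ξ * hc
  have hξ3 : 2 * (u * du (du ξ)) = -du ξ := by
    have h := congrArg du hξ1
    simp [Derivation.leibniz] at h
    linear_combination h
  have hgθ : 2 * (u * du g) = -g := by
    refine sub_eq_zero.1 (mul_left_cancel_of_ne hξu0 ?_)
    linear_combination -2 * u * hgu + g * hξ3
  have hφt : 4 * (u * du (dt φ)) = -dt φ := by
    have h := congrArg dt hφ
    simpa [Derivation.leibniz, ← du_dt] using h
  have hφx : 4 * (u * du (dx φ)) = -dx φ := by
    have h := congrArg dx hφ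
    simpa [Derivation.leibniz, ← du_dx] using h
  have hφφ : 4 * (φ * du φ) = -(v * φ ^ 2) := by
    linear_combination v * φ * hφ - 4 * φ * du φ * huv
  have hb : 2 * (u * du (v * φ ^ 2)) = -3 * (v * φ ^ 2) := by
    simp only [Derivation.leibniz, Derivation.leibniz_pow, smul_eq_mul, nsmul_eq_mul, hvu]
    push_cast
    linear_combination v * φ * hφ - 2 * v * φ ^ 2 * huv
  have hd : 4 * (u * du (ξ * dx φ)) = ξ * dx φ := by
    simp only [Derivation.leibniz, smul_eq_mul]
    linear_combination ξ * hφx + 2 * dx φ * hξ1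
  have hsum : 8 * (u * g) + 8 * con m * u ^ 2 + 8 * con κ * u - 2 * con μ * dt φ
      + 3 * con μ * (v * φ ^ 2) - 2 * con μ * (ξ * dx φ) = 0 := by
    obtain ⟨K, hKdef⟩ : ∃ K, K = dt φ + φ * du φ - ξ * dx φ := ⟨_, rfl⟩
    have hK : 4 * K = 4 * dt φ - v * φ ^ 2 - 4 * (ξ * dx φ) := by
      linear_combination 4 * hKdef + hφφ
    have h4 : ∀ f : SmoothFn D, du (4 * f) = 4 * du f := fun f => by
      simp [Derivation.leibniz]
    have hKu := congrArg du hK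
    rw [map_sub, map_sub, h4, h4, h4] at hKu
    rw [hg, ← hKdef]
    linear_combination -2 * con μ * u * hKu - 2 * con μ * hφt + con μ * hb + 2 * con μ * hd
  have eig : ∀ (n : 𝕜) (f : SmoothFn D), 4 * (u * du f) = con n * f →
      ((u : SmoothFn D) • du) f = con (n / 4) * f := by
    intro n f h
    have h1 : (4 * con (n / 4) : SmoothFn D) = con n := by
      ext z
      rw [SmoothFn.coe_mul, SmoothFn.coe_ofNat, coe_algebraMap, coe_algebraMap]
      ring
    refine sub_eq_zero.1 (natCast_mul_eq_zero (n := 4) (by norm_num) ?_)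
    simp only [Derivation.smul_apply, smul_eq_mul]
    push_cast
    linear_combination h - f * h1
  have dn : ∀ n f : SmoothFn D, du n = 0 → du (n * f) = n * du f := fun n f h => by
    rw [Derivation.leibniz, h, smul_zero, add_zero, smul_eq_mul]
  have dc : ∀ c : 𝕜, du (con c : SmoothFn D) = 0 := fun c => Derivation.map_algebraMap _ c
  have d2 : du (2 * con μ : SmoothFn D) = 0 := by rw [dn _ _ (derivation_ofNat _ 2), dc, mul_zero]
  have d3 : du (3 * con μ : SmoothFn D) = 0 := by rw [dn _ _ (derivation_ofNat _ 3), dc, mul_zero]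
  have d8 : ∀ c : 𝕜, du (8 * con c : SmoothFn D) = 0 := fun c => by
    rw [dn _ _ (derivation_ofNat _ 8), dc, mul_zero]
  have c1 : con 1 = (1 : SmoothFn D) := map_one _
  have c1' : con (-1) = (-1 : SmoothFn D) := by rw [con, map_neg, map_one]
  have c6' : con (-6) = (-6 : SmoothFn D) := by rw [con, map_neg, map_ofNat]
  have c2 : con 2 = (2 : SmoothFn D) := map_ofNat _ 2
  have c8 : con 8 = (8 : SmoothFn D) := map_ofNat _ 8
  have c4 : con 4 = (4 : SmoothFn D) := map_ofNat _ 4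
  have e0 := eig 2 (8 * (u * g)) (by
    rw [dn _ _ (derivation_ofNat _ 8), Derivation.leibniz, du_u, c2, smul_eq_mul, smul_eq_mul]
    linear_combination 16 * u * hgθ)
  have e1 := eig 8 (8 * con m * u ^ 2) (by
    rw [dn _ _ (d8 m), Derivation.leibniz_pow, du_u, c8, smul_eq_mul, nsmul_eq_mul]
    push_cast
    ring)
  have e2 := eig 4 (8 * con κ * u) (by
    rw [dn _ _ (d8 κ), du_u, c4]
    ring)
  have e3 := eig (-1) (-(2 * con μ * dt φ)) (by
    rw [map_neg, dn _ _ d2, c1']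
    linear_combination -2 * con μ * hφt)
  have e4 := eig (-6) (3 * con μ * (v * φ ^ 2)) (by
    rw [dn _ _ d3, c6']
    linear_combination 6 * con μ * hb)
  have e5 := eig 1 (-(2 * con μ * (ξ * dx φ))) (by
    rw [map_neg, dn _ _ d2, c1]
    linear_combination -2 * con μ * hd)
  have key := eq_zero_of_sum_eigenvectors ((u : SmoothFn D) • du)
    (l := ![2 / 4, 8 / 4, 4 / 4, -1 / 4, -6 / 4, 1 / 4]) ?_ Finset.univ
    ![8 * (u * g), 8 * con m * u ^ 2, 8 * con κ * u, -(2 * con μ * dt φ), 3 * con μ * (v * φ ^ 2),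
      -(2 * con μ * (ξ * dx φ))] ?_ ?_
  · have hg0 : g = 0 := by
      have h := key 0 (Finset.mem_univ _)
      simp at h
      exact mul_left_cancel_of_ne hu0 (natCast_mul_eq_zero (n := 8) (by norm_num) (by
        push_cast
        linear_combination h))
    have hm : con m = (0 : SmoothFn D) := by
      have h := key 1 (Finset.mem_univ _)
      simp only [Matrix.cons_val] at h
      exact mul_left_cancel_of_ne hu0 (mul_left_cancel_of_ne hu0
        (natCast_mul_eq_zero (n := 8) (by norm_num) (by
        push_cast
        linear_combination h)))
    have hκ : con κ = (0 : SmoothFn D) := by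
      have h := key 2 (Finset.mem_univ _)
      simp only [Matrix.cons_val] at h
      exact mul_left_cancel_of_ne hu0 (natCast_mul_eq_zero (n := 8) (by norm_num) (by
        push_cast
        linear_combination h))
    have hφ0 : φ = 0 := by
      have h := key 4 (Finset.mem_univ _)
      simp only [Matrix.cons_val] at h
      refine pow_eq_zero_iff two_ne_zero |>.1 (algebraMap_mul_eq_zero hμ
        (natCast_mul_eq_zero (n := 3) (by norm_num) ?_))
      push_cast
      linear_combination u * h - 3 * con μ * φ ^ 2 * huv
    exact ⟨hg0, con_eq_zero hne hm, con_eq_zero hne hκ, hφ0⟩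
  · intro i j h
    fin_cases i <;> fin_cases j <;> first | rfl | (exfalso; norm_num at h)
  · intro i
    fin_cases i
    exacts [e0, e1, e2, e3, e4, e5]
  · simp [Fin.sum_univ_succ]
    linear_combination hsum

end JetPoly

namespace JetPoly

open MvPolynomial SmoothFn

variable {𝕜 : Type*} [RCLike 𝕜] {D : TopologicalSpace.Opens (𝕜 × 𝕜 × 𝕜)}

/-! ### The nonclassical infinitesimals of the singular case -/

/-- If the reduced equation can be solved for `u_xx`, the coefficient of `u_x³` in the criterion
vanishes. -/
theorem ThirdOrderCriterion.leading_eq_zero {ξ φ g i j k : SmoothFn D} {z : D}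
    (H : ThirdOrderCriterion ξ φ 0 0 0 0 g 0 i j k z) :
    g z * (g z * du (du ξ) z - i z * du ξ z) = 0 := by
  by_cases hg : g z = 0
  · rw [hg, zero_mul]
  have hvf : vf ξ φ 0 z = 0 := by simp [vf]
  have key : ∀ a b : 𝕜, g z * b = -(i z * a ^ 2 + j z * a + k z) → _ := fun a b hb => by
    have h1 := H a b 0 (by
      simp only [SmoothFn.coe_zero]
      linear_combination hb)
    simp only [SmoothFn.coe_zero, hvf, zero_mul, mul_zero, add_zero, zero_add, eta₁, eta₂] at h1
    have h2 : vf ξ φ g z * (-(i z * a ^ 2 + j z * a + k z))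
        + g z * (g z * (dx (dx φ) z + 2 * dx (du φ) z * a + du (du φ) z * a ^ 2
          - du (du ξ) z * a ^ 3)
          + (du φ z - 3 * du ξ z * a) * (-(i z * a ^ 2 + j z * a + k z))
        + vf ξ φ i z * a ^ 2 + 2 * i z * a * (dx φ z + du φ z * a - du ξ z * a ^ 2)
        + vf ξ φ j z * a + j z * (dx φ z + du φ z * a - du ξ z * a ^ 2) + vf ξ φ k z) = 0 := by
      rw [← hb]
      linear_combination g z * h1
    exact h2
  have k₁ := key 2 _ (mul_div_cancel₀ _ hg)
  have k₂ := key 1 _ (mul_div_cancel₀ _ hg)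
  have k₃ := key 0 _ (mul_div_cancel₀ _ hg)
  have k₄ := key (-1) _ (mul_div_cancel₀ _ hg)
  -- the third difference with respect to `u_x`
  linear_combination -(k₁ - 3 * k₂ + 3 * k₃ - k₄) / 6

/-- Differentiating `u + μ ξ² = 0` gives `2 μ ξ ξ_u = -1`, so no derivative of `ξ` with respect to
`u` up to order three has a zero. -/
theorem singular_ne_zero {μ : 𝕜} (hμ : μ ≠ 0) {ξ : SmoothFn D} (hs : u + con μ * ξ ^ 2 = 0)
    (z : D) : ξ z ≠ 0 ∧ du ξ z ≠ 0 ∧ du (du ξ) z ≠ 0 ∧ du (du (du ξ)) z ≠ 0 := by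
  have h1 := (singular_xi hμ hs).2.2
  have h2 := congrArg du h1
  have h3 := congrArg du h2
  simp only [Derivation.leibniz, derivation_ofNat, smul_eq_mul, mul_zero, add_zero, map_neg,
    Derivation.map_algebraMap, neg_zero, map_add, map_zero] at h2 h3
  have e1 := congrArg (fun f : SmoothFn D => f z) h1
  have e2 := congrArg (fun f : SmoothFn D => f z) h2
  have e3 := congrArg (fun f : SmoothFn D => f z) h3
  simp only [SmoothFn.coe_mul, SmoothFn.coe_add, SmoothFn.coe_neg, SmoothFn.coe_zero,
    SmoothFn.coe_ofNat, coe_algebraMap] at e1 e2 e3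
  have n0 : ξ z ≠ 0 := fun h => by simp [h, hμ] at e1
  have n1 : du ξ z ≠ 0 := fun h => by simp [h, hμ] at e1
  have n2 : du (du ξ) z ≠ 0 := fun h => by
    rw [h] at e2
    exact pow_ne_zero 2 n1 (by linear_combination e2 / 2)
  refine ⟨n0, n1, n2, fun h => ?_⟩
  rw [h] at e3
  exact mul_ne_zero n1 n2 (by linear_combination e3 / 6)

/-- `singular_homogeneous` without the assumption that `g ∂²ξ/∂u² = ∂g/∂u ∂ξ/∂u` where `g = 0`. -/
theorem singular_homogeneous_of_mul {m κ μ : 𝕜} (hμ : μ ≠ 0) (hne : Nonempty D)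
    {ξ φ g : SmoothFn D} (hs : u + con μ * ξ ^ 2 = 0) (hφ : 4 * (u * du φ) = -φ)
    (hg : g = -(con μ * du (dt φ + φ * du φ - ξ * dx φ)) - con m * u - con κ)
    (hgu : ∀ z, g z * (g z * du (du ξ) z - du g z * du ξ z) = 0) : m = 0 ∧ κ = 0 ∧ φ = 0 := by
  suffices g = 0 from (singular_homogeneous hμ hne hs hφ hg (by simp [this])).2
  by_contra hg0
  obtain ⟨z, hz⟩ : ∃ z, g z ≠ 0 := by
    by_contra! h
    exact hg0 (SmoothFn.ext h)
  have hne' : Nonempty g.support := ⟨⟨z, z.2, hz⟩⟩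
  have h := g.support_le
  have hru : restrict h u = u := by
    ext z
    rw [restrict_apply, u_apply, u_apply]
  have h1 := singular_homogeneous (m := m) (κ := κ) hμ hne' (ξ := restrict h ξ)
    (φ := restrict h φ) (g := restrict h g) ?_ ?_ ?_ ?_
  · have h2 := congrArg (fun f : SmoothFn g.support => f ⟨z, z.2, hz⟩) h1.1
    simp only [restrict_apply] at h2
    exact hz h2
  · have h2 := congrArg (restrict h) hs
    rwa [map_add, map_mul, map_pow, AlgHom.commutes, hru, map_zero] at h2
  · have h2 := congrArg (restrict h) hφ
    rwa [map_mul, map_ofNat, map_mul, map_neg, ← du_restrict, hru] at h2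
  · have h2 := congrArg (restrict h) hg
    rwa [map_sub, map_sub, map_neg, map_mul, map_mul, AlgHom.commutes, AlgHom.commutes,
      AlgHom.commutes, ← du_restrict, map_sub, map_add, map_mul, map_mul, ← du_restrict,
      ← dt_restrict, ← dx_restrict, hru] at h2
  · ext z
    obtain ⟨z, hzD, hz⟩ := z
    simp only [du_restrict, SmoothFn.coe_mul, restrict_apply]
    exact sub_eq_zero.1 ((mul_eq_zero.1 (hgu ⟨z, hzD⟩)).resolve_left hz)

/-- The criterion gives `ε = 0` and `q = 0`, so `u_xxx` does not occur in the reduced equation. It is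
then linear in `u_xx` if `δ = 0`, and quadratic in `u_xx` with vanishing discriminant if not. -/
theorem singular_of_criterion [IsAlgClosed 𝕜] {m κ μ ε δ : 𝕜} (hμ : μ ≠ 0) (hne : Nonempty D)
    {ξ φ J K q f g h i j k : SmoothFn D}
    (hs : u + con μ * ξ ^ 2 = 0) (hJ : J = 2 * ξ * du φ + φ * du ξ)
    (hK : K = dt φ + φ * du φ - ξ * dx φ) (hq : q = con μ * J) (hf : f = 3 * con μ * du J)
    (hg : g = 2 * con μ * dx J - con μ * du K - con m * u - con κ) (hh : h = con μ * du (du J))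
    (hi : i = 2 * con μ * dx (du J) - con μ * du (du K) - con m)
    (hj : j = con μ * dx (dx J) - 2 * con μ * dx (du K) - J) (hk : k = K - con μ * dx (dx K))
    (H : ∀ z, ThirdOrderCriterion ξ φ ε δ q f g h i j k z) :
    ε = 0 ∧ m = 0 ∧ κ = 0 ∧ φ = 0 := by
  have hnz := singular_ne_zero hμ hs
  have hc : con μ⁻¹ * con μ = (1 : SmoothFn D) := by
    rw [← map_mul, inv_mul_cancel₀ hμ, map_one]
  obtain ⟨-, -, hu⟩ := singular_xi hμ hs
  obtain rfl : ε = 0 := hne.elim fun z => (H z).eps_eq_zero (hnz z).2.2.2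
  obtain rfl : q = 0 := SmoothFn.ext fun z => (H z).q_eq_zero (hnz z).2.1
  have hJ0 : J = 0 := algebraMap_mul_eq_zero hμ hq.symm
  rw [hJ0] at hf hg hh hi hj hJ
  simp only [map_zero, mul_zero, zero_sub, sub_zero] at hf hg hh hi hj
  subst hf hh
  have hφ : 4 * (u * du φ) = -φ := by
    linear_combination 4 * du φ * hs + 2 * con μ * ξ * hJ + con μ * φ * hu - φ * hc
  have hgu : du g = i := by
    rw [hg, hi]
    simp [Derivation.leibniz]
  refine ⟨rfl, ?_⟩
  by_cases hδ : δ = 0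
  · subst hδ
    refine singular_homogeneous_of_mul (g := g) hμ hne hs hφ (by rw [hg, hK]) fun z => ?_
    rw [hgu]
    exact (H z).leading_eq_zero
  · have hd := fun z => (H z).discrim_eq_zero hδ (hnz z).2.2.1
    obtain rfl : i = 0 := SmoothFn.ext fun z => (hd z).1
    obtain rfl : j = 0 := SmoothFn.ext fun z => (hd z).2.1
    have hg2 : g ^ 2 = 4 * con δ * k := SmoothFn.ext fun z => by
      simpa using (hd z).2.2
    have hKx : dx (du K) = 0 := algebraMap_mul_eq_zero hμ
      (natCast_mul_eq_zero (n := 2) two_ne_zero (by push_cast; linear_combination hj))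
    have hku : du k = 0 := by
      have h1 := congrArg du hg2
      simp only [Derivation.leibniz_pow, Derivation.leibniz, Derivation.map_algebraMap,
        derivation_ofNat, hgu, smul_zero, add_zero, nsmul_zero, smul_eq_mul] at h1
      exact algebraMap_mul_eq_zero hδ (natCast_mul_eq_zero (n := 4) four_ne_zero (by
        push_cast; linear_combination -h1))
    have hKu : du K = 0 := by
      rw [hk, map_sub, Derivation.leibniz, Derivation.map_algebraMap, du_dx, du_dx, hKx] at hku
      simpa using hku
    have hm : m = 0 := con_eq_zero hne (by
      rw [hKu, map_zero] at hi
      linear_combination hi)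
    obtain ⟨-, -, -, hφ0⟩ := singular_homogeneous (m := 0) (κ := 0) (g := 0) hμ hne hs hφ
      (by rw [← hK, hKu]; simp) (by simp)
    have hK0 : K = 0 := by rw [hK, hφ0]; simp
    have hg0 : g = 0 := by
      rw [hk, hK0] at hg2
      simpa using hg2
    refine ⟨hm, con_eq_zero hne ?_, hφ0⟩
    rw [hg0, hKu, hm] at hg
    simp only [map_zero] at hg
    linear_combination hg

theorem reducedPoly_singular_of_eq_zero {γ μ : 𝕜} (β : 𝕜) (hμ : μ ≠ 0) {ξ : SmoothFn D}
    (hs : u + con μ * ξ ^ 2 = 0) (hm : μ⁻¹ + 2 * γ = 0) :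
    reducedPoly 4 β γ 0 μ ξ 0 = cst 0 * X (1, 0) * X (3, 0) + C 0 * X (3, 0)
      + cst (3 - β) * X (2, 0) ^ 2 + C 0 * X (1, 0) * X (2, 0) + C 0 * X (2, 0)
      + C 0 * X (1, 0) ^ 3 + C 0 * X (1, 0) ^ 2 + C 0 * X (1, 0) + C 0 := by
  rw [reducedPoly_singular 4 β γ 0 μ hμ hs (J := 0) (K := 0) (by simp) (by simp), hm]
  simp only [map_zero, mul_zero, zero_mul, sub_zero, sub_self]

theorem isNonclassical_iff_of_singular [IsAlgClosed 𝕜] {α β γ κ μ : 𝕜} (hμ : μ ≠ 0)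
    (hne : Nonempty D) {ξ φ : 𝕜 → 𝕜 → 𝕜 → 𝕜} {ξ' φ' : SmoothFn D}
    (hξ : ∀ x t u (h : (x, t, u) ∈ D), ξ x t u = ξ' ⟨_, h⟩)
    (hφ : ∀ x t u (h : (x, t, u) ∈ D), φ x t u = φ' ⟨_, h⟩) (hs : u + con μ * ξ' ^ 2 = 0) :
    IsNonclassical α β γ κ μ ξ φ D ↔ α = 4 ∧ 1 + 2 * γ * μ = 0 ∧ κ = 0 ∧ φ' = 0 := by
  have hm : μ⁻¹ + 2 * γ = 0 ↔ 1 + 2 * γ * μ = 0 := by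
    rw [← mul_right_inj' hμ, mul_add, mul_inv_cancel₀ hμ, mul_zero]
    ring_nf
  rw [isNonclassical_iff α β γ κ μ hξ hφ]
  constructor
  · intro H
    rw [forall_ev_iff_of_third_order ξ' φ' (singular_xi hμ hs).1 _ _ _ _ _ _ _ _ _ _
      (reducedPoly_singular α β γ κ μ hμ hs rfl rfl)] at H
    obtain ⟨h1, h2, h3, h4⟩ :=
      singular_of_criterion hμ hne hs rfl rfl rfl rfl rfl rfl rfl rfl rfl H
    exact ⟨(sub_eq_zero.1 h1).symm, hm.1 h2, h3, h4⟩
  · rintro ⟨rfl, h2, rfl, rfl⟩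
    rw [forall_ev_iff_of_third_order ξ' 0 (singular_xi hμ hs).1 _ _ _ _ _ _ _ _ _ _
      (reducedPoly_singular_of_eq_zero β hμ hs (hm.2 h2))]
    intro z a b c h
    have hvf : vf ξ' 0 0 z = 0 := by simp [vf]
    simp only [SmoothFn.coe_zero, hvf, eta₂, map_zero, zero_mul, mul_zero, add_zero, zero_add]
      at h ⊢
    have hb : (3 - β) * b = 0 := by simpa using h
    linear_combination (-2 * du (du ξ') z * a ^ 3 - 6 * du ξ' z * a * b) * hb

end JetPoly

/-! ### Jets of functions of two variables -/

namespace SmoothFn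

variable {𝕜 : Type*} [RCLike 𝕜] {D : TopologicalSpace.Opens (𝕜 × 𝕜 × 𝕜)}

theorem iteratedDeriv_slice_x (f : SmoothFn D) (n : ℕ) (z : D) :
    iteratedDeriv n (fun s => f.extend (s, (z : 𝕜 × 𝕜 × 𝕜).2.1, (z : 𝕜 × 𝕜 × 𝕜).2.2))
      (z : 𝕜 × 𝕜 × 𝕜).1 = dx^[n] f z := by
  induction n generalizing z with
  | zero => rw [iteratedDeriv_zero, Function.iterate_zero, id, ← extend_apply]
  | succ n ih =>
    have hc : Continuous fun s : 𝕜 => (s, (z : 𝕜 × 𝕜 × 𝕜).2.1, (z : 𝕜 × 𝕜 × 𝕜).2.2) := by fun_prop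
    rw [iteratedDeriv_succ, Function.iterate_succ_apply', ← (hasDerivAt_slice_x _ z).deriv]
    refine Filter.EventuallyEq.deriv_eq ?_
    filter_upwards [hc.continuousAt.eventually_mem (D.isOpen.mem_nhds z.2)] with s hs
    rw [extend_apply _ ⟨_, hs⟩]
    exact ih ⟨_, hs⟩

theorem iteratedDeriv_slice_t (f : SmoothFn D) (n : ℕ) (z : D) :
    iteratedDeriv n (fun s => f.extend ((z : 𝕜 × 𝕜 × 𝕜).1, s, (z : 𝕜 × 𝕜 × 𝕜).2.2))
      (z : 𝕜 × 𝕜 × 𝕜).2.1 = dt^[n] f z := by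
  induction n generalizing z with
  | zero => rw [iteratedDeriv_zero, Function.iterate_zero, id, ← extend_apply]
  | succ n ih =>
    have hc : Continuous fun s : 𝕜 => ((z : 𝕜 × 𝕜 × 𝕜).1, s, (z : 𝕜 × 𝕜 × 𝕜).2.2) := by fun_prop
    rw [iteratedDeriv_succ, Function.iterate_succ_apply', ← (hasDerivAt_slice_t _ z).deriv]
    refine Filter.EventuallyEq.deriv_eq ?_
    filter_upwards [hc.continuousAt.eventually_mem (D.isOpen.mem_nhds z.2)] with s hs
    rw [extend_apply _ ⟨_, hs⟩]
    exact ih ⟨_, hs⟩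

end SmoothFn

namespace JetPoly

open MvPolynomial SmoothFn

variable {𝕜 : Type*} [RCLike 𝕜] {D : TopologicalSpace.Opens (𝕜 × 𝕜 × 𝕜)}

/-- The cylinder over a set of points `(x, t)`. Functions of `(x, t)` are treated as functions on
the cylinder that do not depend on the third coordinate. -/
def cylinder {U : Set (𝕜 × 𝕜)} (hU : IsOpen U) : TopologicalSpace.Opens (𝕜 × 𝕜 × 𝕜) :=
  ⟨{z | (z.1, z.2.1) ∈ U}, hU.preimage (by fun_prop)⟩

section

variable {U : Set (𝕜 × 𝕜)} (hU : IsOpen U) {f : 𝕜 → 𝕜 → 𝕜} {w : SmoothFn (cylinder hU)}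
  (hw : ∀ z : cylinder hU, w z = f (z : 𝕜 × 𝕜 × 𝕜).1 (z : 𝕜 × 𝕜 × 𝕜).2.1)
include hw

theorem jetOf_eq (z : cylinder hU) (i j : ℕ) :
    jetOf f (z : 𝕜 × 𝕜 × 𝕜).1 (z : 𝕜 × 𝕜 × 𝕜).2.1 (i, j) = dx^[i] (dt^[j] w) z := by
  have h1 : ∀ z : cylinder hU, iteratedDeriv j (fun s => f (z : 𝕜 × 𝕜 × 𝕜).1 s)
      (z : 𝕜 × 𝕜 × 𝕜).2.1 = dt^[j] w z := by
    rintro ⟨⟨x, t, y⟩, h⟩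
    rw [← iteratedDeriv_slice_t]
    refine Filter.EventuallyEq.iteratedDeriv_eq _ ?_
    have hc : Continuous fun s : 𝕜 => (x, s) := by fun_prop
    filter_upwards [hc.continuousAt.eventually_mem (hU.mem_nhds h)] with s hs
    exact ((extend_apply w ⟨(x, s, y), hs⟩).trans (hw ⟨(x, s, y), hs⟩)).symm
  obtain ⟨⟨x, t, y⟩, h⟩ := z
  rw [← iteratedDeriv_slice_x]
  refine Filter.EventuallyEq.iteratedDeriv_eq _ ?_
  have hc : Continuous fun s : 𝕜 => (s, t) := by fun_prop
  filter_upwards [hc.continuousAt.eventually_mem (hU.mem_nhds h)] with s hs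
  exact (h1 ⟨(s, t, y), hs⟩).trans (extend_apply (dt^[j] w) ⟨(s, t, y), hs⟩).symm

theorem du_eq_zero_of_cylinder : du w = 0 := by
  ext z
  have h := hasDerivAt_slice_u w z
  have h2 : (fun s => w.extend ((z : 𝕜 × 𝕜 × 𝕜).1, (z : 𝕜 × 𝕜 × 𝕜).2.1, s)) = fun _ => w z := by
    funext s
    rw [hw z]
    exact (extend_apply w ⟨(_, _, s), z.2⟩).trans (hw ⟨(_, _, s), z.2⟩)
  rw [h2] at h
  exact h.unique (hasDerivAt_const _ _)

/-- A function on a connected open set of points `(x, t)` is constant if both of its first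
derivatives vanish. -/
theorem exists_eq_const_of_derivs (hU' : IsPreconnected U) (h1 : dx w = 0) (h2 : dt w = 0) :
    ∃ c, ∀ x t, (x, t) ∈ U → f x t = c := by
  have h3 := du_eq_zero_of_cylinder hU hw
  have hd : ∀ p ∈ U, HasFDerivAt (fun p : 𝕜 × 𝕜 => f p.1 p.2) (0 : 𝕜 × 𝕜 →L[𝕜] 𝕜) p := by
    intro p hp
    let L : 𝕜 × 𝕜 →L[𝕜] 𝕜 × 𝕜 × 𝕜 := (ContinuousLinearMap.fst 𝕜 𝕜 𝕜).prod
      ((ContinuousLinearMap.snd 𝕜 𝕜 𝕜).prod 0)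
    have h := (w.hasFDerivAt_extend ⟨L p, hp⟩).comp p L.hasFDerivAt
    have h0 : (fderiv 𝕜 w.extend (L p)).comp L = 0 := by
      ext <;> simp [fderiv_extend w ⟨L p, hp⟩, h1, h2, h3]
    have h' := h.congr_fderiv h0
    refine h'.congr_of_eventuallyEq ?_
    filter_upwards [hU.mem_nhds hp] with q hq
    exact ((extend_apply w ⟨L q, hq⟩).trans (hw ⟨L q, hq⟩)).symm
  obtain ⟨c, hc⟩ := hU.exists_is_const_of_fderiv_eq_zero (𝕜 := 𝕜) hU'
    (fun p hp => (hd p hp).differentiableAt.differentiableWithinAt) fun p hp => (hd p hp).fderiv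
  exact ⟨c, fun x t h => hc (x, t) h⟩

end

/-! ### Solutions of the surface condition in the singular case -/

section

variable {μ : 𝕜} {v w : SmoothFn D}

/-- The surface condition `w_t = -v w_x` with `w = -μ v²` implies `w_tt = -(w²)_xx / (2 μ)`. -/
theorem dt_dt_of_surface (hμ : μ ≠ 0) (hs : w + con μ * v ^ 2 = 0) (ht : dt w = -(v * dx w)) :
    dt (dt w) = -(con μ⁻¹ * (dx w ^ 2 + w * dx (dx w))) := by
  have hc : con μ⁻¹ * con μ = (1 : SmoothFn D) := by
    rw [← map_mul, inv_mul_cancel₀ hμ, map_one]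
  have hx : dx w = -(2 * con μ * v * dx v) := by
    have h := congrArg dx hs
    simp [Derivation.leibniz, Derivation.leibniz_pow] at h
    linear_combination h
  have ht' : dt w = -(2 * con μ * v * dt v) := by
    have h := congrArg dt hs
    simp [Derivation.leibniz, Derivation.leibniz_pow] at h
    linear_combination h
  have htt := congrArg dt ht
  have htx := congrArg dx ht
  simp only [Derivation.leibniz, map_neg, smul_eq_mul, dt_dx] at htt htx
  linear_combination htt - v * htx - dt v * hx + dx v * ht' - dx v * ht
    + con μ⁻¹ * dx (dx w) * hs - v ^ 2 * dx (dx w) * hc + con μ⁻¹ * dx w * hx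
    - 2 * v * dx v * dx w * hc

/-- In the singular case with `α = 4`, `1 + 2γμ = 0` and `κ = 0`, the left-hand side of the
equation is `S - μ S_xx + (3 - β) w_xx²`, where `S = w_tt + (w²)_xx / (2 μ)` vanishes. -/
theorem equation_of_surface (β : 𝕜) (hμ : μ ≠ 0) (hs : w + con μ * v ^ 2 = 0)
    (ht : dt w = -(v * dx w)) :
    dt (dt w) + con μ⁻¹ * (w * dx (dx w) + dx w ^ 2) - w * dx (dx (dx (dx w)))
      - con μ * dx (dx (dt (dt w))) - 4 * dx w * dx (dx (dx w)) - con β * dx (dx w) ^ 2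
      = con (3 - β) * dx (dx w) ^ 2 := by
  have hc : con μ⁻¹ * con μ = (1 : SmoothFn D) := by
    rw [← map_mul, inv_mul_cancel₀ hμ, map_one]
  have h1 := dt_dt_of_surface hμ hs ht
  have h2 := congrArg dx (congrArg dx h1)
  simp only [Derivation.leibniz, Derivation.leibniz_pow, Derivation.map_algebraMap, map_neg,
    map_add, smul_eq_mul, nsmul_eq_mul, Nat.cast_ofNat, derivation_ofNat, mul_zero, add_zero,
    Nat.add_one_sub_one, pow_one] at h2
  have h3 : con (3 - β) = (3 - con β : SmoothFn D) := by
    rw [con, map_sub, map_ofNat]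
  rw [h3]
  linear_combination h1 - con μ * h2 + (3 * dx (dx w) ^ 2 + 4 * dx w * dx (dx (dx w))
    + w * dx (dx (dx (dx w)))) * hc

/-- If `β ≠ 3`, the equation reduces to `w_xx = 0`; differentiating this with respect to `t`
gives `v_xx w_x = 0`, and then `w_x = 0`. -/
theorem derivs_eq_zero_of_surface (hs : w + con μ * v ^ 2 = 0)
    (ht : dt w = -(v * dx w)) (hxx : dx (dx w) = 0) : dx w = 0 ∧ dt w = 0 := by
  have hx : dx w = -(2 * con μ * v * dx v) := by
    have h := congrArg dx hs
    simp [Derivation.leibniz, Derivation.leibniz_pow] at h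
    linear_combination h
  have h1 := congrArg dx (congrArg dx ht)
  have h2 : dx (dx (dt w)) = 0 := by rw [← dt_dx, ← dt_dx, hxx, map_zero]
  have h3 := congrArg dx hx
  rw [h2] at h1
  simp only [Derivation.leibniz, map_neg, map_add, smul_eq_mul, hxx, map_zero, mul_zero,
    add_zero, zero_add, Derivation.map_algebraMap, derivation_ofNat] at h1 h3
  have h4 : dx w = 0 := by
    refine pow_eq_zero_iff (n := 3) three_ne_zero |>.1 ?_
    have h5 : 2 * con μ * dx v ^ 2 * dx w = 0 := by
      linear_combination dx w * h3 - 2 * con μ * v * h1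
    linear_combination dx w * (dx w - 2 * con μ * v * dx v) * hx + 2 * con μ * v ^ 2 * h5
  exact ⟨h4, by rw [ht, h4, mul_zero, neg_zero]⟩

end

end JetPoly

namespace JetPoly

open MvPolynomial SmoothFn

section

variable {𝕜 : Type*} [RCLike 𝕜] {D : TopologicalSpace.Opens (𝕜 × 𝕜 × 𝕜)}
variable {β γ μ : 𝕜} {ξ φ : 𝕜 → 𝕜 → 𝕜 → 𝕜} {ξ' : SmoothFn D}

/-! ### The equation on solutions of the surface condition in the singular case -/

/-- A solution `f` of the surface condition in the singular case, as a function `w` on the cylinder,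
with `v = ξ(x, t, f)`. -/
theorem exists_of_surface (hξ : ∀ x t u (h : (x, t, u) ∈ D), ξ x t u = ξ' ⟨_, h⟩)
    (hφ : ∀ x t u, (x, t, u) ∈ D → φ x t u = 0) (hs : u + con μ * ξ' ^ 2 = 0)
    {U : Set (𝕜 × 𝕜)} {f : 𝕜 → 𝕜 → 𝕜} (hU : IsOpen U) (hf : IsFunctionInto D U f)
    (h : Solves (surfaceCondition ξ (fun _ _ _ => 1) φ) U f) :
    ∃ v w : SmoothFn (cylinder hU),
      (∀ z : cylinder hU, w z = f (z : 𝕜 × 𝕜 × 𝕜).1 (z : 𝕜 × 𝕜 × 𝕜).2.1) ∧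
      w + con μ * v ^ 2 = 0 ∧ dt w = -(v * dx w) := by
  have hpr : ContDiff 𝕜 ∞ fun z : 𝕜 × 𝕜 × 𝕜 => (z.1, z.2.1) := by fun_prop
  have hfc : ContDiffOn 𝕜 ∞ (fun z : 𝕜 × 𝕜 × 𝕜 => f z.1 z.2.1) (cylinder hU) :=
    hf.1.comp hpr.contDiffOn fun z hz => hz
  have hv : ContDiffOn 𝕜 ∞ (fun z : 𝕜 × 𝕜 × 𝕜 => ξ'.extend (z.1, z.2.1, f z.1 z.2.1))
      (cylinder hU) :=
    ξ'.contDiffOn_extend.comp (contDiffOn_fst.prodMk ((contDiff_fst.comp contDiff_snd).contDiffOn.prodMk hfc))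
      fun z hz => hf.2 _ _ hz
  have hw : ∀ z : cylinder hU, (SmoothFn.mk _ hfc : SmoothFn (cylinder hU)) z
      = f (z : 𝕜 × 𝕜 × 𝕜).1 (z : 𝕜 × 𝕜 × 𝕜).2.1 := fun _ => rfl
  refine ⟨SmoothFn.mk _ hv, SmoothFn.mk _ hfc, hw, ?_, ?_⟩
  · ext z
    have h1 := congrArg (fun F : SmoothFn D => F ⟨_, hf.2 _ _ z.2⟩) hs
    simp only [SmoothFn.coe_add, SmoothFn.coe_mul, SmoothFn.coe_pow, coe_algebraMap, mk_apply,
      SmoothFn.coe_zero, u_apply] at h1 ⊢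
    rw [extend_apply ξ' ⟨_, hf.2 _ _ z.2⟩]
    exact h1
  · ext z
    have h1 := h _ _ z.2
    simp only [surfaceCondition, jetOf_eq hU hw z, Function.iterate_succ_apply',
      Function.iterate_zero, id] at h1
    rw [hw, hξ _ _ _ (hf.2 _ _ z.2), hφ _ _ _ (hf.2 _ _ z.2)] at h1
    simp only [SmoothFn.coe_neg, SmoothFn.coe_mul, mk_apply]
    rw [extend_apply ξ' ⟨_, hf.2 _ _ z.2⟩]
    linear_combination h1

/-- In the singular case the equation on a solution of the surface condition is a multiple of the
square of `u_xx`. -/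
theorem equation_jetOf (hμ : μ ≠ 0) (hm : 1 + 2 * γ * μ = 0) {U : Set (𝕜 × 𝕜)} {f : 𝕜 → 𝕜 → 𝕜}
    (hU : IsOpen U) {v w : SmoothFn (cylinder hU)}
    (hw : ∀ z : cylinder hU, w z = f (z : 𝕜 × 𝕜 × 𝕜).1 (z : 𝕜 × 𝕜 × 𝕜).2.1)
    (hs : w + con μ * v ^ 2 = 0) (ht : dt w = -(v * dx w)) (z : cylinder hU) :
    equation 4 β γ 0 μ (z : 𝕜 × 𝕜 × 𝕜).1 (z : 𝕜 × 𝕜 × 𝕜).2.1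
      (jetOf f (z : 𝕜 × 𝕜 × 𝕜).1 (z : 𝕜 × 𝕜 × 𝕜).2.1) = (3 - β) * dx (dx w) z ^ 2 := by
  have h := congrArg (fun F : SmoothFn (cylinder hU) => F z) (equation_of_surface β hμ hs ht)
  simp only [SmoothFn.coe_add, SmoothFn.coe_sub, SmoothFn.coe_mul, SmoothFn.coe_pow,
    coe_algebraMap, SmoothFn.coe_ofNat] at h
  have hγ : μ⁻¹ = -2 * γ := by
    refine inv_eq_of_mul_eq_one_right ?_
    linear_combination -hm
  rw [hγ] at h
  simp only [equation, equationWith, jetOf_eq hU hw z, Function.iterate_succ_apply',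
    Function.iterate_zero, id]
  linear_combination h

theorem exists_eq_const_of_singular (hμ : μ ≠ 0) (hβ : β ≠ 3) (hm : 1 + 2 * γ * μ = 0)
    (hξ : ∀ x t u (h : (x, t, u) ∈ D), ξ x t u = ξ' ⟨_, h⟩)
    (hφ : ∀ x t u, (x, t, u) ∈ D → φ x t u = 0) (hs : u + con μ * ξ' ^ 2 = 0)
    {U : Set (𝕜 × 𝕜)} {f : 𝕜 → 𝕜 → 𝕜} (hU : IsOpen U) (hU' : IsPreconnected U)
    (hf : IsFunctionInto D U f) (he : Solves (equation 4 β γ 0 μ) U f)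
    (h : Solves (surfaceCondition ξ (fun _ _ _ => 1) φ) U f) :
    ∃ c, ∀ x t, (x, t) ∈ U → f x t = c := by
  obtain ⟨v, w, hw, h1, h2⟩ := exists_of_surface hξ hφ hs hU hf h
  have h3 : dx (dx w) = 0 := SmoothFn.ext fun z => by
    have h4 := he _ _ z.2
    rw [equation_jetOf hμ hm hU hw h1 h2 z] at h4
    exact pow_eq_zero_iff two_ne_zero |>.1
      ((mul_eq_zero.1 h4).resolve_left (sub_ne_zero.2 hβ.symm))
  obtain ⟨h4, h5⟩ := derivs_eq_zero_of_surface h1 h2 h3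
  exact exists_eq_const_of_derivs hU hw hU' h4 h5

theorem solves_of_singular (hμ : μ ≠ 0) (hm : 1 + 2 * γ * μ = 0)
    (hξ : ∀ x t u (h : (x, t, u) ∈ D), ξ x t u = ξ' ⟨_, h⟩)
    (hφ : ∀ x t u, (x, t, u) ∈ D → φ x t u = 0) (hs : u + con μ * ξ' ^ 2 = 0)
    {U : Set (𝕜 × 𝕜)} {f : 𝕜 → 𝕜 → 𝕜} (hU : IsOpen U) (hf : IsFunctionInto D U f)
    (h : Solves (surfaceCondition ξ (fun _ _ _ => 1) φ) U f) :
    Solves (equation 4 3 γ 0 μ) U f := by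
  obtain ⟨v, w, hw, h1, h2⟩ := exists_of_surface hξ hφ hs hU hf h
  intro x t hz
  rw [equation_jetOf hμ hm hU hw h1 h2 ⟨(x, t, 0), hz⟩, sub_self, zero_mul]

/-- Near `(x₀, t₀)` the function `u = -μ V²` with `V = (x - x₀ + v₀) / (t - t₀ + 1)`, where `v₀` is
the value of `ξ` at `(x₀, t₀, u₀)`, is a nonconstant solution of the surface condition: `V` solves
`V_t + V V_x = 0`, and `ξ = V` on the graph by continuity. -/
theorem exists_nonconstant_solution (hμ : μ ≠ 0) (hne : Nonempty D)
    (hξ : ∀ x t u (h : (x, t, u) ∈ D), ξ x t u = ξ' ⟨_, h⟩)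
    (hφ : ∀ x t u, (x, t, u) ∈ D → φ x t u = 0) (hs : u + con μ * ξ' ^ 2 = 0) :
    ∃ (U : Set (𝕜 × 𝕜)) (f : 𝕜 → 𝕜 → 𝕜), IsOpen U ∧ IsPreconnected U ∧
      IsFunctionInto D U f ∧ Solves (surfaceCondition ξ (fun _ _ _ => 1) φ) U f ∧
      ¬ ∃ c, ∀ x t, (x, t) ∈ U → f x t = c := by
  have hsz : ∀ x t y (h : (x, t, y) ∈ D), y = -(μ * ξ' ⟨_, h⟩ ^ 2) := fun x t y h => by
    have h1 := congrArg (fun F : SmoothFn D => F ⟨_, h⟩) hs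
    simp only [SmoothFn.coe_add, SmoothFn.coe_mul, SmoothFn.coe_pow, coe_algebraMap,
      SmoothFn.coe_zero, u_apply] at h1
    linear_combination h1
  obtain ⟨⟨⟨x₀, t₀, u₀⟩, h₀⟩⟩ := hne
  obtain ⟨v₀, hv₀⟩ : ∃ v₀, v₀ = ξ' ⟨_, h₀⟩ := ⟨_, rfl⟩
  have hv₀0 : v₀ ≠ 0 := hv₀ ▸ (singular_ne_zero hμ hs _).1
  let V : 𝕜 → 𝕜 → 𝕜 := fun x t => (x - x₀ + v₀) / (t - t₀ + 1)
  let f : 𝕜 → 𝕜 → 𝕜 := fun x t => -(μ * V x t ^ 2)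
  have hV₀ : V x₀ t₀ = v₀ := by simp [V]
  have hf₀ : f x₀ t₀ = u₀ := by
    simp only [f, hV₀]
    rw [hsz _ _ _ h₀, hv₀]
  have hVs : ∀ p : 𝕜 × 𝕜, p.2 - t₀ + 1 ≠ 0 →
      ContDiffAt 𝕜 ∞ (fun p : 𝕜 × 𝕜 => V p.1 p.2) p := fun p hp => by
    refine ContDiffAt.div ?_ ?_ hp <;> fun_prop
  have hfs : ∀ p : 𝕜 × 𝕜, p.2 - t₀ + 1 ≠ 0 →
      ContDiffAt 𝕜 ∞ (fun p : 𝕜 × 𝕜 => f p.1 p.2) p := fun p hp =>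
    (contDiffAt_const.mul ((hVs p hp).pow 2)).neg
  have hp₀ : ((x₀, t₀) : 𝕜 × 𝕜).2 - t₀ + 1 ≠ 0 := by simp
  have hG : ContinuousAt (fun p : 𝕜 × 𝕜 => (p.1, p.2, f p.1 p.2)) (x₀, t₀) :=
    continuousAt_fst.prodMk (continuousAt_snd.prodMk (hfs _ hp₀).continuousAt)
  have hGD : ∀ᶠ p in nhds ((x₀, t₀) : 𝕜 × 𝕜), (p.1, p.2, f p.1 p.2) ∈ D :=
    hG.eventually_mem (D.isOpen.mem_nhds (by
      simp only [hf₀]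
      exact h₀))
  have hsum : ContinuousAt (fun p : 𝕜 × 𝕜 => ξ'.extend (p.1, p.2, f p.1 p.2) + V p.1 p.2)
      (x₀, t₀) := by
    refine ContinuousAt.add ?_ (hVs _ hp₀).continuousAt
    refine ContinuousAt.comp (f := fun p : 𝕜 × 𝕜 => (p.1, p.2, f p.1 p.2)) ?_ hG
    simp only [hf₀]
    exact (ξ'.contDiffAt_extend ⟨_, h₀⟩).continuousAt
  have hsum0 : ∀ᶠ p in nhds ((x₀, t₀) : 𝕜 × 𝕜),
      ξ'.extend (p.1, p.2, f p.1 p.2) + V p.1 p.2 ≠ 0 := by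
    refine hsum.eventually_ne ?_
    simp only [hf₀, hV₀]
    rw [extend_apply ξ' ⟨_, h₀⟩, ← hv₀, ← two_mul]
    exact mul_ne_zero two_ne_zero hv₀0
  have hden : ∀ᶠ p in nhds ((x₀, t₀) : 𝕜 × 𝕜), p.2 - t₀ + 1 ≠ 0 := by
    refine ContinuousAt.eventually_ne ?_ hp₀
    fun_prop
  obtain ⟨r, hr, hball⟩ := Metric.eventually_nhds_iff_ball.1 (hGD.and (hsum0.and hden))
  have hfx : ∀ x t : 𝕜, t - t₀ + 1 ≠ 0 →
      HasDerivAt (fun x => f x t) (-(μ * (2 * V x t * (1 / (t - t₀ + 1))))) x := fun x t h => by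
    have h1 := ((((((hasDerivAt_id x).sub_const x₀).add_const v₀).div_const
      (t - t₀ + 1)).pow 2).const_mul μ).neg
    refine h1.congr_deriv ?_
    simp [V]
  have hft : ∀ x t : 𝕜, t - t₀ + 1 ≠ 0 →
      HasDerivAt (fun t => f x t) (-(μ * (2 * V x t * (-V x t / (t - t₀ + 1))))) t := fun x t h => by
    have h1 := ((((hasDerivAt_const t (x - x₀ + v₀)).div
      (((hasDerivAt_id t).sub_const t₀).add_const 1) h).pow 2).const_mul μ).neg
    refine h1.congr_deriv ?_
    simp only [V, id, Pi.div_apply, Nat.reduceSub, pow_one]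
    push_cast
    field_simp
    ring
  refine ⟨Metric.ball (x₀, t₀) r, f, Metric.isOpen_ball, (convex_ball _ _).isPreconnected,
    ⟨fun p hp => (hfs p (hball p hp).2.2).contDiffWithinAt, fun x t hp => (hball _ hp).1⟩, ?_, ?_⟩
  · intro x t hp
    obtain ⟨h1, h2, h3⟩ := hball _ hp
    have hξV : ξ' ⟨_, h1⟩ = V x t := by
      have h4 := hsz _ _ _ h1
      rw [extend_apply ξ' ⟨_, h1⟩] at h2
      have h5 : μ * ((ξ' ⟨_, h1⟩ + V x t) * (ξ' ⟨_, h1⟩ - V x t)) = 0 := by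
        have h6 : f x t = -(μ * V x t ^ 2) := rfl
        have h7 := h6.symm.trans h4
        linear_combination h7
      exact sub_eq_zero.1
        ((mul_eq_zero.1 ((mul_eq_zero.1 h5).resolve_left hμ)).resolve_left h2)
    simp only [surfaceCondition, jetOf, iteratedDeriv_one, iteratedDeriv_zero]
    rw [hφ _ _ _ h1, hξ _ _ _ h1, hξV, (hfx x t h3).deriv, (hft x t h3).deriv]
    ring
  · rintro ⟨c, hc⟩
    have h1 : (fun x => f x t₀) =ᶠ[nhds x₀] fun _ => c := by
      have hcont : Continuous fun x : 𝕜 => (x, t₀) := by fun_prop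
      filter_upwards [hcont.continuousAt.eventually_mem (Metric.ball_mem_nhds (x₀, t₀) hr)]
        with x hx using hc _ _ hx
    have h2 := (hfx x₀ t₀ hp₀).unique ((hasDerivAt_const x₀ c).congr_of_eventuallyEq h1)
    rw [hV₀] at h2
    simp [hμ, hv₀0] at h2

theorem reducedEquation_eq_zero_of_singular (hμ : μ ≠ 0) (hm : 1 + 2 * γ * μ = 0)
    (hξ : ∀ x t u (h : (x, t, u) ∈ D), ξ x t u = ξ' ⟨_, h⟩)
    (hφ : ∀ x t u, (x, t, u) ∈ D → φ x t u = 0) (hs : u + con μ * ξ' ^ 2 = 0)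
    {x t : 𝕜} {p : ℕ × ℕ → 𝕜} (hp : (x, t, p (0, 0)) ∈ D) :
    reducedEquation 4 3 γ 0 μ ξ φ x t p = 0 := by
  have hφ' : ∀ x t u (h : (x, t, u) ∈ D), φ x t u = (0 : SmoothFn D) ⟨_, h⟩ := hφ
  have hm' : μ⁻¹ + 2 * γ = 0 := by
    rw [← mul_right_inj' hμ, mul_add, mul_inv_cancel₀ hμ, mul_zero]
    linear_combination hm
  rw [(represents_reducedEquation 4 3 γ 0 μ hξ hφ').eq hp,
    reducedPoly_singular_of_eq_zero 3 hμ hs hm']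
  simp [cst]

end

end JetPoly

open JetPoly in
theorem singular_case (α β γ κ μ : ℂ) (hμ : μ ≠ 0) (D : Set (ℂ × ℂ × ℂ)) (hDo : IsOpen D)
      (hne : D.Nonempty) (ξ φ : ℂ → ℂ → ℂ → ℂ) (hξ : SmoothOn D ξ) (hφ : SmoothOn D φ)
      (hw : ∀ x t u, (x, t, u) ∈ D → u + μ * ξ x t u ^ 2 = 0) :
      (IsNonclassical α β γ κ μ ξ φ D ↔
        α = 4 ∧ 1 + 2 * γ * μ = 0 ∧ κ = 0 ∧ ∀ x t u, (x, t, u) ∈ D → φ x t u = 0) ∧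
      (IsNonclassical α β γ κ μ ξ φ D → β ≠ 3 →
        ∀ (U : Set (ℂ × ℂ)) (u : ℂ → ℂ → ℂ), IsOpen U → IsPreconnected U →
          IsFunctionInto D U u → Solves (equation α β γ κ μ) U u →
          Solves (surfaceCondition ξ (fun _ _ _ => 1) φ) U u →
          ∃ c, ∀ x t, (x, t) ∈ U → u x t = c) ∧
      (IsNonclassical α β γ κ μ ξ φ D → β = 3 →
        (∀ x t p, (x, t, p (0, 0)) ∈ D → reducedEquation α β γ κ μ ξ φ x t p = 0) ∧
        (∀ (U : Set (ℂ × ℂ)) (u : ℂ → ℂ → ℂ), IsOpen U → IsFunctionInto D U u →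
          Solves (surfaceCondition ξ (fun _ _ _ => 1) φ) U u →
          Solves (equation α β γ κ μ) U u) ∧
        ∃ (U : Set (ℂ × ℂ)) (u : ℂ → ℂ → ℂ), IsOpen U ∧ IsPreconnected U ∧
          IsFunctionInto D U u ∧ Solves (surfaceCondition ξ (fun _ _ _ => 1) φ) U u ∧
          ¬ ∃ c, ∀ x t, (x, t) ∈ U → u x t = c) := by
  obtain ⟨D', rfl⟩ : ∃ D' : TopologicalSpace.Opens (ℂ × ℂ × ℂ), (D' : Set (ℂ × ℂ × ℂ)) = D :=
    ⟨⟨D, hDo⟩, rfl⟩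
  have hne' : Nonempty D' := hne.to_subtype
  have hξ' : ∀ x t u (h : (x, t, u) ∈ D'), ξ x t u = SmoothFn.mk (D := D') _ hξ ⟨_, h⟩ :=
    fun _ _ _ _ => rfl
  have hφ' : ∀ x t u (h : (x, t, u) ∈ D'), φ x t u = SmoothFn.mk (D := D') _ hφ ⟨_, h⟩ :=
    fun _ _ _ _ => rfl
  have hs : SmoothFn.u + con μ * SmoothFn.mk (D := D') _ hξ ^ 2 = 0 :=
    SmoothFn.ext fun z => by
      simp only [SmoothFn.coe_add, SmoothFn.coe_mul, SmoothFn.coe_pow, SmoothFn.coe_algebraMap,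
        SmoothFn.u_apply, SmoothFn.coe_zero]
      exact hw _ _ _ z.2
  have hiff : IsNonclassical α β γ κ μ ξ φ D' ↔
      α = 4 ∧ 1 + 2 * γ * μ = 0 ∧ κ = 0 ∧ ∀ x t u, (x, t, u) ∈ (D' : Set (ℂ × ℂ × ℂ)) → φ x t u = 0 := by
    rw [isNonclassical_iff_of_singular hμ hne' hξ' hφ' hs]
    refine and_congr_right' (and_congr_right' (and_congr_right' ⟨fun h x t u hz => ?_, fun h => ?_⟩))
    · rw [hφ' x t u hz, h, SmoothFn.coe_zero]
    · exact SmoothFn.ext fun z => h _ _ _ z.2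
  refine ⟨hiff, fun H hβ U u hU hU' hu he hsurf => ?_, fun H hβ => ?_⟩
  · obtain ⟨rfl, hm, rfl, hφ0⟩ := hiff.1 H
    exact exists_eq_const_of_singular hμ hβ hm hξ' hφ0 hs hU hU' hu he hsurf
  · obtain ⟨rfl, hm, rfl, hφ0⟩ := hiff.1 H
    subst hβ
    exact ⟨fun x t p hp => reducedEquation_eq_zero_of_singular hμ hm hξ' hφ0 hs hp,
      fun U u hU hu hsurf => solves_of_singular hμ hm hξ' hφ0 hs hU hu hsurf,
      exists_nonconstant_solution hμ hne' hξ' hφ0 hs⟩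

theorem mainTheorem3 :
    -- the generic case `u + μ ξ² ≠ 0`
    (∀ (𝕜 : Type*) [RCLike 𝕜] (α β γ κ μ : 𝕜), μ ≠ 0 →
      ∀ D : Set (𝕜 × 𝕜 × 𝕜), IsOpen D → Convex ℝ D → D.Nonempty →
      ∀ ξ φ : 𝕜 → 𝕜 → 𝕜 → 𝕜, SmoothOn D ξ → SmoothOn D φ →
      (∀ x t u, (x, t, u) ∈ D → u + μ * ξ x t u ^ 2 ≠ 0) →
      (IsNonclassical α β γ κ μ ξ φ D ↔
        IsClassical α β γ κ μ ξ φ D ∨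
        (∃ g, FamilyI κ ξ φ D g) ∨
        (∃ c₁ c₂, FamilyII γ μ ξ φ D c₁ c₂) ∨
        (∃ c₁ c₂, FamilyIII γ κ μ ξ φ D c₁ c₂) ∨
        (∃ s c, FamilyIV α β γ κ ξ φ D s c) ∨
        (∃ s c₁, FamilyV α β γ κ μ ξ φ D s c₁) ∨
        (∃ c, FamilyVI α β γ κ ξ φ D c) ∨
        (∃ c c₄, FamilyVII α β γ κ ξ φ D c c₄)) ∧
      (∀ g, FamilyI κ ξ φ D g →
        (IsClassical α β γ κ μ ξ φ D ↔
          (∀ t ∈ times D, g t = 0) ∨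
            ∃ d, ∀ t ∈ times D, t + d ≠ 0 ∧ g t = -2 / (t + d))) ∧
      (∀ c₁ c₂, FamilyII γ μ ξ φ D c₁ c₂ → (IsClassical α β γ κ μ ξ φ D ↔ c₁ = 0)) ∧
      (∀ c₁ c₂, FamilyIII γ κ μ ξ φ D c₁ c₂ → ¬ IsClassical α β γ κ μ ξ φ D) ∧
      (∀ s c, FamilyIV α β γ κ ξ φ D s c → (IsClassical α β γ κ μ ξ φ D ↔ c = 0)) ∧
      (∀ s c₁, FamilyV α β γ κ μ ξ φ D s c₁ → (IsClassical α β γ κ μ ξ φ D ↔ κ = 0)) ∧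
      (∀ c, FamilyVI α β γ κ ξ φ D c → (IsClassical α β γ κ μ ξ φ D ↔ c = 0)) ∧
      (∀ c c₄, FamilyVII α β γ κ ξ φ D c c₄ → ¬ IsClassical α β γ κ μ ξ φ D)) ∧
    -- the singular case `u + μ ξ² = 0`
    (∀ (α β γ κ μ : ℂ), μ ≠ 0 →
      ∀ D : Set (ℂ × ℂ × ℂ), IsOpen D → D.Nonempty →
      ∀ ξ φ : ℂ → ℂ → ℂ → ℂ, SmoothOn D ξ → SmoothOn D φ →
      (∀ x t u, (x, t, u) ∈ D → u + μ * ξ x t u ^ 2 = 0) →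
      (IsNonclassical α β γ κ μ ξ φ D ↔
        α = 4 ∧ 1 + 2 * γ * μ = 0 ∧ κ = 0 ∧ ∀ x t u, (x, t, u) ∈ D → φ x t u = 0) ∧
      (IsNonclassical α β γ κ μ ξ φ D → β ≠ 3 →
        ∀ (U : Set (ℂ × ℂ)) (u : ℂ → ℂ → ℂ), IsOpen U → IsPreconnected U →
          IsFunctionInto D U u → Solves (equation α β γ κ μ) U u →
          Solves (surfaceCondition ξ (fun _ _ _ => 1) φ) U u →
          ∃ c, ∀ x t, (x, t) ∈ U → u x t = c) ∧
      (IsNonclassical α β γ κ μ ξ φ D → β = 3 →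
        (∀ x t p, (x, t, p (0, 0)) ∈ D → reducedEquation α β γ κ μ ξ φ x t p = 0) ∧
        (∀ (U : Set (ℂ × ℂ)) (u : ℂ → ℂ → ℂ), IsOpen U → IsFunctionInto D U u →
          Solves (surfaceCondition ξ (fun _ _ _ => 1) φ) U u →
          Solves (equation α β γ κ μ) U u) ∧
        ∃ (U : Set (ℂ × ℂ)) (u : ℂ → ℂ → ℂ), IsOpen U ∧ IsPreconnected U ∧
          IsFunctionInto D U u ∧ Solves (surfaceCondition ξ (fun _ _ _ => 1) φ) U u ∧
          ¬ ∃ c, ∀ x t, (x, t) ∈ U → u x t = c)) := by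
  exact ⟨fun 𝕜 _ α β γ κ μ hμ D hDo hD hne ξ φ hξ hφ hw =>
    generic_case 𝕜 α β γ κ μ hμ D hDo hD hne ξ φ hξ hφ hw, singular_case⟩
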